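/- Let $M$ be a complete, non-compact, connected smooth Riemannian manifold of dimension $N$ with Riemannian measure $\mu$, fix $x_0\in M$, and write $r(x)=\mathrm{dist}(x_0,x)$, $B_R=\{x: r(x)<R\}$, $S=M\times(0,\infty)$. Let $p>1$, $m\ge 1$, $q>\max(p+m-2,1)$. Let $a\in\mathrm{Lip}_{\mathrm{loc}}(M)$ with $a>0$ a.e., $d\mu_a=a\,d\mu$, let $b:[0,\infty)\to[0,K]$ be Borel measurable for some $K>0$, and let $V\in L^1_{\mathrm{loc}}(S)$. A global nonnegative weak solution of $$\partial_t u\ \ge\ \frac1a\,\mathrm{div}\big(a\,u^{m-1}|\nabla u|^{p-2}b(|\nabla u|)\nabla u\big)+V u^q\quad\text{in } S \qquad (*)$$ is a function $u\ge 0$ a.e. on $S$ with weak derivatives $\nabla u$, $\partial_t u$ such that $u^qV$, $u^{p+m-1}$, $|\nabla u|^pu^{m-1}$ and $u\,\partial_tu$ belong to $L^1_{\mathrm{loc}}(S;d\mu_a dt)$ and $$\iint_S\psi u^qV\,d\mu_adt\ \le\ \iint_S\langle\nabla\psi,\nabla u\rangle u^{m-1}|\nabla u|^{p-2}b(|\nabla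 u|)\,d\mu_adt-\iint_S(\partial_t\psi)u\,d\mu_adt$$ for every nonnegative $\psi\in\mathrm{Lip}_{\mathrm{loc}}(S)$ with compact support in $S$. Here $\partial_tu\in L^1_{\mathrm{loc}}(S;d\mu_adt)$ is the weak time derivative with respect to $d\mu_a dt$, and $\nabla u$ is the (locally integrable) weak gradient in the space variable on $\{a>0\}\times(0,\infty)$. If $a$ has zeros, $\nabla u$ is moreover, on an open neighbourhood $O\subseteq S$ of $\{a=0\}\times(0,\infty)$, the gradient in the weighted Sobolev sense: there are locally Lipschitz $w_k$ on $O$ with $w_k\to u$ a.e. and $\nabla w_k\to\nabla u$ in $L^p_{\mathrm{loc}}(O;u^{m-1}d\mu_adt)$. Suppose that $V(x,t)\ge h(x)f(t)$ for a.e. $(x,t)\in S$, where $h:M\to\mathbb R$ and $f:(0,\infty)\to\mathbb R$ are measurable and $$0<h(x)\le C(1+r(x))^{\alpha_1}\ \text{ for a.e. }x,\qquad 0<f(t)\le C(1+t)^{\alpha_2}\ \text{ for a.e. }t>0,$$ and that, for all sufficiently large $R$ and $T$, $$\int_{B_R}h^{-\frac1{q-1}}d\mu_a\le CR^{\sigma_1}(\log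 R)^{\delta_1},\qquad \int_0^Tf^{-\frac1{q-1}}dt\le CT^{\sigma_2}(\log T)^{\delta_2},$$ $$\int_{B_R}h^{-\frac{p+m-2}{q-p-m+2}}d\mu_a\le CR^{\sigma_3}(\log R)^{\delta_3},\qquad \int_0^Tf^{-\frac{p+m-2}{q-p-m+2}}dt\le CT^{\sigma_4}(\log T)^{\delta_4},$$ with $C>0$ and $\alpha_1,\alpha_2,\sigma_1,\dots,\sigma_4,\delta_1,\dots,\delta_4\ge0$. Assume: (i) $\delta_1+\delta_2<\frac1{q-1}$ and $\delta_3+\delta_4<\frac{p+m-2}{q-p-m+2}$; (ii) $0\le\sigma_2\le\frac q{q-1}$ and $0\le\sigma_3\le\frac{pq}{q-p-m+2}$; (iii) if $\sigma_2=\frac q{q-1}$ then $\sigma_1=0$, and if $\sigma_3=\frac{pq}{q-p-m+2}$ then $\sigma_4=0$; (iv) $\sigma_1\sigma_4\le\big(\frac q{q-1}-\sigma_2\big)\big(\frac{pq}{q-p-m+2}-\sigma_3\big)$. Then $(*)$ has no nontrivial global nonnegative weak solution: every global nonnegative weak solution $u$ of $(*)$ satisfies $u=0$ a.e. in $S$.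 -/

import Mathlib

open Set Filter Topology MeasureTheory Bundle
open scoped ENNReal Manifold ContDiff Bundle

noncomputable section

/-! ## The Riemannian measure

`M` is a smooth manifold modelled on `ℝ^N`, with an inner product on each tangent space. -/

section RiemannianMeasure

variable (N : ℕ) {M : Type*} [TopologicalSpace M] [ChartedSpace (EuclideanSpace ℝ (Fin N)) M]

/-- The vector `∂_v` at the point with coordinates `y`, in the chart around `c`. -/
def coordVector (c : M) (y v : EuclideanSpace ℝ (Fin N)) :
    TangentSpace (𝓡 N) ((chartAt (EuclideanSpace ℝ (Fin N)) c).symm y) :=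
  mfderiv (𝓡 N) (𝓡 N) (chartAt (EuclideanSpace ℝ (Fin N)) c).symm y v

variable [RiemannianBundle (fun x : M ↦ TangentSpace (𝓡 N) x)]

/-- The matrix `g_ij` of the metric in the chart around `c`. -/
def metricMatrix (c : M) (y : EuclideanSpace ℝ (Fin N)) : Matrix (Fin N) (Fin N) ℝ :=
  fun i j ↦ inner ℝ (coordVector N c y (EuclideanSpace.single i 1))
    (coordVector N c y (EuclideanSpace.single j 1))

/-- The measure `√(det g_ij) dy` on the target of the chart around `c`, transported to `M`. -/
def chartVolume [MeasurableSpace M] (c : M) : Measure M :=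
  (((volume : Measure (EuclideanSpace ℝ (Fin N))).restrict
      (chartAt (EuclideanSpace ℝ (Fin N)) c).target).withDensity
    (fun y ↦ ENNReal.ofReal (Real.sqrt (metricMatrix N c y).det))).map
    (chartAt (EuclideanSpace ℝ (Fin N)) c).symm

/-- The Riemannian measure `μ`: the least measure that dominates `√(det g_ij) dy` in every chart.
The chart measures agree on overlaps, so on a second countable manifold this is the measure that
restricts to `√(det g_ij) dy` in each chart. -/
def riemannianMeasure (M : Type*) [TopologicalSpace M] [ChartedSpace (EuclideanSpace ℝ (Fin N)) M]
    [RiemannianBundle (fun x : M ↦ TangentSpace (𝓡 N) x)] [MeasurableSpace M] : Measure M :=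
  ⨆ c : M, chartVolume N c

/-- The weighted measure `μ_a = a μ`. -/
def weightedMeasure [MeasurableSpace M] (a : M → ℝ) : Measure M :=
  (riemannianMeasure N M).withDensity (fun x ↦ ENNReal.ofReal (a x))

end RiemannianMeasure

/-! ## Functions on space-time `S = M × (0, ∞)`

Functions on `S` are functions on `M × ℝ` of which only the values on `S` matter. -/

/-- `S = M × (0, ∞)`. -/
def spaceTime (M : Type*) : Set (M × ℝ) := univ ×ˢ Ioi (0 : ℝ)

/-- Locally Lipschitz functions with compact support in `S` (extended by zero). -/
def IsTestFunction {M : Type*} [MetricSpace M] (ψ : M × ℝ → ℝ) : Prop :=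
  LocallyLipschitz ψ ∧ HasCompactSupport ψ ∧ tsupport ψ ⊆ spaceTime M

/-- `∂_t ψ`. -/
def timeDeriv {M : Type*} (ψ : M × ℝ → ℝ) (z : M × ℝ) : ℝ := deriv (fun s ↦ ψ (z.1, s)) z.2

section Derivatives

variable (N : ℕ) {M : Type*} [MetricSpace M] [ChartedSpace (EuclideanSpace ℝ (Fin N)) M]

/-- The differential of `ψ` in the space variable; `spaceDeriv N ψ z X = ⟨∇ψ, X⟩`. -/
def spaceDeriv (ψ : M × ℝ → ℝ) (z : M × ℝ) : TangentSpace (𝓡 N) z.1 →L[ℝ] ℝ :=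
  mfderiv (𝓡 N) 𝓘(ℝ, ℝ) (fun y ↦ ψ (y, z.2)) z.1

variable [RiemannianBundle (fun x : M ↦ TangentSpace (𝓡 N) x)]

/-- `G` is the weak gradient in the space variable of `u` on `U × (0, ∞)`, where `U ⊆ M` is open:
in every chart, `u` and the components `⟨G, ∂_v⟩` are locally integrable and
`∫ u ∂_v η = - ∫ ⟨G, ∂_v⟩ η` for every test function `η`. -/
def IsWeakGradientOn (U : Set M) (u : M × ℝ → ℝ) (G : (z : M × ℝ) → TangentSpace (𝓡 N) z.1) :
    Prop :=
  ∀ (c : M) (v : EuclideanSpace ℝ (Fin N)),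
    let e := chartAt (EuclideanSpace ℝ (Fin N)) c
    let W : Set (EuclideanSpace ℝ (Fin N) × ℝ) := (e.target ∩ e.symm ⁻¹' U) ×ˢ Ioi (0 : ℝ)
    let uc : EuclideanSpace ℝ (Fin N) × ℝ → ℝ := fun y ↦ u (e.symm y.1, y.2)
    let dv : EuclideanSpace ℝ (Fin N) × ℝ → ℝ :=
      fun y ↦ inner ℝ (G (e.symm y.1, y.2)) (coordVector N c y.1 v)
    LocallyIntegrableOn uc W volume ∧ LocallyIntegrableOn dv W volume ∧
      ∀ η : EuclideanSpace ℝ (Fin N) × ℝ → ℝ, ContDiff ℝ ∞ η → HasCompactSupport η →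
        tsupport η ⊆ W →
        ∫ y, uc y * fderiv ℝ η y (v, 0) = - ∫ y, dv y * η y

variable [MeasurableSpace M]

/-- `D` is the weak time derivative of `u` in `S`, with respect to `dμ_a dt`. -/
def IsWeakTimeDeriv (a : M → ℝ) (u D : M × ℝ → ℝ) : Prop :=
  LocallyIntegrableOn u (spaceTime M) ((weightedMeasure N a).prod volume) ∧
  LocallyIntegrableOn D (spaceTime M) ((weightedMeasure N a).prod volume) ∧
  ∀ ψ : M × ℝ → ℝ, IsTestFunction ψ →
    ∫ z, u z * timeDeriv ψ z ∂((weightedMeasure N a).prod volume) =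
      - ∫ z, D z * ψ z ∂((weightedMeasure N a).prod volume)

/-- `G` is the gradient of `u` on the open set `O ⊆ S` in the sense of the weighted Sobolev space
with degenerate weight, i.e. the closure of the locally Lipschitz functions: on `O`, `u` is the
a.e. limit of locally Lipschitz functions `w k` whose gradients `X k = ∇(w k)` tend to `G` in
`L^p_loc(O; u^(m-1) dμ_a dt)`. -/
def IsEnergyGradientOn (p m : ℝ) (a : M → ℝ) (O : Set (M × ℝ)) (u : M × ℝ → ℝ)
    (G : (z : M × ℝ) → TangentSpace (𝓡 N) z.1) : Prop :=
  ∃ (w : ℕ → M × ℝ → ℝ) (X : ℕ → (z : M × ℝ) → TangentSpace (𝓡 N) z.1),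
    (∀ k, LocallyLipschitzOn O (w k)) ∧
    (∀ k, ∀ z ∈ O, ∀ v : TangentSpace (𝓡 N) z.1, inner ℝ (X k z) v = spaceDeriv N (w k) z v) ∧
    (∀ᵐ z ∂((weightedMeasure N a).prod volume).restrict O,
      Tendsto (fun k ↦ w k z) atTop (𝓝 (u z))) ∧
    ∀ K : Set (M × ℝ), IsCompact K → K ⊆ O →
      Tendsto (fun k ↦ ∫⁻ z in K,
          ENNReal.ofReal (‖X k z - G z‖ ^ p * u z ^ (m - 1))
            ∂((weightedMeasure N a).prod volume)) atTop (𝓝 0)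

/-- `G` and `D` are the gradient `∇u` and the time derivative `∂_t u` of `u` in `S`. The gradient
is the weak one where `a > 0`. Near the zeros of `a`, where the weight degenerates, it is the one
of the weighted Sobolev space; that clause is void if `a` has no zero. -/
def HasWeakDerivatives (p m : ℝ) (a : M → ℝ) (u : M × ℝ → ℝ)
    (G : (z : M × ℝ) → TangentSpace (𝓡 N) z.1) (D : M × ℝ → ℝ) : Prop :=
  IsWeakTimeDeriv N a u D ∧
  IsWeakGradientOn N {x | 0 < a x} u G ∧
  ∃ O : Set (M × ℝ), IsOpen O ∧ O ⊆ spaceTime M ∧ {x | a x = 0} ×ˢ Ioi (0 : ℝ) ⊆ O ∧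
    IsEnergyGradientOn N p m a O u G

/-- `u` is a global nonnegative weak solution of
`∂_t u ≥ a⁻¹ div (a u^(m-1) |∇u|^(p-2) b(|∇u|) ∇u) + V u^q` in `M × (0, ∞)`. -/
def IsWeakSolution (p q m : ℝ) (a : M → ℝ) (b : ℝ → ℝ) (V u : M × ℝ → ℝ) : Prop :=
  AEStronglyMeasurable u (((riemannianMeasure N M).prod volume).restrict (spaceTime M)) ∧
  (∀ᵐ z ∂((riemannianMeasure N M).prod volume).restrict (spaceTime M), 0 ≤ u z) ∧
  ∃ (G : (z : M × ℝ) → TangentSpace (𝓡 N) z.1) (D : M × ℝ → ℝ),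
    HasWeakDerivatives N p m a u G D ∧
    LocallyIntegrableOn (fun z ↦ u z ^ q * V z) (spaceTime M)
      ((weightedMeasure N a).prod volume) ∧
    LocallyIntegrableOn (fun z ↦ u z ^ (p + m - 1)) (spaceTime M)
      ((weightedMeasure N a).prod volume) ∧
    LocallyIntegrableOn (fun z ↦ ‖G z‖ ^ p * u z ^ (m - 1)) (spaceTime M)
      ((weightedMeasure N a).prod volume) ∧
    LocallyIntegrableOn (fun z ↦ u z * D z) (spaceTime M)
      ((weightedMeasure N a).prod volume) ∧
    ∀ ψ : M × ℝ → ℝ, IsTestFunction ψ → (∀ z, 0 ≤ ψ z) →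
      ∫ z in spaceTime M, ψ z * u z ^ q * V z ∂((weightedMeasure N a).prod volume) ≤
        (∫ z in spaceTime M,
            spaceDeriv N ψ z (G z) * (u z ^ (m - 1) * ‖G z‖ ^ (p - 2) * b ‖G z‖)
            ∂((weightedMeasure N a).prod volume)) -
          ∫ z in spaceTime M, timeDeriv ψ z * u z ∂((weightedMeasure N a).prod volume)

end Derivatives

end

set_option linter.unusedSectionVars false

noncomputable section

variable {N : ℕ} {M : Type*} [MetricSpace M] [ChartedSpace (EuclideanSpace ℝ (Fin N)) M]
  [IsManifold (𝓡 N) ∞ M] [RiemannianBundle (fun x : M ↦ TangentSpace (𝓡 N) x)]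
  [IsContMDiffRiemannianBundle (𝓡 N) ∞ (EuclideanSpace ℝ (Fin N))
    (fun x : M ↦ TangentSpace (𝓡 N) x)]
  [IsRiemannianManifold (𝓡 N) M] [SecondCountableTopology M] [MeasurableSpace M] [BorelSpace M]
  {a : M → ℝ} [SFinite (weightedMeasure N a)]

local notation "𝔼" => EuclideanSpace ℝ (Fin N)

local notation "μₐₜ" => Measure.prod (weightedMeasure N a) (volume : Measure ℝ)

open Real Metric
open ENNReal (ofReal ofReal_ne_top ofReal_le_ofReal ofReal_mul ofReal_add ofReal_lt_ofReal_iff)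

local notation "𝓛" => (volume : Measure ℝ)
local notation "𝓛ₑ" => (volume : Measure (𝔼 × ℝ))

theorem mdifferentiableAt_chart_symm (c : M) {y : 𝔼}
    (hy : y ∈ (chartAt 𝔼 c).target) :
    MDifferentiableAt (𝓡 N) (𝓡 N) (chartAt 𝔼 c).symm y :=
  mdifferentiableAt_atlas_symm (chart_mem_atlas _ _) hy

theorem mdifferentiableAt_chart (c : M) {x : M}
    (hx : x ∈ (chartAt 𝔼 c).source) :
    MDifferentiableAt (𝓡 N) (𝓡 N) (chartAt 𝔼 c) x :=
  mdifferentiableAt_atlas (chart_mem_atlas _ _) hx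

theorem mfderiv_chart_coordVector (c : M) {y : 𝔼}
    (hy : y ∈ (chartAt 𝔼 c).target) (v : 𝔼) :
    mfderiv (𝓡 N) (𝓡 N) (chartAt 𝔼 c)
      ((chartAt 𝔼 c).symm y) (coordVector N c y v) = v := by
  have h := (mdifferentiable_chart (I := 𝓡 N) c).comp_symm_deriv hy
  exact congrArg (fun L => L v) h

theorem coordVector_mfderiv_chart (c : M) {y : 𝔼}
    (hy : y ∈ (chartAt 𝔼 c).target)
    (X : TangentSpace (𝓡 N) ((chartAt 𝔼 c).symm y)) :
    coordVector N c y (mfderiv (𝓡 N) (𝓡 N) (chartAt 𝔼 c)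
      ((chartAt 𝔼 c).symm y) X) = X := by
  have h := (mdifferentiable_chart (I := 𝓡 N) c).symm.comp_symm_deriv (x := (chartAt 𝔼 c).symm y) ((chartAt 𝔼 c).map_target hy)
  rw [OpenPartialHomeomorph.symm_symm, OpenPartialHomeomorph.right_inv _ hy] at h
  exact congrArg (fun L => L X) h

theorem contMDiffOn_coordVector (c : M) (v : 𝔼) :
    ContMDiffOn (𝓡 N) ((𝓡 N).tangent) 1
      (fun y ↦ (⟨(chartAt 𝔼 c).symm y, coordVector N c y v⟩ :
        TangentBundle (𝓡 N) M)) (chartAt 𝔼 c).target := by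
  have h1 : ContMDiffOn (𝓡 N) (𝓡 N) 2 (chartAt 𝔼 c).symm
      (chartAt 𝔼 c).target :=
    (contMDiffOn_chart_symm (n := ∞)).of_le ENat.LEInfty.out
  have h2 := h1.contMDiffOn_tangentMapWithin (m := 1) (by norm_num)
    (chartAt 𝔼 c).open_target.uniqueMDiffOn
  have h3 : ContMDiff (𝓡 N) ((𝓡 N).tangent) 1
      (fun y : 𝔼 ↦ (TotalSpace.mk' 𝔼 (E := fun y ↦ TangentSpace (𝓡 N) y) y v : TangentBundle (𝓡 N) 𝔼)) := by
    intro y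
    refine (contMDiffAt_section (E := fun y : 𝔼 ↦ TangentSpace (𝓡 N) y) (s := fun _ => v) y).2 ?_
    simp
    exact contMDiffAt_const
  refine (h2.comp h3.contMDiffOn (fun y hy => hy)).congr ?_
  intro y hy
  simp only [tangentMapWithin, Function.comp]
  rw [mfderivWithin_of_isOpen (chartAt 𝔼 c).open_target hy]
  rfl

theorem isContMDiffRiemannianBundle_one : IsContMDiffRiemannianBundle (𝓡 N) 1 𝔼
      (fun x : M ↦ TangentSpace (𝓡 N) x) :=
  IsContMDiffRiemannianBundle.of_le (n := ∞) ENat.LEInfty.out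

theorem continuousOn_inner_coordVector (c : M) (v w : 𝔼) :
    ContinuousOn (fun y ↦ inner ℝ (coordVector N c y v) (coordVector N c y w))
      (chartAt 𝔼 c).target :=
  haveI := isContMDiffRiemannianBundle_one (N := N) (M := M)
  ((contMDiffOn_coordVector c v).inner_bundle (contMDiffOn_coordVector c w)).continuousOn


theorem coordVector_smul (c : M) (y v : 𝔼) (r : ℝ) :
    coordVector N c y (r • v) = r • coordVector N c y v := by
  unfold coordVector; exact map_smul _ _ _

theorem coordVector_zero (c : M) (y : 𝔼) : coordVector N c y 0 = 0 := by
  unfold coordVector; exact map_zero _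

theorem coordVector_sum (c : M) (y : 𝔼) {ι : Type*} (s : Finset ι) (v : ι → 𝔼) :
    coordVector N c y (∑ i ∈ s, v i) = ∑ i ∈ s, coordVector N c y (v i) := by
  unfold coordVector; exact map_sum _ _ _

theorem euclidean_sum_single (v : 𝔼) : v = ∑ i, v i • EuclideanSpace.single i (1 : ℝ) := by
  have := (EuclideanSpace.basisFun (Fin N) ℝ).sum_repr v
  simpa using this.symm

theorem coordVector_eq_sum (c : M) (y v : 𝔼) :
    coordVector N c y v = ∑ i, v i • coordVector N c y (EuclideanSpace.single i 1) := by
  conv_lhs => rw [euclidean_sum_single v, coordVector_sum]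
  simp only [coordVector_smul]

theorem norm_sq_coordVector (c : M) (y v : 𝔼) :
    ‖coordVector N c y v‖ ^ 2 = ∑ i, ∑ j, v i * v j * metricMatrix N c y i j := by
  rw [← real_inner_self_eq_norm_sq]
  conv_lhs => rw [coordVector_eq_sum c y v]
  rw [sum_inner]
  refine Finset.sum_congr rfl fun i _ => ?_
  rw [inner_sum]
  refine Finset.sum_congr rfl fun j _ => ?_
  rw [real_inner_smul_left, real_inner_smul_right, metricMatrix]
  ring

theorem coordVector_ne_zero (c : M) {y v : 𝔼}
    (hy : y ∈ (chartAt 𝔼 c).target) (hv : v ≠ 0) :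
    coordVector N c y v ≠ 0 := by
  intro h
  apply hv
  have := mfderiv_chart_coordVector c hy v
  rw [h, map_zero] at this
  exact this.symm

theorem continuousOn_metricMatrix (c : M) :
    ContinuousOn (metricMatrix N c) (chartAt 𝔼 c).target := by
  refine continuousOn_pi.2 fun i => continuousOn_pi.2 fun j => ?_
  exact continuousOn_inner_coordVector c _ _

theorem continuousOn_norm_coordVector (c : M) :
    ContinuousOn (fun z : 𝔼 × 𝔼 ↦ ‖coordVector N c z.1 z.2‖)
      ((chartAt 𝔼 c).target ×ˢ univ) := by
  have : (fun z : 𝔼 × 𝔼 ↦ ‖coordVector N c z.1 z.2‖) = fun z ↦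
      sqrt (∑ i, ∑ j, z.2 i * z.2 j * metricMatrix N c z.1 i j) := by
    ext z
    rw [← norm_sq_coordVector, sqrt_sq (norm_nonneg _)]
  rw [this]
  apply continuous_sqrt.comp_continuousOn
  refine continuousOn_finsetSum _ fun i _ => continuousOn_finsetSum _ fun j _ => ?_
  have h1 : ContinuousOn (fun z : 𝔼 × 𝔼 => metricMatrix N c z.1 i j)
      ((chartAt 𝔼 c).target ×ˢ univ) :=
    (continuousOn_inner_coordVector c _ _).comp continuousOn_fst (fun z hz => hz.1)
  have h2 : Continuous (fun z : 𝔼 × 𝔼 => z.2 i * z.2 j) := by fun_prop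
  exact h2.continuousOn.mul h1

theorem exists_norm_coordVector_bounds (c : M) {K : Set 𝔼} (hK : IsCompact K)
    (hKt : K ⊆ (chartAt 𝔼 c).target) :
    ∃ C : ℝ, 0 < C ∧ ∀ y ∈ K, ∀ v : 𝔼, ‖coordVector N c y v‖ ≤ C * ‖v‖ ∧
      ‖v‖ ≤ C * ‖coordVector N c y v‖ := by
  have hS : IsCompact (K ×ˢ sphere (0 : 𝔼) 1) := hK.prod (isCompact_sphere _ _)
  have hcont : ContinuousOn (fun z : 𝔼 × 𝔼 ↦ ‖coordVector N c z.1 z.2‖)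
      (K ×ˢ sphere (0 : 𝔼) 1) :=
    (continuousOn_norm_coordVector c).mono (prod_mono hKt (subset_univ _))
  have hpos : ∀ z ∈ K ×ˢ sphere (0 : 𝔼) 1, ‖coordVector N c z.1 z.2‖ ≠ 0 := by
    intro z hz
    rw [norm_ne_zero_iff]
    refine coordVector_ne_zero c (hKt hz.1) ?_
    rintro h
    have := hz.2
    simp [h] at this
  obtain ⟨C1, hC1⟩ := (hS.image_of_continuousOn hcont).isBounded.exists_norm_le
  obtain ⟨C2, hC2⟩ := (hS.image_of_continuousOn (hcont.inv₀ hpos)).isBounded.exists_norm_le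
  refine ⟨max (max C1 C2) 1, by positivity, fun y hy v => ?_⟩
  rcases eq_or_ne v 0 with rfl | hv
  · simp [coordVector_zero]
  have hvn : 0 < ‖v‖ := norm_pos_iff.2 hv
  set w := ‖v‖⁻¹ • v
  have hw : (y, w) ∈ K ×ˢ sphere (0 : 𝔼) 1 := by
    refine ⟨hy, ?_⟩
    simp [w, norm_smul, hvn.ne']
  have hvw : v = ‖v‖ • w := by simp [w, smul_smul, hvn.ne']
  have e1 := hC1 _ (mem_image_of_mem _ hw)
  have e2 := hC2 _ (mem_image_of_mem _ hw)
  simp only [norm_norm, norm_inv, Pi.inv_apply] at e1 e2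
  have e3 : ‖coordVector N c y v‖ = ‖v‖ * ‖coordVector N c y w‖ := by
    conv_lhs => rw [hvw, coordVector_smul, norm_smul, norm_norm]
  have hwpos : 0 < ‖coordVector N c y w‖ := lt_of_le_of_ne (norm_nonneg _) (hpos _ hw).symm
  constructor
  · rw [e3, mul_comm]
    gcongr
    exact e1.trans ((le_max_left _ _).trans (le_max_left _ _))
  · rw [e3]
    have : 1 ≤ max (max C1 C2) 1 * ‖coordVector N c y w‖ := by
      rw [← inv_le_iff_one_le_mul₀ hwpos]
      exact e2.trans ((le_max_right _ _).trans (le_max_left _ _))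
    nlinarith


theorem edist_chart_symm_le (c : M) {y y' : 𝔼} {Λ : NNReal}
    (hseg : segment ℝ y y' ⊆ (chartAt 𝔼 c).target)
    (hΛ : ∀ w ∈ segment ℝ y y', ‖coordVector N c w (y' - y)‖ ≤ Λ) :
    edist ((chartAt 𝔼 c).symm y)
      ((chartAt 𝔼 c).symm y') ≤ Λ := by
  set e := chartAt 𝔼 c
  have hmem : ∀ t ∈ Icc (0:ℝ) 1, y + t • (y' - y) ∈ segment ℝ y y' := by
    intro t ht
    rw [segment_eq_image']
    exact ⟨t, ht, rfl⟩
  set γ : ℝ → M := fun t ↦ e.symm (y + t • (y' - y)) with hγdef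
  have hγ : ContMDiffOn 𝓘(ℝ, ℝ) (𝓡 N) 1 γ (Icc 0 1) := by
    have h1 : ContMDiffOn (𝓡 N) (𝓡 N) 1 e.symm e.target :=
      (contMDiffOn_chart_symm (n := ∞)).of_le ENat.LEInfty.out
    have h2 : ContMDiff 𝓘(ℝ, ℝ) (𝓡 N) 1 (fun t : ℝ ↦ y + t • (y' - y)) := by
      rw [contMDiff_iff_contDiff]
      fun_prop
    exact h1.comp h2.contMDiffOn (fun t ht => hseg (hmem t ht))
  rw [IsRiemannianManifold.out (I := 𝓡 N)]
  refine (Manifold.riemannianEDist_le_pathELength hγ (a := 0) (b := 1) (by simp [hγdef])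
    (by simp [hγdef]) zero_le_one).trans ?_
  rw [Manifold.pathELength_eq_lintegral_mfderiv_Ioo]
  have : ∀ t ∈ Ioo (0:ℝ) 1, ‖mfderiv 𝓘(ℝ, ℝ) (𝓡 N) γ t 1‖ₑ ≤ (Λ : ℝ≥0∞) := by
    intro t ht
    have hm := hmem t ⟨ht.1.le, ht.2.le⟩
    have h1 : MDifferentiableAt (𝓡 N) (𝓡 N) e.symm (y + t • (y' - y)) :=
      mdifferentiableAt_chart_symm c (hseg hm)
    have h2 : HasFDerivAt (fun t : ℝ ↦ y + t • (y' - y))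
        (ContinuousLinearMap.toSpanSingleton ℝ (y' - y)) t := by
      have := ((hasDerivAt_id t).smul_const (y' - y)).const_add y
      simpa [hasDerivAt_iff_hasFDerivAt] using this
    have h3 := (h1.hasMFDerivAt.comp t h2.hasMFDerivAt).mfderiv
    have h4 : mfderiv 𝓘(ℝ, ℝ) (𝓡 N) γ t = _ := h3
    rw [h4]
    have h5 := hΛ _ hm
    rw [enorm_le_coe, ← NNReal.coe_le_coe, coe_nnnorm]
    refine le_trans (le_of_eq ?_) h5
    have h6 : (ContinuousLinearMap.toSpanSingleton ℝ (y' - y)) (1 : ℝ) = y' - y := by simp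
    exact congrArg (fun w : 𝔼 ↦ ‖mfderiv (𝓡 N) (𝓡 N) e.symm (y + t • (y' - y)) w‖) h6
  refine (setLIntegral_mono' measurableSet_Ioo this).trans ?_
  simp

theorem dist_chart_symm_le (c : M) {y y' : 𝔼} {Λ : ℝ} (hΛ0 : 0 ≤ Λ)
    (hseg : segment ℝ y y' ⊆ (chartAt 𝔼 c).target)
    (hΛ : ∀ w ∈ segment ℝ y y', ‖coordVector N c w (y' - y)‖ ≤ Λ) :
    dist ((chartAt 𝔼 c).symm y)
      ((chartAt 𝔼 c).symm y') ≤ Λ := by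
  lift Λ to NNReal using hΛ0
  exact edist_le_coe.1 (edist_chart_symm_le c hseg hΛ)

theorem exists_lipschitzOnWith_chart_symm (c : M) {y : 𝔼}
    (hy : y ∈ (chartAt 𝔼 c).target) :
    ∃ K : NNReal, ∃ r > 0, closedBall y r ⊆ (chartAt 𝔼 c).target ∧
      LipschitzOnWith K (chartAt 𝔼 c).symm (closedBall y r) := by
  obtain ⟨r, hr, hball⟩ := nhds_basis_closedBall.mem_iff.1
    ((chartAt 𝔼 c).open_target.mem_nhds hy)
  obtain ⟨C, hC, hCb⟩ := exists_norm_coordVector_bounds c (isCompact_closedBall y r) hball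
  lift C to NNReal using hC.le
  refine ⟨C, r, hr, hball, LipschitzOnWith.of_dist_le_mul fun w hw w' hw' => ?_⟩
  have hseg : segment ℝ w w' ⊆ closedBall y r :=
    (convex_closedBall y r).segment_subset hw hw'
  refine dist_chart_symm_le c (by positivity) (hseg.trans hball) fun z hz => ?_
  rw [dist_comm, dist_eq_norm]
  exact (hCb z (hseg hz) (w' - w)).1

theorem hasDerivAt_comp_chart_symm (c : M) {y v : 𝔼}
    (hy : y ∈ (chartAt 𝔼 c).target) {f : M → ℝ}
    (hf : MDifferentiableAt (𝓡 N) 𝓘(ℝ, ℝ) f ((chartAt 𝔼 c).symm y)) :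
    HasDerivAt (fun s : ℝ ↦ f ((chartAt 𝔼 c).symm (y + s • v)))
      (mfderiv (𝓡 N) 𝓘(ℝ, ℝ) f ((chartAt 𝔼 c).symm y)
        (coordVector N c y v)) 0 := by
  set e := chartAt 𝔼 c
  have h1 : HasMFDerivAt (𝓡 N) 𝓘(ℝ, ℝ) (f ∘ e.symm) y _ :=
    hf.hasMFDerivAt.comp y (mdifferentiableAt_chart_symm c hy).hasMFDerivAt
  have h2 : HasFDerivAt (𝕜 := ℝ) (f ∘ e.symm)
      (((mfderiv (𝓡 N) 𝓘(ℝ, ℝ) f (e.symm y)).comp (mfderiv (𝓡 N) (𝓡 N) e.symm y) :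
        TangentSpace (𝓡 N) y →L[ℝ] ℝ) : 𝔼 →L[ℝ] ℝ) y := h1.hasFDerivAt
  have h3 : HasDerivAt (fun s : ℝ ↦ y + s • v) v 0 := by
    have := ((hasDerivAt_id (0:ℝ)).smul_const v).const_add y
    simpa using this
  exact h2.comp_hasDerivAt_of_eq (0:ℝ) h3 (by simp)

theorem abs_mfderiv_le_of_eventually_le {f : M → ℝ} {x : M} {Λ : ℝ} (hΛ : 0 ≤ Λ)
    (hf : ∀ᶠ y in 𝓝 x, |f y - f x| ≤ Λ * dist y x) (X : TangentSpace (𝓡 N) x) :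
    abs (α := ℝ) (mfderiv (𝓡 N) 𝓘(ℝ, ℝ) f x X) ≤ Λ * ‖X‖ := by
  by_cases hd : MDifferentiableAt (𝓡 N) 𝓘(ℝ, ℝ) f x
  swap
  · rw [mfderiv_zero_of_not_mdifferentiableAt hd]
    have : |(0 : TangentSpace (𝓡 N) x →L[ℝ] ℝ) X| ≤ Λ * ‖X‖ := by
      rw [zero_apply, abs_zero]
      positivity
    exact this
  obtain ⟨c, hc⟩ : ∃ c : M, x ∈ (chartAt 𝔼 c).source :=
    ⟨x, mem_chart_source _ x⟩
  set e := chartAt 𝔼 c with he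
  obtain ⟨y, hy, rfl⟩ : ∃ y ∈ e.target, e.symm y = x := ⟨e x, e.map_source hc, e.left_inv hc⟩
  set v : 𝔼 := mfderiv (𝓡 N) (𝓡 N) e (e.symm y) X with hv
  have hX : coordVector N c y v = X := coordVector_mfderiv_chart c hy X
  have hder := hasDerivAt_comp_chart_symm c (v := v) hy hd
  rw [hX] at hder
  refine le_of_forall_pos_le_add fun ε hε => ?_
  obtain ⟨δ, hδ, hδε⟩ : ∃ δ > 0, Λ * δ ≤ ε := by
    refine ⟨ε / (Λ + 1), by positivity, ?_⟩
    rw [mul_div_assoc', div_le_iff₀ (by positivity)]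
    nlinarith
  have hcont : ContinuousAt (fun w : 𝔼 ↦ ‖coordVector N c w v‖) y := by
    have := (continuousOn_norm_coordVector c).continuousAt (x := (y, v))
      ((e.open_target.prod isOpen_univ).mem_nhds ⟨hy, mem_univ _⟩)
    exact this.comp (f := fun w : 𝔼 ↦ (w, v)) (by fun_prop)
  have hev : ∀ᶠ w in 𝓝 y, w ∈ e.target ∧ ‖coordVector N c w v‖ < ‖X‖ + δ := by
    refine (e.open_target.eventually_mem hy).and ?_
    refine hcont.eventually_lt continuousAt_const ?_
    rw [hX]; linarith
  obtain ⟨r, hr, hball⟩ := eventually_nhds_iff_ball.1 hev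
  have hγ : Tendsto (fun s : ℝ ↦ y + s • v) (𝓝[>] 0) (𝓝 y) := by
    have : Continuous (fun s : ℝ ↦ y + s • v) := by fun_prop
    have := this.tendsto 0
    simp only [zero_smul, add_zero] at this
    exact this.mono_left nhdsWithin_le_nhds
  have hγ' : Tendsto (fun s : ℝ ↦ e.symm (y + s • v)) (𝓝[>] 0) (𝓝 (e.symm y)) :=
    (e.continuousAt_symm hy).tendsto.comp hγ
  have hbound : ∀ᶠ s in 𝓝[>] (0:ℝ),
      |s⁻¹ * (f (e.symm (y + s • v)) - f (e.symm y))| ≤ Λ * (‖X‖ + δ) := by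
    filter_upwards [hγ.eventually (ball_mem_nhds y hr), hγ'.eventually hf,
      self_mem_nhdsWithin] with s hs hfs hs0
    have hs0' : (0:ℝ) < s := hs0
    have hseg : segment ℝ y (y + s • v) ⊆ ball y r :=
      (convex_ball y r).segment_subset (mem_ball_self hr) hs
    have hd := dist_chart_symm_le c (y := y) (y' := y + s • v)
      (Λ := s * (‖X‖ + δ)) (by positivity)
      (fun w hw => (hball w (hseg hw)).1) (fun w hw => by
        rw [add_sub_cancel_left, coordVector_smul, norm_smul, norm_of_nonneg hs0'.le]
        exact mul_le_mul_of_nonneg_left (hball w (hseg hw)).2.le hs0'.le)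
    have hd' : dist (e.symm (y + s • v)) (e.symm y) ≤ s * (‖X‖ + δ) := by
      rw [dist_comm]; exact hd
    rw [abs_mul, abs_of_pos (inv_pos.2 hs0'), inv_mul_le_iff₀ hs0']
    refine hfs.trans ?_
    calc Λ * dist (e.symm (y + s • v)) (e.symm y) ≤ Λ * (s * (‖X‖ + δ)) := by gcongr
      _ = s * (Λ * (‖X‖ + δ)) := by ring
  have hlim := (hder.tendsto_slope_zero_right).abs
  have := le_of_tendsto hlim (by
    filter_upwards [hbound] with s hs
    simpa using hs)
  refine this.trans ?_
  nlinarith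

theorem exists_dist_lt_of_dist_lt_add (N : ℕ) {M : Type*} [MetricSpace M]
    [ChartedSpace (EuclideanSpace ℝ (Fin N)) M]
    [RiemannianBundle (fun x : M ↦ TangentSpace (𝓡 N) x)]
    [IsRiemannianManifold (𝓡 N) M] {x y : M} {r s : ℝ} (hr : 0 < r) (hs : 0 < s)
    (h : dist x y < r + s) : ∃ z, dist x z < r ∧ dist z y < s := by
  obtain ⟨δ, hδ, h1, h2, h3⟩ : ∃ δ > 0, δ < r ∧ δ < s ∧ dist x y < (r - δ) + (s - δ) := by
    refine ⟨min (min (r / 2) (s / 2)) ((r + s - dist x y) / 4), ?_, ?_, ?_, ?_⟩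
    · have : 0 < r + s - dist x y := by linarith
      positivity
    · exact ((min_le_left _ _).trans (min_le_left _ _)).trans_lt (by linarith)
    · exact ((min_le_left _ _).trans (min_le_right _ _)).trans_lt (by linarith)
    · have := min_le_right (min (r / 2) (s / 2)) ((r + s - dist x y) / 4)
      linarith
  have h4 : edist x y < ofReal (r - δ) + ofReal (s - δ) := by
    rw [← ofReal_add (by linarith) (by linarith), edist_dist]
    exact (ofReal_lt_ofReal_iff (by linarith)).2 h3
  rw [IsRiemannianManifold.out (I := 𝓡 N)] at h4
  obtain ⟨γ, h0, h1', hγ, hlen⟩ := Manifold.exists_lt_of_riemannianEDist_lt h4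
  have hcont : ContinuousOn γ (Icc 0 1) := hγ.continuousOn
  set A := {t : ℝ | t ∈ Icc (0:ℝ) 1 ∧ dist x (γ t) ≤ r - δ}
  set B := {t : ℝ | t ∈ Icc (0:ℝ) 1 ∧ dist (γ t) y ≤ s - δ}
  have hA : IsClosed A := by
    have : ContinuousOn (fun t => dist x (γ t)) (Icc 0 1) := by fun_prop
    exact this.preimage_isClosed_of_isClosed isClosed_Icc isClosed_Iic
  have hB : IsClosed B := by
    have : ContinuousOn (fun t => dist (γ t) y) (Icc 0 1) := by fun_prop
    exact this.preimage_isClosed_of_isClosed isClosed_Icc isClosed_Iic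
  have hcover : Icc (0:ℝ) 1 ⊆ A ∪ B := by
    intro t ht
    have e1 : edist x (γ t) ≤ Manifold.pathELength (𝓡 N) γ 0 t := by
      rw [IsRiemannianManifold.out (I := 𝓡 N)]
      exact Manifold.riemannianEDist_le_pathELength (hγ.mono (Icc_subset_Icc_right ht.2))
        h0 rfl ht.1
    have e2 : edist (γ t) y ≤ Manifold.pathELength (𝓡 N) γ t 1 := by
      rw [IsRiemannianManifold.out (I := 𝓡 N)]
      exact Manifold.riemannianEDist_le_pathELength (hγ.mono (Icc_subset_Icc_left ht.1))
        rfl h1' ht.2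
    rw [← Manifold.pathELength_add ht.1 ht.2] at hlen
    by_contra hcon
    simp only [A, B, mem_union, mem_ofPred_eq, ht, true_and, not_or, not_le] at hcon
    refine absurd hlen (not_lt.2 ?_)
    gcongr
    · refine le_trans ?_ e1
      rw [edist_dist]
      exact ofReal_le_ofReal hcon.1.le
    · refine le_trans ?_ e2
      rw [edist_dist]
      exact ofReal_le_ofReal hcon.2.le
  obtain ⟨t, ht, htA, htB⟩ := isPreconnected_closed_iff.1 isPreconnected_Icc A B hA hB hcover
    ⟨0, by simp, by simp, by simp [h0]; linarith⟩ ⟨1, by simp, by simp, by simp [h1']; linarith⟩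
  exact ⟨γ t, htA.2.trans_lt (by linarith), htB.2.trans_lt (by linarith)⟩

/-- The Hopf-Rinow theorem: a complete Riemannian manifold is proper. -/
theorem properSpace_of_complete_riemannian (N : ℕ) {M : Type*} [MetricSpace M]
    [ChartedSpace (EuclideanSpace ℝ (Fin N)) M]
    [RiemannianBundle (fun x : M ↦ TangentSpace (𝓡 N) x)]
    [IsRiemannianManifold (𝓡 N) M]
    [CompleteSpace M] : ProperSpace M := by
  have : LocallyCompactSpace M := ChartedSpace.locallyCompactSpace (EuclideanSpace ℝ (Fin N)) M
  have key : ∀ x : M, ∀ r : ℝ, IsCompact (closedBall x r) := by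
    intro x
    have hlim : ∀ ρ : ℝ, (∀ r < ρ, IsCompact (closedBall x r)) →
        IsCompact (closedBall x ρ) := by
      intro ρ hρ
      refine TotallyBounded.isCompact_of_isClosed ?_ isClosed_closedBall
      rw [totallyBounded_iff]
      intro ε hε
      rcases lt_or_ge ρ ε with hρε | hρε
      · refine ⟨{x}, finite_singleton _, ?_⟩
        simpa using closedBall_subset_ball hρε
      obtain ⟨F, hF, hFc⟩ := totallyBounded_iff.1
        (hρ (ρ - ε / 4) (by linarith)).totallyBounded (ε / 2) (by linarith)
      refine ⟨F, hF, fun y hy => ?_⟩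
      obtain ⟨z, hz1, hz2⟩ := exists_dist_lt_of_dist_lt_add N (x := x) (y := y) (r := ρ - ε / 4)
        (s := ε / 2) (by linarith) (by linarith) (by
          rw [mem_closedBall, dist_comm] at hy; linarith)
      obtain ⟨w, hw, hzw⟩ := mem_iUnion₂.1 (hFc (show z ∈ closedBall x (ρ - ε / 4) by
        rw [mem_closedBall, dist_comm]; exact hz1.le))
      refine mem_iUnion₂.2 ⟨w, hw, ?_⟩
      rw [mem_ball] at hzw ⊢
      calc dist y w ≤ dist y z + dist z w := dist_triangle _ _ _
        _ < ε := by rw [dist_comm y z]; linarith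
    have hstep : ∀ ρ : ℝ, 0 ≤ ρ → IsCompact (closedBall x ρ) →
        ∃ δ > 0, IsCompact (closedBall x (ρ + δ)) := by
      intro ρ hρ hc
      obtain ⟨δ, hδ, hcδ⟩ := hc.exists_isCompact_cthickening
      refine ⟨δ / 4, by positivity, hcδ.of_isClosed_subset isClosed_closedBall ?_⟩
      intro y hy
      rcases eq_or_lt_of_le hρ with h0 | h0
      · refine mem_cthickening_of_dist_le y x δ _ (by simp [← h0]) ?_
        rw [mem_closedBall] at hy
        linarith
      obtain ⟨z, hz1, hz2⟩ := exists_dist_lt_of_dist_lt_add N (x := x) (y := y) (r := ρ)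
        (s := δ / 2) h0 (by linarith) (by
          rw [mem_closedBall, dist_comm] at hy; linarith)
      refine mem_cthickening_of_dist_le y z δ _ ?_ ?_
      · rw [mem_closedBall, dist_comm]; exact hz1.le
      · rw [dist_comm]; linarith
    by_contra hcon
    push Not at hcon
    obtain ⟨R, hR⟩ := hcon
    set S := {r : ℝ | ¬ IsCompact (closedBall x r)}
    have hSne : S.Nonempty := ⟨R, hR⟩
    have hS0 : ∀ r ∈ S, 0 ≤ r := by
      intro r hr
      by_contra hneg
      exact hr (by rw [closedBall_eq_empty.2 (not_le.1 hneg)]; exact isCompact_empty)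
    have hbdd : BddBelow S := ⟨0, hS0⟩
    have h1 : IsCompact (closedBall x (sInf S)) := by
      refine hlim _ fun r hr => ?_
      by_contra hc
      exact absurd (csInf_le hbdd hc) (not_le.2 hr)
    obtain ⟨δ, hδ, hδc⟩ := hstep _ (le_csInf hSne hS0) h1
    obtain ⟨r, hrS, hr⟩ := exists_lt_of_csInf_lt hSne (show sInf S < sInf S + δ by linarith)
    exact hrS (hδc.of_isClosed_subset isClosed_closedBall
      (closedBall_subset_closedBall hr.le))
  exact ⟨key⟩

theorem inner_eq_inner_coordVector (c : M) {x : M} {y : 𝔼}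
    (hy : y ∈ (chartAt 𝔼 c).target)
    (hx : (chartAt 𝔼 c).symm y = x) (X Y : TangentSpace (𝓡 N) x) :
    inner ℝ X Y =
      inner ℝ (coordVector N c y (mfderiv (𝓡 N) (𝓡 N) (chartAt 𝔼 c) x X))
       (coordVector N c y (mfderiv (𝓡 N) (𝓡 N) (chartAt 𝔼 c) x Y)) := by
  subst hx
  rw [coordVector_mfderiv_chart c hy, coordVector_mfderiv_chart c hy]

theorem inner_coordVector (c : M) (y v w : 𝔼) :
    inner ℝ (coordVector N c y v) (coordVector N c y w) =
      ∑ i, ∑ j, v i * w j * metricMatrix N c y i j := by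
  conv_lhs => rw [coordVector_eq_sum c y v, coordVector_eq_sum c y w]
  rw [sum_inner]
  refine Finset.sum_congr rfl fun i _ => ?_
  rw [inner_sum]
  refine Finset.sum_congr rfl fun j _ => ?_
  rw [real_inner_smul_left, real_inner_smul_right, metricMatrix]
  ring

theorem posDef_metricMatrix (c : M) {y : 𝔼}
    (hy : y ∈ (chartAt 𝔼 c).target) : (metricMatrix N c y).PosDef := by
  have : metricMatrix N c y =
      Matrix.gram ℝ (fun i ↦ coordVector N c y (EuclideanSpace.single i 1)) := rfl
  rw [this]
  apply Matrix.posDef_gram_of_linearIndependent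
  rw [Fintype.linearIndependent_iff]
  intro g hg i
  by_contra hgi
  have h1 : coordVector N c y (WithLp.toLp 2 g) = 0 := by
    rw [coordVector_eq_sum]; exact hg
  refine coordVector_ne_zero c hy (v := WithLp.toLp 2 g) ?_ h1
  intro h
  apply hgi
  have := congrArg (fun v : 𝔼 => v i) h
  simpa using this

/-- The Riemannian volume density in the chart around `c`. -/
def chartDensity (c : M) (y : 𝔼) : ℝ≥0∞ :=
  ofReal (sqrt (metricMatrix N c y).det)

theorem chartDensity_transition (c c' : M) {y y' : 𝔼}
    (hy : y ∈ (chartAt 𝔼 c).target)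
    (hx : (chartAt 𝔼 c).symm y =
      (chartAt 𝔼 c').symm y') (L : 𝔼 →L[ℝ] 𝔼)
    (hL : ∀ v, L v = mfderiv (𝓡 N) (𝓡 N) (chartAt 𝔼 c)
      ((chartAt 𝔼 c').symm y') (coordVector N c' y' v)) :
    chartDensity c' y' = ofReal |L.det| * chartDensity c y := by
  set b := (EuclideanSpace.basisFun (Fin N) ℝ).toBasis
  set A : Matrix (Fin N) (Fin N) ℝ := LinearMap.toMatrix b b (L : 𝔼 →ₗ[ℝ] 𝔼)
  have hA : ∀ i j, A i j = L (EuclideanSpace.single j 1) i := by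
    intro i j
    simp [A, b, LinearMap.toMatrix_apply]
  have hG : metricMatrix N c' y' = A.transpose * metricMatrix N c y * A := by
    ext i j
    have h1 : metricMatrix N c' y' i j = ∑ k, ∑ l, L (EuclideanSpace.single i 1) k *
        L (EuclideanSpace.single j 1) l * metricMatrix N c y k l := by
      rw [← inner_coordVector, hL, hL]
      exact inner_eq_inner_coordVector c hy hx _ _
    rw [h1, Matrix.mul_assoc, Matrix.mul_apply]
    refine Finset.sum_congr rfl fun k _ => ?_
    rw [Matrix.mul_apply, Finset.mul_sum]
    refine Finset.sum_congr rfl fun l _ => ?_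
    rw [Matrix.transpose_apply, hA, hA]
    ring
  have hdet : L.det = A.det := by
    rw [ContinuousLinearMap.det, ← LinearMap.det_toMatrix b]
  rw [chartDensity, chartDensity, hG, Matrix.det_mul, Matrix.det_mul, Matrix.det_transpose, hdet,
    ← ofReal_mul (abs_nonneg _), mul_right_comm, sqrt_mul (mul_self_nonneg _),
    sqrt_mul_self_eq_abs]

theorem measurableSet_chart_target (c : M) :
    MeasurableSet (chartAt 𝔼 c).target :=
  (chartAt 𝔼 c).open_target.measurableSet

theorem measurableSet_chart_source (c : M) :
    MeasurableSet (chartAt 𝔼 c).source :=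
  (chartAt 𝔼 c).open_source.measurableSet

theorem aemeasurable_chart_symm (c : M) : AEMeasurable (chartAt 𝔼 c).symm
      ((volume : Measure 𝔼).restrict (chartAt 𝔼 c).target) :=
  (chartAt 𝔼 c).continuousOn_symm.aemeasurable
    (measurableSet_chart_target c)

theorem measurableSet_preimage_chart_symm (c : M) {s : Set M} (hs : MeasurableSet s) :
    MeasurableSet ((chartAt 𝔼 c).symm ⁻¹' s ∩
      (chartAt 𝔼 c).target) := by
  set e := chartAt 𝔼 c
  have h1 : Measurable (e.target.domRestrict e.symm) :=
    (continuousOn_iff_continuous_domRestrict.1 e.continuousOn_symm).measurable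
  have h2 := (measurableSet_chart_target c).subtype_image (h1 hs)
  rw [inter_comm]
  convert h2 using 1
  ext y
  simp only [mem_inter_iff, mem_preimage, mem_image, Subtype.exists, exists_and_right,
    exists_eq_right]
  exact ⟨fun h => ⟨h.1, h.2⟩, fun ⟨h, h'⟩ => ⟨h, h'⟩⟩

theorem chartVolume_apply (c : M) {s : Set M} (hs : MeasurableSet s) :
    chartVolume N c s = ∫⁻ y in (chartAt 𝔼 c).symm ⁻¹' s ∩
      (chartAt 𝔼 c).target, chartDensity c y := by
  rw [chartVolume, Measure.map_apply_of_aemeasurable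
    ((aemeasurable_chart_symm c).mono_ac (withDensity_absolutelyContinuous _ _)) hs,
    withDensity_apply', Measure.restrict_restrict' (measurableSet_chart_target c)]
  rfl

theorem chartVolume_restrict_le (c c' : M) :
    (chartVolume N c').restrict (chartAt 𝔼 c).source ≤
      chartVolume N c := by
  refine Measure.le_iff.2 fun s hs => ?_
  set e := chartAt 𝔼 c
  set e' := chartAt 𝔼 c'
  have hms : MeasurableSet (s ∩ e.source) := hs.inter (measurableSet_chart_source c)
  rw [Measure.restrict_apply hs, chartVolume_apply c' hms, chartVolume_apply c hs]
  set A' : Set 𝔼 := e'.symm ⁻¹' (s ∩ e.source) ∩ e'.target with hA'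
  have hA'm : MeasurableSet A' := by
    exact measurableSet_preimage_chart_symm c' hms
  set φ : 𝔼 → 𝔼 := fun y ↦ e (e'.symm y) with hφ
  set L : 𝔼 → 𝔼 →L[ℝ] 𝔼 := fun y' ↦ ((mfderiv (𝓡 N) (𝓡 N) e (e'.symm y')).comp
    (mfderiv (𝓡 N) (𝓡 N) e'.symm y') : TangentSpace (𝓡 N) y' →L[ℝ] 𝔼) with hL
  have hder : ∀ y' ∈ A', HasFDerivWithinAt φ (L y') A' y' := by
    intro y' hy'
    have h1 := (mdifferentiableAt_chart c hy'.1.2).hasMFDerivAt.comp y'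
      (mdifferentiableAt_chart_symm c' hy'.2).hasMFDerivAt
    exact (show HasFDerivAt φ (L y') y' from h1.hasFDerivAt).hasFDerivWithinAt
  have hinj : InjOn φ A' := by
    intro y1 h1 y2 h2 h12
    exact e'.symm.injOn h1.2 h2.2 (e.injOn h1.1.2 h2.1.2 h12)
  have hsub : φ '' A' ⊆ e.symm ⁻¹' s ∩ e.target := by
    rintro _ ⟨y', hy', rfl⟩
    refine ⟨?_, e.map_source hy'.1.2⟩
    simp only [φ, mem_preimage, e.left_inv hy'.1.2]
    exact hy'.1.1
  refine le_trans (le_of_eq ?_) (lintegral_mono_set hsub)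
  rw [lintegral_image_eq_lintegral_abs_det_fderiv_mul volume hA'm hder hinj]
  refine setLIntegral_congr_fun hA'm fun y' hy' => ?_
  refine chartDensity_transition c c' (e.map_source hy'.1.2) (e.left_inv hy'.1.2) (L y') fun v => rfl

theorem riemannianMeasure_restrict_chart_source (c : M) :
    (riemannianMeasure N M).restrict (chartAt 𝔼 c).source =
      chartVolume N c := by
  set e := chartAt 𝔼 c
  have hms := measurableSet_chart_source (N := N) c
  apply le_antisymm
  · have h1 : riemannianMeasure N M ≤
        chartVolume N c + (riemannianMeasure N M).restrict e.sourceᶜ := by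
      refine iSup_le fun c' => ?_
      rw [← Measure.restrict_add_restrict_compl (μ := chartVolume N c') hms]
      exact add_le_add (chartVolume_restrict_le c c')
        (Measure.restrict_mono subset_rfl (le_iSup (fun c : M => chartVolume N c) c'))
    have h2 := Measure.restrict_mono (subset_refl e.source) h1
    rw [Measure.restrict_add, Measure.restrict_restrict hms, inter_compl_self,
      Measure.restrict_empty, add_zero] at h2
    exact h2.trans Measure.restrict_le_self
  · have h1 : (chartVolume N c).restrict e.source = chartVolume N c := by
      rw [Measure.restrict_eq_self_of_ae_mem]
      rw [ae_iff]
      have : {x | x ∉ e.source} = e.sourceᶜ := rfl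
      rw [this, chartVolume_apply c hms.compl]
      have : e.symm ⁻¹' e.sourceᶜ ∩ e.target = ∅ := by
        ext y
        simp only [mem_inter_iff, mem_preimage, mem_compl_iff, mem_empty_iff_false, iff_false]
        rintro ⟨h1, h2⟩
        exact h1 (e.map_target h2)
      rw [this]; simp
    rw [← h1]
    exact Measure.restrict_mono subset_rfl (le_iSup (fun c : M => chartVolume N c) c)

section MeasureLemmas
variable {α β γ : Type*} [MeasurableSpace α] [MeasurableSpace β] [MeasurableSpace γ]

theorem withDensity_map_eq {μ : Measure α} [SFinite μ] {f : α → β} (hf : AEMeasurable f μ)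
    {g : β → ℝ≥0∞} (hg : Measurable g) :
    (μ.map f).withDensity g = (μ.withDensity (fun x ↦ g (f x))).map f := by
  ext s hs
  rw [withDensity_apply _ hs, ← lintegral_indicator hs,
    lintegral_map' (hg.indicator hs).aemeasurable hf,
    Measure.map_apply_of_aemeasurable (hf.mono_ac (withDensity_absolutelyContinuous _ _)) hs,
    withDensity_apply', ← lintegral_indicator₀ (hf.nullMeasurableSet_preimage hs)]
  rfl

theorem map_prod_eq_map {μ : Measure α} [SFinite μ] {τ : Measure γ} [SFinite τ] {f : α → β}
    (hf : AEMeasurable f μ) :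
    (μ.map f).prod τ = (μ.prod τ).map (fun z ↦ (f z.1, z.2)) := by
  have h1 : μ.map f = μ.map (hf.mk f) := Measure.map_congr hf.ae_eq_mk
  have h2 : (fun z : α × γ ↦ (f z.1, z.2)) =ᵐ[μ.prod τ] Prod.map (hf.mk f) id := by
    filter_upwards [Measure.quasiMeasurePreserving_fst.ae hf.ae_eq_mk] with z hz
    exact Prod.ext hz rfl
  rw [h1, Measure.map_congr h2, ← Measure.map_prod_map _ _ hf.measurable_mk measurable_id,
    Measure.map_id]

end MeasureLemmas

variable (N) in
/-- The inverse of the chart around `c`, times the identity of the time axis. -/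
def spaceTimeChartSymm (c : M)
    (y : 𝔼 × ℝ) : M × ℝ :=
  ((chartAt 𝔼 c).symm y.1, y.2)

variable (N) in
/-- The chart around `c`, times the identity of the time axis. -/
def spaceTimeChart (c : M) (z : M × ℝ) :
    𝔼 × ℝ :=
  (chartAt 𝔼 c z.1, z.2)

variable (N) in
/-- The domain of the space-time chart around `c`. -/
def spaceTimeSource (c : M) : Set (M × ℝ) :=
  (chartAt 𝔼 c).source ×ˢ univ

variable (N) in
/-- The image of the space-time chart around `c`. -/
def spaceTimeTarget (c : M) : Set (𝔼 × ℝ) :=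
  (chartAt 𝔼 c).target ×ˢ univ

local notation "Ξ" => spaceTimeChartSymm N

theorem isOpen_spaceTimeSource (c : M) : IsOpen (spaceTimeSource N c) :=
  (chartAt 𝔼 c).open_source.prod isOpen_univ

theorem isOpen_spaceTimeTarget (c : M) : IsOpen (spaceTimeTarget N c) :=
  (chartAt 𝔼 c).open_target.prod isOpen_univ

theorem spaceTimeChartSymm_mem {c : M} {y : 𝔼 × ℝ} (hy : y ∈ spaceTimeTarget N c) :
    Ξ c y ∈ spaceTimeSource N c :=
  ⟨(chartAt 𝔼 c).map_target hy.1, mem_univ _⟩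

theorem spaceTimeChart_mem {c : M} {z : M × ℝ} (hz : z ∈ spaceTimeSource N c) :
    spaceTimeChart N c z ∈ spaceTimeTarget N c :=
  ⟨(chartAt 𝔼 c).map_source hz.1, mem_univ _⟩

theorem spaceTimeChartSymm_chart {c : M} {z : M × ℝ} (hz : z ∈ spaceTimeSource N c) :
    Ξ c (spaceTimeChart N c z) = z :=
  Prod.ext ((chartAt 𝔼 c).left_inv hz.1) rfl

theorem spaceTimeChart_chartSymm {c : M} {y : 𝔼 × ℝ} (hy : y ∈ spaceTimeTarget N c) :
    spaceTimeChart N c (Ξ c y) = y :=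
  Prod.ext ((chartAt 𝔼 c).right_inv hy.1) rfl

theorem continuousOn_spaceTimeChartSymm (c : M) :
    ContinuousOn (Ξ c) (spaceTimeTarget N c) :=
  ((chartAt 𝔼 c).continuousOn_symm.comp continuousOn_fst
    (fun _ hz => hz.1)).prodMk continuousOn_snd

theorem continuousOn_spaceTimeChart (c : M) :
    ContinuousOn (spaceTimeChart N c) (spaceTimeSource N c) :=
  ((chartAt 𝔼 c).continuousOn.comp continuousOn_fst
    (fun _ hz => hz.1)).prodMk continuousOn_snd

theorem continuousOn_det_metricMatrix (c : M) :
    ContinuousOn (fun y ↦ (metricMatrix N c y).det)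
      (chartAt 𝔼 c).target :=
  continuous_id.matrix_det.comp_continuousOn (continuousOn_metricMatrix c)

/-- The density of the weighted space-time measure in the chart around `c`. -/
def weightedDensity (a : M → ℝ) (c : M) (y : 𝔼) : ℝ :=
  sqrt (metricMatrix N c y).det * a ((chartAt 𝔼 c).symm y)

theorem continuousOn_weightedDensity (ha : Continuous a) (c : M) :
    ContinuousOn (weightedDensity (N := N) a c)
      (chartAt 𝔼 c).target :=
  (continuous_sqrt.comp_continuousOn (continuousOn_det_metricMatrix c)).mul
    (ha.comp_continuousOn (chartAt 𝔼 c).continuousOn_symm)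

theorem weightedDensity_pos {c : M} {y : 𝔼}
    (hy : y ∈ (chartAt 𝔼 c).target)
    (h : 0 < a ((chartAt 𝔼 c).symm y)) :
    0 < weightedDensity (N := N) a c y :=
  mul_pos (sqrt_pos.2 (posDef_metricMatrix c hy).det_pos) h

theorem weightedMeasure_restrict_chart_source (ha : Continuous a) (c : M) :
    (weightedMeasure N a).restrict (chartAt 𝔼 c).source =
      (((volume : Measure 𝔼).restrict (chartAt 𝔼 c).target).withDensity
        (fun y ↦ ofReal (weightedDensity a c y))).map
        (chartAt 𝔼 c).symm := by
  set e := chartAt 𝔼 c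
  have hms := measurableSet_chart_source (N := N) c
  have hmt := measurableSet_chart_target (N := N) c
  have hd : AEMeasurable (fun y ↦ ofReal (sqrt (metricMatrix N c y).det))
      ((volume : Measure 𝔼).restrict e.target) :=
    (ContinuousOn.aemeasurable (continuous_sqrt.comp_continuousOn
      (continuousOn_det_metricMatrix c)) hmt).ennreal_ofReal
  have haM : Measurable (fun x ↦ ofReal (a x)) := ha.measurable.ennreal_ofReal
  have hsymm := aemeasurable_chart_symm (N := N) c
  rw [weightedMeasure, restrict_withDensity hms, riemannianMeasure_restrict_chart_source,
    chartVolume]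
  rw [withDensity_map_eq (hsymm.mono_ac (withDensity_absolutelyContinuous _ _)) haM]
  congr 1
  refine (withDensity_mul₀ hd (haM.comp_aemeasurable hsymm)).symm.trans ?_
  congr 1
  ext y
  rw [Pi.mul_apply, weightedDensity, ofReal_mul (sqrt_nonneg _)]
  rfl

theorem prod_weightedMeasure_restrict_source (ha : Continuous a) (c : M) :
    (μₐₜ).restrict (spaceTimeSource N c) =
      (((𝓛ₑ).restrict (spaceTimeTarget N c)).withDensity
        (fun y ↦ ofReal (weightedDensity a c y.1))).map (Ξ c) := by
  have hmt := measurableSet_chart_target (N := N) c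
  have hρ : AEMeasurable (fun y ↦ ofReal (weightedDensity (N := N) a c y))
      ((volume : Measure 𝔼).restrict (chartAt 𝔼 c).target) :=
    ((continuousOn_weightedDensity ha c).aemeasurable hmt).ennreal_ofReal
  have hsymm := aemeasurable_chart_symm (N := N) c
  rw [spaceTimeSource, ← Measure.prod_restrict, weightedMeasure_restrict_chart_source ha,
    Measure.restrict_univ, map_prod_eq_map (hsymm.mono_ac (withDensity_absolutelyContinuous _ _)),
    prod_withDensity_left₀ hρ, spaceTimeTarget, Measure.volume_eq_prod, ← Measure.prod_restrict,
    Measure.restrict_univ]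
  rfl

theorem ae_of_ae_spaceTimeChart (ha : Continuous a) (c : M) {P : M × ℝ → Prop}
    (hP : ∀ᵐ y : 𝔼 × ℝ, y ∈ spaceTimeTarget N c → P (Ξ c y)) :
    ∀ᵐ z ∂μₐₜ, z ∈ spaceTimeSource N c → P z := by
  have hms : MeasurableSet (spaceTimeSource N c) := (isOpen_spaceTimeSource c).measurableSet
  have hmt : MeasurableSet (spaceTimeTarget N c) := (isOpen_spaceTimeTarget c).measurableSet
  set κ := ((𝓛ₑ).restrict (spaceTimeTarget N c)).withDensity
        (fun y ↦ ofReal (weightedDensity a c y.1)) with hκ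
  have hκac : κ ≪ (𝓛ₑ).restrict (spaceTimeTarget N c) :=
    withDensity_absolutelyContinuous _ _
  have hΦ : AEMeasurable (Ξ c) κ :=
    ((continuousOn_spaceTimeChartSymm c).aemeasurable hmt).mono_ac hκac
  have heq := prod_weightedMeasure_restrict_source (N := N) ha c
  rw [← ae_restrict_iff' hms]
  have hΨ : AEMeasurable (spaceTimeChart N c)
      ((μₐₜ).restrict (spaceTimeSource N c)) :=
    (continuousOn_spaceTimeChart c).aemeasurable hms
  have hmap : ((μₐₜ).restrict
      (spaceTimeSource N c)).map (spaceTimeChart N c) = κ := by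
    rw [heq] at hΨ ⊢
    rw [AEMeasurable.map_map_of_aemeasurable hΨ hΦ]
    conv_rhs => rw [← Measure.map_id (μ := κ)]
    refine Measure.map_congr (hκac.ae_le ?_)
    filter_upwards [ae_restrict_mem hmt] with y hy
    exact spaceTimeChart_chartSymm hy
  have h1 : ∀ᵐ y ∂κ, P (Ξ c y) := by
    exact hκac.ae_le ((ae_restrict_iff' hmt).2 hP)
  rw [← hmap] at h1
  filter_upwards [ae_of_ae_map hΨ h1, ae_restrict_mem hms] with z hz hzs
  rwa [spaceTimeChartSymm_chart hzs] at hz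

theorem ae_spaceTimeChart_of_ae (ha : Continuous a) (c : M) {P : M × ℝ → Prop}
    (hP : ∀ᵐ z ∂μₐₜ, z ∈ spaceTimeSource N c → P z) :
    ∀ᵐ y : 𝔼 × ℝ, y ∈ spaceTimeTarget N c → 0 < a (Ξ c y).1 →
      P (Ξ c y) := by
  have hms : MeasurableSet (spaceTimeSource N c) := (isOpen_spaceTimeSource c).measurableSet
  have hmt : MeasurableSet (spaceTimeTarget N c) := (isOpen_spaceTimeTarget c).measurableSet
  rw [← ae_restrict_iff' hms, prod_weightedMeasure_restrict_source ha c] at hP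
  have hρ : AEMeasurable (fun y : 𝔼 × ℝ ↦ ofReal (weightedDensity (N := N) a c y.1))
      ((𝓛ₑ).restrict (spaceTimeTarget N c)) :=
    (ContinuousOn.aemeasurable ((continuousOn_weightedDensity ha c).comp continuousOn_fst
      (fun _ hz => hz.1)) hmt).ennreal_ofReal
  have h1 := ae_of_ae_map (((continuousOn_spaceTimeChartSymm c).aemeasurable hmt).mono_ac
    (withDensity_absolutelyContinuous _ _)) hP
  rw [ae_withDensity_iff' hρ, ae_restrict_iff' hmt] at h1
  filter_upwards [h1] with y hy hyt hya
  refine hy hyt ?_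
  rw [ne_eq, ENNReal.ofReal_eq_zero, not_le]
  exact weightedDensity_pos hyt.1 hya



theorem LocallyLipschitzOn.ae_differentiableAt {E : Type*} [NormedAddCommGroup E] [NormedSpace ℝ E]
    [FiniteDimensional ℝ E] [MeasurableSpace E] [BorelSpace E] {μ : Measure E}
    [μ.IsAddHaarMeasure] {f : E → ℝ} {s : Set E} (hs : IsOpen s) (hf : LocallyLipschitzOn s f) :
    ∀ᵐ x ∂μ, x ∈ s → DifferentiableAt ℝ f x := by
  rw [ae_iff]
  refine measure_null_of_locally_null _ fun x hx => ?_
  simp only [Classical.not_imp, mem_ofPred_eq] at hx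
  obtain ⟨K, t, ht, hft⟩ := hf hx.1
  rw [nhdsWithin_eq_nhds.2 (hs.mem_nhds hx.1)] at ht
  obtain ⟨u, hut, huo, hxu⟩ := _root_.mem_nhds_iff.1 ht
  refine ⟨u ∩ {x | ¬(x ∈ s → DifferentiableAt ℝ f x)},
    inter_mem (nhdsWithin_le_nhds (huo.mem_nhds hxu)) self_mem_nhdsWithin, ?_⟩
  have h1 := (hft.mono hut).ae_differentiableWithinAt_of_mem (μ := μ)
  rw [ae_iff] at h1
  refine measure_mono_null ?_ h1
  rintro y ⟨hyu, hy⟩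
  simp only [Classical.not_imp, mem_ofPred_eq] at hy ⊢
  exact ⟨hyu, fun h => hy.2 (h.differentiableAt (huo.mem_nhds hyu))⟩

instance isAddHaarMeasure_volume_euclidean_prod :
    (𝓛ₑ).IsAddHaarMeasure := by
  rw [Measure.volume_eq_prod]; infer_instance

variable (N) in
/-- `ψ` is differentiable at `z` in the space variable and in the time variable. -/
def SliceDifferentiableAt (ψ : M × ℝ → ℝ) (z : M × ℝ) : Prop :=
  MDifferentiableAt (𝓡 N) 𝓘(ℝ, ℝ) (fun y ↦ ψ (y, z.2)) z.1 ∧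
    DifferentiableAt ℝ (fun s ↦ ψ (z.1, s)) z.2

theorem sliceDifferentiableAt_of_chart {c : M} {ψ : M × ℝ → ℝ} {y : 𝔼 × ℝ}
    (hy : y ∈ spaceTimeTarget N c) (h : DifferentiableAt ℝ (ψ ∘ Ξ c) y) :
    SliceDifferentiableAt N ψ (Ξ c y) ∧
    (∀ X, spaceDeriv N ψ (Ξ c y) X =
      fderiv ℝ (ψ ∘ Ξ c) y
        ((mfderiv (𝓡 N) (𝓡 N) (chartAt 𝔼 c)
          (Ξ c y).1 X : 𝔼), (0 : ℝ))) := by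
  set e := chartAt 𝔼 c with he
  have hsrc : e.symm y.1 ∈ e.source := e.map_target hy.1
  have hy1 : e (e.symm y.1) = y.1 := e.right_inv hy.1
  have h1 : HasFDerivAt (fun w : 𝔼 ↦ (ψ ∘ Ξ c) (w, y.2))
      ((fderiv ℝ (ψ ∘ Ξ c) y).comp (ContinuousLinearMap.inl ℝ 𝔼 ℝ)) y.1 :=
    HasFDerivAt.comp (g := ψ ∘ Ξ c) (f := fun w : 𝔼 ↦ (w, y.2)) y.1
      h.hasFDerivAt (hasFDerivAt_prodMk_left y.1 y.2)
  have h2 : HasMFDerivAt (𝓡 N) 𝓘(ℝ, ℝ) (fun w : 𝔼 ↦ (ψ ∘ Ξ c) (w, y.2))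
      (e (e.symm y.1))
      ((fderiv ℝ (ψ ∘ Ξ c) y).comp (ContinuousLinearMap.inl ℝ 𝔼 ℝ)) := by
    rw [hy1]; exact h1.hasMFDerivAt
  have h3 := h2.comp (e.symm y.1) (mdifferentiableAt_chart c hsrc).hasMFDerivAt
  have h4 : (fun x ↦ ψ (x, y.2)) =ᶠ[𝓝 (e.symm y.1)]
      ((fun w : 𝔼 ↦ (ψ ∘ Ξ c) (w, y.2)) ∘ e) := by
    filter_upwards [e.open_source.mem_nhds hsrc] with x hx
    simp only [Function.comp, spaceTimeChartSymm]
    rw [e.left_inv hx]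
  have h5 := h3.congr_of_eventuallyEq h4
  refine ⟨⟨h5.mdifferentiableAt, ?_⟩, ?_⟩
  · have : DifferentiableAt ℝ (fun s : ℝ ↦ (ψ ∘ Ξ c) (y.1, s)) y.2 :=
      DifferentiableAt.comp (g := ψ ∘ Ξ c) (f := fun s : ℝ ↦ (y.1, s)) y.2 h
        (hasFDerivAt_prodMk_right y.1 y.2).differentiableAt
    exact this
  · intro X
    have h6 : spaceDeriv N ψ (Ξ c y) = _ := h5.mfderiv
    rw [h6]
    rfl

theorem LocallyLipschitzOn.comp_spaceTimeChartSymm {ψ : M × ℝ → ℝ} {O : Set (M × ℝ)}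
    (hO : IsOpen O) (hψ : LocallyLipschitzOn O ψ) (c : M) :
    LocallyLipschitzOn (spaceTimeTarget N c ∩ Ξ c ⁻¹' O)
      (ψ ∘ Ξ c) := by
  intro y hy
  obtain ⟨K, t, ht, hK⟩ := hψ hy.2
  rw [nhdsWithin_eq_nhds.2 (hO.mem_nhds hy.2)] at ht
  obtain ⟨K', r, hr, hball, hK'⟩ := exists_lipschitzOnWith_chart_symm c hy.1.1
  have hΦ : LipschitzOnWith (max K' 1) (Ξ c)
      (closedBall y.1 r ×ˢ univ) := by
    have h1 : LipschitzOnWith (K' * 1) (fun y : 𝔼 × ℝ ↦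
        (chartAt 𝔼 c).symm y.1) (closedBall y.1 r ×ˢ univ) :=
      hK'.comp LipschitzWith.prod_fst.lipschitzOnWith (fun z hz => hz.1)
    have h2 : LipschitzOnWith 1 (fun y : 𝔼 × ℝ ↦ y.2) (closedBall y.1 r ×ˢ univ) :=
      LipschitzWith.prod_snd.lipschitzOnWith
    rw [mul_one] at h1
    exact h1.prodMk h2
  refine ⟨K * max K' 1, (closedBall y.1 r ×ˢ univ) ∩ Ξ c ⁻¹' t, ?_, ?_⟩
  · refine nhdsWithin_le_nhds (inter_mem ?_ ?_)
    · exact prod_mem_nhds (closedBall_mem_nhds _ hr) univ_mem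
    · exact ((continuousOn_spaceTimeChartSymm c).continuousAt
        ((isOpen_spaceTimeTarget c).mem_nhds hy.1)).preimage_mem_nhds ht
  · exact hK.comp (hΦ.mono inter_subset_left) (fun z hz => hz.2)

theorem isOpen_target_inter_preimage {O : Set (M × ℝ)} (hO : IsOpen O) (c : M) :
    IsOpen (spaceTimeTarget N c ∩ Ξ c ⁻¹' O) :=
  (continuousOn_spaceTimeChartSymm c).isOpen_inter_preimage (isOpen_spaceTimeTarget c) hO

theorem ae_differentiableAt_chart {ψ : M × ℝ → ℝ} {O : Set (M × ℝ)}
    (hO : IsOpen O) (hψ : LocallyLipschitzOn O ψ) (c : M) :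
    ∀ᵐ y : 𝔼 × ℝ, y ∈ spaceTimeTarget N c → Ξ c y ∈ O →
      DifferentiableAt ℝ (ψ ∘ Ξ c) y := by
  filter_upwards [(hψ.comp_spaceTimeChartSymm hO c).ae_differentiableAt (μ := volume)
    (isOpen_target_inter_preimage hO c)] with y hy h1 h2
  exact hy ⟨h1, h2⟩

theorem ae_of_ae_forall_spaceTimeChart (ha : Continuous a) {P : M × ℝ → Prop}
    (hP : ∀ c : M, ∀ᵐ y : 𝔼 × ℝ, y ∈ spaceTimeTarget N c → P (Ξ c y)) :
    ∀ᵐ z ∂μₐₜ, P z := by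
  rw [ae_iff]
  refine measure_null_of_locally_null _ fun z _ => ?_
  have hz : z ∈ spaceTimeSource N z.1 := ⟨mem_chart_source _ z.1, mem_univ _⟩
  refine ⟨spaceTimeSource N z.1 ∩ {z | ¬ P z},
    inter_mem (nhdsWithin_le_nhds ((isOpen_spaceTimeSource z.1).mem_nhds hz))
      self_mem_nhdsWithin, ?_⟩
  have h1 := ae_of_ae_spaceTimeChart ha z.1 (hP z.1)
  rw [ae_iff] at h1
  refine measure_mono_null ?_ h1
  rintro w ⟨hw1, hw2⟩
  simp only [Classical.not_imp, mem_ofPred_eq]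
  exact ⟨hw1, hw2⟩

theorem LocallyLipschitzOn.ae_sliceDifferentiableAt (ha : Continuous a) {ψ : M × ℝ → ℝ} {O : Set (M × ℝ)}
    (hO : IsOpen O) (hψ : LocallyLipschitzOn O ψ) :
    ∀ᵐ z ∂μₐₜ, z ∈ O →
      SliceDifferentiableAt N ψ z := by
  refine ae_of_ae_forall_spaceTimeChart ha fun c => ?_
  filter_upwards [ae_differentiableAt_chart hO hψ c] with y hy h1 h2
  exact (sliceDifferentiableAt_of_chart h1 (hy h1 h2)).1

theorem ae_weight_pos (ha : Continuous a) :
    ∀ᵐ z ∂μₐₜ, 0 < a z.1 := by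
  have h1 : ∀ᵐ x ∂weightedMeasure N a, 0 < a x := by
    rw [weightedMeasure, ae_withDensity_iff ha.measurable.ennreal_ofReal]
    refine Eventually.of_forall fun x hx => ?_
    rwa [ne_eq, ENNReal.ofReal_eq_zero, not_le] at hx
  exact Measure.quasiMeasurePreserving_fst.ae h1

theorem aestronglyMeasurable_of_spaceTimeChart (ha : Continuous a) {f : M × ℝ → ℝ} {A : Set (M × ℝ)} (hA : IsOpen A)
    (hf : ∀ c : M, AEStronglyMeasurable (f ∘ Ξ c)
      ((𝓛ₑ).restrict {y | y ∈ spaceTimeTarget N c ∧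
        Ξ c y ∈ A ∧ 0 < a (Ξ c y).1})) :
    AEStronglyMeasurable f
      ((μₐₜ).restrict A) := by
  obtain ⟨s, hs, hcov⟩ := TopologicalSpace.isOpen_iUnion_countable
    (fun c : M => spaceTimeSource N c) (fun c => isOpen_spaceTimeSource c)
  have hAU : A = ⋃ c : s, (A ∩ spaceTimeSource N c.1) := by
    rw [← inter_iUnion]
    symm
    rw [inter_eq_left]
    intro z _
    have : z ∈ ⋃ c : M, spaceTimeSource N c :=
      mem_iUnion.2 ⟨z.1, mem_chart_source _ z.1, mem_univ _⟩
    rw [← hcov] at this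
    obtain ⟨c, hc, hz⟩ := mem_iUnion₂.1 this
    exact mem_iUnion.2 ⟨⟨c, hc⟩, hz⟩
  have : Countable s := hs.to_subtype
  rw [hAU, aestronglyMeasurable_iUnion_iff]
  rintro ⟨c, -⟩
  simp only
  have hm : MeasurableSet (A ∩ spaceTimeSource N c) :=
    (hA.inter (isOpen_spaceTimeSource c)).measurableSet
  have hmW : MeasurableSet {y | y ∈ spaceTimeTarget N c ∧
        Ξ c y ∈ A ∧ 0 < a (Ξ c y).1} := by
    have h1 : IsOpen (A ∩ {z : M × ℝ | 0 < a z.1}) :=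
      hA.inter (isOpen_lt continuous_const (ha.comp continuous_fst))
    exact ((continuousOn_spaceTimeChartSymm c).isOpen_inter_preimage
      (isOpen_spaceTimeTarget c) h1).measurableSet
  refine ⟨(hf c).mk _ ∘ ((continuousOn_spaceTimeChart (N := N) c).aemeasurable
    (μ := μₐₜ)
    (isOpen_spaceTimeSource c).measurableSet).mk _, ?_, ?_⟩
  · exact (hf c).stronglyMeasurable_mk.comp_measurable (AEMeasurable.measurable_mk _)
  have h1 := (ae_restrict_iff' hmW).1 (hf c).ae_eq_mk
  have h2 := ae_of_ae_spaceTimeChart ha c (P := fun z => z ∈ A → 0 < a z.1 →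
    f z = (hf c).mk _ (spaceTimeChart N c z)) (by
      filter_upwards [h1] with y hy hyt hyA hya
      rw [spaceTimeChart_chartSymm hyt]
      exact hy ⟨hyt, hyA, hya⟩)
  have h3 := ((continuousOn_spaceTimeChart (N := N) c).aemeasurable
    (μ := μₐₜ)
    (isOpen_spaceTimeSource c).measurableSet).ae_eq_mk
  have h3' := (ae_restrict_iff' (isOpen_spaceTimeSource c).measurableSet).1 h3
  refine (ae_restrict_iff' hm).2 ?_
  filter_upwards [h2, h3', ae_weight_pos ha] with z hz1 hz2 hz3 hz
  rw [Function.comp, ← hz2 hz.2]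
  exact hz1 hz.2 hz.1 hz3

section GradientMeasurability
/-- The coordinates of the vector field `G` in the chart around `c`. -/
def chartComponents (c : M) (G : (z : M × ℝ) → TangentSpace (𝓡 N) z.1) (y : 𝔼 × ℝ) : 𝔼 :=
  mfderiv (𝓡 N) (𝓡 N) (chartAt 𝔼 c) (Ξ c y).1
    (G (Ξ c y))

/-- The scalar product of the vector field `G` with the coordinate vector `∂_v`. -/
def chartPairing (c : M) (G : (z : M × ℝ) → TangentSpace (𝓡 N) z.1) (v : 𝔼) (y : 𝔼 × ℝ) : ℝ :=
  inner ℝ (G ((chartAt 𝔼 c).symm y.1, y.2)) (coordVector N c y.1 v)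

theorem coordVector_chartComponents (c : M) (G : (z : M × ℝ) → TangentSpace (𝓡 N) z.1)
    {y : 𝔼 × ℝ} (hy : y ∈ spaceTimeTarget N c) :
    coordVector N c y.1 (chartComponents c G y) = G (Ξ c y) :=
  coordVector_mfderiv_chart c hy.1 _

theorem chartPairing_eq (c : M) (G : (z : M × ℝ) → TangentSpace (𝓡 N) z.1)
    {y : 𝔼 × ℝ} (hy : y ∈ spaceTimeTarget N c) (v : 𝔼) :
    chartPairing c G v y =
      inner ℝ (coordVector N c y.1 (chartComponents c G y)) (coordVector N c y.1 v) := by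
  rw [coordVector_chartComponents c G hy]; rfl

theorem chartComponents_eq (c : M) (G : (z : M × ℝ) → TangentSpace (𝓡 N) z.1)
    {y : 𝔼 × ℝ} (hy : y ∈ spaceTimeTarget N c) (i : Fin N) :
    chartComponents c G y i = ∑ j, (metricMatrix N c y.1)⁻¹ i j *
      chartPairing c G (EuclideanSpace.single j 1) y := by
  have h1 : (fun j => chartPairing c G (EuclideanSpace.single j 1) y) =
      (metricMatrix N c y.1).mulVec (fun k => chartComponents c G y k) := by
    ext j
    rw [chartPairing_eq c G hy, coordVector_eq_sum, sum_inner, Matrix.mulVec, dotProduct]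
    refine Finset.sum_congr rfl fun k _ => ?_
    rw [real_inner_smul_left, metricMatrix, real_inner_comm, mul_comm]
  have h2 : IsUnit (metricMatrix N c y.1).det :=
    (posDef_metricMatrix c hy.1).det_pos.ne'.isUnit
  have h3 : (metricMatrix N c y.1)⁻¹.mulVec
      (fun j => chartPairing c G (EuclideanSpace.single j 1) y) =
        fun k => chartComponents c G y k := by
    rw [h1, Matrix.mulVec_mulVec, Matrix.nonsing_inv_mul _ h2, Matrix.one_mulVec]
  exact (congrFun h3 i).symm

theorem norm_sq_eq_sum_chartPairing (c : M) (G : (z : M × ℝ) → TangentSpace (𝓡 N) z.1)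
    {y : 𝔼 × ℝ} (hy : y ∈ spaceTimeTarget N c) :
    ‖G (Ξ c y)‖ ^ 2 = ∑ i, chartComponents c G y i *
      chartPairing c G (EuclideanSpace.single i 1) y := by
  have h : ∀ w : 𝔼, inner ℝ (coordVector N c y.1 (chartComponents c G y))
      (coordVector N c y.1 w) = ∑ i, w i * chartPairing c G (EuclideanSpace.single i 1) y := by
    intro w
    rw [coordVector_eq_sum c y.1 w, inner_sum]
    refine Finset.sum_congr rfl fun i _ => ?_
    rw [real_inner_smul_right, chartPairing_eq c G hy]
  rw [← h, real_inner_self_eq_norm_sq, coordVector_chartComponents c G hy]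
  rfl

theorem continuousOn_inv_metricMatrix (c : M) (i j : Fin N) :
    ContinuousOn (fun y ↦ (metricMatrix N c y)⁻¹ i j)
      (chartAt 𝔼 c).target := by
  simp only [Matrix.inv_def, Ring.inverse_eq_inv', Matrix.smul_apply, smul_eq_mul]
  refine ContinuousOn.mul ((continuousOn_det_metricMatrix c).inv₀ fun y hy =>
    (posDef_metricMatrix c hy).det_pos.ne') ?_
  have : Continuous (fun A : Matrix (Fin N) (Fin N) ℝ => A.adjugate i j) :=
    (continuous_id.matrix_adjugate).matrix_elem i j
  exact this.comp_continuousOn (continuousOn_metricMatrix c)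

/-- The part of the space-time chart around `c` over which `a` is positive. -/
def positiveTarget (a : M → ℝ) (c : M) : Set (𝔼 × ℝ) :=
  {y | y ∈ spaceTimeTarget N c ∧ Ξ c y ∈ spaceTime M ∧
    0 < a (Ξ c y).1}

theorem isOpen_spaceTime (M : Type*) [TopologicalSpace M] : IsOpen (spaceTime M) :=
  isOpen_univ.prod isOpen_Ioi

theorem isOpen_positiveTarget (ha : Continuous a) (c : M) :
    IsOpen (positiveTarget (N := N) a c) :=
  (continuousOn_spaceTimeChartSymm c).isOpen_inter_preimage (isOpen_spaceTimeTarget c)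
    ((isOpen_spaceTime M).inter (isOpen_lt continuous_const (ha.comp continuous_fst)))

theorem positiveTarget_eq (a : M → ℝ) (c : M) : positiveTarget (N := N) a c =
    ((chartAt 𝔼 c).target ∩
      (chartAt 𝔼 c).symm ⁻¹' {x | 0 < a x}) ×ˢ Ioi (0 : ℝ) := by
  ext y
  simp only [positiveTarget, spaceTimeTarget, spaceTime, spaceTimeChartSymm, mem_ofPred_eq,
    mem_prod, mem_univ, and_true, true_and, mem_inter_iff, mem_preimage]
  tauto

section
variable {u : M × ℝ → ℝ} {G : (z : M × ℝ) → TangentSpace (𝓡 N) z.1}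

theorem IsWeakGradientOn.aestronglyMeasurable_pairing
    (hG : IsWeakGradientOn N {x | 0 < a x} u G) (c : M) (v : 𝔼) :
    AEStronglyMeasurable (chartPairing c G v)
      ((𝓛ₑ).restrict (positiveTarget a c)) := by
  rw [positiveTarget_eq]
  exact (hG c v).2.1.aestronglyMeasurable

theorem IsWeakGradientOn.aestronglyMeasurable_components (ha : Continuous a)
    (hG : IsWeakGradientOn N {x | 0 < a x} u G) (c : M) (i : Fin N) :
    AEStronglyMeasurable (fun y ↦ chartComponents c G y i)
      ((𝓛ₑ).restrict (positiveTarget a c)) := by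
  have hm := (isOpen_positiveTarget (N := N) ha c).measurableSet
  have h1 : AEStronglyMeasurable (fun y : 𝔼 × ℝ ↦ ∑ j, (metricMatrix N c y.1)⁻¹ i j *
      chartPairing c G (EuclideanSpace.single j 1) y)
      ((𝓛ₑ).restrict (positiveTarget a c)) := by
    refine Finset.aestronglyMeasurable_fun_sum _ fun j _ => ?_
    refine AEStronglyMeasurable.mul ?_ (hG.aestronglyMeasurable_pairing c _)
    exact ((continuousOn_inv_metricMatrix c i j).comp continuousOn_fst
      (fun y hy => hy.1.1)).aestronglyMeasurable hm
  refine h1.congr ?_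
  filter_upwards [ae_restrict_mem hm] with y hy
  exact (chartComponents_eq c G hy.1 i).symm

theorem IsWeakGradientOn.aestronglyMeasurable_norm (ha : Continuous a) (hG : IsWeakGradientOn N {x | 0 < a x} u G) :
    AEStronglyMeasurable (fun z ↦ ‖G z‖)
      ((μₐₜ).restrict (spaceTime M)) := by
  refine aestronglyMeasurable_of_spaceTimeChart ha (isOpen_spaceTime M) fun c => ?_
  have hm := (isOpen_positiveTarget (N := N) ha c).measurableSet
  have h1 : AEStronglyMeasurable (fun y : 𝔼 × ℝ ↦ sqrt (∑ i, chartComponents c G y i *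
      chartPairing c G (EuclideanSpace.single i 1) y))
      ((𝓛ₑ).restrict (positiveTarget a c)) := by
    refine continuous_sqrt.comp_aestronglyMeasurable ?_
    exact Finset.aestronglyMeasurable_fun_sum _ fun j _ =>
      (hG.aestronglyMeasurable_components ha c j).mul (hG.aestronglyMeasurable_pairing c _)
  refine h1.congr ?_
  filter_upwards [ae_restrict_mem hm] with y hy
  rw [← norm_sq_eq_sum_chartPairing c G hy.1, sqrt_sq (norm_nonneg _)]
  rfl

theorem spaceDeriv_apply_eq_sum {c : M} {ψ : M × ℝ → ℝ} {y : 𝔼 × ℝ}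
    (hy : y ∈ spaceTimeTarget N c) (h : DifferentiableAt ℝ (ψ ∘ Ξ c) y) :
    spaceDeriv N ψ (Ξ c y) (G (Ξ c y)) =
      ∑ i, chartComponents c G y i *
        fderiv ℝ (ψ ∘ Ξ c) y (EuclideanSpace.single i (1 : ℝ), (0 : ℝ)) := by
  rw [(sliceDifferentiableAt_of_chart hy h).2]
  have h1 : ((chartComponents c G y : 𝔼), (0 : ℝ)) =
      ∑ i, chartComponents c G y i • ((EuclideanSpace.single i (1 : ℝ) : 𝔼), (0 : ℝ)) := by
    refine Prod.ext ?_ ?_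
    · rw [Prod.fst_sum]
      exact euclidean_sum_single _
    · rw [Prod.snd_sum]; simp
  have h2 := congrArg (fderiv ℝ (ψ ∘ Ξ c) y) h1
  rw [map_sum] at h2
  simp only [map_smul, smul_eq_mul] at h2
  exact h2

theorem IsWeakGradientOn.aestronglyMeasurable_spaceDeriv (ha : Continuous a) (hG : IsWeakGradientOn N {x | 0 < a x} u G)
    {ψ : M × ℝ → ℝ} {O : Set (M × ℝ)} (hO : IsOpen O) (hOS : O ⊆ spaceTime M)
    (hψ : LocallyLipschitzOn O ψ) :
    AEStronglyMeasurable (fun z ↦ spaceDeriv N ψ z (G z))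
      ((μₐₜ).restrict O) := by
  refine aestronglyMeasurable_of_spaceTimeChart ha hO fun c => ?_
  have hsub : {y : 𝔼 × ℝ | y ∈ spaceTimeTarget N c ∧ Ξ c y ∈ O ∧
      0 < a (Ξ c y).1} ⊆ positiveTarget a c :=
    fun y hy => ⟨hy.1, hOS hy.2.1, hy.2.2⟩
  have hm : MeasurableSet {y : 𝔼 × ℝ | y ∈ spaceTimeTarget N c ∧ Ξ c y ∈ O ∧
      0 < a (Ξ c y).1} :=
    ((continuousOn_spaceTimeChartSymm c).isOpen_inter_preimage (isOpen_spaceTimeTarget c)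
      (hO.inter (isOpen_lt continuous_const (ha.comp continuous_fst)))).measurableSet
  have h1 : AEStronglyMeasurable (fun y : 𝔼 × ℝ ↦ ∑ i, chartComponents c G y i *
        fderiv ℝ (ψ ∘ Ξ c) y (EuclideanSpace.single i (1 : ℝ), (0 : ℝ)))
      ((𝓛ₑ).restrict {y : 𝔼 × ℝ | y ∈ spaceTimeTarget N c ∧
        Ξ c y ∈ O ∧ 0 < a (Ξ c y).1}) := by
    refine Finset.aestronglyMeasurable_fun_sum _ fun j _ => ?_
    refine ((hG.aestronglyMeasurable_components ha c j).mono_measure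
      (Measure.restrict_mono hsub le_rfl)).mul ?_
    exact (measurable_fderiv_apply_const ℝ _ _).aestronglyMeasurable
  refine h1.congr ?_
  filter_upwards [ae_restrict_mem hm, ae_restrict_of_ae (ae_differentiableAt_chart hO hψ c)]
    with y hy hd
  exact (spaceDeriv_apply_eq_sum hy.1 (hd hy.1 hy.2.1)).symm
end
end GradientMeasurability


/-- Continuity in `L^p` of small measure preserving displacements. -/
theorem exists_forall_eLpNorm_comp_sub_le {X : Type*} [MetricSpace X] [ProperSpace X]
    [MeasurableSpace X] [BorelSpace X] {ν : Measure X} [ν.Regular]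
    {p : ℝ≥0∞} (hp1 : 1 ≤ p) (hp : p ≠ ⊤) {f : X → ℝ} (hf : MemLp f p ν) {ε : ℝ≥0∞}
    (hε : ε ≠ 0) :
    ∃ δ > 0, ∀ W : X → X, MeasurePreserving W ν ν → (∀ x, dist (W x) x ≤ δ) →
      eLpNorm (fun x ↦ f (W x) - f x) p ν ≤ ε := by
  have hε3 : ε / 3 ≠ 0 := by
    rw [ne_eq, ENNReal.div_eq_zero_iff]; push Not; exact ⟨hε, by norm_num⟩
  obtain ⟨g, hgs, hfg, hgc, hgm⟩ := hf.exists_hasCompactSupport_eLpNorm_sub_le hp hε3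
  set K := cthickening 1 (tsupport g) with hK
  have hKc : IsCompact K := hgs.isCompact.cthickening
  have hKm : ν K ≠ ⊤ := hKc.measure_lt_top.ne
  obtain ⟨η, hη, hηε⟩ : ∃ η : ℝ, 0 < η ∧
      ofReal η * ν K ^ (1 / p.toReal) ≤ ε / 3 := by
    by_cases htop : ε = ⊤
    · exact ⟨1, one_pos, by simp [htop, ENNReal.top_div]⟩
    have hc : ν K ^ (1 / p.toReal) ≠ ⊤ := ENNReal.rpow_ne_top_of_nonneg (by positivity) hKm
    have ht : Tendsto (fun η : ℝ ↦ ofReal η * ν K ^ (1 / p.toReal)) (𝓝[>] 0) (𝓝 0) := by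
      have : Tendsto (fun η : ℝ ↦ ofReal η) (𝓝[>] 0) (𝓝 0) := by
        have := (ENNReal.continuous_ofReal.tendsto 0).mono_left
          (nhdsWithin_le_nhds (s := Ioi (0 : ℝ)))
        simpa using this
      simpa using ENNReal.Tendsto.mul_const this (Or.inr hc)
    have h1 := ht.eventually (ge_mem_nhds (pos_iff_ne_zero.2 hε3))
    obtain ⟨η, h2, h3⟩ := (h1.and self_mem_nhdsWithin).exists
    exact ⟨η, h3, h2⟩
  have hgu : UniformContinuous g := hgc.uniformContinuous_of_tendsto_cocompact hgs.is_zero_at_infty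
  obtain ⟨δ, hδ, hgδ⟩ := uniformContinuous_iff.1 hgu η hη
  refine ⟨min (δ / 2) 1, by positivity, fun W hW hWd ↦ ?_⟩
  have h1 : eLpNorm ((f - g) ∘ W) p ν ≤ ε / 3 := by
    rw [eLpNorm_comp_measurePreserving (hf.1.sub hgm.1) hW]; exact hfg
  have h2 : eLpNorm (g ∘ W - g) p ν ≤ ε / 3 := by
    refine (eLpNorm_sub_le_of_dist_bdd ν hp hKc.measurableSet hη.le (fun x ↦ ?_) ?_ ?_).trans hηε
    · exact (hgδ (((hWd x).trans (min_le_left _ _)).trans_lt (half_lt_self hδ))).le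
    · intro x hx
      refine mem_cthickening_of_dist_le x (W x) _ _ (subset_tsupport g hx) ?_
      rw [dist_comm]; exact (hWd x).trans (min_le_right _ _)
    · exact (subset_tsupport g).trans (self_subset_cthickening _)
  have h3 : eLpNorm (g - f) p ν ≤ ε / 3 := by rwa [eLpNorm_sub_comm]
  have e : (fun x ↦ f (W x) - f x) = (f - g) ∘ W + ((g ∘ W - g) + (g - f)) := by
    ext x; simp
  have hWm := hW.quasiMeasurePreserving
  rw [e]
  calc _ ≤ eLpNorm ((f - g) ∘ W) p ν + eLpNorm ((g ∘ W - g) + (g - f)) p ν :=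
        eLpNorm_add_le ((hf.1.sub hgm.1).comp_quasiMeasurePreserving hWm)
          (((hgm.1.comp_quasiMeasurePreserving hWm).sub hgm.1).add (hgm.1.sub hf.1)) hp1
    _ ≤ eLpNorm ((f - g) ∘ W) p ν + (eLpNorm (g ∘ W - g) p ν + eLpNorm (g - f) p ν) := by
        gcongr
        exact eLpNorm_add_le ((hgm.1.comp_quasiMeasurePreserving hWm).sub hgm.1)
          (hgm.1.sub hf.1) hp1
    _ ≤ ε / 3 + (ε / 3 + ε / 3) := by gcongr
    _ = ε := by rw [← add_assoc]; exact ENNReal.add_thirds ε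


section Mollify

variable {E : Type*} [NormedAddCommGroup E] [NormedSpace ℝ E] [FiniteDimensional ℝ E]
  [MeasurableSpace E] [BorelSpace E] {μ : Measure E} [μ.IsAddHaarMeasure]

theorem exists_forall_eLpNorm_translate_sub_le {p : ℝ≥0∞} (hp1 : 1 ≤ p) (hp : p ≠ ⊤)
    {f : E → ℝ} (hf : MemLp f p μ) {ε : ℝ≥0∞} (hε : ε ≠ 0) :
    ∃ δ > 0, ∀ w : E, ‖w‖ ≤ δ → eLpNorm (fun x ↦ f (x - w) - f x) p μ ≤ ε := by
  have : ProperSpace E := FiniteDimensional.proper ℝ E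
  obtain ⟨δ, hδ, h⟩ := exists_forall_eLpNorm_comp_sub_le hp1 hp hf hε
  exact ⟨δ, hδ, fun w hw ↦ h (fun x ↦ x - w) (measurePreserving_sub_right μ w)
    (fun x ↦ by simpa [dist_eq_norm] using hw)⟩

/-- A smooth mollifier supported in the closed ball of radius `δ`. -/
structure IsMollifier (μ : Measure E) (R : E → ℝ) (δ : ℝ) : Prop where
  contDiff : ContDiff ℝ ∞ R
  hasCompactSupport : HasCompactSupport R
  nonneg : ∀ w, 0 ≤ R w
  integral_eq_one : ∫ w, R w ∂μ = 1
  norm_le : ∀ w, R w ≠ 0 → ‖w‖ ≤ δ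

/-- `R * f`. -/
def mollify (μ : Measure E) (R f : E → ℝ) (x : E) : ℝ := ∫ w, R w * f (x - w) ∂μ

theorem exists_isMollifier {δ : ℝ} (hδ : 0 < δ) : ∃ R : E → ℝ, IsMollifier μ R δ := by
  let φ : ContDiffBump (0 : E) := ⟨δ / 2, δ, by positivity, by linarith⟩
  refine ⟨φ.normed μ, φ.contDiff_normed, φ.hasCompactSupport_normed, fun w ↦ φ.nonneg_normed w,
    φ.integral_normed, fun w hw ↦ ?_⟩
  have : w ∈ Function.support (φ.normed μ) := hw
  rw [φ.support_normed_eq] at this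
  simpa using (mem_ball_zero_iff.1 this).le

variable {R f : E → ℝ} {δ : ℝ}

theorem mollify_eq_convolution :
    mollify μ R f = MeasureTheory.convolution R f (ContinuousLinearMap.mul ℝ ℝ) μ := by
  ext x; simp [mollify, MeasureTheory.convolution]

theorem integrable_mul_comp_sub (hRc : Continuous R) (hR : HasCompactSupport R)
    (hf : LocallyIntegrable f μ) (x : E) : Integrable (fun w ↦ R w * f (x - w)) μ := by
  have := (hR.convolutionExists_left (ContinuousLinearMap.mul ℝ ℝ) hRc hf) x
  simpa [MeasureTheory.ConvolutionExistsAt] using this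

theorem contDiff_mollify (hRc : ContDiff ℝ ∞ R) (hR : HasCompactSupport R)
    (hf : LocallyIntegrable f μ) : ContDiff ℝ ∞ (mollify μ R f) := by
  rw [mollify_eq_convolution]
  exact hR.contDiff_convolution_left _ (by exact_mod_cast hRc) hf

theorem fderiv_mollify (hRc : ContDiff ℝ ∞ R) (hR : HasCompactSupport R)
    (hf : LocallyIntegrable f μ) (x v : E) :
    fderiv ℝ (mollify μ R f) x v = ∫ w, fderiv ℝ R w v * f (x - w) ∂μ := by
  rw [mollify_eq_convolution]
  have h1 : ContDiff ℝ 1 R := hRc.of_le (by exact_mod_cast le_top)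
  rw [(hR.hasFDerivAt_convolution_left (ContinuousLinearMap.mul ℝ ℝ) h1 hf x).fderiv]
  have hi := (hR.fderiv ℝ).convolutionExists_left
    ((ContinuousLinearMap.mul ℝ ℝ).precompL E) (h1.continuous_fderiv one_ne_zero) hf x
  rw [MeasureTheory.convolution, ContinuousLinearMap.integral_apply hi]
  simp

theorem mollify_nonneg_le (hR : IsMollifier μ R δ) {B : ℝ} (hfm : LocallyIntegrable f μ)
    (hf0 : ∀ x, 0 ≤ f x) (hfB : ∀ x, f x ≤ B) (x : E) :
    0 ≤ mollify μ R f x ∧ mollify μ R f x ≤ B := by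
  refine ⟨integral_nonneg fun w ↦ mul_nonneg (hR.nonneg w) (hf0 _), ?_⟩
  have hi : Integrable R μ := hR.contDiff.continuous.integrable_of_hasCompactSupport
    hR.hasCompactSupport
  calc mollify μ R f x ≤ ∫ w, R w * B ∂μ := integral_mono
        (integrable_mul_comp_sub hR.contDiff.continuous hR.hasCompactSupport hfm x)
        (hi.mul_const B) (fun w ↦ mul_le_mul_of_nonneg_left (hfB _) (hR.nonneg w))
    _ = B := by rw [integral_mul_const, hR.integral_eq_one, one_mul]

theorem IsMollifier.integrable (hR : IsMollifier μ R δ) : Integrable R μ :=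
  hR.contDiff.continuous.integrable_of_hasCompactSupport hR.hasCompactSupport

theorem enorm_mollify_sub_le (hR : IsMollifier μ R δ) (hf : LocallyIntegrable f μ) (x : E) :
    ‖mollify μ R f x - f x‖ₑ ≤ ∫⁻ w, ofReal (R w) * ‖f (x - w) - f x‖ₑ ∂μ := by
  have h1 := integrable_mul_comp_sub hR.contDiff.continuous hR.hasCompactSupport hf x
  have e : mollify μ R f x - f x = ∫ w, R w * (f (x - w) - f x) ∂μ := by
    simp only [mul_sub]
    rw [integral_sub h1 (hR.integrable.mul_const _), integral_mul_const, hR.integral_eq_one,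
      one_mul, mollify]
  rw [e]
  refine (enorm_integral_le_lintegral_enorm _).trans (le_of_eq ?_)
  refine lintegral_congr fun w ↦ ?_
  rw [enorm_mul, enorm_of_nonneg (hR.nonneg w)]

theorem lintegral_ofReal_mollifier (hR : IsMollifier μ R δ) :
    ∫⁻ w, ofReal (R w) ∂μ = 1 := by
  rw [← ofReal_integral_eq_lintegral_ofReal hR.integrable (ae_of_all _ hR.nonneg),
    hR.integral_eq_one, ENNReal.ofReal_one]

theorem eLpNorm_mollify_sub_le (hR : IsMollifier μ R δ) (hfm : Measurable f)
    (hf : LocallyIntegrable f μ) {ε : ℝ≥0∞}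
    (hε : ∀ w : E, ‖w‖ ≤ δ → eLpNorm (fun x ↦ f (x - w) - f x) 1 μ ≤ ε) :
    eLpNorm (fun x ↦ mollify μ R f x - f x) 1 μ ≤ ε := by
  simp only [eLpNorm_one_eq_lintegral_enorm] at hε ⊢
  calc _ ≤ ∫⁻ x, ∫⁻ w, ofReal (R w) * ‖f (x - w) - f x‖ₑ ∂μ ∂μ :=
        lintegral_mono fun x ↦ enorm_mollify_sub_le hR hf x
    _ = ∫⁻ w, ∫⁻ x, ofReal (R w) * ‖f (x - w) - f x‖ₑ ∂μ ∂μ := by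
        refine lintegral_lintegral_swap (Measurable.aemeasurable ?_)
        have := hR.contDiff.continuous.measurable
        unfold Function.uncurry
        fun_prop
    _ ≤ ∫⁻ w, ofReal (R w) * ε ∂μ := by
        refine lintegral_mono fun w ↦ ?_
        rw [lintegral_const_mul' _ _ ofReal_ne_top]
        by_cases hw : R w = 0
        · simp [hw]
        · gcongr
          exact hε w (hR.norm_le w hw)
    _ = ε := by
        rw [lintegral_mul_const _ hR.contDiff.continuous.measurable.ennreal_ofReal,
          lintegral_ofReal_mollifier hR, one_mul]

/-- `d` is the weak derivative of `u` on `W` in the direction `v`. -/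
def IsWeakDirDeriv (μ : Measure E) (W : Set E) (v : E) (u d : E → ℝ) : Prop :=
  ∀ η : E → ℝ, ContDiff ℝ ∞ η → HasCompactSupport η → tsupport η ⊆ W →
    ∫ y, u y * fderiv ℝ η y v ∂μ = - ∫ y, d y * η y ∂μ

theorem fderiv_mollify_of_isWeakDirDeriv {W : Set E} {v : E} {u d : E → ℝ}
    (hR : IsMollifier μ R δ) (hu : LocallyIntegrable u μ)
    (hd : IsWeakDirDeriv μ W v u d) {x : E} (hx : closedBall x δ ⊆ W) :
    fderiv ℝ (mollify μ R u) x v = mollify μ R d x := by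
  rw [fderiv_mollify hR.contDiff hR.hasCompactSupport hu]
  have hη := hd (fun y ↦ R (x - y)) (hR.contDiff.comp (contDiff_const.sub contDiff_id))
    (hR.hasCompactSupport.comp_homeomorph (Homeomorph.subLeft x)) ?_
  · have e1 : ∀ y, fderiv ℝ (fun y ↦ R (x - y)) y v = - fderiv ℝ R (x - y) v := by
      intro y
      have hd1 : HasFDerivAt R (fderiv ℝ R (x - y)) (x - y) :=
        (hR.contDiff.differentiable (by simp)).differentiableAt.hasFDerivAt
      have h2 : HasFDerivAt (fun y : E ↦ x - y) (-ContinuousLinearMap.id ℝ E) y :=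
        (hasFDerivAt_id y).const_sub x
      have := (HasFDerivAt.comp (g := R) (f := fun y : E ↦ x - y) y hd1 h2).fderiv
      have h3 := congrArg (fun L => L v) this
      simpa [Function.comp_def] using h3
    simp only [e1, mul_neg, integral_neg, neg_inj] at hη
    have s1 := integral_sub_left_eq_self (fun y ↦ u y * fderiv ℝ R (x - y) v) μ x
    have s2 := integral_sub_left_eq_self (fun y ↦ d y * R (x - y)) μ x
    simp only [sub_sub_cancel] at s1 s2
    rw [mollify]
    simp only [mul_comm (fderiv ℝ R _ v), mul_comm (R _)]
    rw [s1, s2, hη]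
  · refine Subset.trans (closure_minimal ?_ isClosed_closedBall) hx
    intro y hy
    have := hR.norm_le _ hy
    rwa [mem_closedBall, dist_comm, dist_eq_norm]

/-- Smooth approximation of a function with a weak derivative. -/
theorem exists_smooth_approximation {W K : Set E} (hW : IsOpen W) (hK : IsCompact K)
    (hKW : K ⊆ W) {v : E} {u d : E → ℝ} (hum : Measurable u) (hdm : Measurable d)
    (hu : Integrable u μ) (hdi : Integrable d μ) (hd : IsWeakDirDeriv μ W v u d) :
    ∃ U : ℕ → E → ℝ, (∀ j, ContDiff ℝ ∞ (U j)) ∧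
      (∀ᵐ x ∂μ, Tendsto (fun j ↦ U j x) atTop (𝓝 (u x))) ∧
      Tendsto (fun j ↦ ∫⁻ x in K, ‖fderiv ℝ (U j) x v - d x‖ₑ ∂μ) atTop (𝓝 0) := by
  obtain ⟨δ₀, hδ₀, hKδ⟩ := hK.exists_cthickening_subset_open hW hKW
  have hmem (f : E → ℝ) (hf : Integrable f μ) (n : ℕ) := exists_forall_eLpNorm_translate_sub_le
    le_rfl ENNReal.one_ne_top (memLp_one_iff_integrable.2 hf)
    (ε := ofReal (1 / ((n : ℝ) + 1))) (by simp; positivity)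
  choose δ₁ hδ₁ h₁ using hmem u hu
  choose δ₂ hδ₂ h₂ using hmem d hdi
  have hR (n : ℕ) := exists_isMollifier (μ := μ) (δ := min δ₀ (min (δ₁ n) (δ₂ n)))
    (lt_min hδ₀ (lt_min (hδ₁ n) (hδ₂ n)))
  choose R hR using hR
  have hlim : Tendsto (fun n : ℕ ↦ ofReal (1 / ((n : ℝ) + 1))) atTop (𝓝 0) := by
    have := ENNReal.tendsto_ofReal (tendsto_one_div_add_atTop_nhds_zero_nat (𝕜 := ℝ))
    simpa using this
  have hA : Tendsto (fun n ↦ eLpNorm (fun x ↦ mollify μ (R n) u x - u x) 1 μ) atTop (𝓝 0) :=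
    tendsto_of_tendsto_of_tendsto_of_le_of_le tendsto_const_nhds hlim (fun _ ↦ zero_le)
      fun n ↦ eLpNorm_mollify_sub_le (hR n) hum hu.locallyIntegrable fun w hw ↦
        h₁ n w (hw.trans ((min_le_right _ _).trans (min_le_left _ _)))
  have hB : Tendsto (fun n ↦ eLpNorm (fun x ↦ mollify μ (R n) d x - d x) 1 μ) atTop (𝓝 0) :=
    tendsto_of_tendsto_of_tendsto_of_le_of_le tendsto_const_nhds hlim (fun _ ↦ zero_le)
      fun n ↦ eLpNorm_mollify_sub_le (hR n) hdm hdi.locallyIntegrable fun w hw ↦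
        h₂ n w (hw.trans ((min_le_right _ _).trans (min_le_right _ _)))
  have hcd (n : ℕ) : ContDiff ℝ ∞ (mollify μ (R n) u) :=
    contDiff_mollify (hR n).contDiff (hR n).hasCompactSupport hu.locallyIntegrable
  have hmeas := tendstoInMeasure_of_tendsto_eLpNorm (p := 1) one_ne_zero
    (f := fun n ↦ mollify μ (R n) u) (g := u)
    (fun n ↦ (hcd n).continuous.aestronglyMeasurable) hum.aestronglyMeasurable hA
  obtain ⟨ns, hns, hae⟩ := hmeas.exists_seq_tendsto_ae
  refine ⟨fun j ↦ mollify μ (R (ns j)) u, fun j ↦ hcd _, hae, ?_⟩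
  refine tendsto_of_tendsto_of_tendsto_of_le_of_le tendsto_const_nhds
    (hB.comp hns.tendsto_atTop) (fun _ ↦ zero_le) fun j ↦ ?_
  simp only [Function.comp_apply, eLpNorm_one_eq_lintegral_enorm]
  refine (lintegral_mono_ae ((ae_restrict_iff' hK.measurableSet).2 (ae_of_all _ fun x hx ↦ ?_))).trans
    (setLIntegral_le_lintegral K _)
  rw [fderiv_mollify_of_isWeakDirDeriv (hR _) hu.locallyIntegrable hd]
  refine Subset.trans ?_ hKδ
  exact (closedBall_subset_closedBall (min_le_left _ _)).trans
    (closedBall_subset_cthickening hx _)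

end Mollify

section ChainRule

variable {E : Type*} [NormedAddCommGroup E] [NormedSpace ℝ E] [FiniteDimensional ℝ E]
  [MeasurableSpace E] [BorelSpace E] {μ : Measure E} [μ.IsAddHaarMeasure]

/-- Approximation of `G ∘ u` by `C¹` functions, together with its derivative. -/
theorem exists_C1_approximation_comp {W K : Set E} (hW : IsOpen W) (hK : IsCompact K)
    (hKW : K ⊆ W) {v : E} {u d : E → ℝ} (hum : Measurable u) (hdm : Measurable d)
    (hu : Integrable u μ) (hdi : Integrable d μ) (hd : IsWeakDirDeriv μ W v u d)
    {G : ℝ → ℝ} (hG : ContDiff ℝ 1 G) {B : ℝ} (hB : ∀ s, ‖deriv G s‖ ≤ B) :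
    ∃ U : ℕ → E → ℝ, (∀ j, ContDiff ℝ 1 (U j)) ∧ (∀ j x, U j x ∈ range G) ∧
      (∀ᵐ x ∂μ, Tendsto (fun j ↦ U j x) atTop (𝓝 (G (u x)))) ∧
      Tendsto (fun j ↦ ∫⁻ x in K, ‖fderiv ℝ (U j) x v - deriv G (u x) * d x‖ₑ ∂μ)
        atTop (𝓝 0) := by
  obtain ⟨U, hU, hae, hL⟩ := exists_smooth_approximation hW hK hKW hum hdm hu hdi hd
  have hU1 (j : ℕ) : ContDiff ℝ 1 (U j) := (hU j).of_le (by exact_mod_cast le_top)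
  have hG' : Continuous (deriv G) := hG.continuous_deriv le_rfl
  refine ⟨fun j ↦ G ∘ U j, fun j ↦ hG.comp (hU1 j), fun j x ↦ ⟨U j x, rfl⟩,
    hae.mono fun x hx ↦ (hG.continuous.tendsto _).comp hx, ?_⟩
  have hder (j : ℕ) (x : E) :
      fderiv ℝ (G ∘ U j) x v = deriv G (U j x) * fderiv ℝ (U j) x v := by
    have h1 := ((hG.differentiable one_ne_zero) (U j x)).hasDerivAt.hasFDerivAt
    have h2 := (((hU1 j).differentiable one_ne_zero) x).hasFDerivAt
    rw [(HasFDerivAt.comp (g := G) (f := U j) x h1 h2).fderiv]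
    simp [mul_comm]
  have hB0 : 0 ≤ B := (norm_nonneg _).trans (hB 0)
  have h2 : Tendsto (fun j ↦ ∫⁻ x in K, ‖(deriv G (U j x) - deriv G (u x)) * d x‖ₑ ∂μ)
      atTop (𝓝 0) := by
    have := tendsto_lintegral_of_dominated_convergence' (μ := μ.restrict K)
      (F := fun j x ↦ ‖(deriv G (U j x) - deriv G (u x)) * d x‖ₑ) (f := fun _ ↦ 0)
      (fun x ↦ ofReal (2 * B) * ‖d x‖ₑ) (fun j ↦ ?_) (fun j ↦ ae_of_all _ fun x ↦ ?_) ?_ ?_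
    · simpa using this
    · have := (hU j).continuous.measurable
      have := hG'.measurable
      fun_prop
    · simp only [enorm_mul]
      gcongr
      rw [← ofReal_norm]
      refine ofReal_le_ofReal ((norm_sub_le _ _).trans ?_)
      linarith [hB (U j x), hB (u x)]
    · rw [lintegral_const_mul' _ _ ofReal_ne_top]
      exact ENNReal.mul_ne_top ofReal_ne_top hdi.restrict.2.ne
    · refine ae_restrict_of_ae (hae.mono fun x hx ↦ ?_)
      have h3 : Tendsto (fun j ↦ (deriv G (U j x) - deriv G (u x)) * d x) atTop (𝓝 0) := by
        have := (((hG'.tendsto _).comp hx).sub_const (deriv G (u x))).mul_const (d x)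
        simpa using this
      simpa using h3.enorm
  have h1 : Tendsto (fun j ↦ ofReal B * ∫⁻ x in K, ‖fderiv ℝ (U j) x v - d x‖ₑ ∂μ)
      atTop (𝓝 0) := by
    simpa using ENNReal.Tendsto.const_mul hL (Or.inr ofReal_ne_top)
  have h12 := h1.add h2
  rw [add_zero] at h12
  refine tendsto_of_tendsto_of_tendsto_of_le_of_le tendsto_const_nhds h12 (fun _ ↦ zero_le)
    fun j ↦ ?_
  simp only
  rw [← lintegral_const_mul' _ _ ofReal_ne_top, ← lintegral_add_left']
  · refine lintegral_mono fun x ↦ ?_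
    rw [hder]
    have e : deriv G (U j x) * fderiv ℝ (U j) x v - deriv G (u x) * d x =
        deriv G (U j x) * (fderiv ℝ (U j) x v - d x) +
          (deriv G (U j x) - deriv G (u x)) * d x := by ring
    rw [e]
    refine (enorm_add_le _ _).trans ?_
    gcongr
    rw [enorm_mul]
    gcongr
    rw [← ofReal_norm]
    exact ofReal_le_ofReal (hB _)
  · have : Measurable fun x ↦ fderiv ℝ (U j) x v :=
      (((hU1 j).continuous_fderiv one_ne_zero).clm_apply continuous_const).measurable
    fun_prop

/-- Chain rule for weak derivatives. -/
theorem IsWeakDirDeriv.comp {W : Set E} (hW : IsOpen W) {v : E} {u d : E → ℝ}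
    (hum : Measurable u) (hdm : Measurable d) (hu : Integrable u μ) (hdi : Integrable d μ)
    (hd : IsWeakDirDeriv μ W v u d) {G : ℝ → ℝ} (hG : ContDiff ℝ 1 G) {B B₀ : ℝ}
    (hB : ∀ s, ‖deriv G s‖ ≤ B) (hB₀ : ∀ s, ‖G s‖ ≤ B₀) :
    IsWeakDirDeriv μ W v (fun x ↦ G (u x)) (fun x ↦ deriv G (u x) * d x) := by
  intro η hη hηc hηW
  obtain ⟨U, hU, hUr, hae, hL⟩ :=
    exists_C1_approximation_comp hW hηc.isCompact hηW hum hdm hu hdi hd hG hB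
  have hη1 : ContDiff ℝ 1 η := hη.of_le (by exact_mod_cast le_top)
  have hη'c : Continuous fun x ↦ fderiv ℝ η x v :=
    (hη1.continuous_fderiv one_ne_zero).clm_apply continuous_const
  have hη's : HasCompactSupport fun x ↦ fderiv ℝ η x v := by
    refine (hηc.fderiv ℝ).comp_left (g := fun L : E →L[ℝ] ℝ ↦ L v) (by simp)
  have hη'i : Integrable (fun x ↦ fderiv ℝ η x v) μ := hη'c.integrable_of_hasCompactSupport hη's
  obtain ⟨Cη, hCη⟩ := hηc.exists_bound_of_continuous hη.continuous
  have hCη0 : 0 ≤ Cη := (norm_nonneg _).trans (hCη 0)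
  have hU' (j : ℕ) : Continuous fun x ↦ fderiv ℝ (U j) x v :=
    ((hU j).continuous_fderiv one_ne_zero).clm_apply continuous_const
  have hi (F : E → ℝ) (hF : Continuous F) : Integrable (fun x ↦ F x * η x) μ :=
    (hF.mul hη.continuous).integrable_of_hasCompactSupport hηc.mul_left
  have hGd : Integrable (fun x ↦ deriv G (u x) * d x) μ := by
    refine hdi.bdd_mul (c := B) (((hG.continuous_deriv le_rfl).measurable.comp
      hum).aestronglyMeasurable) (ae_of_all _ fun x ↦ hB _)
  have hGdη : Integrable (fun x ↦ deriv G (u x) * d x * η x) μ :=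
    hGd.mul_bdd (c := Cη) hη.continuous.aestronglyMeasurable (ae_of_all _ hCη)
  have hparts (j : ℕ) : ∫ x, U j x * fderiv ℝ η x v ∂μ = - ∫ x, fderiv ℝ (U j) x v * η x ∂μ :=
    integral_mul_fderiv_eq_neg_fderiv_mul_of_integrable (hi _ (hU' j))
      (((hU j).continuous.mul hη'c).integrable_of_hasCompactSupport hη's.mul_left)
      (hi _ (hU j).continuous) (fun x _ ↦ ((hU j).differentiable one_ne_zero) x)
      (fun x _ ↦ (hη1.differentiable one_ne_zero) x)
  have l1 : Tendsto (fun j ↦ ∫ x, U j x * fderiv ℝ η x v ∂μ) atTop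
      (𝓝 (∫ x, G (u x) * fderiv ℝ η x v ∂μ)) := by
    refine tendsto_integral_of_dominated_convergence (fun x ↦ B₀ * ‖fderiv ℝ η x v‖)
      (fun j ↦ ((hU j).continuous.mul hη'c).aestronglyMeasurable) (hη'i.norm.const_mul _)
      (fun j ↦ ae_of_all _ fun x ↦ ?_) (hae.mono fun x hx ↦ hx.mul_const _)
    obtain ⟨s, hs⟩ := hUr j x
    rw [norm_mul]
    gcongr
    rw [← hs]; exact hB₀ s
  have l2 : Tendsto (fun j ↦ ∫ x, fderiv ℝ (U j) x v * η x ∂μ) atTop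
      (𝓝 (∫ x, deriv G (u x) * d x * η x ∂μ)) := by
    refine tendsto_integral_of_L1 _ hGdη.aestronglyMeasurable (Eventually.of_forall fun j ↦ hi _ (hU' j)) ?_
    have : Tendsto (fun j ↦ ofReal Cη *
        ∫⁻ x in tsupport η, ‖fderiv ℝ (U j) x v - deriv G (u x) * d x‖ₑ ∂μ) atTop (𝓝 0) := by
      simpa using ENNReal.Tendsto.const_mul hL (Or.inr ofReal_ne_top)
    refine tendsto_of_tendsto_of_tendsto_of_le_of_le tendsto_const_nhds this (fun _ ↦ zero_le)
      fun j ↦ ?_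
    simp only
    rw [← lintegral_const_mul' _ _ ofReal_ne_top,
      ← lintegral_indicator hηc.isCompact.measurableSet]
    refine lintegral_mono fun x ↦ ?_
    by_cases hx : x ∈ tsupport η
    · rw [indicator_of_mem hx, ← sub_mul, enorm_mul, mul_comm]
      gcongr
      rw [← ofReal_norm]
      exact ofReal_le_ofReal (hCη _)
    · simp [image_eq_zero_of_notMem_tsupport hx]
  have l3 : Tendsto (fun j ↦ ∫ x, U j x * fderiv ℝ η x v ∂μ) atTop
      (𝓝 (- ∫ x, deriv G (u x) * d x * η x ∂μ)) := by
    simp only [hparts]; exact l2.neg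
  exact tendsto_nhds_unique l1 l3

/-- Difference quotients are controlled by averages of the derivative along segments. -/
theorem ae_enorm_sub_translate_le {K K₁ : Set E} (hK : MeasurableSet K) (hK₁ : MeasurableSet K₁)
    {v : E} (hseg : ∀ x ∈ K₁, ∀ σ ∈ Ioc (0 : ℝ) 1, x - σ • v ∈ K) {z e : E → ℝ}
    (hem : Measurable e) {U : ℕ → E → ℝ} (hU : ∀ j, ContDiff ℝ 1 (U j))
    (hae : ∀ᵐ x ∂μ, Tendsto (fun j ↦ U j x) atTop (𝓝 (z x)))
    (hL : Tendsto (fun j ↦ ∫⁻ x in K, ‖fderiv ℝ (U j) x v - e x‖ₑ ∂μ) atTop (𝓝 0)) :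
    ∀ᵐ x ∂μ.restrict K₁, ‖z x - z (x - v)‖ₑ ≤ ∫⁻ σ in Ioc (0 : ℝ) 1, ‖e (x - σ • v)‖ₑ := by
  have hU' (j : ℕ) : Continuous fun x ↦ fderiv ℝ (U j) x v :=
    ((hU j).continuous_fderiv one_ne_zero).clm_apply continuous_const
  set k : ℕ → E → ℝ≥0∞ := fun j x ↦ ‖fderiv ℝ (U j) x v - e x‖ₑ with hk
  have hkm (j : ℕ) : Measurable (k j) := by
    have := (hU' j).measurable
    fun_prop
  set r : ℕ → E → ℝ≥0∞ := fun j x ↦ ∫⁻ σ in Ioc (0 : ℝ) 1, k j (x - σ • v) with hr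
  have hjm (j : ℕ) : Measurable (Function.uncurry fun (x : E) (σ : ℝ) ↦ k j (x - σ • v)) := by
    have := hkm j
    unfold Function.uncurry
    fun_prop
  have hrm (j : ℕ) : Measurable (r j) := (hjm j).lintegral_prod_right
  have hrK (j : ℕ) : ∫⁻ x in K₁, r j x ∂μ ≤ ∫⁻ x in K, k j x ∂μ := by
    calc ∫⁻ x in K₁, r j x ∂μ = ∫⁻ σ in Ioc (0 : ℝ) 1, ∫⁻ x in K₁, k j (x - σ • v) ∂μ :=
          lintegral_lintegral_swap (hjm j).aemeasurable
      _ ≤ ∫⁻ σ in Ioc (0 : ℝ) 1, ∫⁻ x in K, k j x ∂μ := by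
          refine setLIntegral_mono' measurableSet_Ioc fun σ hσ ↦ ?_
          rw [← lintegral_indicator hK, ← lintegral_indicator hK₁,
            ← lintegral_sub_right_eq_self (K.indicator _) (σ • v)]
          refine lintegral_mono fun x ↦ ?_
          by_cases hx : x ∈ K₁
          · rw [indicator_of_mem hx, indicator_of_mem (hseg x hx σ hσ)]
          · simp [indicator_of_notMem hx]
      _ = ∫⁻ x in K, k j x ∂μ := by simp
  have hlim : ∫⁻ x in K₁, liminf (fun j ↦ r j x) atTop ∂μ = 0 := by
    refine le_antisymm ?_ zero_le
    calc _ ≤ liminf (fun j ↦ ∫⁻ x in K₁, r j x ∂μ) atTop := lintegral_liminf_le hrm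
      _ ≤ liminf (fun j ↦ ∫⁻ x in K, k j x ∂μ) atTop :=
          liminf_le_liminf (Eventually.of_forall hrK)
      _ = 0 := hL.liminf_eq
  rw [lintegral_eq_zero_iff (Measurable.liminf hrm)] at hlim
  have hae' : ∀ᵐ x ∂μ, Tendsto (fun j ↦ U j (x - v)) atTop (𝓝 (z (x - v))) :=
    (measurePreserving_sub_right μ v).quasiMeasurePreserving.ae hae
  filter_upwards [hlim, ae_restrict_of_ae hae, ae_restrict_of_ae hae'] with x h0 h1 h2
  have hj (j : ℕ) : ‖U j x - U j (x - v)‖ₑ ≤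
      (∫⁻ σ in Ioc (0 : ℝ) 1, ‖e (x - σ • v)‖ₑ) + r j x := by
    have hd (σ : ℝ) : HasDerivAt (fun σ : ℝ ↦ U j (x - σ • v))
        (-(fderiv ℝ (U j) (x - σ • v) v)) σ := by
      have h1 := (((hU j).differentiable one_ne_zero) (x - σ • v)).hasFDerivAt
      have h2 : HasDerivAt (fun σ : ℝ ↦ x - σ • v) (-v) σ := by
        simpa using ((hasDerivAt_id σ).smul_const v).const_sub x
      have h3 := HasFDerivAt.comp_hasDerivAt σ h1 h2
      rw [map_neg] at h3
      exact h3
    have hc : Continuous fun σ : ℝ ↦ -(fderiv ℝ (U j) (x - σ • v) v) :=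
      ((hU' j).comp (by fun_prop : Continuous fun σ : ℝ ↦ x - σ • v)).neg
    have hin := intervalIntegral.integral_eq_sub_of_hasDerivAt (a := 0) (b := 1)
      (fun σ _ ↦ hd σ) (hc.intervalIntegrable _ _)
    simp only [one_smul, zero_smul, sub_zero] at hin
    rw [← enorm_neg, neg_sub, ← hin, intervalIntegral.integral_of_le zero_le_one]
    refine (enorm_integral_le_lintegral_enorm _).trans ?_
    rw [hr]
    simp only
    rw [← lintegral_add_right _ (by have := hkm j; fun_prop)]
    refine lintegral_mono fun σ ↦ ?_
    rw [enorm_neg]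
    calc _ = ‖e (x - σ • v) + (fderiv ℝ (U j) (x - σ • v) v - e (x - σ • v))‖ₑ := by
          congr 1; ring
      _ ≤ _ := enorm_add_le _ _
  have hle : liminf (fun j ↦ ‖U j x - U j (x - v)‖ₑ) atTop ≤
      liminf (fun j ↦ (∫⁻ σ in Ioc (0 : ℝ) 1, ‖e (x - σ • v)‖ₑ) + r j x) atTop :=
    liminf_le_liminf (Eventually.of_forall hj)
  rw [(h1.sub h2).enorm.liminf_eq] at hle
  refine hle.trans ?_
  have hfr : ∃ᶠ _ : ℕ in atTop, True := frequently_true_iff_neBot atTop |>.2 inferInstance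
  refine le_of_forall_gt fun c hc ↦ ?_
  by_cases hI : (∫⁻ σ in Ioc (0 : ℝ) 1, ‖e (x - σ • v)‖ₑ) = ⊤
  · rw [hI] at hc; exact absurd hc not_top_lt
  obtain ⟨c', hc1, hc2⟩ := exists_between hc
  have hpos : liminf (fun j ↦ r j x) atTop <
      c' - ∫⁻ σ in Ioc (0 : ℝ) 1, ‖e (x - σ • v)‖ₑ := by
    have h00 : liminf (fun j ↦ r j x) atTop = 0 := h0
    rw [h00]; exact tsub_pos_of_lt hc1
  have hf := frequently_lt_of_liminf_lt (by isBoundedDefault) hpos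
  refine lt_of_le_of_lt (liminf_le_of_frequently_le (hf.mono fun j hj' ↦ ?_)
    (by isBoundedDefault)) hc2
  have := add_le_add_right hj'.le (∫⁻ σ in Ioc (0 : ℝ) 1, ‖e (x - σ • v)‖ₑ)
  rwa [add_tsub_cancel_of_le hc1.le] at this

end ChainRule

section Power

/-- A `C¹` function with bounded derivative that agrees with `w ^ ℓ` for small `w ≥ 0`. -/
def truncatedPower (ℓ M w : ℝ) : ℝ := ∫ t in (0 : ℝ)..w, min (ℓ * |t| ^ (ℓ - 1)) M

variable {ℓ M : ℝ}

theorem continuous_min_rpow (hℓ : 1 ≤ ℓ) : Continuous fun t : ℝ ↦ min (ℓ * |t| ^ (ℓ - 1)) M := by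
  have : Continuous fun t : ℝ ↦ |t| ^ (ℓ - 1) :=
    continuous_abs.rpow_const fun _ ↦ Or.inr (by linarith)
  fun_prop

theorem hasDerivAt_truncatedPower (hℓ : 1 ≤ ℓ) (w : ℝ) :
    HasDerivAt (truncatedPower ℓ M) (min (ℓ * |w| ^ (ℓ - 1)) M) w :=
  (continuous_min_rpow hℓ).integral_hasStrictDerivAt 0 w |>.hasDerivAt

theorem contDiff_truncatedPower (hℓ : 1 ≤ ℓ) : ContDiff ℝ 1 (truncatedPower ℓ M) := by
  rw [contDiff_one_iff_deriv]
  refine ⟨fun w ↦ (hasDerivAt_truncatedPower hℓ w).differentiableAt, ?_⟩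
  have : deriv (truncatedPower ℓ M) = fun w ↦ min (ℓ * |w| ^ (ℓ - 1)) M :=
    funext fun w ↦ (hasDerivAt_truncatedPower hℓ w).deriv
  rw [this]
  exact continuous_min_rpow hℓ

theorem truncatedPower_eq (hℓ : 1 ≤ ℓ) {w : ℝ} (hw : 0 ≤ w) (hM : ℓ * w ^ (ℓ - 1) ≤ M) :
    truncatedPower ℓ M w = w ^ ℓ := by
  have : truncatedPower ℓ M w = ∫ t in (0 : ℝ)..w, ℓ * t ^ (ℓ - 1) := by
    refine intervalIntegral.integral_congr fun t ht ↦ ?_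
    rw [uIcc_of_le hw] at ht
    rw [abs_of_nonneg ht.1, min_eq_left]
    refine le_trans ?_ hM
    have := rpow_le_rpow ht.1 ht.2 (by linarith : 0 ≤ ℓ - 1)
    nlinarith
  rw [this, intervalIntegral.integral_const_mul, integral_rpow (Or.inl (by linarith))]
  rw [sub_add_cancel, zero_rpow (by linarith)]
  field_simp
  ring

variable {E : Type*} [NormedAddCommGroup E] [NormedSpace ℝ E] [FiniteDimensional ℝ E]
  [MeasurableSpace E] [BorelSpace E] {μ : Measure E} [μ.IsAddHaarMeasure]

theorem ae_enorm_rpow_sub_translate_le {W K K₁ : Set E} (hW : IsOpen W) (hK : IsCompact K)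
    (hKW : K ⊆ W) (hK₁ : MeasurableSet K₁)
    {v : E} (hseg : ∀ x ∈ K₁, ∀ σ ∈ Ioc (0 : ℝ) 1, x - σ • v ∈ K) {u d : E → ℝ}
    (hum : Measurable u) (hdm : Measurable d) (hu : Integrable u μ) (hdi : Integrable d μ)
    (hd : IsWeakDirDeriv μ W v u d) (hℓ : 1 ≤ ℓ) (hu0 : ∀ x, 0 ≤ u x) :
    ∀ᵐ x ∂μ.restrict K₁, ‖u x ^ ℓ - u (x - v) ^ ℓ‖ₑ ≤
      ∫⁻ σ in Ioc (0 : ℝ) 1, ofReal (ℓ * u (x - σ • v) ^ (ℓ - 1) * |d (x - σ • v)|) := by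
  have hmain (n : ℕ) : ∀ᵐ x ∂μ.restrict K₁,
      ‖truncatedPower ℓ n (u x) - truncatedPower ℓ n (u (x - v))‖ₑ ≤
      ∫⁻ σ in Ioc (0 : ℝ) 1,
        ofReal (ℓ * u (x - σ • v) ^ (ℓ - 1) * |d (x - σ • v)|) := by
    have hB (s : ℝ) : ‖deriv (truncatedPower ℓ n) s‖ ≤ n := by
      rw [(hasDerivAt_truncatedPower hℓ s).deriv, norm_of_nonneg]
      · exact min_le_right _ _
      · exact le_min (by positivity) (by positivity)
    obtain ⟨U, hU, -, hae, hL⟩ := exists_C1_approximation_comp hW hK hKW hum hdm hu hdi hd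
      (contDiff_truncatedPower hℓ) hB
    have hem : Measurable fun x ↦ deriv (truncatedPower ℓ n) (u x) * d x := by
      have := measurable_deriv (truncatedPower ℓ n)
      fun_prop
    refine (ae_enorm_sub_translate_le (z := fun x ↦ truncatedPower ℓ n (u x)) hK.measurableSet
      hK₁ hseg hem hU hae hL).mono fun x hx ↦ hx.trans (lintegral_mono fun σ ↦ ?_)
    rw [← ofReal_norm]
    refine ofReal_le_ofReal ?_
    rw [norm_mul, norm_eq_abs (d _), (hasDerivAt_truncatedPower hℓ _).deriv,
      norm_of_nonneg (le_min (by positivity) (by positivity)), abs_of_nonneg (hu0 _)]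
    gcongr
    exact min_le_left _ _
  filter_upwards [ae_all_iff.2 hmain] with x hx
  obtain ⟨n, hn⟩ := exists_nat_ge (max (ℓ * u x ^ (ℓ - 1)) (ℓ * u (x - v) ^ (ℓ - 1)))
  have := hx n
  rwa [truncatedPower_eq hℓ (hu0 _) ((le_max_left _ _).trans hn),
    truncatedPower_eq hℓ (hu0 _) ((le_max_right _ _).trans hn)] at this

end Power

section Kernels

variable {E : Type*} [NormedAddCommGroup E] [NormedSpace ℝ E] [FiniteDimensional ℝ E]
  [MeasurableSpace E] [BorelSpace E] {μ : Measure E} [μ.IsAddHaarMeasure]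

theorem IsMollifier.integrable_fderiv {R : E → ℝ} {δ : ℝ} (hR : IsMollifier μ R δ) (v : E) :
    Integrable (fun w ↦ fderiv ℝ R w v) μ := by
  have h1 : ContDiff ℝ 1 R := hR.contDiff.of_le (by exact_mod_cast le_top)
  refine ((h1.continuous_fderiv one_ne_zero).clm_apply
    continuous_const).integrable_of_hasCompactSupport ?_
  exact (hR.hasCompactSupport.fderiv ℝ).comp_left (g := fun L : E →L[ℝ] ℝ ↦ L v) (by simp)

/-- Mollifiers at scale `δ` whose derivative has mass `O(1/δ)`. -/
theorem exists_isMollifier_deriv_le (μ : Measure E) [μ.IsAddHaarMeasure] :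
    ∃ C : ℝ, 0 ≤ C ∧ ∀ δ : ℝ, 0 < δ → ∃ R : E → ℝ, IsMollifier μ R δ ∧
      ∀ v : E, ∫⁻ w, ‖fderiv ℝ R w v‖ₑ ∂μ ≤ ofReal (C * ‖v‖ / δ) := by
  obtain ⟨ρ, hρ⟩ := exists_isMollifier (μ := μ) one_pos
  have h1 : ContDiff ℝ 1 ρ := hρ.contDiff.of_le (by exact_mod_cast le_top)
  have hin : Integrable (fun w ↦ ‖fderiv ℝ ρ w‖) μ :=
    (h1.continuous_fderiv one_ne_zero).norm.integrable_of_hasCompactSupport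
      (hρ.hasCompactSupport.fderiv ℝ).norm
  refine ⟨∫ w, ‖fderiv ℝ ρ w‖ ∂μ, integral_nonneg fun _ ↦ norm_nonneg _, fun δ hδ ↦ ?_⟩
  set n := Module.finrank ℝ E
  have hδn : 0 < δ ^ n := pow_pos hδ n
  have hR : IsMollifier μ (fun w ↦ (δ ^ n)⁻¹ * ρ (δ⁻¹ • w)) δ := by
    refine ⟨contDiff_const.mul (hρ.contDiff.comp (contDiff_const_smul _)), ?_, fun w ↦
      mul_nonneg (by positivity) (hρ.nonneg _), ?_, fun w hw ↦ ?_⟩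
    · exact HasCompactSupport.mul_left (f := fun _ ↦ (δ ^ n)⁻¹)
        (hρ.hasCompactSupport.comp_smul (inv_ne_zero hδ.ne'))
    · rw [integral_const_mul, Measure.integral_comp_inv_smul_of_nonneg μ ρ hδ.le,
        hρ.integral_eq_one, smul_eq_mul, mul_one]
      exact inv_mul_cancel₀ hδn.ne'
    · have := hρ.norm_le _ (right_ne_zero_of_mul hw)
      rw [norm_smul, norm_inv, norm_of_nonneg hδ.le] at this
      rwa [inv_mul_le_iff₀ hδ, mul_one] at this
  refine ⟨_, hR, fun v ↦ ?_⟩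
  have hd (w : E) : fderiv ℝ (fun w ↦ (δ ^ n)⁻¹ * ρ (δ⁻¹ • w)) w v =
      (δ ^ n)⁻¹ * (δ⁻¹ * fderiv ℝ ρ (δ⁻¹ • w) v) := by
    have e1 : HasFDerivAt ρ (fderiv ℝ ρ (δ⁻¹ • w)) (δ⁻¹ • w) :=
      ((h1.differentiable one_ne_zero) _).hasFDerivAt
    have e2 : HasFDerivAt (fun w : E ↦ δ⁻¹ • w) (δ⁻¹ • ContinuousLinearMap.id ℝ E) w :=
      (hasFDerivAt_id w).const_smul _
    have := ((HasFDerivAt.comp (g := ρ) (f := fun w : E ↦ δ⁻¹ • w) w e1 e2).const_mul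
      (δ ^ n)⁻¹).fderiv
    have h3 := congrArg (fun L => L v) this
    simpa [Function.comp_def] using h3
  rw [← ofReal_integral_norm_eq_lintegral_enorm (hR.integrable_fderiv v)]
  refine ofReal_le_ofReal ?_
  simp only [hd]
  calc ∫ w, ‖(δ ^ n)⁻¹ * (δ⁻¹ * fderiv ℝ ρ (δ⁻¹ • w) v)‖ ∂μ
      ≤ ∫ w, (δ ^ n)⁻¹ * (δ⁻¹ * ‖v‖) * ‖fderiv ℝ ρ (δ⁻¹ • w)‖ ∂μ := by
        refine integral_mono_of_nonneg (ae_of_all _ fun _ ↦ norm_nonneg _) ?_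
          (ae_of_all _ fun w ↦ ?_)
        · exact (hin.comp_smul (inv_ne_zero hδ.ne')).const_mul _
        · simp only [norm_mul, norm_inv, norm_pow, norm_of_nonneg hδ.le]
          have := (fderiv ℝ ρ (δ⁻¹ • w)).le_opNorm v
          calc (δ ^ n)⁻¹ * (δ⁻¹ * ‖fderiv ℝ ρ (δ⁻¹ • w) v‖)
              ≤ (δ ^ n)⁻¹ * (δ⁻¹ * (‖fderiv ℝ ρ (δ⁻¹ • w)‖ * ‖v‖)) := by gcongr
            _ = _ := by ring
    _ = (∫ w, ‖fderiv ℝ ρ w‖ ∂μ) * ‖v‖ / δ := by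
        rw [integral_const_mul,
          Measure.integral_comp_inv_smul_of_nonneg μ (fun w ↦ ‖fderiv ℝ ρ w‖) hδ.le, smul_eq_mul]
        have : Module.finrank ℝ E = n := rfl
        rw [this]
        field_simp

end Kernels


theorem isMollifier_prod {ρ : 𝔼 → ℝ} {θ : ℝ → ℝ} {δ h : ℝ} (hρ : IsMollifier volume ρ δ)
    (hθ : IsMollifier volume θ h) (hh : h ≤ δ) :
    IsMollifier volume (fun w : 𝔼 × ℝ ↦ ρ w.1 * θ w.2) δ := by
  refine ⟨(hρ.contDiff.comp contDiff_fst).mul (hθ.contDiff.comp contDiff_snd), ?_,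
    fun w ↦ mul_nonneg (hρ.nonneg _) (hθ.nonneg _), ?_, fun w hw ↦ ?_⟩
  · refine HasCompactSupport.intro (hρ.hasCompactSupport.isCompact.prod
      hθ.hasCompactSupport.isCompact) fun w hw ↦ ?_
    rw [mem_prod, not_and_or] at hw
    rcases hw with hw | hw
    · simp [image_eq_zero_of_notMem_tsupport hw]
    · simp [image_eq_zero_of_notMem_tsupport hw]
  · rw [Measure.volume_eq_prod, integral_prod_mul, hρ.integral_eq_one, hθ.integral_eq_one, one_mul]
  · exact max_le (hρ.norm_le _ (left_ne_zero_of_mul hw))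
      ((hθ.norm_le _ (right_ne_zero_of_mul hw)).trans hh)

theorem fderiv_prod_kernel {ρ : 𝔼 → ℝ} {θ : ℝ → ℝ} {δ h : ℝ} (hρ : IsMollifier volume ρ δ)
    (hθ : IsMollifier volume θ h) (w : 𝔼 × ℝ) (v : 𝔼) :
    fderiv ℝ (fun w : 𝔼 × ℝ ↦ ρ w.1 * θ w.2) w (v, 0) = fderiv ℝ ρ w.1 v * θ w.2 := by
  have e1 : HasFDerivAt ρ (fderiv ℝ ρ w.1) w.1 :=
    ((hρ.contDiff.differentiable (by simp)) _).hasFDerivAt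
  have e2 : HasFDerivAt θ (fderiv ℝ θ w.2) w.2 :=
    ((hθ.contDiff.differentiable (by simp)) _).hasFDerivAt
  have f1 := HasFDerivAt.comp (g := ρ) (f := fun w : 𝔼 × ℝ ↦ w.1) w e1 hasFDerivAt_fst
  have f2 := HasFDerivAt.comp (g := θ) (f := fun w : 𝔼 × ℝ ↦ w.2) w e2 hasFDerivAt_snd
  have h3 := congrArg (fun L => L (v, (0 : ℝ))) (f1.mul f2).fderiv
  simpa [Function.comp_def, mul_comm, Pi.mul_def] using h3

theorem lintegral_enorm_fderiv_prod_kernel {ρ : 𝔼 → ℝ} {θ : ℝ → ℝ} {δ h : ℝ}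
    (hρ : IsMollifier volume ρ δ) (hθ : IsMollifier volume θ h) (v : 𝔼) :
    ∫⁻ w, ‖fderiv ℝ (fun w : 𝔼 × ℝ ↦ ρ w.1 * θ w.2) w (v, 0)‖ₑ = ∫⁻ y, ‖fderiv ℝ ρ y v‖ₑ := by
  simp only [fderiv_prod_kernel hρ hθ, enorm_mul]
  rw [Measure.volume_eq_prod, lintegral_prod_mul (f := fun y ↦ ‖fderiv ℝ ρ y v‖ₑ)
    (g := fun s ↦ ‖θ s‖ₑ)]
  · simp only [enorm_of_nonneg (hθ.nonneg _)]
    rw [lintegral_ofReal_mollifier hθ, mul_one]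
  · exact (hρ.integrable_fderiv v).aestronglyMeasurable.enorm
  · exact hθ.contDiff.continuous.measurable.enorm.aemeasurable

theorem lintegral_enorm_mul_le {α : Type*} [MeasurableSpace α] {μ : Measure α} {p p' : ℝ}
    (hpp : p.HolderConjugate p') {f g : α → ℝ} (hf : AEStronglyMeasurable f μ)
    (hg : AEStronglyMeasurable g μ) :
    ∫⁻ x, ‖f x‖ₑ * ‖g x‖ₑ ∂μ ≤
      eLpNorm f (ofReal p) μ * eLpNorm g (ofReal p') μ := by
  have h1 := hpp.pos
  have h2 := hpp.symm.pos
  rw [eLpNorm_eq_lintegral_rpow_enorm_toReal (by simpa using h1) ofReal_ne_top,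
    eLpNorm_eq_lintegral_rpow_enorm_toReal (by simpa using h2) ofReal_ne_top,
    ENNReal.toReal_ofReal h1.le, ENNReal.toReal_ofReal h2.le]
  exact ENNReal.lintegral_mul_le_Lp_mul_Lq μ hpp hf.enorm hg.enorm

/-- The error made when a difference quotient of `z` is replaced by `H`. -/
def differenceError (z H : 𝔼 × ℝ → ℝ) (w x : 𝔼 × ℝ) : ℝ≥0∞ :=
  ‖w.1‖ₑ * (∫⁻ σ in Ioc (0 : ℝ) 1, ‖H (x - σ • (w.1, 0)) - H x‖ₑ) +
    ‖z (x - (w.1, 0)) - z (x - w)‖ₑ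

theorem measurable_differenceError {z H : 𝔼 × ℝ → ℝ} (hz : Measurable z) (hH : Measurable H) :
    Measurable (Function.uncurry (differenceError (N := N) z H)) := by
  unfold Function.uncurry differenceError
  have h1 : Measurable fun a : (𝔼 × ℝ) × (𝔼 × ℝ) ↦
      ∫⁻ σ in Ioc (0 : ℝ) 1, ‖H (a.2 - σ • (a.1.1, 0)) - H a.2‖ₑ := by
    refine Measurable.lintegral_prod_right' (f := fun b : ((𝔼 × ℝ) × (𝔼 × ℝ)) × ℝ ↦
      ‖H (b.1.2 - b.2 • (b.1.1.1, 0)) - H b.1.2‖ₑ) ?_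
    fun_prop
  fun_prop

theorem lintegral_mul_segment_le {p p' : ℝ} (hpp : p.HolderConjugate p')
    {f H : 𝔼 × ℝ → ℝ} {δ : ℝ} {ωH : ℝ≥0∞} (hf : Measurable f) (hH : Measurable H)
    (hωH : ∀ w : 𝔼 × ℝ, ‖w‖ ≤ δ →
      eLpNorm (fun x ↦ H (x - w) - H x) (ofReal p) volume ≤ ωH)
    {y : 𝔼} (hy : ‖y‖ ≤ δ) :
    ∫⁻ x, ‖f x‖ₑ * (‖y‖ₑ * ∫⁻ σ in Ioc (0 : ℝ) 1, ‖H (x - σ • (y, 0)) - H x‖ₑ) ≤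
      eLpNorm f (ofReal p') volume * (ofReal δ * ωH) := by
  have hm : Measurable fun a : (𝔼 × ℝ) × ℝ ↦ ‖H (a.1 - a.2 • (y, 0)) - H a.1‖ₑ * ‖f a.1‖ₑ := by
    have h1 : Measurable fun a : (𝔼 × ℝ) × ℝ ↦ H (a.1 - a.2 • (y, 0)) :=
      hH.comp (by fun_prop)
    have h2 : Measurable fun a : (𝔼 × ℝ) × ℝ ↦ H a.1 := hH.comp measurable_fst
    have h3 : Measurable fun a : (𝔼 × ℝ) × ℝ ↦ f a.1 := hf.comp measurable_fst
    exact (h1.sub h2).enorm.mul h3.enorm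
  have hle (σ : ℝ) (hσ : σ ∈ Ioc (0 : ℝ) 1) :
      ∫⁻ x, ‖H (x - σ • (y, 0)) - H x‖ₑ * ‖f x‖ₑ ≤
        ωH * eLpNorm f (ofReal p') volume := by
    refine (lintegral_enorm_mul_le hpp ((hH.comp (measurable_id.sub_const _)).sub
      hH).aestronglyMeasurable hf.aestronglyMeasurable).trans ?_
    gcongr
    refine hωH _ ?_
    rw [norm_smul, norm_of_nonneg hσ.1.le, Prod.norm_mk, norm_zero,
      max_eq_left (norm_nonneg _)]
    exact (mul_le_of_le_one_left (norm_nonneg _) hσ.2).trans hy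
  calc ∫⁻ x, ‖f x‖ₑ * (‖y‖ₑ * ∫⁻ σ in Ioc (0 : ℝ) 1, ‖H (x - σ • (y, 0)) - H x‖ₑ)
      = ‖y‖ₑ * ∫⁻ x, ∫⁻ σ in Ioc (0 : ℝ) 1, ‖H (x - σ • (y, 0)) - H x‖ₑ * ‖f x‖ₑ := by
        rw [← lintegral_const_mul' _ _ enorm_ne_top]
        refine lintegral_congr fun x ↦ ?_
        rw [lintegral_mul_const' _ _ enorm_ne_top]
        ring
    _ = ‖y‖ₑ * ∫⁻ σ in Ioc (0 : ℝ) 1, ∫⁻ x, ‖H (x - σ • (y, 0)) - H x‖ₑ * ‖f x‖ₑ := by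
        rw [lintegral_lintegral_swap hm.aemeasurable]
    _ ≤ ofReal δ * ∫⁻ σ in Ioc (0 : ℝ) 1, ωH * eLpNorm f (ofReal p') volume := by
        gcongr ?_ * ?_
        · rw [← ofReal_norm]; exact ofReal_le_ofReal hy
        · exact setLIntegral_mono' measurableSet_Ioc hle
    _ = _ := by simp; ring

theorem lintegral_mul_time_translate_le {p p' : ℝ} (hpp : p.HolderConjugate p')
    {f z : 𝔼 × ℝ → ℝ} {h : ℝ} {ωz : ℝ≥0∞} (hf : Measurable f) (hz : Measurable z)
    (hωz : ∀ s : ℝ, |s| ≤ h →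
      eLpNorm (fun x : 𝔼 × ℝ ↦ z (x - (0, s)) - z x) (ofReal p) volume ≤ ωz)
    {w : 𝔼 × ℝ} (hw : |w.2| ≤ h) :
    ∫⁻ x, ‖f x‖ₑ * ‖z (x - (w.1, 0)) - z (x - w)‖ₑ ≤
      eLpNorm f (ofReal p') volume * ωz := by
  have hzw (w : 𝔼 × ℝ) : Measurable fun x ↦ z (x - w) := hz.comp (measurable_id.sub_const _)
  refine (lintegral_enorm_mul_le hpp.symm hf.aestronglyMeasurable
    ((hzw _).sub (hzw w)).aestronglyMeasurable).trans ?_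
  gcongr
  have hmp := measurePreserving_sub_right 𝓛ₑ (w.1, (0 : ℝ))
  have := eLpNorm_comp_measurePreserving (p := ofReal p)
    (g := fun x : 𝔼 × ℝ ↦ z (x - (0, w.2)) - z x) ((hzw _).sub hz).aestronglyMeasurable hmp
  have hz2 := hωz _ hw
  rw [← this] at hz2
  refine le_trans (le_of_eq ?_) hz2
  rw [← eLpNorm_neg]
  congr 1
  ext x
  have e : x - (w.1, (0 : ℝ)) - (0, w.2) = x - w := by ext <;> simp
  simp only [Pi.neg_apply, Pi.sub_apply, Function.comp_apply, neg_sub, e]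

theorem lintegral_mul_lintegral_le {α : Type*} [MeasurableSpace α] {μ : Measure α} [SFinite μ]
    {F r : α → ℝ≥0∞} {e : α → α → ℝ≥0∞} (hF : Measurable F) (hr : Measurable r)
    (he : Measurable (Function.uncurry e)) {A : ℝ≥0∞}
    (hA : ∀ w, r w ≠ 0 → ∫⁻ x, F x * e w x ∂μ ≤ A) :
    ∫⁻ x, F x * ∫⁻ w, r w * e w x ∂μ ∂μ ≤ (∫⁻ w, r w ∂μ) * A := by
  have hew (w : α) : Measurable (e w) := he.comp measurable_prodMk_left
  have hex (x : α) : Measurable fun w ↦ e w x := he.comp measurable_prodMk_right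
  have hm : Measurable (Function.uncurry fun x w ↦ F x * (r w * e w x)) :=
    (hF.comp measurable_fst).mul ((hr.comp measurable_snd).mul (he.comp measurable_swap))
  calc ∫⁻ x, F x * ∫⁻ w, r w * e w x ∂μ ∂μ = ∫⁻ x, ∫⁻ w, F x * (r w * e w x) ∂μ ∂μ :=
        lintegral_congr fun x ↦ (lintegral_const_mul _ (hr.mul (hex x))).symm
    _ = ∫⁻ w, ∫⁻ x, F x * (r w * e w x) ∂μ ∂μ := lintegral_lintegral_swap hm.aemeasurable
    _ ≤ ∫⁻ w, r w * A ∂μ := by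
        refine lintegral_mono fun w ↦ ?_
        by_cases hw : r w = 0
        · simp [hw]
        calc ∫⁻ x, F x * (r w * e w x) ∂μ = ∫⁻ x, r w * (F x * e w x) ∂μ :=
              lintegral_congr fun x ↦ by ring
          _ = r w * ∫⁻ x, F x * e w x ∂μ := lintegral_const_mul _ (hF.mul (hew w))
          _ ≤ r w * A := by gcongr; exact hA w hw
    _ = _ := lintegral_mul_const _ hr

theorem lintegral_mul_differenceError_le {p p' : ℝ} (hpp : p.HolderConjugate p')
    {f z H : 𝔼 × ℝ → ℝ} {r : 𝔼 × ℝ → ℝ≥0∞} {δ h : ℝ} {ωH ωz : ℝ≥0∞} (hf : Measurable f)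
    (hz : Measurable z) (hH : Measurable H) (hr : Measurable r)
    (hrs : ∀ w, r w ≠ 0 → ‖w.1‖ ≤ δ ∧ |w.2| ≤ h)
    (hωH : ∀ w : 𝔼 × ℝ, ‖w‖ ≤ δ →
      eLpNorm (fun x ↦ H (x - w) - H x) (ofReal p) volume ≤ ωH)
    (hωz : ∀ s : ℝ, |s| ≤ h →
      eLpNorm (fun x : 𝔼 × ℝ ↦ z (x - (0, s)) - z x) (ofReal p) volume ≤ ωz) :
    ∫⁻ x, ‖f x‖ₑ * ∫⁻ w, r w * differenceError z H w x ≤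
      (∫⁻ w, r w) * (eLpNorm f (ofReal p') volume * (ofReal δ * ωH + ωz)) := by
  refine lintegral_mul_lintegral_le hf.enorm hr (measurable_differenceError hz hH) fun w hw ↦ ?_
  have hm : Measurable fun x ↦ ‖f x‖ₑ * ‖z (x - (w.1, 0)) - z (x - w)‖ₑ :=
    hf.enorm.mul ((hz.comp (measurable_id.sub_const _)).sub
      (hz.comp (measurable_id.sub_const _))).enorm
  simp only [differenceError, mul_add]
  rw [lintegral_add_right _ hm]
  exact add_le_add (lintegral_mul_segment_le hpp hf hH hωH (hrs w hw).1)
    (lintegral_mul_time_translate_le hpp hf hz hωz (hrs w hw).2)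


section DominatedWithError

variable {E : Type*} [NormedAddCommGroup E] [NormedSpace ℝ E] [FiniteDimensional ℝ E]
  [MeasurableSpace E] [BorelSpace E] {μ : Measure E} [μ.IsAddHaarMeasure]

theorem IsMollifier.norm_le_of_fderiv_ne_zero {R : E → ℝ} {δ : ℝ} (hR : IsMollifier μ R δ)
    {w v : E} (hw : fderiv ℝ R w v ≠ 0) : ‖w‖ ≤ δ := by
  have h1 : w ∈ tsupport R := by
    refine support_fderiv_subset ℝ ?_
    intro h
    rw [h] at hw
    simp at hw
  have : tsupport R ⊆ closedBall 0 δ :=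
    closure_minimal (fun y hy ↦ by simpa using hR.norm_le y hy) isClosed_closedBall
  simpa using this h1

theorem integral_fderiv_mollifier {R : E → ℝ} {δ : ℝ} (hR : IsMollifier μ R δ) (v : E) :
    ∫ w, fderiv ℝ R w v ∂μ = 0 := by
  have h := fderiv_mollify (f := fun _ ↦ (1 : ℝ)) hR.contDiff hR.hasCompactSupport
    (locallyIntegrable_const (μ := μ) _) 0 v
  have e : mollify μ R (fun _ ↦ (1 : ℝ)) = fun _ ↦ (1 : ℝ) := by
    ext x; simp [mollify, hR.integral_eq_one]
  rw [e] at h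
  simpa using h.symm

/-- Dominated convergence with a dominating function up to an error that tends to zero in `L¹`. -/
theorem tendsto_lintegral_zero_of_le_add {α : Type*} [MeasurableSpace α] {μ : Measure α}
    {F e : ℕ → α → ℝ≥0∞} {Φ : α → ℝ≥0∞} (hF : ∀ k, AEMeasurable (F k) μ) (hΦm : AEMeasurable Φ μ)
    (hΦ : ∫⁻ x, Φ x ∂μ ≠ ⊤) (hle : ∀ k, ∀ᵐ x ∂μ, F k x ≤ Φ x + e k x)
    (he : Tendsto (fun k ↦ ∫⁻ x, e k x ∂μ) atTop (𝓝 0))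
    (hlim : ∀ᵐ x ∂μ, Tendsto (fun k ↦ F k x) atTop (𝓝 0)) :
    Tendsto (fun k ↦ ∫⁻ x, F k x ∂μ) atTop (𝓝 0) := by
  have h1 : Tendsto (fun k ↦ ∫⁻ x, min (F k x) (Φ x) ∂μ) atTop (𝓝 0) := by
    have := tendsto_lintegral_of_dominated_convergence' (μ := μ)
      (F := fun k x ↦ min (F k x) (Φ x)) (f := fun _ ↦ 0) Φ
      (fun k ↦ (hF k).min hΦm) (fun k ↦ ae_of_all _ fun x ↦ min_le_right _ _) hΦ
      (hlim.mono fun x hx ↦ by simpa using hx.min (tendsto_const_nhds (x := Φ x)))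
    simpa using this
  have h2 := h1.add he
  rw [add_zero] at h2
  refine tendsto_of_tendsto_of_tendsto_of_le_of_le tendsto_const_nhds h2 (fun _ ↦ zero_le)
    fun k ↦ ?_
  simp only
  rw [← lintegral_add_left' ((hF k).min hΦm)]
  refine lintegral_mono_ae ((hle k).mono fun x hx ↦ ?_)
  rcases le_total (F k x) (Φ x) with h | h
  · rw [min_eq_left h]; exact le_self_add
  · rw [min_eq_right h]; exact hx

theorem eventually_eLpNorm_translate_sub_le {p : ℝ≥0∞} (hp1 : 1 ≤ p) (hp : p ≠ ⊤)
    {f : E → ℝ} (hf : MemLp f p μ) {ε : ℝ≥0∞} (hε : ε ≠ 0) :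
    ∀ᶠ δ in 𝓝[>] (0 : ℝ), ∀ w : E, ‖w‖ ≤ δ → eLpNorm (fun x ↦ f (x - w) - f x) p μ ≤ ε := by
  obtain ⟨δ, hδ, h⟩ := exists_forall_eLpNorm_translate_sub_le hp1 hp hf hε
  filter_upwards [Ioo_mem_nhdsGT hδ] with δ' hδ' w hw using h w (hw.trans hδ'.2.le)

theorem enorm_fderiv_mollify_le {R : E → ℝ} {δ : ℝ} (hδ : 0 < δ) (hR : IsMollifier μ R δ)
    {ζ : E → ℝ} (hζm : Measurable ζ) {B : ℝ} (hζ : ∀ x, |ζ x| ≤ B) {x v : E} {C₁ : ℝ}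
    (hC₁ : 0 ≤ C₁) (hRC : ∫⁻ w, ‖fderiv ℝ R w v‖ₑ ∂μ ≤ ofReal (C₁ / δ))
    {c A : ℝ≥0∞} (hc : c ≠ ⊤) {C : ℝ} {k : E → ℝ≥0∞} (hk : Measurable k)
    (h : ∀ᵐ w ∂μ, ‖w‖ ≤ δ →
      c * ‖ζ (x - w) - ζ x‖ₑ ≤ ofReal C * (ofReal δ * A + k w)) :
    c * ‖fderiv ℝ (mollify μ R ζ) x v‖ₑ ≤
      ofReal C * (ofReal C₁ * A + ∫⁻ w, ‖fderiv ℝ R w v‖ₑ * k w ∂μ) := by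
  have hrm : Measurable fun w ↦ fderiv ℝ R w v :=
    (((hR.contDiff.of_le (by exact_mod_cast le_top) : ContDiff ℝ 1 R).continuous_fderiv
      one_ne_zero).clm_apply continuous_const).measurable
  have hrk : Measurable fun w ↦ ‖fderiv ℝ R w v‖ₑ * k w := hrm.enorm.mul hk
  have hloc : LocallyIntegrable ζ μ :=
    (locallyIntegrable_const B).mono hζm.aestronglyMeasurable
      (ae_of_all _ fun x ↦ (hζ _).trans (le_abs_self B))
  have hi : Integrable (fun w ↦ fderiv ℝ R w v * ζ (x - w)) μ :=
    (hR.integrable_fderiv v).mul_bdd (c := B)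
      (hζm.comp (measurable_const.sub measurable_id)).aestronglyMeasurable
      (ae_of_all _ fun w ↦ hζ _)
  have e1 : fderiv ℝ (mollify μ R ζ) x v = ∫ w, fderiv ℝ R w v * (ζ (x - w) - ζ x) ∂μ := by
    rw [fderiv_mollify hR.contDiff hR.hasCompactSupport hloc]
    simp only [mul_sub]
    rw [integral_sub hi ((hR.integrable_fderiv v).mul_const _), integral_mul_const,
      integral_fderiv_mollifier hR, zero_mul, sub_zero]
  calc c * ‖fderiv ℝ (mollify μ R ζ) x v‖ₑ
      ≤ c * ∫⁻ w, ‖fderiv ℝ R w v * (ζ (x - w) - ζ x)‖ₑ ∂μ := by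
        rw [e1]; gcongr; exact enorm_integral_le_lintegral_enorm _
    _ = ∫⁻ w, c * ‖fderiv ℝ R w v * (ζ (x - w) - ζ x)‖ₑ ∂μ :=
        (lintegral_const_mul' _ _ hc).symm
    _ ≤ ∫⁻ w, ofReal C * (‖fderiv ℝ R w v‖ₑ * (ofReal δ * A) +
          ‖fderiv ℝ R w v‖ₑ * k w) ∂μ := by
        refine lintegral_mono_ae (h.mono fun w hw ↦ ?_)
        by_cases h0 : fderiv ℝ R w v = 0
        · simp [h0]
        calc _ = ‖fderiv ℝ R w v‖ₑ * (c * ‖ζ (x - w) - ζ x‖ₑ) := by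
              rw [enorm_mul]; ring
          _ ≤ ‖fderiv ℝ R w v‖ₑ * (ofReal C * (ofReal δ * A + k w)) := by
              exact mul_le_mul_right (hw (hR.norm_le_of_fderiv_ne_zero h0)) _
          _ = _ := by ring
    _ = ofReal C * ((∫⁻ w, ‖fderiv ℝ R w v‖ₑ ∂μ) * (ofReal δ * A) +
          ∫⁻ w, ‖fderiv ℝ R w v‖ₑ * k w ∂μ) := by
        rw [lintegral_const_mul' _ _ ofReal_ne_top,
          lintegral_add_right _ hrk, lintegral_mul_const _ hrm.enorm]
    _ ≤ _ := by
        refine mul_le_mul_right (add_le_add_left ?_ _) _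
        rw [← mul_assoc]
        refine mul_le_mul_left ?_ _
        calc _ ≤ ofReal (C₁ / δ) * ofReal δ := mul_le_mul_left hRC _
          _ = ofReal C₁ := by
            rw [← ofReal_mul (by positivity), div_mul_cancel₀ _ hδ.ne']

end DominatedWithError


theorem IsWeakDirDeriv.sum_smul {W : Set (𝔼 × ℝ)} {u : 𝔼 × ℝ → ℝ} {d : Fin N → 𝔼 × ℝ → ℝ}
    (hu : Integrable u volume) (hdi : ∀ i, Integrable (d i) volume)
    (hd : ∀ i, IsWeakDirDeriv volume W (EuclideanSpace.single i 1, 0) u (d i)) (v : 𝔼) :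
    IsWeakDirDeriv volume W (v, 0) u (fun x ↦ ∑ i, v i * d i x) := by
  intro η hη hηc hηW
  have hη1 : ContDiff ℝ 1 η := hη.of_le (by exact_mod_cast le_top)
  have hv : ((v, 0) : 𝔼 × ℝ) = ∑ i, v i • ((EuclideanSpace.single i 1, 0) : 𝔼 × ℝ) := by
    have := euclidean_sum_single (N := N) v
    have h2 := congrArg (fun y : 𝔼 ↦ LinearMap.inl ℝ 𝔼 ℝ y) this
    simpa [map_sum] using h2
  have hbd (w : 𝔼 × ℝ) : Integrable (fun y ↦ u y * fderiv ℝ η y w) volume := by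
    have hc : Continuous fun y ↦ fderiv ℝ η y w :=
      (hη1.continuous_fderiv one_ne_zero).clm_apply continuous_const
    obtain ⟨C, hC⟩ := ((hηc.fderiv ℝ).comp_left (g := fun L : 𝔼 × ℝ →L[ℝ] ℝ ↦ L w)
      (by simp)).exists_bound_of_continuous hc
    exact hu.mul_bdd (c := C) hc.aestronglyMeasurable (ae_of_all _ hC)
  have hbη (i : Fin N) : Integrable (fun y ↦ d i y * η y) volume := by
    obtain ⟨C, hC⟩ := hηc.exists_bound_of_continuous hη.continuous
    exact (hdi i).mul_bdd (c := C) hη.continuous.aestronglyMeasurable (ae_of_all _ hC)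
  calc ∫ y, u y * fderiv ℝ η y (v, 0)
      = ∫ y, ∑ i, v i * (u y * fderiv ℝ η y (EuclideanSpace.single i 1, 0)) := by
        refine integral_congr_ae (ae_of_all _ fun y ↦ ?_)
        simp only
        rw [hv, map_sum, Finset.mul_sum]
        refine Finset.sum_congr rfl fun i _ ↦ ?_
        rw [map_smul, smul_eq_mul]; ring
    _ = ∑ i, v i * ∫ y, u y * fderiv ℝ η y (EuclideanSpace.single i 1, 0) := by
        rw [integral_finsetSum _ fun i _ ↦ (hbd _).const_mul _]
        simp only [integral_const_mul]
    _ = - ∑ i, v i * ∫ y, d i y * η y := by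
        rw [← Finset.sum_neg_distrib]
        refine Finset.sum_congr rfl fun i _ ↦ ?_
        rw [hd i η hη hηc hηW]; ring
    _ = - ∫ y, (∑ i, v i * d i y) * η y := by
        simp only [Finset.sum_mul, mul_assoc]
        rw [integral_finsetSum _ fun i _ ↦ (hbη i).const_mul _]
        simp only [integral_const_mul]

/-- The differences of `u ^ ℓ` are controlled by `H = ℓ u ^ (ℓ - 1) ∑ |∂_i u|`. -/
theorem ae_enorm_translate_sub_rpow_le {W K : Set (𝔼 × ℝ)} (hW : IsOpen W) (hK : IsCompact K)
    {δ : ℝ} (hKW : cthickening δ K ⊆ W) {u : 𝔼 × ℝ → ℝ} {d : Fin N → 𝔼 × ℝ → ℝ}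
    (hum : Measurable u) (hdm : ∀ i, Measurable (d i)) (hu : Integrable u volume)
    (hdi : ∀ i, Integrable (d i) volume)
    (hd : ∀ i, IsWeakDirDeriv volume W (EuclideanSpace.single i 1, 0) u (d i))
    {ℓ : ℝ} (hℓ : 1 ≤ ℓ) (hu0 : ∀ x, 0 ≤ u x) {w : 𝔼 × ℝ} (hw : ‖w.1‖ ≤ δ) :
    ∀ᵐ x ∂volume.restrict K, ‖u (x - w) ^ ℓ - u x ^ ℓ‖ₑ ≤
      ‖w.1‖ₑ * ‖ℓ * u x ^ (ℓ - 1) * ∑ i, |d i x|‖ₑ +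
        differenceError (fun x ↦ u x ^ ℓ) (fun x ↦ ℓ * u x ^ (ℓ - 1) * ∑ i, |d i x|) w x := by
  set H : 𝔼 × ℝ → ℝ := fun x ↦ ℓ * u x ^ (ℓ - 1) * ∑ i, |d i x| with hH
  have hHm : Measurable H := by
    have : ∀ i, Measurable fun x ↦ |d i x| := fun i ↦ (hdm i).norm
    fun_prop
  have hK2 : IsCompact (cthickening δ K) := hK.cthickening
  have hseg : ∀ x ∈ K, ∀ σ ∈ Ioc (0 : ℝ) 1,
      x - σ • ((w.1, 0) : 𝔼 × ℝ) ∈ cthickening δ K := by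
    intro x hx σ hσ
    refine mem_cthickening_of_dist_le _ x _ _ hx ?_
    rw [dist_eq_norm, sub_sub_cancel_left, norm_neg, norm_smul, norm_of_nonneg hσ.1.le,
      Prod.norm_mk, norm_zero, max_eq_left (norm_nonneg _)]
    exact (mul_le_of_le_one_left (norm_nonneg _) hσ.2).trans hw
  have hDm : Measurable fun x ↦ ∑ i, w.1 i * d i x := by
    have : ∀ i, Measurable fun x ↦ w.1 i * d i x := fun i ↦ (hdm i).const_mul _
    fun_prop
  have key := ae_enorm_rpow_sub_translate_le hW hK2 hKW hK.measurableSet hseg hum hDm hu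
    (integrable_finsetSum _ fun i _ ↦ (hdi i).const_mul _)
    (IsWeakDirDeriv.sum_smul hu hdi hd w.1) hℓ hu0
  refine key.mono fun x hx ↦ ?_
  have h1 : ‖u x ^ ℓ - u (x - (w.1, 0)) ^ ℓ‖ₑ ≤
      ‖w.1‖ₑ * ‖H x‖ₑ + ‖w.1‖ₑ * ∫⁻ σ in Ioc (0 : ℝ) 1, ‖H (x - σ • (w.1, 0)) - H x‖ₑ := by
    refine hx.trans ?_
    have e1 : ‖w.1‖ₑ * ‖H x‖ₑ = ∫⁻ _ in Ioc (0 : ℝ) 1, ‖w.1‖ₑ * ‖H x‖ₑ := by simp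
    rw [e1, ← lintegral_const_mul' _ _ enorm_ne_top, ← lintegral_add_left measurable_const]
    refine lintegral_mono fun σ ↦ ?_
    simp only
    rw [← mul_add]
    have h2 : ofReal (ℓ * u (x - σ • (w.1, 0)) ^ (ℓ - 1) *
        |∑ i, w.1 i * d i (x - σ • (w.1, 0))|) ≤ ‖w.1‖ₑ * ‖H (x - σ • (w.1, 0))‖ₑ := by
      set y := x - σ • ((w.1, 0) : 𝔼 × ℝ)
      rw [show ‖w.1‖ₑ * ‖H y‖ₑ = ofReal (‖w.1‖ * ‖H y‖) by
        rw [ofReal_mul (norm_nonneg _), ofReal_norm, ofReal_norm]]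
      refine ofReal_le_ofReal ?_
      have h3 : |∑ i, w.1 i * d i y| ≤ ‖w.1‖ * ∑ i, |d i y| := by
        refine (Finset.abs_sum_le_sum_abs _ _).trans ?_
        rw [Finset.mul_sum]
        refine Finset.sum_le_sum fun i _ ↦ ?_
        rw [abs_mul]
        gcongr
        exact PiLp.norm_apply_le w.1 i
      have h4 : 0 ≤ ℓ * u y ^ (ℓ - 1) := mul_nonneg (by linarith) (rpow_nonneg (hu0 _) _)
      have h5 : 0 ≤ H y := mul_nonneg h4 (Finset.sum_nonneg fun i _ ↦ abs_nonneg _)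
      rw [norm_of_nonneg h5]
      calc _ ≤ ℓ * u y ^ (ℓ - 1) * (‖w.1‖ * ∑ i, |d i y|) := by gcongr
        _ = _ := by rw [hH]; ring
    refine h2.trans ?_
    gcongr
    calc ‖H (x - σ • (w.1, 0))‖ₑ = ‖H x + (H (x - σ • (w.1, 0)) - H x)‖ₑ := by
          congr 1; ring
      _ ≤ _ := enorm_add_le _ _
  calc ‖u (x - w) ^ ℓ - u x ^ ℓ‖ₑ
      = ‖-(u x ^ ℓ - u (x - (w.1, 0)) ^ ℓ) - (u (x - (w.1, 0)) ^ ℓ - u (x - w) ^ ℓ)‖ₑ := by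
        congr 1; ring
    _ ≤ ‖u x ^ ℓ - u (x - (w.1, 0)) ^ ℓ‖ₑ + ‖u (x - (w.1, 0)) ^ ℓ - u (x - w) ^ ℓ‖ₑ := by
        refine (enorm_sub_le).trans ?_
        rw [enorm_neg]
    _ ≤ _ := by
        rw [differenceError, ← add_assoc]
        gcongr

theorem ae_ae_le_of_forall_mem {α β : Type*} [MeasurableSpace α] [MeasurableSpace β]
    {μ : Measure α} {ν : Measure β} [SFinite μ] [SFinite ν] {F G : α → β → ℝ≥0∞}
    (hF : Measurable (Function.uncurry F)) (hG : Measurable (Function.uncurry G)) {S : Set α}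
    (hS : MeasurableSet S) (h : ∀ w ∈ S, ∀ᵐ x ∂ν, F w x ≤ G w x) :
    ∀ᵐ x ∂ν, ∀ᵐ w ∂μ, w ∈ S → F w x ≤ G w x := by
  rw [← Measure.ae_ae_comm (p := fun w x ↦ w ∈ S → F w x ≤ G w x)]
  · refine ae_of_all _ fun w ↦ ?_
    by_cases hw : w ∈ S
    · exact (h w hw).mono fun x hx _ ↦ hx
    · exact ae_of_all _ fun x hx ↦ absurd hx hw
  · exact (measurable_fst hS).imp (measurableSet_le hF hG)

theorem ae_weight_mul_enorm_fderiv_mollify_le {K : Set (𝔼 × ℝ)} {δ : ℝ} (hδ : 0 < δ)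
    {z H c ζ : 𝔼 × ℝ → ℝ} (hzm : Measurable z) (hHm : Measurable H) (hζm : Measurable ζ)
    (hzH : ∀ w : 𝔼 × ℝ, ‖w.1‖ ≤ δ → ∀ᵐ x ∂volume.restrict K,
      ‖z (x - w) - z x‖ₑ ≤ ‖w.1‖ₑ * ‖H x‖ₑ + differenceError z H w x)
    (hc : ∀ x, 0 ≤ c x) {B C : ℝ} (hC : 0 ≤ C) (hζB : ∀ x, |ζ x| ≤ B)
    (hζ : ∀ x y, c x * |ζ y - ζ x| ≤ C * |z y - z x|)
    {R : 𝔼 × ℝ → ℝ} (hR : IsMollifier volume R δ) {v : 𝔼 × ℝ} {C₁ : ℝ} (hC₁ : 0 ≤ C₁)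
    (hRC : ∫⁻ w, ‖fderiv ℝ R w v‖ₑ ≤ ofReal (C₁ / δ)) :
    ∀ᵐ x ∂volume.restrict K,
      ofReal (c x) * ‖fderiv ℝ (mollify volume R ζ) x v‖ₑ ≤
      ofReal C * (ofReal C₁ * ‖H x‖ₑ +
        ∫⁻ w, ‖fderiv ℝ R w v‖ₑ * differenceError z H w x) := by
  have hem := measurable_differenceError hzm hHm
  have m1 : Measurable (Function.uncurry fun w x : 𝔼 × ℝ ↦ ‖z (x - w) - z x‖ₑ) :=
    ((hzm.comp (measurable_snd.sub measurable_fst)).sub (hzm.comp measurable_snd)).enorm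
  have m2 : Measurable (Function.uncurry fun w x : 𝔼 × ℝ ↦
      ‖w.1‖ₑ * ‖H x‖ₑ + differenceError z H w x) :=
    ((measurable_fst.fst.enorm).mul (hHm.comp measurable_snd).enorm).add hem
  have m3 : MeasurableSet {w : 𝔼 × ℝ | ‖w.1‖ ≤ δ} :=
    measurableSet_le measurable_fst.norm measurable_const
  have hae : ∀ᵐ x ∂volume.restrict K, ∀ᵐ w : 𝔼 × ℝ, w ∈ {w : 𝔼 × ℝ | ‖w.1‖ ≤ δ} →
      ‖z (x - w) - z x‖ₑ ≤ ‖w.1‖ₑ * ‖H x‖ₑ + differenceError z H w x :=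
    ae_ae_le_of_forall_mem m1 m2 m3 fun w hw ↦ hzH w hw
  refine hae.mono fun x hx ↦ ?_
  have hkm : Measurable fun w ↦ differenceError z H w x := by
    have h0 := hem.comp (measurable_prodMk_right (y := x))
    simpa only [Function.comp_def, Function.uncurry_apply_pair] using h0
  refine enorm_fderiv_mollify_le hδ hR hζm hζB hC₁ hRC ofReal_ne_top hkm
    (hx.mono fun w hw hwδ ↦ ?_)
  have h1 : ofReal (c x) * ‖ζ (x - w) - ζ x‖ₑ ≤
      ofReal C * ‖z (x - w) - z x‖ₑ := by
    rw [← ofReal_norm, ← ofReal_norm, ← ofReal_mul (hc x), ← ofReal_mul hC]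
    exact ofReal_le_ofReal (hζ _ _)
  have h2 : ‖w.1‖ ≤ δ := (norm_fst_le w).trans hwδ
  have h3 : ‖w.1‖ₑ ≤ ofReal δ := by
    rw [← ofReal_norm]; exact ofReal_le_ofReal h2
  exact h1.trans (mul_le_mul' le_rfl ((hw h2).trans (add_le_add (mul_le_mul' h3 le_rfl) le_rfl)))

/-- Smooth approximation of `g ∘ u` for which the gradients converge with the weight
`u ^ (ℓ - 1)`. -/
theorem exists_smooth_composition_approximation {W K : Set (𝔼 × ℝ)} (hW : IsOpen W)
    (hK : IsCompact K) (hKW : K ⊆ W) {u : 𝔼 × ℝ → ℝ} {d : Fin N → 𝔼 × ℝ → ℝ}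
    (hum : Measurable u) (hdm : ∀ i, Measurable (d i)) (hu : Integrable u volume)
    (hdi : ∀ i, Integrable (d i) volume)
    (hd : ∀ i, IsWeakDirDeriv volume W (EuclideanSpace.single i 1, 0) u (d i))
    {p p' ℓ : ℝ} (hpp : p.HolderConjugate p') (hℓ : 1 ≤ ℓ) (hu0 : ∀ x, 0 ≤ u x)
    (hz : MemLp (fun x ↦ u x ^ ℓ) (ofReal p) volume)
    (hH : MemLp (fun x ↦ ℓ * u x ^ (ℓ - 1) * ∑ i, |d i x|) (ofReal p) volume)
    {g : ℝ → ℝ} {B B' C : ℝ} (hgd : ContDiff ℝ 1 g) (hg0 : ∀ s, 0 ≤ g s) (hgB : ∀ s, g s ≤ B)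
    (hgB' : ∀ s, |deriv g s| ≤ B') (hC : 0 ≤ C)
    (hg : ∀ a b, 0 ≤ a → 0 ≤ b → a ^ (ℓ - 1) * |g b - g a| ≤ C * |b ^ ℓ - a ^ ℓ|)
    {f : 𝔼 × ℝ → ℝ} (hfm : Measurable f) (hf : MemLp f (ofReal p') volume) :
    ∃ ζ : ℕ → 𝔼 × ℝ → ℝ, (∀ k, ContDiff ℝ ∞ (ζ k)) ∧ (∀ k x, 0 ≤ ζ k x ∧ ζ k x ≤ B) ∧
      (∀ᵐ x ∂volume.restrict K, Tendsto (fun k ↦ ζ k x) atTop (𝓝 (g (u x)))) ∧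
      ∀ i, Tendsto (fun k ↦ ∫⁻ x in K,
        ‖(fderiv ℝ (ζ k) x (EuclideanSpace.single i 1, 0) - deriv g (u x) * d i x) *
          (u x ^ (ℓ - 1) * f x)‖ₑ) atTop (𝓝 0) := by
  set H : 𝔼 × ℝ → ℝ := fun x ↦ ℓ * u x ^ (ℓ - 1) * ∑ i, |d i x| with hHdef
  set z : 𝔼 × ℝ → ℝ := fun x ↦ u x ^ ℓ with hzdef
  have hgc : Continuous g := hgd.continuous
  have hg'c : Continuous (deriv g) := hgd.continuous_deriv le_rfl
  have hzm : Measurable z := by fun_prop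
  have hHm : Measurable H := by
    have : ∀ i, Measurable fun x ↦ |d i x| := fun i ↦ (hdm i).norm
    fun_prop
  have hgabs (s : ℝ) : |g s| ≤ B := by rw [abs_of_nonneg (hg0 s)]; exact hgB s
  have hB'0 : 0 ≤ B' := (abs_nonneg _).trans (hgB' 0)
  set e : Fin N → 𝔼 × ℝ := fun i ↦ (EuclideanSpace.single i 1, 0) with he
  have hen (i : Fin N) : ‖(EuclideanSpace.single i (1 : ℝ) : 𝔼)‖ = 1 := by simp
  set D : Fin N → 𝔼 × ℝ → ℝ := fun i x ↦ deriv g (u x) * d i x with hD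
  have hDm (i : Fin N) : Measurable (D i) := (hg'c.measurable.comp hum).mul (hdm i)
  have hDi (i : Fin N) : Integrable (D i) volume :=
    (hdi i).bdd_mul (c := B') (hg'c.measurable.comp hum).aestronglyMeasurable
      (ae_of_all _ fun x ↦ hgB' _)
  have hDw (i : Fin N) : IsWeakDirDeriv volume W (e i) (fun x ↦ g (u x)) (D i) :=
    (hd i).comp hW hum (hdm i) hu (hdi i) hgd hgB' hgabs
  set ζ₀ : 𝔼 × ℝ → ℝ := fun x ↦ g (u x) with hζ₀
  have hζ₀m : Measurable ζ₀ := hgc.measurable.comp hum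
  have hloc : LocallyIntegrable ζ₀ 𝓛ₑ :=
    (locallyIntegrable_const B).mono hζ₀m.aestronglyMeasurable
      (ae_of_all _ fun x ↦ (hgabs _).trans (le_abs_self B))
  obtain ⟨δ₀, hδ₀, hKδ⟩ := hK.exists_cthickening_subset_open hW hKW
  obtain ⟨C₁, hC₁, hker⟩ := exists_isMollifier_deriv_le (volume : Measure 𝔼)
  have hp1 : 1 ≤ ofReal p := by simpa using hpp.lt.le
  have hε (k : ℕ) : ofReal (1 / ((k : ℝ) + 1)) ≠ 0 := by
    rw [ENNReal.ofReal_ne_zero_iff]; positivity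
  have hchoice (k : ℕ) : ∃ (δ h : ℝ) (ρ : 𝔼 → ℝ) (θ : ℝ → ℝ), 0 < δ ∧ δ ≤ δ₀ ∧ h ≤ δ ∧
      IsMollifier volume ρ δ ∧ IsMollifier volume θ h ∧
      (∀ v, ∫⁻ y, ‖fderiv ℝ ρ y v‖ₑ ≤ ofReal (C₁ * ‖v‖ / δ)) ∧
      (∀ w : 𝔼 × ℝ, ‖w‖ ≤ δ → eLpNorm (fun x ↦ u (x - w) - u x) 1 volume ≤
        ofReal (1 / ((k : ℝ) + 1))) ∧
      (∀ i, ∀ w : 𝔼 × ℝ, ‖w‖ ≤ δ → eLpNorm (fun x ↦ D i (x - w) - D i x) 1 volume ≤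
        ofReal (1 / ((k : ℝ) + 1))) ∧
      (∀ w : 𝔼 × ℝ, ‖w‖ ≤ δ → eLpNorm (fun x ↦ H (x - w) - H x) (ofReal p) volume ≤
        ofReal (1 / ((k : ℝ) + 1))) ∧
      ∀ s : ℝ, |s| ≤ h →
        eLpNorm (fun x : 𝔼 × ℝ ↦ z (x - (0, s)) - z x) (ofReal p) volume ≤
        ofReal (δ * (1 / ((k : ℝ) + 1))) := by
    have e1 := eventually_eLpNorm_translate_sub_le le_rfl ENNReal.one_ne_top
      (memLp_one_iff_integrable.2 hu) (hε k)
    have e2 := eventually_all.2 fun i ↦ eventually_eLpNorm_translate_sub_le le_rfl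
      ENNReal.one_ne_top (memLp_one_iff_integrable.2 (hDi i)) (hε k)
    have e3 := eventually_eLpNorm_translate_sub_le hp1 ofReal_ne_top hH (hε k)
    have e4 : ∀ᶠ δ in 𝓝[>] (0 : ℝ), δ ∈ Ioc 0 δ₀ := Ioc_mem_nhdsGT hδ₀
    obtain ⟨δ, ⟨h1, h2⟩, h3, h4, h5⟩ := ((e1.and e2).and (e3.and e4)).exists
    obtain ⟨h, hh, hzh⟩ := exists_forall_eLpNorm_translate_sub_le hp1 ofReal_ne_top hz
      (ε := ofReal (δ * (1 / ((k : ℝ) + 1))))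
      (by rw [ENNReal.ofReal_ne_zero_iff]; positivity)
    obtain ⟨ρ, hρ, hρ'⟩ := hker δ h4
    obtain ⟨θ, hθ⟩ := exists_isMollifier (μ := 𝓛) (lt_min hh h4)
    refine ⟨δ, min h δ, ρ, θ, h4, h5, min_le_right _ _, hρ, hθ, hρ', h1, h2, h3, fun s hs ↦
      hzh _ ?_⟩
    rw [Prod.norm_mk, norm_zero, max_eq_right (norm_nonneg _)]
    exact hs.trans (min_le_left _ _)
  choose δ h ρ θ hδ hδδ₀ hhδ hρ hθ hρC hωu hωD hωH hωz using hchoice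
  set R : ℕ → 𝔼 × ℝ → ℝ := fun k w ↦ ρ k w.1 * θ k w.2 with hRdef
  have hR (k : ℕ) : IsMollifier volume (R k) (δ k) := isMollifier_prod (hρ k) (hθ k) (hhδ k)
  have hRint (k : ℕ) (i : Fin N) :
      ∫⁻ w, ‖fderiv ℝ (R k) w (e i)‖ₑ ≤ ofReal (C₁ / δ k) := by
    rw [lintegral_enorm_fderiv_prod_kernel (hρ k) (hθ k)]
    simpa [hen] using hρC k (EuclideanSpace.single i 1)
  have hlim : Tendsto (fun n : ℕ ↦ ofReal (1 / ((n : ℝ) + 1))) atTop (𝓝 0) := by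
    have := ENNReal.tendsto_ofReal (tendsto_one_div_add_atTop_nhds_zero_nat (𝕜 := ℝ))
    simpa using this
  set Z : ℕ → 𝔼 × ℝ → ℝ := fun k ↦ mollify volume (R k) ζ₀ with hZ
  have hZs (k : ℕ) : ContDiff ℝ ∞ (Z k) :=
    contDiff_mollify (hR k).contDiff (hR k).hasCompactSupport hloc
  have hZd (k : ℕ) (i : Fin N) : Continuous fun x ↦ fderiv ℝ (Z k) x (e i) :=
    (((hZs k).of_le (by exact_mod_cast le_top) : ContDiff ℝ 1 (Z k)).continuous_fderiv
      one_ne_zero).clm_apply continuous_const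
  -- convergence in `L¹`
  have hA (k : ℕ) : ∫⁻ x in K, ‖Z k x - ζ₀ x‖ₑ ≤
      ofReal B' * ofReal (1 / ((k : ℝ) + 1)) := by
    refine (setLIntegral_le_lintegral _ _).trans ?_
    rw [← eLpNorm_one_eq_lintegral_enorm]
    refine eLpNorm_mollify_sub_le (hR k) hζ₀m hloc fun w hw ↦ ?_
    refine le_trans ?_ (mul_le_mul_right (hωu k w hw) _)
    refine eLpNorm_le_mul_eLpNorm_of_ae_le_mul (ae_of_all _ fun x ↦ ?_) 1
    exact Convex.norm_image_sub_le_of_norm_deriv_le (s := univ)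
      (fun s _ ↦ (hgd.differentiable one_ne_zero) s) (fun s _ ↦ hgB' s) convex_univ
      (mem_univ _) (mem_univ _)
  have hB (k : ℕ) (i : Fin N) : ∫⁻ x in K, ‖fderiv ℝ (Z k) x (e i) - D i x‖ₑ ≤
      ofReal (1 / ((k : ℝ) + 1)) := by
    have e1 : ∫⁻ x in K, ‖fderiv ℝ (Z k) x (e i) - D i x‖ₑ =
        ∫⁻ x in K, ‖mollify volume (R k) (D i) x - D i x‖ₑ := by
      refine setLIntegral_congr_fun hK.measurableSet fun x hx ↦ ?_
      rw [hZ, fderiv_mollify_of_isWeakDirDeriv (hR k) hloc (hDw i)]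
      exact (closedBall_subset_closedBall (hδδ₀ k)).trans
        ((closedBall_subset_cthickening hx _).trans hKδ)
    rw [e1]
    refine (setLIntegral_le_lintegral _ _).trans ?_
    rw [← eLpNorm_one_eq_lintegral_enorm]
    exact eLpNorm_mollify_sub_le (hR k) (hDm i) (hDi i).locallyIntegrable (hωD k i)
  set Q : ℕ → 𝔼 × ℝ → ℝ := fun k x ↦ |Z k x - ζ₀ x| +
    ∑ i, |fderiv ℝ (Z k) x (e i) - D i x| with hQ
  have hm1 (k : ℕ) : Measurable fun x ↦ |Z k x - ζ₀ x| :=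
    ((hZs k).continuous.measurable.sub hζ₀m).norm
  have hm2 (k : ℕ) (i : Fin N) : Measurable fun x ↦ |fderiv ℝ (Z k) x (e i) - D i x| :=
    ((hZd k i).measurable.sub (hDm i)).norm
  have hQm (k : ℕ) : Measurable (Q k) := by
    have := hm1 k; have := hm2 k
    fun_prop
  have hQlim : Tendsto (fun k ↦ eLpNorm (Q k - 0) 1 (volume.restrict K)) atTop (𝓝 0) := by
    have hl : Tendsto (fun n : ℕ ↦ (ofReal B' + N) * ofReal (1 / ((n : ℝ) + 1)))
        atTop (𝓝 0) := by
      simpa using ENNReal.Tendsto.const_mul hlim (Or.inr (by simp))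
    refine tendsto_of_tendsto_of_tendsto_of_le_of_le tendsto_const_nhds hl (fun _ ↦ zero_le)
      fun k ↦ ?_
    simp only [sub_zero, eLpNorm_one_eq_lintegral_enorm]
    calc ∫⁻ x in K, ‖Q k x‖ₑ ≤ ∫⁻ x in K, (‖Z k x - ζ₀ x‖ₑ +
          ∑ i, ‖fderiv ℝ (Z k) x (e i) - D i x‖ₑ) := by
          refine lintegral_mono fun x ↦ ?_
          refine (enorm_add_le _ _).trans ?_
          rw [enorm_abs]
          gcongr
          refine (enorm_sum_le _ _).trans (le_of_eq ?_)
          simp only [enorm_abs]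
      _ ≤ ofReal B' * ofReal (1 / ((k : ℝ) + 1)) +
          ∑ i : Fin N, ofReal (1 / ((k : ℝ) + 1)) := by
          rw [lintegral_add_left (by simpa using (hm1 k).enorm), lintegral_finsetSum _
            fun i _ ↦ by simpa using (hm2 k i).enorm]
          exact add_le_add (hA k) (Finset.sum_le_sum fun i _ ↦ hB k i)
      _ = _ := by simp [add_mul]
  obtain ⟨ns, hns, hae⟩ := (tendstoInMeasure_of_tendsto_eLpNorm (p := 1) one_ne_zero
    (fun k ↦ (hQm k).aestronglyMeasurable) aestronglyMeasurable_zero hQlim).exists_seq_tendsto_ae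
  have hle1 (k : ℕ) (x : 𝔼 × ℝ) : |Z k x - ζ₀ x| ≤ Q k x :=
    le_add_of_nonneg_right (Finset.sum_nonneg fun i _ ↦ abs_nonneg _)
  have hle2 (k : ℕ) (x : 𝔼 × ℝ) (i : Fin N) : |fderiv ℝ (Z k) x (e i) - D i x| ≤ Q k x :=
    (Finset.single_le_sum (f := fun i ↦ |fderiv ℝ (Z k) x (e i) - D i x|)
      (fun i _ ↦ abs_nonneg _) (Finset.mem_univ i)).trans (le_add_of_nonneg_left (abs_nonneg _))
  refine ⟨fun k ↦ Z (ns k), fun k ↦ hZs _, fun k x ↦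
    mollify_nonneg_le (hR _) hloc (fun x ↦ hg0 _) (fun x ↦ hgB _) x, ?_, fun i ↦ ?_⟩
  · filter_upwards [hae] with x hx
    rw [tendsto_iff_dist_tendsto_zero]
    exact squeeze_zero (fun _ ↦ dist_nonneg) (fun k ↦ hle1 _ x) hx
  have hwt (x : 𝔼 × ℝ) : 0 ≤ u x ^ (ℓ - 1) := rpow_nonneg (hu0 x) _
  refine tendsto_lintegral_zero_of_le_add
    (Φ := fun x ↦ (ofReal (C * C₁) + ofReal B') * (‖H x‖ₑ * ‖f x‖ₑ))
    (e := fun k x ↦ ofReal C * (‖f x‖ₑ * ∫⁻ w, ‖fderiv ℝ (R (ns k)) w (e i)‖ₑ *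
      differenceError z H w x)) (fun k ↦ ?_) ?_ ?_ (fun k ↦ ?_) ?_ ?_
  · have := (hZd (ns k) i).measurable
    have := hDm i
    refine Measurable.aemeasurable (Measurable.enorm (Measurable.mul ?_ ?_))
    · exact this.comp measurable_id |> (hZd (ns k) i).measurable.sub
    · fun_prop
  · fun_prop
  · rw [lintegral_const_mul _ (by fun_prop)]
    refine ENNReal.mul_ne_top (by simp) (ne_top_of_le_ne_top ?_
      ((setLIntegral_le_lintegral _ _).trans (lintegral_enorm_mul_le hpp hHm.aestronglyMeasurable
        hfm.aestronglyMeasurable)))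
    exact ENNReal.mul_ne_top hH.eLpNorm_ne_top hf.eLpNorm_ne_top
  · have key := ae_weight_mul_enorm_fderiv_mollify_le (c := fun x ↦ u x ^ (ℓ - 1)) (K := K)
      (hδ (ns k)) hzm hHm hζ₀m
      (fun w hw ↦ ae_enorm_translate_sub_rpow_le hW hK
        ((cthickening_mono (hδδ₀ (ns k)) K).trans hKδ) hum hdm hu hdi hd hℓ hu0 hw)
      hwt hC (fun x ↦ hgabs _) (fun x y ↦ hg _ _ (hu0 x) (hu0 y)) (hR (ns k)) hC₁
      (hRint (ns k) i)
    filter_upwards [key] with x hx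
    have h1 : ofReal (u x ^ (ℓ - 1)) * ‖D i x‖ₑ ≤ ofReal B' * ‖H x‖ₑ := by
      rw [← ofReal_norm, ← ofReal_norm, ← ofReal_mul (hwt x), ← ofReal_mul hB'0]
      refine ofReal_le_ofReal ?_
      have hs : |d i x| ≤ ∑ i, |d i x| :=
        Finset.single_le_sum (f := fun i ↦ |d i x|) (fun i _ ↦ abs_nonneg _) (Finset.mem_univ i)
      have hs0 : 0 ≤ ∑ i, |d i x| := (abs_nonneg _).trans hs
      rw [hD, norm_mul, hHdef, norm_of_nonneg (mul_nonneg
        (mul_nonneg (by linarith) (hwt x)) hs0)]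
      calc u x ^ (ℓ - 1) * (‖deriv g (u x)‖ * ‖d i x‖)
          ≤ u x ^ (ℓ - 1) * (B' * ∑ i, |d i x|) := by
            have := hwt x
            gcongr
            exacts [hgB' _, hs]
        _ = 1 * (B' * (u x ^ (ℓ - 1) * ∑ i, |d i x|)) := by ring
        _ ≤ ℓ * (B' * (u x ^ (ℓ - 1) * ∑ i, |d i x|)) := by
            have := hwt x
            gcongr
        _ = _ := by ring
    calc ‖(fderiv ℝ (Z (ns k)) x (e i) - D i x) * (u x ^ (ℓ - 1) * f x)‖ₑ
        ≤ (‖fderiv ℝ (Z (ns k)) x (e i)‖ₑ + ‖D i x‖ₑ) *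
            (ofReal (u x ^ (ℓ - 1)) * ‖f x‖ₑ) := by
          rw [enorm_mul, enorm_mul, enorm_of_nonneg (hwt x)]
          gcongr
          exact enorm_sub_le
      _ = (ofReal (u x ^ (ℓ - 1)) * ‖fderiv ℝ (Z (ns k)) x (e i)‖ₑ +
            ofReal (u x ^ (ℓ - 1)) * ‖D i x‖ₑ) * ‖f x‖ₑ := by ring
      _ ≤ (ofReal C * (ofReal C₁ * ‖H x‖ₑ +
            ∫⁻ w, ‖fderiv ℝ (R (ns k)) w (e i)‖ₑ * differenceError z H w x) +
            ofReal B' * ‖H x‖ₑ) * ‖f x‖ₑ := by gcongr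
      _ = _ := by rw [ofReal_mul hC]; ring
  · have hl : Tendsto (fun n : ℕ ↦ ofReal C * (ofReal C₁ *
        (eLpNorm f (ofReal p') volume * (2 * ofReal (1 / ((n : ℝ) + 1))))))
        atTop (𝓝 0) := by
      have h1 := ENNReal.Tendsto.const_mul hlim (Or.inr (by simp : (2 : ℝ≥0∞) ≠ ⊤))
      have h2 := ENNReal.Tendsto.const_mul h1 (Or.inr hf.eLpNorm_ne_top)
      have h3 := ENNReal.Tendsto.const_mul h2 (Or.inr (ofReal_ne_top (r := C₁)))
      simpa using ENNReal.Tendsto.const_mul h3 (Or.inr (ofReal_ne_top (r := C)))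
    refine tendsto_of_tendsto_of_tendsto_of_le_of_le tendsto_const_nhds
      (hl.comp hns.tendsto_atTop) (fun _ ↦ zero_le) fun k ↦ ?_
    simp only [Function.comp_apply]
    generalize ns k = n
    rw [lintegral_const_mul' _ _ ofReal_ne_top]
    gcongr
    refine (setLIntegral_le_lintegral _ _).trans ?_
    have hrm : Measurable fun w ↦ ‖fderiv ℝ (R n) w (e i)‖ₑ :=
      (((hR n).contDiff.of_le (by exact_mod_cast le_top) : ContDiff ℝ 1 (R n)).continuous_fderiv
        one_ne_zero).clm_apply continuous_const |>.measurable.enorm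
    refine (lintegral_mul_differenceError_le hpp hfm hzm hHm hrm (δ := δ n) (h := h n)
      (fun w hw ↦ ?_) (hωH n) (hωz n)).trans ?_
    · have hw' : fderiv ℝ (R n) w (e i) ≠ 0 := by simpa using hw
      have := fderiv_prod_kernel (hρ n) (hθ n) w (EuclideanSpace.single i 1)
      rw [show fderiv ℝ (R n) w (e i) = _ from this] at hw'
      exact ⟨(hρ n).norm_le_of_fderiv_ne_zero (left_ne_zero_of_mul hw'),
        (hθ n).norm_le _ (right_ne_zero_of_mul hw')⟩
    · calc _ ≤ ofReal (C₁ / δ n) * (eLpNorm f (ofReal p') volume *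
            (ofReal (δ n) * ofReal (1 / ((n : ℝ) + 1)) +
              ofReal (δ n * (1 / ((n : ℝ) + 1))))) := by
            gcongr; exact hRint n i
        _ = (ofReal (C₁ / δ n) * ofReal (δ n)) *
            (eLpNorm f (ofReal p') volume *
              (2 * ofReal (1 / ((n : ℝ) + 1)))) := by
            rw [ofReal_mul (hδ n).le]; ring
        _ = _ := by
            rw [← ofReal_mul (div_nonneg hC₁ (hδ n).le), div_mul_cancel₀ _ (hδ n).ne']
  · filter_upwards [hae] with x hx
    have h1 : Tendsto (fun k ↦ (fderiv ℝ (Z (ns k)) x (e i) - D i x) * (u x ^ (ℓ - 1) * f x))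
        atTop (𝓝 0) := by
      have h2 : Tendsto (fun k ↦ fderiv ℝ (Z (ns k)) x (e i) - D i x) atTop (𝓝 0) :=
        squeeze_zero_norm (fun k ↦ hle2 _ x i) hx
      simpa using h2.mul_const (u x ^ (ℓ - 1) * f x)
    simpa using h1.enorm


theorem exists_norm_mfderiv_chart_le (x : M) : ∃ C : NNReal, ∃ r > 0,
    ball x r ⊆ (chartAt 𝔼 x).source ∧ ∀ y ∈ ball x r, ∀ X : TangentSpace (𝓡 N) y,
      norm (E := 𝔼) (mfderiv (𝓡 N) (𝓡 N) (chartAt 𝔼 x) y X) ≤ C * ‖X‖ := by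
  set e := chartAt 𝔼 x
  obtain ⟨ρ, hρ, hball⟩ := nhds_basis_closedBall.mem_iff.1
    (e.open_target.mem_nhds (mem_chart_target 𝔼 x))
  obtain ⟨C, hC, hCb⟩ := exists_norm_coordVector_bounds x (isCompact_closedBall (e x) ρ) hball
  have h1 : e ⁻¹' ball (e x) ρ ∈ 𝓝 x :=
    (e.continuousAt (mem_chart_source 𝔼 x)).preimage_mem_nhds (ball_mem_nhds _ hρ)
  obtain ⟨r, hr, hrs⟩ := Metric.mem_nhds_iff.1
    (inter_mem h1 (e.open_source.mem_nhds (mem_chart_source 𝔼 x)))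
  refine ⟨⟨C, hC.le⟩, r, hr, fun y hy ↦ (hrs hy).2, fun y hy X ↦ ?_⟩
  obtain ⟨hy1, hy2⟩ := hrs hy
  obtain ⟨w, hw, rfl⟩ : ∃ w ∈ e.target, e.symm w = y := ⟨e y, e.map_source hy2, e.left_inv hy2⟩
  have hw2 : w ∈ closedBall (e x) ρ := by
    have : e (e.symm w) ∈ ball (e x) ρ := hy1
    rw [e.right_inv hw] at this
    exact ball_subset_closedBall this
  have h2 := (hCb w hw2 (mfderiv (𝓡 N) (𝓡 N) e (e.symm w) X)).2
  have h3 := coordVector_mfderiv_chart x hw X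
  refine h2.trans (le_of_eq ?_)
  exact congrArg (fun t ↦ C * ‖t‖) h3

theorem exists_lipschitzOnWith_chart (x : M) : ∃ C : NNReal, ∃ r > 0,
    ball x r ⊆ (chartAt 𝔼 x).source ∧
      LipschitzOnWith C (chartAt 𝔼 x) (ball x r) := by
  obtain ⟨C, r, hr, hsrc, hC⟩ := exists_norm_mfderiv_chart_le (N := N) x
  set e := chartAt 𝔼 x
  refine ⟨C, r / 3, by positivity,
    (ball_subset_ball (by linarith)).trans hsrc, ?_⟩
  have hsrc' : ball x r ⊆ e.source := hsrc
  intro y hy y' hy'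
  have hyy : edist y y' < ofReal (2 * r / 3) := by
    rw [edist_dist, ofReal_lt_ofReal_iff (by positivity)]
    have h1 := mem_ball.1 hy
    have h2 := mem_ball'.1 hy'
    calc dist y y' ≤ dist y x + dist x y' := dist_triangle _ _ _
      _ < 2 * r / 3 := by linarith
  have key : ∀ s ∈ Ioo (edist y y') (ofReal (2 * r / 3)), edist (e y) (e y') ≤ C * s := by
    rintro s ⟨hs1, hs2⟩
    rw [IsRiemannianManifold.out (I := 𝓡 N) y y'] at hs1
    obtain ⟨γ, hγ0, hγ1, hγ, hlen⟩ := Manifold.exists_lt_of_riemannianEDist_lt hs1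
    have hball : ∀ t ∈ Icc (0 : ℝ) 1, γ t ∈ ball x r := by
      intro t ht
      have h1 : edist y (γ t) < ofReal (2 * r / 3) := by
        rw [IsRiemannianManifold.out (I := 𝓡 N) y (γ t)]
        refine lt_of_le_of_lt ((Manifold.riemannianEDist_le_pathELength
          (hγ.mono (Icc_subset_Icc_right ht.2)) hγ0 rfl ht.1).trans ?_) (hlen.trans hs2)
        exact Manifold.pathELength_mono le_rfl ht.2
      rw [edist_dist, ofReal_lt_ofReal_iff (by positivity)] at h1
      have h2 := mem_ball'.1 hy
      rw [mem_ball']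
      calc dist x (γ t) ≤ dist x y + dist y (γ t) := dist_triangle _ _ _
        _ < r := by linarith
    have hc : ContMDiffOn 𝓘(ℝ, ℝ) (𝓡 N) 1 (e ∘ γ) (Icc 0 1) :=
      ((contMDiffOn_chart (I := 𝓡 N) (x := x) (n := ∞)).of_le (by exact_mod_cast le_top)).comp hγ
        fun t ht ↦ hsrc' (hball t ht)
    have h1 : ‖(e ∘ γ) 1 - (e ∘ γ) 0‖ₑ ≤
        ∫⁻ t in Icc 0 1, ‖derivWithin (e ∘ γ) (Icc 0 1) t‖ₑ := by
      apply enorm_sub_le_lintegral_derivWithin_Icc_of_contDiffOn_Icc _ zero_le_one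
      rwa [← contMDiffOn_iff_contDiffOn]
    have h2 : ∀ t ∈ Icc (0 : ℝ) 1, ‖derivWithin (e ∘ γ) (Icc 0 1) t‖ₑ ≤
        C * ‖mfderivWithin 𝓘(ℝ, ℝ) (𝓡 N) γ (Icc 0 1) t 1‖ₑ := by
      intro t ht
      have h3 : mfderivWithin 𝓘(ℝ, ℝ) (𝓡 N) (e ∘ γ) (Icc 0 1) t =
          (mfderiv (𝓡 N) (𝓡 N) e (γ t)).comp (mfderivWithin 𝓘(ℝ, ℝ) (𝓡 N) γ (Icc 0 1) t) := by
        apply mfderiv_comp_mfderivWithin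
        · exact mdifferentiableAt_chart x (hsrc' (hball t ht))
        · exact hγ.mdifferentiableOn one_ne_zero _ ht
        · rw [uniqueMDiffWithinAt_iff_uniqueDiffWithinAt]
          exact uniqueDiffOn_Icc one_pos _ ht
      have h4 := congrArg (fun L => L (1 : ℝ)) h3
      have h5 : derivWithin (e ∘ γ) (Icc 0 1) t =
          mfderiv (𝓡 N) (𝓡 N) e (γ t) (mfderivWithin 𝓘(ℝ, ℝ) (𝓡 N) γ (Icc 0 1) t (1 : ℝ)) := by
        rw [← fderivWithin_derivWithin, ← mfderivWithin_eq_fderivWithin]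
        exact h4
      have h6 := hC (γ t) (hball t ht) (mfderivWithin 𝓘(ℝ, ℝ) (𝓡 N) γ (Icc 0 1) t (1 : ℝ))
      rw [h5]
      have h7 := ofReal_le_ofReal h6
      rw [ofReal_mul (NNReal.coe_nonneg C), ofReal_norm, ENNReal.ofReal_coe_nnreal] at h7
      refine le_trans (le_of_eq ?_) h7
      exact (ofReal_norm _).symm
    have h3 : edist (e y) (e y') ≤ C * Manifold.pathELength (𝓡 N) γ 0 1 := by
      rw [edist_comm, edist_eq_enorm_sub, ← hγ0, ← hγ1]
      refine h1.trans ?_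
      rw [Manifold.pathELength_eq_lintegral_mfderivWithin_Icc,
        ← lintegral_const_mul' _ _ ENNReal.coe_ne_top]
      exact setLIntegral_mono' measurableSet_Icc h2
    exact h3.trans (by gcongr)
  have ht : Tendsto (fun s : ℝ≥0∞ ↦ (C : ℝ≥0∞) * s) (𝓝[>] (edist y y'))
      (𝓝 (C * edist y y')) :=
    ((ENNReal.continuous_const_mul ENNReal.coe_ne_top).tendsto _).mono_left nhdsWithin_le_nhds
  have : (𝓝[>] (edist y y')).NeBot := nhdsGT_neBot_of_exists_gt ⟨_, hyy⟩
  exact ge_of_tendsto ht (mem_of_superset (Ioo_mem_nhdsGT hyy) fun s hs ↦ key s hs)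


/-- A bounded `C¹` function `g ≥ 0` with bounded derivative whose differences, with the weight
`w ^ (ℓ - 1)`, are controlled by those of `w ^ ℓ`. -/
structure IsAdmissible (ℓ B B' C : ℝ) (g : ℝ → ℝ) : Prop where
  contDiff : ContDiff ℝ 1 g
  nonneg : ∀ s, 0 ≤ g s
  le : ∀ s, g s ≤ B
  abs_deriv_le : ∀ s, |deriv g s| ≤ B'
  const_nonneg : 0 ≤ C
  weighted_le : ∀ a b, 0 ≤ a → 0 ≤ b → a ^ (ℓ - 1) * |g b - g a| ≤ C * |b ^ ℓ - a ^ ℓ|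

theorem exists_local_composition_approximation {W K₂ K : Set (𝔼 × ℝ)} (hK₂ : IsCompact K₂)
    (hK : IsCompact K) (hKK : K ⊆ interior K₂) (hKW : K₂ ⊆ W) {u : 𝔼 × ℝ → ℝ}
    {d : Fin N → 𝔼 × ℝ → ℝ} (hu0 : ∀ᵐ x ∂volume.restrict K₂, 0 ≤ u x)
    (hu : IntegrableOn u K₂ volume) (hdi : ∀ i, IntegrableOn (d i) K₂ volume)
    (hd : ∀ i, IsWeakDirDeriv volume W (EuclideanSpace.single i 1, 0) u (d i))
    {p m : ℝ} (hp : 1 < p) (hm : 1 ≤ m)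
    (hz : IntegrableOn (fun x ↦ u x ^ (p + m - 1)) K₂ volume)
    (hH : IntegrableOn (fun x ↦ u x ^ (m - 1) * (∑ i, |d i x|) ^ p) K₂ volume)
    {g : ℝ → ℝ} {B B' C : ℝ} (hg : IsAdmissible ((p + m - 1) / p) B B' C g) :
    ∃ ζ : ℕ → 𝔼 × ℝ → ℝ, (∀ k, ContDiff ℝ ∞ (ζ k)) ∧ (∀ k x, 0 ≤ ζ k x ∧ ζ k x ≤ B) ∧
      (∀ᵐ x ∂volume.restrict K, Tendsto (fun k ↦ ζ k x) atTop (𝓝 (g (u x)))) ∧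
      ∀ i, Tendsto (fun k ↦ ∫⁻ x in K,
        ‖(fderiv ℝ (ζ k) x (EuclideanSpace.single i 1, 0) - deriv g (u x) * d i x) *
          (u x ^ (m - 1) * (∑ i, |d i x|) ^ (p - 1))‖ₑ) atTop (𝓝 0) := by
  have hK₂m := hK₂.measurableSet
  have hp0 : 0 < p := by linarith
  set ℓ := (p + m - 1) / p with hℓdef
  have hℓ : 1 ≤ ℓ := by rw [hℓdef, le_div_iff₀ hp0]; linarith
  have hℓ1 : (ℓ - 1) * p = m - 1 := by rw [hℓdef]; field_simp; ring
  have hℓp : ℓ * p = p + m - 1 := by rw [hℓdef]; field_simp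
  have hpp := Real.HolderConjugate.conjExponent hp
  set p' := p.conjExponent
  -- measurable versions that vanish off `K₂`
  obtain ⟨u₀, hu₀m, hu₀⟩ := hu.aestronglyMeasurable
  have hd₀ (i : Fin N) := (hdi i).aestronglyMeasurable
  choose d₀ hd₀m hd₀ using hd₀
  obtain ⟨U, hUdef⟩ : ∃ U : 𝔼 × ℝ → ℝ, U = K₂.indicator fun x ↦ max (u₀ x) 0 := ⟨_, rfl⟩
  obtain ⟨D, hDdef⟩ : ∃ D : Fin N → 𝔼 × ℝ → ℝ, D = fun i ↦ K₂.indicator (d₀ i) := ⟨_, rfl⟩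
  have hUm : Measurable U := by
    rw [hUdef]; exact (hu₀m.measurable.max measurable_const).indicator hK₂m
  have hDm (i : Fin N) : Measurable (D i) := by
    rw [hDdef]; exact (hd₀m i).measurable.indicator hK₂m
  have hU0 (x : 𝔼 × ℝ) : 0 ≤ U x := by
    rw [hUdef]; exact indicator_nonneg (fun _ _ ↦ le_max_right _ _) x
  have hUae : ∀ᵐ x ∂volume, x ∈ K₂ → U x = u x := by
    rw [← ae_restrict_iff' hK₂m]
    filter_upwards [hu₀, hu0, ae_restrict_mem hK₂m] with x h1 h2 h3
    rw [hUdef, indicator_of_mem h3, ← h1, max_eq_left h2]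
  have hDae (i : Fin N) : ∀ᵐ x ∂volume, x ∈ K₂ → D i x = d i x := by
    rw [← ae_restrict_iff' hK₂m]
    filter_upwards [hd₀ i, ae_restrict_mem hK₂m] with x h1 h3
    rw [hDdef]
    simp only
    rw [indicator_of_mem h3, ← h1]
  have hall : ∀ᵐ x ∂volume, x ∈ K₂ → U x = u x ∧ ∀ i, D i x = d i x := by
    filter_upwards [hUae, ae_all_iff.2 hDae] with x h1 h2 hx
    exact ⟨h1 hx, fun i ↦ h2 i hx⟩
  have hUout (x : 𝔼 × ℝ) (hx : x ∉ K₂) : U x = 0 := by rw [hUdef, indicator_of_notMem hx]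
  have hDout (i : Fin N) (x : 𝔼 × ℝ) (hx : x ∉ K₂) : D i x = 0 := by
    rw [hDdef]; exact indicator_of_notMem hx _
  have hUi : Integrable U volume := by
    refine ((integrable_indicator_iff hK₂m).2 hu).congr ?_
    filter_upwards [hUae] with x h
    by_cases hx : x ∈ K₂
    · rw [indicator_of_mem hx, h hx]
    · rw [indicator_of_notMem hx, hUout x hx]
  have hDi (i : Fin N) : Integrable (D i) volume := by
    refine ((integrable_indicator_iff hK₂m).2 (hdi i)).congr ?_
    filter_upwards [hDae i] with x h
    by_cases hx : x ∈ K₂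
    · rw [indicator_of_mem hx, h hx]
    · rw [indicator_of_notMem hx, hDout i x hx]
  have hDw (i : Fin N) :
      IsWeakDirDeriv volume (interior K₂) (EuclideanSpace.single i 1, 0) U (D i) := by
    intro η hη hηc hηK
    have h := hd i η hη hηc (hηK.trans (interior_subset.trans hKW))
    have e1 : ∫ y, U y * fderiv ℝ η y (EuclideanSpace.single i 1, 0) =
        ∫ y, u y * fderiv ℝ η y (EuclideanSpace.single i 1, 0) := by
      refine integral_congr_ae ?_
      filter_upwards [hUae] with y hy
      by_cases hyη : y ∈ tsupport η
      · rw [hy (interior_subset (hηK hyη))]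
      · have : fderiv ℝ η y = 0 := by
          by_contra h0
          exact hyη (support_fderiv_subset ℝ h0)
        rw [this]; simp
    have e2 : ∫ y, D i y * η y = ∫ y, d i y * η y := by
      refine integral_congr_ae ?_
      filter_upwards [hDae i] with y hy
      by_cases hyη : y ∈ tsupport η
      · rw [hy (interior_subset (hηK hyη))]
      · simp [image_eq_zero_of_notMem_tsupport hyη]
    rw [e1, e2, h]
  have hΘm : Measurable fun x ↦ ∑ i, |D i x| := by
    have : ∀ i, Measurable fun x ↦ |D i x| := fun i ↦ (hDm i).norm
    fun_prop
  have hΘ0 (x : 𝔼 × ℝ) : 0 ≤ ∑ i, |D i x| := Finset.sum_nonneg fun i _ ↦ abs_nonneg _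
  have hΘout (x : 𝔼 × ℝ) (hx : x ∉ K₂) : ∑ i, |D i x| = 0 :=
    Finset.sum_eq_zero fun i _ ↦ by rw [hDout i x hx, abs_zero]
  have hp1 : ofReal p ≠ 0 := by simpa using hp0
  have hzp : Integrable (fun x ↦ U x ^ (p + m - 1)) volume := by
    refine ((integrable_indicator_iff hK₂m).2 hz).congr ?_
    filter_upwards [hUae] with x h
    by_cases hx : x ∈ K₂
    · rw [indicator_of_mem hx, h hx]
    · rw [indicator_of_notMem hx, hUout x hx, zero_rpow (by linarith)]
  have hHp : Integrable (fun x ↦ U x ^ (m - 1) * (∑ i, |D i x|) ^ p) volume := by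
    refine ((integrable_indicator_iff hK₂m).2 hH).congr ?_
    filter_upwards [hall] with x h
    by_cases hx : x ∈ K₂
    · rw [indicator_of_mem hx, (h hx).1]
      simp only [(h hx).2]
    · rw [indicator_of_notMem hx, hΘout x hx, zero_rpow hp0.ne', mul_zero]
  have hpow (x : 𝔼 × ℝ) : (U x ^ (ℓ - 1)) ^ p = U x ^ (m - 1) := by
    rw [← rpow_mul (hU0 x), hℓ1]
  have hzL : MemLp (fun x ↦ U x ^ ℓ) (ofReal p) volume := by
    refine (integrable_norm_rpow_iff (hUm.pow_const ℓ).aestronglyMeasurable hp1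
      ofReal_ne_top).1 ?_
    refine hzp.congr (ae_of_all _ fun x ↦ ?_)
    simp only
    rw [ENNReal.toReal_ofReal hp0.le, norm_of_nonneg (rpow_nonneg (hU0 x) _),
      ← rpow_mul (hU0 x), hℓp]
  have hH₁ : MemLp (fun x ↦ U x ^ (ℓ - 1) * ∑ i, |D i x|) (ofReal p) volume := by
    have hm₁ : Measurable fun x ↦ U x ^ (ℓ - 1) * ∑ i, |D i x| := (hUm.pow_const (ℓ - 1)).mul hΘm
    refine (integrable_norm_rpow_iff hm₁.aestronglyMeasurable hp1
      ofReal_ne_top).1 ?_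
    refine hHp.congr (ae_of_all _ fun x ↦ ?_)
    simp only
    rw [ENNReal.toReal_ofReal hp0.le, norm_of_nonneg
      (mul_nonneg (rpow_nonneg (hU0 x) _) (hΘ0 x)),
      mul_rpow (rpow_nonneg (hU0 x) _) (hΘ0 x), hpow]
  have hHL : MemLp (fun x ↦ ℓ * U x ^ (ℓ - 1) * ∑ i, |D i x|) (ofReal p) volume := by
    simpa only [mul_assoc] using hH₁.const_mul ℓ
  obtain ⟨f, hfdef⟩ : ∃ f : 𝔼 × ℝ → ℝ, f = fun x ↦ (U x ^ (ℓ - 1) * ∑ i, |D i x|) ^ (p - 1) :=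
    ⟨_, rfl⟩
  have hfm : Measurable f := by rw [hfdef]; exact ((hUm.pow_const (ℓ - 1)).mul hΘm).pow_const (p - 1)
  have hfL : MemLp f (ofReal p') volume := by
    have hp'0 : 0 < p' := hpp.symm.pos
    refine (integrable_norm_rpow_iff hfm.aestronglyMeasurable (by simpa using hp'0)
      ofReal_ne_top).1 ?_
    refine hHp.congr (ae_of_all _ fun x ↦ ?_)
    have h0 : 0 ≤ U x ^ (ℓ - 1) * ∑ i, |D i x| :=
      mul_nonneg (rpow_nonneg (hU0 x) _) (hΘ0 x)
    simp only [hfdef]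
    rw [ENNReal.toReal_ofReal hp'0.le, norm_of_nonneg (rpow_nonneg h0 _),
      ← rpow_mul h0, hpp.sub_one_mul_conj,
      mul_rpow (rpow_nonneg (hU0 x) _) (hΘ0 x), hpow]
  obtain ⟨ζ, hζ1, hζ2, hζ3, hζ4⟩ := exists_smooth_composition_approximation isOpen_interior hK hKK
    hUm hDm hUi hDi hDw hpp hℓ hU0 hzL hHL hg.contDiff hg.nonneg hg.le hg.abs_deriv_le
    hg.const_nonneg hg.weighted_le hfm hfL
  have hallK : ∀ᵐ x ∂volume.restrict K, U x = u x ∧ ∀ i, D i x = d i x := by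
    rw [ae_restrict_iff' hK.measurableSet]
    filter_upwards [hall] with x h hx using h (interior_subset (hKK hx))
  refine ⟨ζ, hζ1, hζ2, ?_, fun i ↦ ?_⟩
  · filter_upwards [hζ3, hallK] with x h1 h2
    rwa [h2.1] at h1
  · refine (hζ4 i).congr fun k ↦ lintegral_congr_ae ?_
    filter_upwards [hallK] with x h2
    have e : U x ^ (ℓ - 1) * f x = u x ^ (m - 1) * (∑ i, |d i x|) ^ (p - 1) := by
      rw [hfdef]
      simp only
      rw [mul_rpow (rpow_nonneg (hU0 x) _) (hΘ0 x), ← mul_assoc]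
      have h3 : U x ^ (ℓ - 1) * (U x ^ (ℓ - 1)) ^ (p - 1) = U x ^ (m - 1) := by
        rw [← hpow x]
        rcases (rpow_nonneg (hU0 x) (ℓ - 1)).eq_or_lt with h0 | h0
        · rw [← h0, zero_rpow hp0.ne', zero_mul]
        · nth_rewrite 1 [← rpow_one (U x ^ (ℓ - 1))]
          rw [← rpow_add h0]; congr 1; ring
      rw [h3, h2.1]
      simp only [h2.2]
    simp only [h2.1, h2.2] at e ⊢
    rw [e]


theorem restrict_image_spaceTimeChartSymm (ha : Continuous a) (c : M) {K : Set (𝔼 × ℝ)} (hK : IsCompact K)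
    (hKt : K ⊆ spaceTimeTarget N c) :
    (μₐₜ).restrict (Ξ c '' K) =
      (((𝓛ₑ).restrict K).withDensity
        (fun y ↦ ofReal (weightedDensity a c y.1))).map (Ξ c) := by
  have hmt : MeasurableSet (spaceTimeTarget N c) := (isOpen_spaceTimeTarget c).measurableSet
  have hKc : IsCompact (Ξ c '' K) :=
    hK.image_of_continuousOn ((continuousOn_spaceTimeChartSymm c).mono hKt)
  have hsub : Ξ c '' K ⊆ spaceTimeSource N c := by
    rintro _ ⟨y, hy, rfl⟩; exact spaceTimeChartSymm_mem (hKt hy)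
  set κ := ((𝓛ₑ).restrict (spaceTimeTarget N c)).withDensity
        (fun y ↦ ofReal (weightedDensity a c y.1)) with hκ
  have hκac : κ ≪ (𝓛ₑ).restrict (spaceTimeTarget N c) :=
    withDensity_absolutelyContinuous _ _
  have hΦ : AEMeasurable (Ξ c) κ :=
    ((continuousOn_spaceTimeChartSymm c).aemeasurable hmt).mono_ac hκac
  have h1 := congrArg (fun μ ↦ μ.restrict (Ξ c '' K))
    (prod_weightedMeasure_restrict_source (N := N) ha c)
  rw [Measure.restrict_restrict hKc.measurableSet, inter_eq_self_of_subset_left hsub,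
    Measure.restrict_map_of_aemeasurable hΦ hKc.measurableSet] at h1
  rw [h1]
  congr 1
  have h2 : Ξ c ⁻¹' (Ξ c '' K) =ᵐ[κ] K := by
    have : ∀ᵐ y ∂κ, y ∈ spaceTimeTarget N c := hκac.ae_le (ae_restrict_mem hmt)
    filter_upwards [this] with y hy
    refine propext ⟨?_, fun h ↦ mem_image_of_mem _ h⟩
    rintro ⟨y', hy', he⟩
    have := congrArg (spaceTimeChart N c) he
    rw [spaceTimeChart_chartSymm (hKt hy'), spaceTimeChart_chartSymm hy] at this
    rwa [← this]
  rw [Measure.restrict_congr_set h2, hκ, restrict_withDensity hK.measurableSet,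
    Measure.restrict_restrict hK.measurableSet, inter_eq_self_of_subset_left hKt]

/-- On compact sets over which `a > 0`, the measure `dμ_a dt` is comparable with the Lebesgue
measure in the chart. -/
theorem exists_measure_comparison (ha : Continuous a) (c : M) {K : Set (𝔼 × ℝ)} (hK : IsCompact K)
    (hKp : K ⊆ positiveTarget a c) :
    ∃ C : ℝ, ((𝓛ₑ).restrict K).map (Ξ c) ≤
        ofReal C • (μₐₜ).restrict
          (Ξ c '' K) ∧
      (μₐₜ).restrict (Ξ c '' K) ≤
        ofReal C • ((𝓛ₑ).restrict K).map (Ξ c) := by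
  have hKt : K ⊆ spaceTimeTarget N c := fun y hy ↦ (hKp hy).1
  have hρc : ContinuousOn (fun y : 𝔼 × ℝ ↦ weightedDensity (N := N) a c y.1) K :=
    (continuousOn_weightedDensity ha c).comp continuousOn_fst fun y hy ↦ (hKt hy).1
  have hρpos : ∀ y ∈ K, weightedDensity (N := N) a c y.1 ≠ 0 := fun y hy ↦
    (weightedDensity_pos (hKt hy).1 (hKp hy).2.2).ne'
  obtain ⟨C₁, hC₁⟩ := hK.exists_bound_of_continuousOn hρc
  obtain ⟨C₂, hC₂⟩ := hK.exists_bound_of_continuousOn (hρc.inv₀ hρpos)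
  have hC2' : ∀ y ∈ K, 1 ≤ max C₁ C₂ * weightedDensity (N := N) a c y.1 := by
    intro y hy
    have h1 := weightedDensity_pos (N := N) (hKt hy).1 (hKp hy).2.2
    have h2 : ‖(weightedDensity (N := N) a c y.1)⁻¹‖ ≤ C₂ := hC₂ y hy
    rw [norm_of_nonneg (inv_nonneg.2 h1.le), inv_le_iff_one_le_mul₀ h1] at h2
    exact h2.trans (mul_le_mul_of_nonneg_right (le_max_right _ _) h1.le)
  have hC1' : ∀ y ∈ K, weightedDensity (N := N) a c y.1 ≤ max C₁ C₂ := fun y hy ↦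
    (le_abs_self _).trans ((hC₁ y hy).trans (le_max_left _ _))
  have hΦ : AEMeasurable (Ξ c) ((𝓛ₑ).restrict K) :=
    ((continuousOn_spaceTimeChartSymm c).mono hKt).aemeasurable hK.measurableSet
  set κ := ((𝓛ₑ).restrict K).withDensity
        (fun y ↦ ofReal (weightedDensity a c y.1)) with hκ
  have hΦκ : AEMeasurable (Ξ c) κ :=
    hΦ.mono_ac (withDensity_absolutelyContinuous _ _)
  have hρm : AEMeasurable (fun y : 𝔼 × ℝ ↦ ofReal (weightedDensity (N := N) a c y.1))
      ((𝓛ₑ).restrict K) :=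
    (hρc.aemeasurable hK.measurableSet).ennreal_ofReal
  have hle₁ : (𝓛ₑ).restrict K ≤ ofReal (max C₁ C₂) • κ := by
    have h1 : ofReal (max C₁ C₂) • κ = ((𝓛ₑ).restrict K).withDensity
        (ofReal (max C₁ C₂) •
          fun y ↦ ofReal (weightedDensity (N := N) a c y.1)) := by
      rw [hκ, withDensity_smul' _ _ ofReal_ne_top]
    rw [h1]
    calc (𝓛ₑ).restrict K
        = ((𝓛ₑ).restrict K).withDensity 1 := withDensity_one.symm
      _ ≤ _ := by
        refine withDensity_mono ?_
        filter_upwards [ae_restrict_mem hK.measurableSet] with y hy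
        simp only [Pi.one_apply, Pi.smul_apply, smul_eq_mul]
        rw [← ENNReal.ofReal_mul' (weightedDensity_pos (N := N) (hKt hy).1 (hKp hy).2.2).le]
        simpa using hC2' y hy
  have hle₂ : κ ≤ ofReal (max C₁ C₂) • (𝓛ₑ).restrict K := by
    rw [hκ, ← withDensity_const]
    refine withDensity_mono ?_
    filter_upwards [ae_restrict_mem hK.measurableSet] with y hy
    exact ofReal_le_ofReal (hC1' y hy)
  refine ⟨max C₁ C₂, ?_, ?_⟩
  · rw [restrict_image_spaceTimeChartSymm ha c hK hKt]
    refine Measure.le_iff.2 fun s hs ↦ ?_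
    rw [Measure.smul_apply, Measure.map_apply_of_aemeasurable hΦ hs,
      Measure.map_apply_of_aemeasurable hΦκ hs]
    exact hle₁ _
  · rw [restrict_image_spaceTimeChartSymm ha c hK hKt]
    refine Measure.le_iff.2 fun s hs ↦ ?_
    rw [Measure.smul_apply, Measure.map_apply_of_aemeasurable hΦ hs,
      Measure.map_apply_of_aemeasurable hΦκ hs]
    exact hle₂ _


theorem abs_sum_mul_rpow_le {ι : Type*} [Fintype ι] {γ d e : ι → ℝ} {C n w p : ℝ} (hC : 0 ≤ C)
    (hn : 0 ≤ n) (hw : 0 ≤ w) (hp : 1 < p) (hγ : ∀ i, |γ i| ≤ C * n)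
    (hsq : n ^ 2 = ∑ i, γ i * d i) :
    |(∑ i, γ i * e i) * (w * n ^ (p - 2))| ≤
      C * C ^ (p - 1) * ∑ i, |e i * (w * (∑ j, |d j|) ^ (p - 1))| := by
  have hS : 0 ≤ ∑ j, |d j| := Finset.sum_nonneg fun j _ ↦ abs_nonneg _
  rcases hn.eq_or_lt with h0 | h0
  · have hz : ∀ i, γ i = 0 := fun i ↦ by
      have := hγ i
      rw [← h0, mul_zero] at this
      exact abs_nonpos_iff.1 this
    simp only [hz, zero_mul, Finset.sum_const_zero, abs_zero]
    exact mul_nonneg (mul_nonneg hC (rpow_nonneg hC _))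
      (Finset.sum_nonneg fun j _ ↦ abs_nonneg _)
  have h1 : n ≤ C * ∑ j, |d j| := by
    have h2 : n * n ≤ n * (C * ∑ j, |d j|) := by
      calc n * n = ∑ i, γ i * d i := by rw [← hsq]; ring
        _ ≤ ∑ i, C * n * |d i| := by
          refine Finset.sum_le_sum fun i _ ↦ (le_abs_self _).trans ?_
          rw [abs_mul]
          exact mul_le_mul_of_nonneg_right (hγ i) (abs_nonneg _)
        _ = n * (C * ∑ j, |d j|) := by rw [← Finset.mul_sum]; ring
    exact le_of_mul_le_mul_left h2 h0
  have h3 : n * n ^ (p - 2) ≤ C ^ (p - 1) * (∑ j, |d j|) ^ (p - 1) := by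
    calc n * n ^ (p - 2) = n ^ (p - 1) := by
          nth_rewrite 1 [← rpow_one n]
          rw [← rpow_add h0]; congr 1; ring
      _ ≤ (C * ∑ j, |d j|) ^ (p - 1) := rpow_le_rpow hn h1 (by linarith)
      _ = _ := mul_rpow hC hS
  have hn2 : 0 ≤ n ^ (p - 2) := rpow_nonneg hn _
  calc |(∑ i, γ i * e i) * (w * n ^ (p - 2))|
      = |∑ i, γ i * e i| * (w * n ^ (p - 2)) := by
        rw [abs_mul, abs_of_nonneg (mul_nonneg hw hn2)]
    _ ≤ (∑ i, C * n * |e i|) * (w * n ^ (p - 2)) := by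
        refine mul_le_mul_of_nonneg_right ?_ (mul_nonneg hw hn2)
        refine (Finset.abs_sum_le_sum_abs _ _).trans (Finset.sum_le_sum fun i _ ↦ ?_)
        rw [abs_mul]
        exact mul_le_mul_of_nonneg_right (hγ i) (abs_nonneg _)
    _ = C * (∑ i, |e i|) * w * (n * n ^ (p - 2)) := by rw [← Finset.mul_sum]; ring
    _ ≤ C * (∑ i, |e i|) * w * (C ^ (p - 1) * (∑ j, |d j|) ^ (p - 1)) :=
        mul_le_mul_of_nonneg_left h3 (mul_nonneg (mul_nonneg hC
          (Finset.sum_nonneg fun j _ ↦ abs_nonneg _)) hw)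
    _ = _ := by
        have : ∀ i, |e i * (w * (∑ j, |d j|) ^ (p - 1))| =
            |e i| * (w * (∑ j, |d j|) ^ (p - 1)) := fun i ↦ by
          rw [abs_mul, abs_of_nonneg (mul_nonneg hw (rpow_nonneg hS _))]
        simp only [this, ← Finset.sum_mul]
        ring

/-- On the open set `O`, the function `g ∘ u` is the limit of locally Lipschitz functions whose
derivatives along `G` converge in the weighted `L¹` sense. -/
def HasLipschitzApproximation (p m : ℝ) (a : M → ℝ) (u : M × ℝ → ℝ)
    (G : (z : M × ℝ) → TangentSpace (𝓡 N) z.1) (g : ℝ → ℝ) (B : ℝ) (O : Set (M × ℝ)) : Prop :=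
  ∃ ζ : ℕ → M × ℝ → ℝ, (∀ k, LocallyLipschitzOn O (ζ k)) ∧
    (∀ k, ∀ z ∈ O, 0 ≤ ζ k z ∧ ζ k z ≤ B) ∧
    (∀ᵐ z ∂(weightedMeasure N a).prod 𝓛, z ∈ O →
      Tendsto (fun k ↦ ζ k z) atTop (𝓝 (g (u z)))) ∧
    Tendsto (fun k ↦ ∫⁻ z in O, ‖(spaceDeriv N (ζ k) z (G z) - deriv g (u z) * ‖G z‖ ^ 2) *
      (u z ^ (m - 1) * ‖G z‖ ^ (p - 2))‖ₑ ∂(weightedMeasure N a).prod 𝓛)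
      atTop (𝓝 0)

theorem integrableOn_comp_spaceTimeChartSymm (ha : Continuous a) (c : M) {K : Set (𝔼 × ℝ)} (hK : IsCompact K)
    (hKp : K ⊆ positiveTarget a c) {f : M × ℝ → ℝ}
    (hf : LocallyIntegrableOn f (spaceTime M) μₐₜ) :
    IntegrableOn (f ∘ Ξ c) K volume := by
  have hKt : K ⊆ spaceTimeTarget N c := fun y hy ↦ (hKp hy).1
  have hΦ : AEMeasurable (Ξ c) ((𝓛ₑ).restrict K) :=
    ((continuousOn_spaceTimeChartSymm c).mono hKt).aemeasurable hK.measurableSet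
  obtain ⟨C, hC, -⟩ := exists_measure_comparison ha c hK hKp
  have h1 : IntegrableOn f (Ξ c '' K) μₐₜ :=
    hf.integrableOn_compact_subset (by rintro _ ⟨y, hy, rfl⟩; exact (hKp hy).2.1)
      (hK.image_of_continuousOn ((continuousOn_spaceTimeChartSymm c).mono hKt))
  have h2 := h1.of_measure_le_smul (ofReal_ne_top (r := C)) hC
  exact (integrable_map_measure h2.aestronglyMeasurable hΦ).1 h2

theorem LocallyLipschitz.comp_spaceTimeChart {ζ : 𝔼 × ℝ → ℝ} (hζ : LocallyLipschitz ζ) {c : M}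
    {s : Set M} {C : NNReal} (hs : IsOpen s) (hsc : s ⊆ (chartAt 𝔼 c).source)
    (hC : LipschitzOnWith C (chartAt 𝔼 c) s) {O : Set (M × ℝ)} (hO : ∀ z ∈ O, z.1 ∈ s) :
    LocallyLipschitzOn O (ζ ∘ spaceTimeChart N c) := by
  intro z hz
  obtain ⟨K, t, ht, hK⟩ := hζ (spaceTimeChart N c z)
  have hΦ : LipschitzOnWith (max C 1) (spaceTimeChart N c) (s ×ˢ univ) := by
    have h1 : LipschitzOnWith (C * 1) (fun z : M × ℝ ↦ chartAt 𝔼 c z.1) (s ×ˢ univ) :=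
      hC.comp LipschitzWith.prod_fst.lipschitzOnWith (fun z hz => hz.1)
    have h2 : LipschitzOnWith 1 (fun y : M × ℝ ↦ y.2) (s ×ˢ univ) :=
      LipschitzWith.prod_snd.lipschitzOnWith
    rw [mul_one] at h1
    exact h1.prodMk h2
  refine ⟨K * max C 1, (s ×ˢ univ) ∩ spaceTimeChart N c ⁻¹' t, ?_, ?_⟩
  · refine nhdsWithin_le_nhds (inter_mem ?_ ?_)
    · exact prod_mem_nhds (hs.mem_nhds (hO z hz)) univ_mem
    · exact ((continuousOn_spaceTimeChart c).continuousAt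
        ((isOpen_spaceTimeSource c).mem_nhds ⟨hsc (hO z hz), mem_univ _⟩)).preimage_mem_nhds ht
  · exact hK.comp (hΦ.mono inter_subset_left) (fun z hz => hz.2)

theorem exists_lipschitzApproximation_of_pos (ha : Continuous a) {p m : ℝ} (hp : 1 < p) (hm : 1 ≤ m) {u : M × ℝ → ℝ}
    {G : (z : M × ℝ) → TangentSpace (𝓡 N) z.1}
    (hu0 : ∀ᵐ z ∂μₐₜ, z ∈ spaceTime M → 0 ≤ u z)
    (hG : IsWeakGradientOn N {x | 0 < a x} u G)
    (hz : LocallyIntegrableOn (fun z ↦ u z ^ (p + m - 1)) (spaceTime M)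
      μₐₜ)
    (hE : LocallyIntegrableOn (fun z ↦ ‖G z‖ ^ p * u z ^ (m - 1)) (spaceTime M)
      μₐₜ)
    {g : ℝ → ℝ} {B B' C : ℝ} (hg : IsAdmissible ((p + m - 1) / p) B B' C g)
    {z₀ : M × ℝ} (hz₀ : 0 < z₀.2) (haz : 0 < a z₀.1) :
    ∃ O, IsOpen O ∧ z₀ ∈ O ∧ O ⊆ spaceTime M ∧ HasLipschitzApproximation p m a u G g B O := by
  obtain ⟨c, hc⟩ : ∃ c, c = z₀.1 := ⟨_, rfl⟩
  have hsrc₀ : z₀ ∈ spaceTimeSource N c := ⟨hc ▸ mem_chart_source 𝔼 c, mem_univ _⟩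
  obtain ⟨y₀, hy₀⟩ : ∃ y₀, y₀ = spaceTimeChart N c z₀ := ⟨_, rfl⟩
  have hy₀t : y₀ ∈ spaceTimeTarget N c := hy₀ ▸ spaceTimeChart_mem hsrc₀
  have hy₀s : Ξ c y₀ = z₀ := by rw [hy₀, spaceTimeChartSymm_chart hsrc₀]
  have hy₀p : y₀ ∈ positiveTarget a c := by
    refine ⟨hy₀t, ?_, ?_⟩
    · rw [hy₀s]; exact ⟨mem_univ _, hz₀⟩
    · rw [hy₀s]; exact haz
  obtain ⟨ρ, hρ, hball⟩ := nhds_basis_closedBall.mem_iff.1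
    ((isOpen_positiveTarget (N := N) ha c).mem_nhds hy₀p)
  obtain ⟨L, r, hr, hrs, hL⟩ := exists_lipschitzOnWith_chart (N := N) c
  have hK₂ : IsCompact (closedBall y₀ ρ) := isCompact_closedBall y₀ ρ
  have hK : IsCompact (closedBall y₀ (ρ / 2)) := isCompact_closedBall y₀ (ρ / 2)
  have hKK : closedBall y₀ (ρ / 2) ⊆ interior (closedBall y₀ ρ) :=
    (closedBall_subset_ball (by linarith)).trans ball_subset_interior_closedBall
  have hKp : closedBall y₀ (ρ / 2) ⊆ positiveTarget a c :=
    (hKK.trans interior_subset).trans hball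
  -- the functions in the chart
  obtain ⟨d, hd⟩ : ∃ d : Fin N → 𝔼 × ℝ → ℝ, d = fun i ↦
    chartPairing c G (EuclideanSpace.single i 1) := ⟨_, rfl⟩
  have hui : IntegrableOn (u ∘ Ξ c) (closedBall y₀ ρ) volume := by
    have := (hG c 0).1
    refine this.integrableOn_compact_subset ?_ hK₂
    rw [← positiveTarget_eq]; exact hball
  have hdi (i : Fin N) : IntegrableOn (d i) (closedBall y₀ ρ) volume := by
    rw [hd]
    have := (hG c (EuclideanSpace.single i 1)).2.1
    refine this.integrableOn_compact_subset ?_ hK₂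
    rw [← positiveTarget_eq]; exact hball
  have hdw (i : Fin N) : IsWeakDirDeriv volume (positiveTarget a c)
      (EuclideanSpace.single i 1, 0) (u ∘ Ξ c) (d i) := by
    rw [hd, positiveTarget_eq]
    exact (hG c (EuclideanSpace.single i 1)).2.2
  have hu0K : ∀ᵐ y : 𝔼 × ℝ, y ∈ positiveTarget a c → 0 ≤ u (Ξ c y) := by
    have := ae_spaceTimeChart_of_ae ha c (P := fun z ↦ z ∈ spaceTime M → 0 ≤ u z)
      (hu0.mono fun z h _ ↦ h)
    filter_upwards [this] with y h hy using h hy.1 hy.2.2 hy.2.1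
  obtain ⟨C₀, hC₀, hC₀b⟩ := exists_norm_coordVector_bounds c
    (hK₂.image continuous_fst) (by rintro _ ⟨y, hy, rfl⟩; exact (hball hy).1.1)
  have hdle : ∀ y ∈ closedBall y₀ ρ, ∀ i,
      |d i y| ≤ C₀ * ‖G (Ξ c y)‖ := by
    intro y hy i
    rw [hd]
    refine (abs_real_inner_le_norm _ _).trans ?_
    rw [mul_comm]
    refine mul_le_mul_of_nonneg_right ?_ (norm_nonneg _)
    refine ((hC₀b y.1 (mem_image_of_mem _ hy) _).1).trans ?_
    simp
  have hΓle : ∀ y ∈ closedBall y₀ ρ, ∀ i,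
      |chartComponents c G y i| ≤ C₀ * ‖G (Ξ c y)‖ := by
    intro y hy i
    have h1 := (hC₀b y.1 (mem_image_of_mem _ hy) (chartComponents c G y)).2
    rw [coordVector_chartComponents c G (hball hy).1] at h1
    exact (PiLp.norm_apply_le (chartComponents c G y) i).trans h1
  have hzi := integrableOn_comp_spaceTimeChartSymm ha c hK₂ hball hz
  have hEi := integrableOn_comp_spaceTimeChartSymm ha c hK₂ hball hE
  have hHi : IntegrableOn (fun y ↦ (u ∘ Ξ c) y ^ (m - 1) *
      (∑ i, |d i y|) ^ p) (closedBall y₀ ρ) volume := by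
    have hm1 : AEMeasurable (u ∘ Ξ c)
      ((𝓛ₑ).restrict (closedBall y₀ ρ)) :=
        hui.aestronglyMeasurable.aemeasurable
    have hm2 : AEMeasurable (fun y ↦ ∑ i, |d i y|)
      ((𝓛ₑ).restrict (closedBall y₀ ρ)) :=
        Finset.aemeasurable_fun_sum _ fun i _ ↦ (hdi i).aestronglyMeasurable.aemeasurable.norm
    refine Integrable.mono' (hEi.const_mul ((N * C₀) ^ p))
      ((hm1.pow_const _).mul (hm2.pow_const _)).aestronglyMeasurable ?_
    filter_upwards [ae_restrict_mem hK₂.measurableSet, ae_restrict_of_ae hu0K] with y hy h0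
    have hu0y : 0 ≤ (u ∘ Ξ c) y := h0 (hball hy)
    have hS : 0 ≤ ∑ i, |d i y| := Finset.sum_nonneg fun i _ ↦ abs_nonneg _
    rw [norm_of_nonneg (mul_nonneg (rpow_nonneg hu0y _) (rpow_nonneg hS _))]
    have h1 : ∑ i, |d i y| ≤ N * C₀ * ‖G (Ξ c y)‖ := by
      refine (Finset.sum_le_sum fun i _ ↦ hdle y hy i).trans ?_
      simp [mul_assoc]
    have h2 : (∑ i, |d i y|) ^ p ≤ (N * C₀) ^ p * ‖G (Ξ c y)‖ ^ p := by
      rw [← mul_rpow (by positivity) (norm_nonneg _)]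
      exact rpow_le_rpow hS h1 (by linarith)
    calc _ ≤ (u ∘ Ξ c) y ^ (m - 1) *
          ((N * C₀) ^ p * ‖G (Ξ c y)‖ ^ p) :=
          mul_le_mul_of_nonneg_left h2 (rpow_nonneg hu0y _)
      _ = _ := by simp only [Function.comp]; ring
  obtain ⟨ζ, hζs, hζb, hζt, hζi⟩ := exists_local_composition_approximation hK₂ hK hKK hball
    (by filter_upwards [ae_restrict_mem hK₂.measurableSet, ae_restrict_of_ae hu0K] with y hy h0
        exact h0 (hball hy)) hui hdi hdw hp hm hzi hHi hg
  have hOo : IsOpen (spaceTimeSource N c ∩ spaceTimeChart N c ⁻¹' ball y₀ (ρ / 2)) :=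
    (continuousOn_spaceTimeChart c).isOpen_inter_preimage (isOpen_spaceTimeSource c)
      isOpen_ball
  obtain ⟨O, hO⟩ : ∃ O : Set (M × ℝ), O = (ball c r ×ˢ univ) ∩
    (spaceTimeSource N c ∩ spaceTimeChart N c ⁻¹' ball y₀ (ρ / 2)) := ⟨_, rfl⟩
  have hOK : ∀ z ∈ O, spaceTimeChart N c z ∈ closedBall y₀ (ρ / 2) := fun z hz ↦ by
    rw [hO] at hz
    exact ball_subset_closedBall hz.2.2
  have hOs : ∀ z ∈ O, z ∈ spaceTimeSource N c := fun z hz ↦ by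
    rw [hO] at hz; exact hz.2.1
  refine ⟨O, ?_, ?_, ?_, fun k ↦ ζ k ∘ spaceTimeChart N c, fun k ↦ ?_, fun k z _ ↦ hζb k _, ?_, ?_⟩
  · rw [hO]; exact (isOpen_ball.prod isOpen_univ).inter hOo
  · rw [hO]
    refine ⟨⟨hc ▸ mem_ball_self hr, mem_univ _⟩, hsrc₀, ?_⟩
    rw [mem_preimage, ← hy₀]; exact mem_ball_self (by linarith)
  · intro z hz
    have := (hKp (hOK z hz)).2.1
    rwa [spaceTimeChartSymm_chart (hOs z hz)] at this
  · refine LocallyLipschitz.comp_spaceTimeChart (s := ball c r)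
      ((hζs k).of_le (by exact_mod_cast le_top)).locallyLipschitz
      isOpen_ball hrs hL fun z hz ↦ ?_
    rw [hO] at hz; exact hz.1.1
  · have := ae_of_ae_spaceTimeChart ha c (P := fun z ↦ z ∈ O →
      Tendsto (fun k ↦ (ζ k ∘ spaceTimeChart N c) z) atTop (𝓝 (g (u z)))) (by
        rw [ae_restrict_iff' hK.measurableSet] at hζt
        filter_upwards [hζt] with y h hyt hyO
        have hyK := hOK _ hyO
        rw [spaceTimeChart_chartSymm hyt] at hyK
        simpa only [Function.comp, spaceTimeChart_chartSymm hyt] using h hyK)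
    filter_upwards [this] with z h hz using h (hOs z hz) hz
  · obtain ⟨C₁, -, hC₁⟩ := exists_measure_comparison ha c hK hKp
    have hsub : O ⊆ Ξ c '' closedBall y₀ (ρ / 2) := fun z hz ↦
      ⟨_, hOK z hz, spaceTimeChartSymm_chart (hOs z hz)⟩
    have hpt : ∀ k, ∀ᵐ y ∂(𝓛ₑ).restrict (closedBall y₀ (ρ / 2)),
        ‖(spaceDeriv N (ζ k ∘ spaceTimeChart N c) (Ξ c y)
          (G (Ξ c y)) - deriv g (u (Ξ c y)) *
            ‖G (Ξ c y)‖ ^ 2) * (u (Ξ c y) ^ (m - 1) *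
            ‖G (Ξ c y)‖ ^ (p - 2))‖ₑ ≤
        ofReal (C₀ * C₀ ^ (p - 1)) * ∑ i, ‖(fderiv ℝ (ζ k) y (EuclideanSpace.single i 1, 0)
          - deriv g ((u ∘ Ξ c) y) * d i y) *
          ((u ∘ Ξ c) y ^ (m - 1) * (∑ i, |d i y|) ^ (p - 1))‖ₑ := by
      intro k
      filter_upwards [ae_restrict_mem hK.measurableSet, ae_restrict_of_ae hu0K] with y hy h0
      have hyp := hKp hy
      have hyt := hyp.1
      have hy2 : y ∈ closedBall y₀ ρ := (hKK.trans interior_subset) hy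
      have heq : (ζ k ∘ spaceTimeChart N c) ∘ Ξ c =ᶠ[𝓝 y] ζ k := by
        filter_upwards [(isOpen_spaceTimeTarget c).mem_nhds hyt] with w hw
        simp only [Function.comp, spaceTimeChart_chartSymm hw]
      have hdiff : DifferentiableAt ℝ (ζ k) y := ((hζs k).differentiable (by simp)) y
      have hs := spaceDeriv_apply_eq_sum (G := G) hyt (hdiff.congr_of_eventuallyEq heq)
      rw [heq.fderiv_eq] at hs
      have hsq := norm_sq_eq_sum_chartPairing c G hyt
      have hsq' : ‖G (Ξ c y)‖ ^ 2 = ∑ i, chartComponents c G y i * d i y := by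
        rw [hsq, hd]
      have hkey := abs_sum_mul_rpow_le (e := fun i ↦
        fderiv ℝ (ζ k) y (EuclideanSpace.single i 1, 0) -
          deriv g ((u ∘ Ξ c) y) * d i y)
        hC₀.le (norm_nonneg _) (rpow_nonneg (h0 hyp) (m - 1)) hp (hΓle y hy2) hsq'
      have hlhs : spaceDeriv N (ζ k ∘ spaceTimeChart N c) (Ξ c y)
          (G (Ξ c y)) - deriv g (u (Ξ c y)) *
            ‖G (Ξ c y)‖ ^ 2 = ∑ i, chartComponents c G y i *
            (fderiv ℝ (ζ k) y (EuclideanSpace.single i 1, 0) -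
              deriv g ((u ∘ Ξ c) y) * d i y) := by
        rw [hs, hsq', Finset.mul_sum, ← Finset.sum_sub_distrib]
        refine Finset.sum_congr rfl fun i _ ↦ ?_
        simp only [Function.comp]; ring
      rw [hlhs]
      simp only [← ofReal_norm, norm_eq_abs]
      rw [← ENNReal.ofReal_sum_of_nonneg fun i _ ↦ abs_nonneg _,
        ← ofReal_mul (mul_nonneg hC₀.le (rpow_nonneg hC₀.le _))]
      exact ofReal_le_ofReal hkey
    have hlim : Tendsto (fun k ↦ ofReal C₁ * (ofReal (C₀ * C₀ ^ (p - 1)) *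
        ∑ i, ∫⁻ y in closedBall y₀ (ρ / 2),
          ‖(fderiv ℝ (ζ k) y (EuclideanSpace.single i 1, 0)
          - deriv g ((u ∘ Ξ c) y) * d i y) *
          ((u ∘ Ξ c) y ^ (m - 1) * (∑ i, |d i y|) ^ (p - 1))‖ₑ)) atTop (𝓝 0) := by
      have h1 := tendsto_finsetSum (Finset.univ : Finset (Fin N)) fun i _ ↦ hζi i
      rw [Finset.sum_const_zero] at h1
      have h2 := ENNReal.Tendsto.const_mul (a := ofReal (C₀ * C₀ ^ (p - 1))) h1
        (Or.inr ofReal_ne_top)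
      have h3 := ENNReal.Tendsto.const_mul (a := ofReal C₁) h2
        (Or.inr ofReal_ne_top)
      simpa only [mul_zero] using h3
    refine tendsto_of_tendsto_of_tendsto_of_le_of_le tendsto_const_nhds hlim (fun _ ↦ zero_le)
      fun k ↦ ?_
    refine (lintegral_mono' ((Measure.restrict_mono hsub le_rfl).trans hC₁) le_rfl).trans ?_
    rw [lintegral_smul_measure, smul_eq_mul]
    refine mul_le_mul_right ?_ _
    refine (lintegral_map_le _ (Ξ c)).trans ?_
    refine (lintegral_mono_ae (hpt k)).trans ?_
    rw [lintegral_const_mul' _ _ ofReal_ne_top]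
    refine mul_le_mul_right (le_of_eq ?_) _
    refine lintegral_finsetSum' _ fun i _ ↦ ?_
    have hm1 : AEMeasurable (u ∘ Ξ c)
      ((𝓛ₑ).restrict (closedBall y₀ (ρ / 2))) :=
        hui.aestronglyMeasurable.aemeasurable.mono_measure
          (Measure.restrict_mono (hKK.trans interior_subset) le_rfl)
    have hm3 (i : Fin N) : AEMeasurable (d i)
        ((𝓛ₑ).restrict (closedBall y₀ (ρ / 2))) :=
      (hdi i).aestronglyMeasurable.aemeasurable.mono_measure
          (Measure.restrict_mono (hKK.trans interior_subset) le_rfl)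
    have hm2 : AEMeasurable (fun y ↦ ∑ i, |d i y|)
      ((𝓛ₑ).restrict (closedBall y₀ (ρ / 2))) :=
        Finset.aemeasurable_fun_sum _ fun i _ ↦ (hm3 i).norm
    have hm4 : AEMeasurable (fun y ↦ deriv g ((u ∘ Ξ c) y))
        ((𝓛ₑ).restrict (closedBall y₀ (ρ / 2))) :=
      (measurable_deriv g).comp_aemeasurable hm1
    exact (((measurable_fderiv_apply_const ℝ _ _).aemeasurable.sub (hm4.mul (hm3 i))).mul
      ((hm1.pow_const _).mul (hm2.pow_const _))).enorm


theorem mul_rpow_le_add {x y s p : ℝ} (hx : 0 ≤ x) (hy : 0 ≤ y) (hs : 0 < s) (hp : 1 < p) :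
    x * y ^ (p - 1) ≤ s ^ (1 - p) * x ^ p + s * y ^ p := by
  have e (r : ℝ) (hr : 0 ≤ r) : r * r ^ (p - 1) = r ^ p := by
    rcases hr.eq_or_lt with rfl | h0
    · rw [zero_mul, zero_rpow (by linarith)]
    · nth_rewrite 1 [← rpow_one r]
      rw [← rpow_add h0]; congr 1; ring
  rcases le_total x (s * y) with h | h
  · calc x * y ^ (p - 1) ≤ s * y * y ^ (p - 1) :=
          mul_le_mul_of_nonneg_right h (rpow_nonneg hy _)
      _ = s * y ^ p := by rw [mul_assoc, e y hy]
      _ ≤ _ := le_add_of_nonneg_left (by positivity)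
  · have h1 : s ^ (p - 1) * y ^ (p - 1) ≤ x ^ (p - 1) := by
      rw [← mul_rpow hs.le hy]
      exact rpow_le_rpow (by positivity) h (by linarith)
    have h2 : s ^ (1 - p) * s ^ (p - 1) = 1 := by
      rw [← rpow_add hs, show 1 - p + (p - 1) = 0 by ring, rpow_zero]
    calc x * y ^ (p - 1) = x * (s ^ (1 - p) * (s ^ (p - 1) * y ^ (p - 1))) := by
          rw [← mul_assoc (s ^ (1 - p)), h2, one_mul]
      _ ≤ x * (s ^ (1 - p) * x ^ (p - 1)) := by gcongr
      _ = s ^ (1 - p) * x ^ p := by rw [← e x hx]; ring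
      _ ≤ _ := le_add_of_nonneg_right (by positivity)

theorem tendsto_zero_of_forall_le_add_mul {T : ℕ → ℝ≥0∞} {E : ℝ≥0∞} (hE : E ≠ ⊤)
    (h : ∀ s : NNReal, 0 < s → ∃ c : ℕ → ℝ≥0∞, Tendsto c atTop (𝓝 0) ∧ ∀ k, T k ≤ c k + s * E) :
    Tendsto T atTop (𝓝 0) := by
  rw [ENNReal.tendsto_nhds_zero]
  intro ε hε
  obtain ⟨s, hs, hsE⟩ := ENNReal.exists_nnreal_pos_mul_lt hE (ENNReal.half_pos hε.ne').ne'
  obtain ⟨c, hc, hT⟩ := h s hs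
  filter_upwards [ENNReal.tendsto_nhds_zero.1 hc _ (ENNReal.half_pos hε.ne')] with k hk
  calc T k ≤ c k + s * E := hT k
    _ ≤ ε / 2 + ε / 2 := add_le_add hk hsE.le
    _ = ε := ENNReal.add_halves ε

theorem IsAdmissible.lipschitzWith {ℓ B B' C : ℝ} {g : ℝ → ℝ} (hg : IsAdmissible ℓ B B' C g) :
    LipschitzWith B'.toNNReal g := by
  refine lipschitzWith_of_nnnorm_deriv_le (hg.contDiff.differentiable one_ne_zero) fun s ↦ ?_
  rw [← NNReal.coe_le_coe, coe_nnnorm, norm_eq_abs]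
  exact (hg.abs_deriv_le s).trans (le_coe_toNNReal _)

theorem LipschitzWith.comp_locallyLipschitzOn {α β γ : Type*} [PseudoEMetricSpace α]
    [PseudoEMetricSpace β] [PseudoEMetricSpace γ] {g : β → γ} {f : α → β} {s : Set α} {C : NNReal}
    (hg : LipschitzWith C g) (hf : LocallyLipschitzOn s f) : LocallyLipschitzOn s (g ∘ f) := by
  intro x hx
  obtain ⟨K, t, ht, hK⟩ := hf hx
  exact ⟨C * K, t, ht, hg.comp_lipschitzOnWith hK⟩

theorem spaceDeriv_comp {g : ℝ → ℝ} {w : M × ℝ → ℝ} {z : M × ℝ}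
    (hw : SliceDifferentiableAt N w z) (hg : DifferentiableAt ℝ g (w z))
    (v : TangentSpace (𝓡 N) z.1) :
    spaceDeriv N (g ∘ w) z v = deriv g (w z) * spaceDeriv N w z v := by
  have h1 : HasMFDerivAt 𝓘(ℝ, ℝ) 𝓘(ℝ, ℝ) g ((fun y ↦ w (y, z.2)) z.1) (fderiv ℝ g (w z)) :=
    hg.hasFDerivAt.hasMFDerivAt
  have h2 := h1.comp z.1 hw.1.hasMFDerivAt
  have h3 : spaceDeriv N (g ∘ w) z = _ := h2.mfderiv
  rw [h3]
  have h4 := (fderiv_eq_smul_deriv (f := g) (x := w z) (spaceDeriv N w z v))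
  rw [smul_eq_mul, mul_comm] at h4
  exact h4

theorem exists_lipschitzApproximation_of_energyGradient [ProperSpace M]
    (ha : Continuous a) {p m : ℝ} (hp : 1 < p) {u : M × ℝ → ℝ}
    {G : (z : M × ℝ) → TangentSpace (𝓡 N) z.1}
    (hu : LocallyIntegrableOn u (spaceTime M) μₐₜ)
    (hu0 : ∀ᵐ z ∂μₐₜ, z ∈ spaceTime M → 0 ≤ u z)
    (hE : LocallyIntegrableOn (fun z ↦ ‖G z‖ ^ p * u z ^ (m - 1)) (spaceTime M)
      μₐₜ)
    {g : ℝ → ℝ} {ℓ B B' C : ℝ} (hg : IsAdmissible ℓ B B' C g)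
    {O' : Set (M × ℝ)} (hO' : IsOpen O') (hO'S : O' ⊆ spaceTime M)
    (hEG : IsEnergyGradientOn N p m a O' u G) {z₀ : M × ℝ} (hz₀ : z₀ ∈ O') :
    ∃ O, IsOpen O ∧ z₀ ∈ O ∧ O ⊆ spaceTime M ∧ HasLipschitzApproximation p m a u G g B O := by
  obtain ⟨w, X, hw, hX, hwt, hXt⟩ := hEG
  obtain ⟨r, hr, hball⟩ := nhds_basis_closedBall.mem_iff.1 (hO'.mem_nhds hz₀)
  have hK : IsCompact (closedBall z₀ r) := isCompact_closedBall z₀ r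
  have hKm := hK.measurableSet
  have hbK : ball z₀ r ⊆ closedBall z₀ r := ball_subset_closedBall
  have hB' : 0 ≤ B' := (abs_nonneg _).trans (hg.abs_deriv_le 0)
  have hdm : Measurable (deriv g) := measurable_deriv g
  have hEK := hE.integrableOn_compact_subset (hball.trans hO'S) hK
  have huK := hu.integrableOn_compact_subset (hball.trans hO'S) hK
  rw [ae_restrict_iff' hO'.measurableSet] at hwt
  refine ⟨ball z₀ r, isOpen_ball, mem_ball_self hr,
    (hbK.trans hball).trans hO'S, fun k ↦ g ∘ w k, fun k ↦ ?_, fun k z _ ↦ ⟨hg.nonneg _, hg.le _⟩,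
    ?_, ?_⟩
  · exact hg.lipschitzWith.comp_locallyLipschitzOn ((hw k).mono (hbK.trans hball))
  · filter_upwards [hwt] with z hz hzO
    exact (hg.contDiff.continuous.tendsto _).comp (hz (hball (hbK hzO)))
  set ν := μₐₜ with hν
  have hEfin : ∫⁻ z in closedBall z₀ r, ofReal (‖G z‖ ^ p * u z ^ (m - 1)) ∂ν ≠ ⊤ :=
    hEK.lintegral_lt_top.ne
  have hEm : AEMeasurable (fun z ↦ ofReal (‖G z‖ ^ p * u z ^ (m - 1)))
      (ν.restrict (closedBall z₀ r)) :=
    hEK.aestronglyMeasurable.aemeasurable.ennreal_ofReal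
  have hwm (k : ℕ) : AEMeasurable (w k) (ν.restrict (closedBall z₀ r)) :=
    ((hw k).continuousOn.mono hball).aemeasurable hKm
  have hgm (k : ℕ) : AEMeasurable (fun z ↦ ofReal |deriv g (w k z) - deriv g (u z)| *
      ofReal (‖G z‖ ^ p * u z ^ (m - 1))) (ν.restrict (closedBall z₀ r)) :=
    (((hdm.comp_aemeasurable (hwm k)).sub
      (hdm.comp_aemeasurable huK.aestronglyMeasurable.aemeasurable)).norm.ennreal_ofReal).mul hEm
  have hlim : Tendsto (fun k ↦ ∫⁻ z in closedBall z₀ r,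
      ofReal |deriv g (w k z) - deriv g (u z)| *
      ofReal (‖G z‖ ^ p * u z ^ (m - 1)) ∂ν) atTop (𝓝 0) := by
    have := tendsto_lintegral_of_dominated_convergence' (f := fun _ ↦ 0)
      (fun z ↦ ofReal (2 * B') * ofReal (‖G z‖ ^ p * u z ^ (m - 1))) hgm
      (fun k ↦ ae_of_all _ fun z ↦ ?_) ?_ ?_
    · simpa only [lintegral_zero] using this
    · refine mul_le_mul_left (ofReal_le_ofReal ?_) _
      refine (abs_sub _ _).trans ?_
      linarith [hg.abs_deriv_le (w k z), hg.abs_deriv_le (u z)]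
    · rw [lintegral_const_mul' _ _ ofReal_ne_top]
      exact ENNReal.mul_ne_top ofReal_ne_top hEfin
    · filter_upwards [ae_restrict_mem hKm, ae_restrict_of_ae hwt] with z hz h
      have h1 : Tendsto (fun k ↦ |deriv g (w k z) - deriv g (u z)|) atTop (𝓝 0) := by
        have h2 := ((hg.contDiff.continuous_deriv le_rfl).tendsto (u z)).comp (h (hball hz))
        simpa using (h2.sub_const (deriv g (u z))).abs
      have h3 := ENNReal.Tendsto.mul_const (b := ofReal (‖G z‖ ^ p * u z ^ (m - 1)))
        (ENNReal.tendsto_ofReal h1) (Or.inr ofReal_ne_top)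
      simpa using h3
  refine tendsto_zero_of_forall_le_add_mul
    (ENNReal.mul_ne_top (ofReal_ne_top (r := B')) hEfin) fun s hs ↦
    ⟨fun k ↦ ofReal (B' * (s : ℝ) ^ (1 - p)) * (∫⁻ z in closedBall z₀ r,
          ofReal (‖X k z - G z‖ ^ p * u z ^ (m - 1)) ∂ν) +
        ∫⁻ z in closedBall z₀ r, ofReal |deriv g (w k z) - deriv g (u z)| *
          ofReal (‖G z‖ ^ p * u z ^ (m - 1)) ∂ν, ?_, fun k ↦ ?_⟩
  · have h1 := ENNReal.Tendsto.const_mul (a := ofReal (B' * (s : ℝ) ^ (1 - p)))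
      (hXt _ hK hball) (Or.inr ofReal_ne_top)
    simpa using h1.add hlim
  have hs' : (0 : ℝ) < s := hs
  have hpt : ∀ᵐ z ∂ν.restrict (closedBall z₀ r),
      ‖(spaceDeriv N (g ∘ w k) z (G z) - deriv g (u z) * ‖G z‖ ^ 2) *
        (u z ^ (m - 1) * ‖G z‖ ^ (p - 2))‖ₑ ≤
      ofReal (B' * (s : ℝ) ^ (1 - p)) *
          ofReal (‖X k z - G z‖ ^ p * u z ^ (m - 1)) +
        (ofReal |deriv g (w k z) - deriv g (u z)| *
          ofReal (‖G z‖ ^ p * u z ^ (m - 1)) +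
        ofReal (B' * s) * ofReal (‖G z‖ ^ p * u z ^ (m - 1))) := by
    filter_upwards [ae_restrict_mem hKm, ae_restrict_of_ae hu0,
      ae_restrict_of_ae ((hw k).ae_sliceDifferentiableAt ha hO')] with z hz h0 hd
    have hzO := hball hz
    have hu0z := h0 (hO'S hzO)
    have hum : 0 ≤ u z ^ (m - 1) := rpow_nonneg hu0z _
    rw [spaceDeriv_comp (hd hzO) (hg.contDiff.differentiable one_ne_zero _), ← hX k z hzO]
    have e1 : inner ℝ (X k z) (G z) = inner ℝ (X k z - G z) (G z) + ‖G z‖ ^ 2 := by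
      rw [inner_sub_left, real_inner_self_eq_norm_sq]; ring
    have hGp : ‖G z‖ * ‖G z‖ ^ (p - 2) ≤ ‖G z‖ ^ (p - 1) := by
      rcases (norm_nonneg (G z)).eq_or_lt with h | h
      · rw [← h, zero_mul]; exact rpow_nonneg le_rfl _
      · nth_rewrite 1 [← rpow_one ‖G z‖]
        rw [← rpow_add h]
        exact le_of_eq (by congr 1; ring)
    have hGp2 : ‖G z‖ ^ 2 * ‖G z‖ ^ (p - 2) = ‖G z‖ ^ p := by
      rcases (norm_nonneg (G z)).eq_or_lt with h | h
      · rw [← h, zero_rpow (by linarith : p ≠ 0)]; ring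
      · rw [← rpow_natCast, ← rpow_add h]
        congr 1; push_cast; ring
    have hnn : 0 ≤ ‖G z‖ ^ (p - 2) := rpow_nonneg (norm_nonneg _) _
    have hreal : |(deriv g (w k z) * inner ℝ (X k z) (G z) - deriv g (u z) * ‖G z‖ ^ 2) *
        (u z ^ (m - 1) * ‖G z‖ ^ (p - 2))| ≤
        B' * (s : ℝ) ^ (1 - p) * (‖X k z - G z‖ ^ p * u z ^ (m - 1)) +
        (|deriv g (w k z) - deriv g (u z)| * (‖G z‖ ^ p * u z ^ (m - 1)) +
          B' * s * (‖G z‖ ^ p * u z ^ (m - 1))) := by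
      have e2 : (deriv g (w k z) * inner ℝ (X k z) (G z) - deriv g (u z) * ‖G z‖ ^ 2) *
          (u z ^ (m - 1) * ‖G z‖ ^ (p - 2)) =
          deriv g (w k z) * inner ℝ (X k z - G z) (G z) * (u z ^ (m - 1) * ‖G z‖ ^ (p - 2)) +
          (deriv g (w k z) - deriv g (u z)) * (‖G z‖ ^ p * u z ^ (m - 1)) := by
        rw [e1, ← hGp2]; ring
      have e3 : |deriv g (w k z) * inner ℝ (X k z - G z) (G z) *
          (u z ^ (m - 1) * ‖G z‖ ^ (p - 2))| ≤ B' * (‖X k z - G z‖ * ‖G z‖ ^ (p - 1)) *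
            u z ^ (m - 1) := by
        rw [abs_mul, abs_mul, abs_of_nonneg (mul_nonneg hum hnn)]
        calc _ ≤ B' * (‖X k z - G z‖ * ‖G z‖) * (u z ^ (m - 1) * ‖G z‖ ^ (p - 2)) := by
              refine mul_le_mul_of_nonneg_right ?_ (mul_nonneg hum hnn)
              exact mul_le_mul (hg.abs_deriv_le _) (abs_real_inner_le_norm _ _) (abs_nonneg _) hB'
          _ = B' * ‖X k z - G z‖ * u z ^ (m - 1) * (‖G z‖ * ‖G z‖ ^ (p - 2)) := by ring
          _ ≤ B' * ‖X k z - G z‖ * u z ^ (m - 1) * ‖G z‖ ^ (p - 1) :=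
              mul_le_mul_of_nonneg_left hGp (mul_nonneg (mul_nonneg hB' (norm_nonneg _)) hum)
          _ = _ := by ring
      have e4 := mul_rpow_le_add (norm_nonneg (X k z - G z)) (norm_nonneg (G z)) hs' hp
      rw [e2]
      refine (abs_add_le _ _).trans ?_
      rw [abs_mul (deriv g (w k z) - deriv g (u z)),
        abs_of_nonneg (mul_nonneg (rpow_nonneg (norm_nonneg (G z)) p) hum)]
      have e5 : B' * (‖X k z - G z‖ * ‖G z‖ ^ (p - 1)) * u z ^ (m - 1) ≤
          B' * ((s : ℝ) ^ (1 - p) * ‖X k z - G z‖ ^ p + s * ‖G z‖ ^ p) * u z ^ (m - 1) :=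
        mul_le_mul_of_nonneg_right (mul_le_mul_of_nonneg_left e4 hB') hum
      linarith [e3, e5]
    have hsp : 0 ≤ (s : ℝ) ^ (1 - p) := rpow_nonneg hs'.le _
    have hEnn : 0 ≤ ‖G z‖ ^ p * u z ^ (m - 1) :=
      mul_nonneg (rpow_nonneg (norm_nonneg _) _) hum
    have hXnn : 0 ≤ ‖X k z - G z‖ ^ p * u z ^ (m - 1) :=
      mul_nonneg (rpow_nonneg (norm_nonneg _) _) hum
    rw [← ofReal_norm, norm_eq_abs, ← ofReal_mul (mul_nonneg hB' hsp),
      ← ofReal_mul (abs_nonneg _), ← ofReal_mul (mul_nonneg hB' hs'.le),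
      ← ofReal_add (mul_nonneg (abs_nonneg _) hEnn)
        (mul_nonneg (mul_nonneg hB' hs'.le) hEnn),
      ← ofReal_add (mul_nonneg (mul_nonneg hB' hsp) hXnn)
        (add_nonneg (mul_nonneg (abs_nonneg _) hEnn) (mul_nonneg (mul_nonneg hB' hs'.le) hEnn))]
    exact ofReal_le_ofReal hreal
  refine (lintegral_mono' (Measure.restrict_mono hbK le_rfl) le_rfl).trans ?_
  refine (lintegral_mono_ae hpt).trans ?_
  have hm₂ : AEMeasurable (fun z ↦ ofReal |deriv g (w k z) - deriv g (u z)| *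
      ofReal (‖G z‖ ^ p * u z ^ (m - 1)) +
      ofReal (B' * s) * ofReal (‖G z‖ ^ p * u z ^ (m - 1)))
      (ν.restrict (closedBall z₀ r)) := (hgm k).add (hEm.const_mul _)
  have hsB : ofReal (B' * s) = s * ofReal B' := by
    rw [mul_comm, ofReal_mul hs'.le, ENNReal.ofReal_coe_nnreal]
  rw [lintegral_add_right' _ hm₂, lintegral_add_left' (hgm k),
    lintegral_const_mul' _ _ ofReal_ne_top, lintegral_const_mul' _ _ ofReal_ne_top,
    add_assoc, hsB]
  refine le_of_eq ?_
  ring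


/-- The translation of space-time by `s` in the time direction. -/
def timeShift (s : ℝ) (z : M × ℝ) : M × ℝ := (z.1, z.2 + s)

@[simp] theorem timeShift_zero : (timeShift 0 : M × ℝ → M × ℝ) = id := by
  ext z <;> simp [timeShift]

theorem timeDeriv_comp_timeShift (ψ : M × ℝ → ℝ) (s : ℝ) (z : M × ℝ) :
    timeDeriv (ψ ∘ timeShift s) z = timeDeriv ψ (timeShift s z) := by
  simp only [timeDeriv, timeShift, Function.comp_def]
  exact deriv_comp_add_const (fun r ↦ ψ (z.1, r)) s z.2

theorem measurePreserving_timeShift (μ : Measure M) [SFinite μ] (s : ℝ) :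
    MeasurePreserving (timeShift s) (μ.prod 𝓛) (μ.prod volume) :=
  (MeasurePreserving.id μ).prod (measurePreserving_add_right volume s)

theorem timeShift_timeShift_neg (s : ℝ) (z : M × ℝ) : timeShift s (timeShift (-s) z) = z := by
  simp [timeShift]

theorem measurableEmbedding_timeShift (s : ℝ) :
    MeasurableEmbedding (timeShift s : M × ℝ → M × ℝ) := by
  have hm (s : ℝ) : Measurable (timeShift s : M × ℝ → M × ℝ) :=
    measurable_fst.prodMk (measurable_snd.add_const s)
  refine MeasurableEquiv.measurableEmbedding (⟨⟨timeShift s, timeShift (-s), fun z ↦ ?_, fun z ↦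
    timeShift_timeShift_neg s z⟩, hm s, hm (-s)⟩ : M × ℝ ≃ᵐ M × ℝ)
  simpa using timeShift_timeShift_neg (-s) z

theorem integral_mul_comp_timeShift (μ : Measure M) [SFinite μ] (s : ℝ)
    (f φ : M × ℝ → ℝ) :
    ∫ z, f z * φ (timeShift s z) ∂μ.prod 𝓛 =
      ∫ z, f (timeShift (-s) z) * φ z ∂μ.prod 𝓛 := by
  rw [← (measurePreserving_timeShift μ s).integral_comp (measurableEmbedding_timeShift s)
    (fun z ↦ f (timeShift (-s) z) * φ z)]
  have (z : M × ℝ) : timeShift (-s) (timeShift s z) = z := by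
    simpa using timeShift_timeShift_neg (-s) z
  simp only [this]

theorem dist_timeShift (s : ℝ) (z : M × ℝ) : dist (timeShift s z) z = |s| := by
  simp [timeShift, Prod.dist_eq]

theorem LipschitzWith.comp_timeShift_right {ψ : M × ℝ → ℝ} {Λ : NNReal} (hψ : LipschitzWith Λ ψ)
    (z : M × ℝ) : LipschitzWith Λ fun s ↦ ψ (timeShift s z) := by
  refine LipschitzWith.of_dist_le_mul fun s t ↦ (hψ.dist_le_mul _ _).trans (le_of_eq ?_)
  simp [timeShift, Prod.dist_eq]

theorem IsTestFunction.exists_lipschitzWith [ProperSpace M] {ψ : M × ℝ → ℝ}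
    (hψ : IsTestFunction ψ) : ∃ Λ : NNReal, LipschitzWith Λ ψ := by
  have hK : IsCompact (cthickening 1 (tsupport ψ)) := hψ.2.1.isCompact.cthickening
  obtain ⟨L, hL⟩ := LocallyLipschitzOn.exists_lipschitzOnWith_of_compact hK
    (hψ.1.locallyLipschitzOn (s := cthickening 1 (tsupport ψ)))
  obtain ⟨B, hB⟩ := hψ.2.1.exists_bound_of_continuous hψ.1.continuous
  have key : ∀ z w, z ∈ tsupport ψ → dist (ψ z) (ψ w) ≤ max L B.toNNReal * dist z w := by
    intro z w hz
    by_cases hw : w ∈ cthickening 1 (tsupport ψ)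
    · refine (hL.dist_le_mul z (self_subset_cthickening _ hz) w hw).trans ?_
      exact mul_le_mul_of_nonneg_right (by exact_mod_cast le_max_left _ _) dist_nonneg
    · have hw0 : ψ w = 0 := image_eq_zero_of_notMem_tsupport fun h ↦
        hw (self_subset_cthickening _ h)
      have hd : 1 ≤ dist z w := by
        by_contra! h1
        rw [dist_comm] at h1
        exact hw (mem_cthickening_of_dist_le w z 1 _ hz h1.le)
      have h2 : ‖ψ z‖ ≤ ((max L B.toNNReal : NNReal) : ℝ) :=
        (hB z).trans ((le_coe_toNNReal B).trans (by exact_mod_cast le_max_right _ _))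
      rw [hw0, dist_zero_right]
      exact h2.trans (le_mul_of_one_le_right (NNReal.coe_nonneg _) hd)
  refine ⟨max L B.toNNReal, LipschitzWith.of_dist_le_mul fun z w ↦ ?_⟩
  by_cases hz : z ∈ tsupport ψ
  · exact key z w hz
  by_cases hw : w ∈ tsupport ψ
  · rw [dist_comm, dist_comm z w]; exact key w z hw
  rw [image_eq_zero_of_notMem_tsupport hz, image_eq_zero_of_notMem_tsupport hw, dist_self]
  positivity

theorem measurable_timeDeriv {ψ : M × ℝ → ℝ} (hψ : Continuous ψ) : Measurable (timeDeriv ψ) :=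
  measurable_deriv_with_param (f := fun x t ↦ ψ (x, t)) hψ

/-- Differentiation of `s ↦ ∫ U ψ(·, t + s)`. -/
theorem hasDerivAt_integral_mul_comp_timeShift {μ : Measure M} [SFinite μ] {U : M × ℝ → ℝ}
    (hU : Integrable U (μ.prod 𝓛)) {ψ : M × ℝ → ℝ} {Λ : NNReal} {B : ℝ}
    (hψ : LipschitzWith Λ ψ) (hB : ∀ z, |ψ z| ≤ B)
    (hd : ∀ᵐ z ∂μ.prod 𝓛, DifferentiableAt ℝ (fun r ↦ ψ (z.1, r)) z.2) (s : ℝ) :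
    HasDerivAt (fun s ↦ ∫ z, U z * ψ (timeShift s z) ∂μ.prod 𝓛)
      (∫ z, U z * timeDeriv ψ (timeShift s z) ∂μ.prod 𝓛) s := by
  have hsm (s : ℝ) : Measurable (timeShift s : M × ℝ → M × ℝ) :=
    (measurableEmbedding_timeShift s).measurable
  have hFm (s : ℝ) : AEStronglyMeasurable (fun z ↦ U z * ψ (timeShift s z))
      (μ.prod 𝓛) :=
    hU.1.mul (hψ.continuous.measurable.comp (hsm s)).aestronglyMeasurable
  refine (hasDerivAt_integral_of_dominated_loc_of_lip (bound := fun z ↦ |U z| * Λ) univ_mem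
    (Eventually.of_forall hFm) ?_ ?_ ?_ (hU.abs.mul_const _) ?_).2
  · refine (hU.mul_bdd (c := B) (hψ.continuous.measurable.comp (hsm s)).aestronglyMeasurable
      (ae_of_all _ fun z ↦ ?_))
    exact hB _
  · exact hU.1.mul ((measurable_timeDeriv hψ.continuous).comp (hsm s)).aestronglyMeasurable
  · refine ae_of_all _ fun z ↦ LipschitzWith.lipschitzOnWith ?_
    refine LipschitzWith.of_dist_le_mul fun r t ↦ ?_
    have h1 := (hψ.comp_timeShift_right z).dist_le_mul r t
    rw [dist_eq] at h1
    rw [dist_eq, ← mul_sub, abs_mul, coe_nnabs,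
      abs_of_nonneg (mul_nonneg (abs_nonneg (U z)) (NNReal.coe_nonneg Λ)), mul_assoc]
    exact mul_le_mul_of_nonneg_left h1 (abs_nonneg _)
  · filter_upwards [(measurePreserving_timeShift μ s).quasiMeasurePreserving.ae hd] with z hz
    have h1 : HasDerivAt (fun r ↦ ψ (z.1, r)) (timeDeriv ψ (timeShift s z)) (z.2 + s) :=
      hz.hasDerivAt
    exact (h1.comp_const_add z.2 s).const_mul (U z)

/-- If `E` is the weak time derivative of `U`, tested against the translates of `ψ`, then
`∫ (U - U(·, t - h)) ψ` is close to `h ∫ E ψ`. -/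
theorem abs_integral_timeShift_sub_le {μ : Measure M} [SFinite μ] {U E : M × ℝ → ℝ}
    (hU : Integrable U (μ.prod 𝓛))
    (hE : Integrable E (μ.prod 𝓛)) {ψ : M × ℝ → ℝ} {Λ : NNReal} {B : ℝ}
    (hψ : LipschitzWith Λ ψ) (hB0 : 0 ≤ B) (hB : ∀ z, |ψ z| ≤ B)
    (hd : ∀ᵐ z ∂μ.prod 𝓛, DifferentiableAt ℝ (fun r ↦ ψ (z.1, r)) z.2)
    {h η : ℝ} (hh : 0 ≤ h)
    (hw : ∀ s ∈ Icc 0 h, ∫ z, U z * timeDeriv (ψ ∘ timeShift s) z ∂μ.prod 𝓛 =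
      - ∫ z, E z * ψ (timeShift s z) ∂μ.prod 𝓛)
    (hη : ∀ s ∈ Icc 0 h, ∫ z, |E (timeShift (-s) z) - E z| ∂μ.prod 𝓛 ≤ η) :
    |(∫ z, U z * ψ (timeShift h z) ∂μ.prod 𝓛) -
      (∫ z, U z * ψ z ∂μ.prod 𝓛) +
      h * ∫ z, E z * ψ z ∂μ.prod 𝓛| ≤ B * η * h := by
  have hsm (s : ℝ) : Measurable (timeShift s : M × ℝ → M × ℝ) :=
    (measurableEmbedding_timeShift s).measurable
  have hEs (s : ℝ) : Integrable (fun z ↦ E (timeShift s z)) (μ.prod 𝓛) :=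
    (measurePreserving_timeShift μ s).integrable_comp_of_integrable hE
  have hmul {F : M × ℝ → ℝ} (hF : Integrable F (μ.prod 𝓛)) :
      Integrable (fun z ↦ F z * ψ z) (μ.prod 𝓛) :=
    hF.mul_bdd (c := B) hψ.continuous.measurable.aestronglyMeasurable (ae_of_all _ hB)
  set J := ∫ z, E z * ψ z ∂μ.prod 𝓛 with hJ
  have hder : ∀ s ∈ Icc 0 h, HasDerivWithinAt
      (fun s ↦ (∫ z, U z * ψ (timeShift s z) ∂μ.prod 𝓛) + s * J)
      (-(∫ z, (E (timeShift (-s) z) - E z) * ψ z ∂μ.prod 𝓛)) (Icc 0 h) s := by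
    intro s hs
    have h1 := (hasDerivAt_integral_mul_comp_timeShift hU hψ hB hd s).add
      ((hasDerivAt_id s).mul_const J)
    have h2 := hw s hs
    simp only [timeDeriv_comp_timeShift] at h2
    rw [h2, integral_mul_comp_timeShift μ s E ψ] at h1
    refine (h1.congr_deriv ?_).hasDerivWithinAt
    have h3 : ∫ z, (E (timeShift (-s) z) - E z) * ψ z ∂μ.prod 𝓛 =
        (∫ z, E (timeShift (-s) z) * ψ z ∂μ.prod 𝓛) - J := by
      rw [hJ, ← integral_sub (hmul (hEs (-s))) (hmul hE)]
      simp only [sub_mul]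
    rw [h3]; ring
  have hbd : ∀ s ∈ Ico 0 h,
      ‖-(∫ z, (E (timeShift (-s) z) - E z) * ψ z ∂μ.prod 𝓛)‖ ≤ B * η := by
    intro s hs
    rw [norm_neg]
    refine (norm_integral_le_integral_norm _).trans ?_
    have h1 : ∫ z, ‖(E (timeShift (-s) z) - E z) * ψ z‖ ∂μ.prod 𝓛 ≤
        ∫ z, B * |E (timeShift (-s) z) - E z| ∂μ.prod 𝓛 := by
      refine integral_mono_of_nonneg (ae_of_all _ fun _ ↦ norm_nonneg _)
        (((hEs (-s)).sub hE).abs.const_mul B) (ae_of_all _ fun z ↦ ?_)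
      simp only
      rw [norm_mul, mul_comm, norm_eq_abs, norm_eq_abs]
      exact mul_le_mul_of_nonneg_right (hB z) (abs_nonneg _)
    refine h1.trans ?_
    rw [integral_const_mul]
    exact mul_le_mul_of_nonneg_left (hη s ⟨hs.1, hs.2.le⟩) hB0
  have := norm_image_sub_le_of_norm_deriv_le_segment' hder hbd h ⟨hh, le_rfl⟩
  simp only [timeShift_zero, id, zero_mul, add_zero, sub_zero] at this
  rw [norm_eq_abs] at this
  convert this using 2
  ring

theorem Antitone.intervalIntegral_le {g : ℝ → ℝ} (hg : Antitone g) (a b : ℝ) :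
    ∫ s in a..b, g s ≤ g a * (b - a) := by
  rcases le_total a b with h | h
  · have := intervalIntegral.integral_mono_on (μ := volume) h hg.intervalIntegrable
      (intervalIntegrable_const (c := g a)) fun x hx ↦ hg hx.1
    simpa [mul_comm] using this
  · have := intervalIntegral.integral_mono_on (μ := volume) h (intervalIntegrable_const (c := g a))
      hg.intervalIntegrable fun x hx ↦ hg hx.2
    rw [intervalIntegral.integral_symm]
    simp only [intervalIntegral.integral_const, smul_eq_mul] at this
    linarith

theorem exists_integral_abs_timeShift_sub_le [ProperSpace M] {μ : Measure M} [SFinite μ]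
    [(μ.prod 𝓛).Regular] {E : M × ℝ → ℝ}
    (hE : Integrable E (μ.prod 𝓛)) {η : ℝ} (hη : 0 < η) :
    ∃ δ > 0, ∀ s, |s| ≤ δ →
      ∫ z, |E (timeShift s z) - E z| ∂μ.prod 𝓛 ≤ η := by
  obtain ⟨δ, hδ, h⟩ := exists_forall_eLpNorm_comp_sub_le le_rfl ENNReal.one_ne_top
    (memLp_one_iff_integrable.2 hE) (ε := ofReal η) (by simpa using hη)
  refine ⟨δ, hδ, fun s hs ↦ ?_⟩
  have h1 := h (timeShift s) (measurePreserving_timeShift μ s) fun z ↦ by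
    rw [dist_timeShift]; exact hs
  rw [eLpNorm_one_eq_lintegral_enorm] at h1
  have h2 : Integrable (fun z ↦ E (timeShift s z) - E z) (μ.prod 𝓛) :=
    ((measurePreserving_timeShift μ s).integrable_comp_of_integrable hE).sub hE
  have h3 := integral_norm_eq_lintegral_enorm h2.1
  simp only [norm_eq_abs] at h3
  rw [h3]
  exact ENNReal.toReal_le_of_le_ofReal hη.le h1

/-- The chain rule for weak time derivatives, as an inequality: `χ ∂_t u g(u)` integrates to at
most `- ∂_t χ 𝒢(u)`, where `𝒢' = g` is nonincreasing. -/
theorem integral_timeDeriv_primitive_le [ProperSpace M] {μ : Measure M} [SFinite μ]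
    [(μ.prod 𝓛).Regular] {U E : M × ℝ → ℝ}
    (hU : Integrable U (μ.prod 𝓛))
    (hE : Integrable E (μ.prod 𝓛))
    {g : ℝ → ℝ} {B : ℝ} (hgc : Continuous g) (hga : Antitone g) (hg0 : ∀ s, 0 ≤ g s)
    (hgB : ∀ s, g s ≤ B) {χ : M × ℝ → ℝ} {Λ : NNReal} {Bχ : ℝ} (hχ : LipschitzWith Λ χ)
    (hχ0 : ∀ z, 0 ≤ χ z) (hχB : ∀ z, χ z ≤ Bχ)
    (hχd : ∀ᵐ z ∂μ.prod 𝓛, DifferentiableAt ℝ (fun r ↦ χ (z.1, r)) z.2)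
    {ψ : ℕ → M × ℝ → ℝ} {Λ' : ℕ → NNReal} {B₁ : ℝ} (hB₁ : 0 ≤ B₁)
    (hψ : ∀ k, LipschitzWith (Λ' k) (ψ k)) (hψB : ∀ k z, |ψ k z| ≤ B₁)
    (hψd : ∀ k, ∀ᵐ z ∂μ.prod 𝓛, DifferentiableAt ℝ (fun r ↦ ψ k (z.1, r)) z.2)
    {δ : ℝ} (hδ : 0 < δ)
    (hw : ∀ k, ∀ s ∈ Icc 0 δ,
      ∫ z, U z * timeDeriv (ψ k ∘ timeShift s) z ∂μ.prod 𝓛 =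
        - ∫ z, E z * ψ k (timeShift s z) ∂μ.prod 𝓛)
    (hlim : ∀ᵐ z ∂μ.prod 𝓛,
      Tendsto (fun k ↦ ψ k z) atTop (𝓝 (χ z * g (U z)))) :
    ∫ z, E z * (χ z * g (U z)) ∂μ.prod 𝓛 ≤
      - ∫ z, (∫ s in 0..U z, g s) * timeDeriv χ z ∂μ.prod 𝓛 := by
  have hgm : Measurable g := hgc.measurable
  have hχm : AEStronglyMeasurable χ (μ.prod 𝓛) :=
    hχ.continuous.measurable.aestronglyMeasurable
  have hχabs (z : M × ℝ) : |χ z| ≤ Bχ := by rw [abs_of_nonneg (hχ0 z)]; exact hχB z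
  have hPm : AEStronglyMeasurable (fun z ↦ ∫ s in 0..U z, g s) (μ.prod 𝓛) :=
    (intervalIntegral.continuous_primitive (fun a b ↦ hgc.intervalIntegrable a b) 0
      ).comp_aestronglyMeasurable hU.1
  have hP : Integrable (fun z ↦ ∫ s in 0..U z, g s) (μ.prod 𝓛) := by
    refine (hU.abs.const_mul B).mono' hPm (ae_of_all _ fun z ↦ ?_)
    have := intervalIntegral.norm_integral_le_of_norm_le_const (f := g) (a := 0) (b := U z) (C := B)
      fun s _ ↦ by rw [norm_of_nonneg (hg0 s)]; exact hgB s
    simpa using this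
  have hsh {F : M × ℝ → ℝ} (hF : Integrable F (μ.prod 𝓛)) (s : ℝ) :
      Integrable (fun z ↦ F (timeShift s z)) (μ.prod 𝓛) :=
    (measurePreserving_timeShift μ s).integrable_comp_of_integrable hF
  have hΨm : AEStronglyMeasurable (fun z ↦ χ z * g (U z)) (μ.prod 𝓛) :=
    hχm.mul (hgc.comp_aestronglyMeasurable hU.1)
  have hΨb : ∀ᵐ z ∂μ.prod 𝓛, ‖χ z * g (U z)‖ ≤ B₁ := by
    filter_upwards [hlim] with z hz
    exact le_of_tendsto hz.norm (Eventually.of_forall fun k ↦ hψB k z)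
  have hL {F : M × ℝ → ℝ} (hF : Integrable F (μ.prod 𝓛)) :
      Tendsto (fun k ↦ ∫ z, F z * ψ k z ∂μ.prod 𝓛) atTop
        (𝓝 (∫ z, F z * (χ z * g (U z)) ∂μ.prod 𝓛)) := by
    refine tendsto_integral_of_dominated_convergence (fun z ↦ |F z| * B₁)
      (fun k ↦ hF.1.mul (hψ k).continuous.measurable.aestronglyMeasurable)
      (hF.abs.mul_const _) (fun k ↦ ae_of_all _ fun z ↦ ?_) ?_
    · rw [norm_mul]
      exact mul_le_mul_of_nonneg_left (hψB k z) (norm_nonneg _)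
    · filter_upwards [hlim] with z hz using hz.const_mul _
  have hder := hasDerivAt_integral_mul_comp_timeShift hP hχ hχabs hχd 0
  simp only [timeShift_zero, id] at hder
  have hsl := hder.tendsto_slope_zero_right
  refine le_neg_of_le_neg (le_of_forall_pos_le_add fun κ hκ ↦ ?_)
  obtain ⟨δ', hδ', hη⟩ := exists_integral_abs_timeShift_sub_le hE
    (η := κ / (B₁ + 1)) (by positivity)
  have hκB : B₁ * (κ / (B₁ + 1)) ≤ κ := by
    rw [mul_div_assoc', div_le_iff₀ (by positivity)]
    nlinarith
  refine le_of_tendsto hsl ?_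
  filter_upwards [Ioc_mem_nhdsGT (lt_min hδ hδ')] with h hh
  have hhδ : h ≤ δ := hh.2.trans (min_le_left _ _)
  have hhδ' : h ≤ δ' := hh.2.trans (min_le_right _ _)
  have hk : |(∫ z, U (timeShift (-h) z) * (χ z * g (U z)) ∂μ.prod 𝓛) -
      (∫ z, U z * (χ z * g (U z)) ∂μ.prod 𝓛) +
      h * ∫ z, E z * (χ z * g (U z)) ∂μ.prod 𝓛| ≤
        B₁ * (κ / (B₁ + 1)) * h := by
    refine le_of_tendsto ((((hL (hsh hU (-h))).sub (hL hU)).add ((hL hE).const_mul h)).abs)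
      (Eventually.of_forall fun k ↦ ?_)
    have := abs_integral_timeShift_sub_le hU hE (hψ k) hB₁ (hψB k) (hψd k) hh.1.le
      (fun s hs ↦ hw k s ⟨hs.1, hs.2.trans hhδ⟩)
      (fun s hs ↦ hη (-s) (by rw [abs_neg, abs_of_nonneg hs.1]; exact hs.2.trans hhδ'))
    rwa [integral_mul_comp_timeShift μ h U (ψ k)] at this
  have hcmul {F : M × ℝ → ℝ} (hF : Integrable F (μ.prod 𝓛)) :
      Integrable (fun z ↦ F z * χ z) (μ.prod 𝓛) :=
    hF.mul_bdd (c := Bχ) hχm (ae_of_all _ hχabs)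
  have hcmul' {F : M × ℝ → ℝ} (hF : Integrable F (μ.prod 𝓛)) :
      Integrable (fun z ↦ F z * (χ z * g (U z))) (μ.prod 𝓛) :=
    hF.mul_bdd (c := B₁) hΨm hΨb
  have hconc : (∫ z, U z * (χ z * g (U z)) ∂μ.prod 𝓛) -
      (∫ z, U (timeShift (-h) z) * (χ z * g (U z)) ∂μ.prod 𝓛) ≤
      (∫ z, (∫ s in 0..U z, g s) * χ z ∂μ.prod 𝓛) -
        ∫ z, (∫ s in 0..U z, g s) * χ (timeShift h z) ∂μ.prod 𝓛 := by
    rw [integral_mul_comp_timeShift μ h, ← integral_sub (hcmul' hU) (hcmul' (hsh hU _)),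
      ← integral_sub (hcmul hP) (hcmul (hsh hP (-h)))]
    refine integral_mono ((hcmul' hU).sub (hcmul' (hsh hU _)))
      ((hcmul hP).sub (hcmul (hsh hP (-h)))) fun z ↦ ?_
    have h1 := hga.intervalIntegral_le (U z) (U (timeShift (-h) z))
    have h2 := intervalIntegral.integral_add_adjacent_intervals
      (hgc.intervalIntegrable (μ := volume) 0 (U z))
      (hgc.intervalIntegrable (U z) (U (timeShift (-h) z)))
    simp only
    have h3 := mul_le_mul_of_nonneg_right h1 (hχ0 z)
    rw [← h2]
    linarith
  have hfin := (abs_le.1 hk).2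
  rw [zero_add, smul_eq_mul, inv_mul_le_iff₀ hh.1]
  have h5 := mul_le_mul_of_nonneg_right hκB hh.1.le
  simp only [timeShift_zero, id]
  linarith


section LocallyLipschitz
variable {X : Type*} [PseudoMetricSpace X]

theorem LocallyLipschitzOn.mul_real {f g : X → ℝ} {s : Set X} (hf : LocallyLipschitzOn s f)
    (hg : LocallyLipschitzOn s g) : LocallyLipschitzOn s fun x ↦ f x * g x := by
  intro x hx
  obtain ⟨K₁, t₁, ht₁, hK₁⟩ := hf hx
  obtain ⟨K₂, t₂, ht₂, hK₂⟩ := hg hx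
  have h1 : ∀ᶠ y in 𝓝[s] x, |f y| < |f x| + 1 :=
    (hf.continuousOn x hx).abs.eventually_lt_const (lt_add_one _)
  have h2 : ∀ᶠ y in 𝓝[s] x, |g y| < |g x| + 1 :=
    (hg.continuousOn x hx).abs.eventually_lt_const (lt_add_one _)
  refine ⟨((|f x| + 1) * K₂ + (|g x| + 1) * K₁).toNNReal,
    (t₁ ∩ t₂) ∩ ({y | |f y| < |f x| + 1} ∩ {y | |g y| < |g x| + 1}),
    inter_mem (inter_mem ht₁ ht₂) (inter_mem h1 h2), ?_⟩
  refine LipschitzOnWith.of_dist_le_mul fun y hy z hz ↦ ?_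
  have e : f y * g y - f z * g z = f y * (g y - g z) + g z * (f y - f z) := by ring
  have a1 := hK₁.dist_le_mul y hy.1.1 z hz.1.1
  have a2 := hK₂.dist_le_mul y hy.1.2 z hz.1.2
  rw [dist_eq] at a1 a2 ⊢
  have hfy : |f y| < |f x| + 1 := hy.2.1
  have hgz : |g z| < |g x| + 1 := hz.2.2
  rw [e]
  calc |f y * (g y - g z) + g z * (f y - f z)|
      ≤ |f y| * |g y - g z| + |g z| * |f y - f z| := by
        refine (abs_add_le _ _).trans ?_
        rw [abs_mul, abs_mul]
    _ ≤ (|f x| + 1) * (K₂ * dist y z) + (|g x| + 1) * (K₁ * dist y z) := by gcongr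
    _ = ((|f x| + 1) * K₂ + (|g x| + 1) * K₁) * dist y z := by ring
    _ ≤ _ := mul_le_mul_of_nonneg_right (le_coe_toNNReal _) dist_nonneg

theorem LocallyLipschitz.mul_real {f g : X → ℝ} (hf : LocallyLipschitz f)
    (hg : LocallyLipschitz g) : LocallyLipschitz fun x ↦ f x * g x := by
  rw [← locallyLipschitzOn_univ] at hf hg ⊢
  exact hf.mul_real hg

theorem locallyLipschitz_mul_of_tsupport_subset {χ ζ : X → ℝ} {O : Set X} (hO : IsOpen O)
    (hχ : LocallyLipschitz χ) (hζ : LocallyLipschitzOn O ζ) (h : tsupport χ ⊆ O) :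
    LocallyLipschitz fun z ↦ χ z * ζ z := by
  intro z
  by_cases hz : z ∈ O
  · obtain ⟨K, t, ht, hK⟩ := ((hχ.locallyLipschitzOn (s := O)).mul_real hζ) hz
    rw [nhdsWithin_eq_nhds.2 (hO.mem_nhds hz)] at ht
    exact ⟨K, t, ht, hK⟩
  · refine ⟨0, (tsupport χ)ᶜ, (isClosed_tsupport χ).isOpen_compl.mem_nhds fun h' ↦ hz (h h'), ?_⟩
    refine LipschitzOnWith.of_dist_le_mul fun y hy w hw ↦ ?_
    rw [image_eq_zero_of_notMem_tsupport hy, image_eq_zero_of_notMem_tsupport hw]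
    simp

end LocallyLipschitz

theorem IsTestFunction.mul_of_locallyLipschitzOn {χ ζ : M × ℝ → ℝ} (hχ : IsTestFunction χ)
    {O : Set (M × ℝ)} (hO : IsOpen O) (hζ : LocallyLipschitzOn O ζ) (h : tsupport χ ⊆ O) :
    IsTestFunction fun z ↦ χ z * ζ z :=
  ⟨locallyLipschitz_mul_of_tsupport_subset hO hχ.1 hζ h, hχ.2.1.mul_right,
    (tsupport_mul_subset_left).trans hχ.2.2⟩

theorem IsTestFunction.mul {χ ζ : M × ℝ → ℝ} (hχ : IsTestFunction χ) (hζ : LocallyLipschitz ζ) :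
    IsTestFunction fun z ↦ χ z * ζ z :=
  hχ.mul_of_locallyLipschitzOn isOpen_univ hζ.locallyLipschitzOn (subset_univ _)

theorem tsupport_comp_timeShift_subset {χ : M × ℝ → ℝ} {s δ : ℝ} (hs : |s| ≤ δ) :
    tsupport (χ ∘ timeShift s) ⊆ cthickening δ (tsupport χ) := by
  refine closure_minimal (fun z hz ↦ ?_) isClosed_cthickening
  refine mem_cthickening_of_dist_le z (timeShift s z) _ _ (subset_tsupport χ hz) ?_
  rw [dist_comm, dist_timeShift]; exact hs

theorem IsTestFunction.comp_timeShift [ProperSpace M] {χ : M × ℝ → ℝ} (hχ : IsTestFunction χ)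
    {s δ : ℝ} (hs : |s| ≤ δ) (hδ : cthickening δ (tsupport χ) ⊆ spaceTime M) :
    IsTestFunction (χ ∘ timeShift s) := by
  have h1 := tsupport_comp_timeShift_subset (χ := χ) hs
  refine ⟨?_, hχ.2.1.isCompact.cthickening.of_isClosed_subset (isClosed_tsupport _) h1,
    h1.trans hδ⟩
  have : LipschitzWith 1 (timeShift s : M × ℝ → M × ℝ) := by
    refine LipschitzWith.of_dist_le_mul fun z w ↦ le_of_eq ?_
    simp [timeShift, Prod.dist_eq]
  exact hχ.1.comp this.locallyLipschitz

theorem timeDeriv_eq_zero {ψ : M × ℝ → ℝ} {z : M × ℝ} (hz : z ∉ tsupport ψ) :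
    timeDeriv ψ z = 0 := by
  have h1 : (fun s ↦ ψ (z.1, s)) =ᶠ[𝓝 z.2] fun _ ↦ 0 := by
    have h2 := notMem_tsupport_iff_eventuallyEq.1 hz
    exact (Continuous.prodMk_right z.1).continuousAt.eventually (f := fun s ↦ (z.1, s)) h2
  rw [timeDeriv, h1.deriv_eq, deriv_const]

theorem abs_timeDeriv_le {ψ : M × ℝ → ℝ} {Λ : NNReal} (hψ : LipschitzWith Λ ψ) (z : M × ℝ) :
    |timeDeriv ψ z| ≤ Λ := by
  have h : LipschitzWith Λ fun s ↦ ψ (z.1, s) :=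
    LipschitzWith.of_dist_le_mul fun s t ↦ (hψ.dist_le_mul _ _).trans (le_of_eq (by
      simp [Prod.dist_eq]))
  exact norm_deriv_le_of_lipschitz h

theorem spaceDeriv_eq_zero {ψ : M × ℝ → ℝ} {z : M × ℝ} (hz : z ∉ tsupport ψ) :
    spaceDeriv N ψ z = 0 := by
  have h1 : (fun y ↦ ψ (y, z.2)) =ᶠ[𝓝 z.1] fun _ ↦ 0 := by
    have h2 := notMem_tsupport_iff_eventuallyEq.1 hz
    exact (Continuous.prodMk_left z.2).continuousAt.eventually (f := fun y ↦ (y, z.2)) h2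
  rw [spaceDeriv, h1.mfderiv_eq]
  exact mfderiv_const

theorem spaceDeriv_mul {φ ψ : M × ℝ → ℝ} {z : M × ℝ} (hφ : SliceDifferentiableAt N φ z)
    (hψ : SliceDifferentiableAt N ψ z) (X : TangentSpace (𝓡 N) z.1) :
    spaceDeriv N (fun z ↦ φ z * ψ z) z X =
      φ z * spaceDeriv N ψ z X + ψ z * spaceDeriv N φ z X := by
  have h1 := hφ.1.hasMFDerivAt.mul hψ.1.hasMFDerivAt
  have h2 : spaceDeriv N (fun z ↦ φ z * ψ z) z = _ := h1.mfderiv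
  rw [h2]
  rfl

theorem spaceDeriv_add {φ ψ : M × ℝ → ℝ} {z : M × ℝ} (hφ : SliceDifferentiableAt N φ z)
    (hψ : SliceDifferentiableAt N ψ z) (X : TangentSpace (𝓡 N) z.1) :
    spaceDeriv N (fun z ↦ φ z + ψ z) z X = spaceDeriv N φ z X + spaceDeriv N ψ z X := by
  have h1 := hφ.1.hasMFDerivAt.add hψ.1.hasMFDerivAt
  have h2 : spaceDeriv N (fun z ↦ φ z + ψ z) z = _ := h1.mfderiv
  rw [h2]
  rfl

theorem timeDeriv_add {φ ψ : M × ℝ → ℝ} {z : M × ℝ} (hφ : SliceDifferentiableAt N φ z)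
    (hψ : SliceDifferentiableAt N ψ z) :
    timeDeriv (fun z ↦ φ z + ψ z) z = timeDeriv φ z + timeDeriv ψ z :=
  deriv_add hφ.2 hψ.2

theorem abs_spaceDeriv_le {ψ : M × ℝ → ℝ} {Λ : NNReal} (hψ : LipschitzWith Λ ψ) (z : M × ℝ)
    (X : TangentSpace (𝓡 N) z.1) : |spaceDeriv N ψ z X| ≤ Λ * ‖X‖ := by
  refine abs_mfderiv_le_of_eventually_le (NNReal.coe_nonneg Λ) (Eventually.of_forall fun y ↦ ?_) X
  have := hψ.dist_le_mul (y, z.2) (z.1, z.2)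
  simpa [Prod.dist_eq, dist_eq] using this


section TestedInequality
/-- The function `u^(m-1) |∇u|^(p-2) b(|∇u|)`. -/
def fluxFactor (p m : ℝ) (b : ℝ → ℝ) (u : M × ℝ → ℝ)
    (G : (z : M × ℝ) → TangentSpace (𝓡 N) z.1) (z : M × ℝ) : ℝ :=
  u z ^ (m - 1) * ‖G z‖ ^ (p - 2) * b ‖G z‖

variable (N) in
/-- A weak solution with given derivatives, where all integrals are over `M × ℝ`. -/
structure IsWeakSolutionWith (p q m K : ℝ) (a : M → ℝ) (b : ℝ → ℝ) (V u : M × ℝ → ℝ)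
    (G : (z : M × ℝ) → TangentSpace (𝓡 N) z.1) (D : M × ℝ → ℝ) : Prop where
  one_lt : 1 < p
  one_le : 1 ≤ m
  bound_nonneg : 0 ≤ K
  measurable_b : Measurable b
  b_nonneg : ∀ s, 0 ≤ s → 0 ≤ b s
  b_le : ∀ s, 0 ≤ s → b s ≤ K
  continuous_weight : Continuous a
  nonneg : ∀ᵐ z ∂(weightedMeasure N a).prod 𝓛, z ∈ spaceTime M → 0 ≤ u z
  timeDeriv : IsWeakTimeDeriv N a u D
  gradient : IsWeakGradientOn N {x | 0 < a x} u G
  reaction : LocallyIntegrableOn (fun z ↦ u z ^ q * V z) (spaceTime M)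
    ((weightedMeasure N a).prod volume)
  power : LocallyIntegrableOn (fun z ↦ u z ^ (p + m - 1)) (spaceTime M)
    ((weightedMeasure N a).prod volume)
  energy : LocallyIntegrableOn (fun z ↦ ‖G z‖ ^ p * u z ^ (m - 1)) (spaceTime M)
    ((weightedMeasure N a).prod volume)
  le : ∀ ψ : M × ℝ → ℝ, IsTestFunction ψ → (∀ z, 0 ≤ ψ z) →
    ∫ z, ψ z * (u z ^ q * V z) ∂((weightedMeasure N a).prod volume) ≤
      (∫ z, spaceDeriv N ψ z (G z) * fluxFactor p m b u G z ∂((weightedMeasure N a).prod volume)) +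
        ∫ z, D z * ψ z ∂((weightedMeasure N a).prod volume)

variable {p q m K : ℝ} {b : ℝ → ℝ} {V u : M × ℝ → ℝ} {G : (z : M × ℝ) → TangentSpace (𝓡 N) z.1}
  {D : M × ℝ → ℝ}

namespace IsWeakSolutionWith

theorem aestronglyMeasurable_u (hs : IsWeakSolutionWith N p q m K a b V u G D) :
    AEStronglyMeasurable u ((μₐₜ).restrict (spaceTime M)) :=
  hs.timeDeriv.1.aestronglyMeasurable

theorem aestronglyMeasurable_norm (hs : IsWeakSolutionWith N p q m K a b V u G D) :
    AEStronglyMeasurable (fun z ↦ ‖G z‖)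
      ((μₐₜ).restrict (spaceTime M)) :=
  hs.gradient.aestronglyMeasurable_norm hs.continuous_weight

theorem aestronglyMeasurable_fluxFactor (hs : IsWeakSolutionWith N p q m K a b V u G D) :
    AEStronglyMeasurable (fluxFactor p m b u G)
      ((μₐₜ).restrict (spaceTime M)) := by
  have h1 := hs.aestronglyMeasurable_u.aemeasurable
  have h2 := hs.aestronglyMeasurable_norm.aemeasurable
  exact (((h1.pow_const (m - 1)).mul (h2.pow_const (p - 2))).mul
    (hs.measurable_b.comp_aemeasurable h2)).aestronglyMeasurable

theorem norm_mul_abs_fluxFactor_le (hs : IsWeakSolutionWith N p q m K a b V u G D) {z : M × ℝ}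
    (hz : 0 ≤ u z) :
    ‖G z‖ * |fluxFactor p m b u G z| ≤ K * (1 + u z ^ (p + m - 1) + ‖G z‖ ^ p * u z ^ (m - 1)) := by
  have hp := hs.one_lt
  have hm := hs.one_le
  have hK := hs.bound_nonneg
  have hb := hs.b_nonneg _ (norm_nonneg (G z))
  have hb' := hs.b_le _ (norm_nonneg (G z))
  have hu1 : 0 ≤ u z ^ (m - 1) := rpow_nonneg hz _
  have hu2 : 0 ≤ u z ^ (p + m - 1) := rpow_nonneg hz _
  have hg : 0 ≤ ‖G z‖ ^ (p - 2) := rpow_nonneg (norm_nonneg _) _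
  have hgp : 0 ≤ ‖G z‖ ^ p := rpow_nonneg (norm_nonneg _) _
  have h1 : ‖G z‖ * ‖G z‖ ^ (p - 2) ≤ 1 + ‖G z‖ ^ p := by
    rcases (norm_nonneg (G z)).eq_or_lt with h | h
    · rw [← h, zero_mul, zero_rpow (by linarith)]; norm_num
    · nth_rewrite 1 [← rpow_one ‖G z‖]
      rw [← rpow_add h]
      rcases le_total ‖G z‖ 1 with h1 | h1
      · exact (rpow_le_one h.le h1 (by linarith)).trans (by linarith)
      · exact (rpow_le_rpow_of_exponent_le h1
          (show 1 + (p - 2) ≤ p by linarith)).trans (by linarith)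
  have h2 : u z ^ (m - 1) ≤ 1 + u z ^ (p + m - 1) := by
    rcases le_total (u z) 1 with h | h
    · exact (rpow_le_one hz h (by linarith)).trans (by linarith)
    · exact (rpow_le_rpow_of_exponent_le h
        (show m - 1 ≤ p + m - 1 by linarith)).trans (by linarith)
  rw [fluxFactor, abs_of_nonneg (mul_nonneg (mul_nonneg hu1 hg) hb)]
  calc ‖G z‖ * (u z ^ (m - 1) * ‖G z‖ ^ (p - 2) * b ‖G z‖)
      = (‖G z‖ * ‖G z‖ ^ (p - 2)) * u z ^ (m - 1) * b ‖G z‖ := by ring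
    _ ≤ (1 + ‖G z‖ ^ p) * u z ^ (m - 1) * K := by gcongr
    _ = K * (u z ^ (m - 1) + ‖G z‖ ^ p * u z ^ (m - 1)) := by ring
    _ ≤ _ := by gcongr

theorem norm_sq_mul_abs_fluxFactor_le (hs : IsWeakSolutionWith N p q m K a b V u G D) {z : M × ℝ}
    (hz : 0 ≤ u z) :
    |‖G z‖ ^ 2 * fluxFactor p m b u G z| ≤ K * (‖G z‖ ^ p * u z ^ (m - 1)) := by
  have hp := hs.one_lt
  have hb := hs.b_nonneg _ (norm_nonneg (G z))
  have hb' := hs.b_le _ (norm_nonneg (G z))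
  have hu1 : 0 ≤ u z ^ (m - 1) := rpow_nonneg hz _
  have hg : 0 ≤ ‖G z‖ ^ (p - 2) := rpow_nonneg (norm_nonneg _) _
  have hgp : 0 ≤ ‖G z‖ ^ p := rpow_nonneg (norm_nonneg _) _
  have hGp2 : ‖G z‖ ^ 2 * ‖G z‖ ^ (p - 2) = ‖G z‖ ^ p := by
    rcases (norm_nonneg (G z)).eq_or_lt with h | h
    · rw [← h, zero_rpow (by linarith : p ≠ 0)]; ring
    · rw [← rpow_natCast, ← rpow_add h]
      congr 1; push_cast; ring
  have e : ‖G z‖ ^ 2 * fluxFactor p m b u G z = b ‖G z‖ * (‖G z‖ ^ p * u z ^ (m - 1)) := by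
    rw [fluxFactor, ← hGp2]; ring
  rw [e, abs_of_nonneg (by positivity)]
  gcongr

/-- Products of a locally integrable function on `S` and a bounded function supported in a compact
subset of `S` are integrable. -/
theorem _root_.integrable_mul_of_locallyIntegrableOn {ν : Measure (M × ℝ)} {F φ : M × ℝ → ℝ}
    (hF : LocallyIntegrableOn F (spaceTime M) ν) {T : Set (M × ℝ)} (hT : IsCompact T)
    (hTS : T ⊆ spaceTime M) {C : ℝ} (hφm : AEStronglyMeasurable φ (ν.restrict T))
    (hφC : ∀ᵐ z ∂ν.restrict T, |φ z| ≤ C) (hφ : ∀ z ∉ T, φ z = 0) :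
    Integrable (fun z ↦ F z * φ z) ν := by
  have h1 : IntegrableOn (fun z ↦ F z * φ z) T ν :=
    (hF.integrableOn_compact_subset hTS hT).mul_bdd (c := C) hφm hφC
  refine (integrableOn_iff_integrable_of_support_subset fun z hz ↦ ?_).1 h1
  by_contra h
  exact hz (by simp [hφ z h])

variable [ProperSpace M] [IsLocallyFiniteMeasure ((weightedMeasure N a).prod (volume : Measure ℝ))]
  {g : ℝ → ℝ} {χ : M × ℝ → ℝ}

theorem locallyIntegrableOn_bound (hs : IsWeakSolutionWith N p q m K a b V u G D) :
    LocallyIntegrableOn (fun z ↦ 1 + u z ^ (p + m - 1) + ‖G z‖ ^ p * u z ^ (m - 1)) (spaceTime M)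
      μₐₜ :=
  (((locallyIntegrable_const (1 : ℝ)).locallyIntegrableOn _).add hs.power).add hs.energy

theorem integrable_spaceDeriv_mul (hs : IsWeakSolutionWith N p q m K a b V u G D)
    (hχ : IsTestFunction χ) {F : M × ℝ → ℝ} {C : ℝ}
    (hFm : AEStronglyMeasurable F
      ((μₐₜ).restrict (spaceTime M)))
    (hFC : ∀ z, |F z| ≤ C) :
    Integrable (fun z ↦ F z * (spaceDeriv N χ z (G z) * fluxFactor p m b u G z))
      μₐₜ := by
  obtain ⟨Λ, hΛ⟩ := hχ.exists_lipschitzWith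
  have hsub : tsupport χ ⊆ spaceTime M := hχ.2.2
  have hm1 : AEStronglyMeasurable
      (fun z ↦ F z * (spaceDeriv N χ z (G z) * fluxFactor p m b u G z))
      ((μₐₜ).restrict (spaceTime M)) :=
    hFm.mul ((hs.gradient.aestronglyMeasurable_spaceDeriv hs.continuous_weight
      (isOpen_spaceTime M) le_rfl hχ.1.locallyLipschitzOn).mul hs.aestronglyMeasurable_fluxFactor)
  have h1 : IntegrableOn (fun z ↦ F z * (spaceDeriv N χ z (G z) * fluxFactor p m b u G z))
      (tsupport χ) μₐₜ := by
    refine Integrable.mono' ((hs.locallyIntegrableOn_bound.integrableOn_compact_subset hsub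
      hχ.2.1.isCompact).const_mul (C * Λ * K))
      (hm1.mono_measure (Measure.restrict_mono hsub le_rfl)) ?_
    filter_upwards [ae_restrict_mem (isClosed_tsupport χ).measurableSet,
      ae_restrict_of_ae hs.nonneg] with z hz h0
    have hu := h0 (hsub hz)
    have h2 := hs.norm_mul_abs_fluxFactor_le hu
    have h3 := abs_spaceDeriv_le hΛ z (G z)
    have hC : 0 ≤ C := (abs_nonneg _).trans (hFC z)
    rw [norm_eq_abs, abs_mul, abs_mul]
    calc |F z| * (|spaceDeriv N χ z (G z)| * |fluxFactor p m b u G z|)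
        ≤ C * (Λ * ‖G z‖ * |fluxFactor p m b u G z|) := by
          gcongr
          exact hFC z
      _ = C * Λ * (‖G z‖ * |fluxFactor p m b u G z|) := by ring
      _ ≤ C * Λ * (K * _) := by gcongr
      _ = _ := by ring
  refine (integrableOn_iff_integrable_of_support_subset fun z hz ↦ ?_).1 h1
  by_contra h
  exact hz (by simp only [spaceDeriv_eq_zero h, zero_apply, zero_mul, mul_zero])

theorem integrable_norm_sq_mul (hs : IsWeakSolutionWith N p q m K a b V u G D)
    {F : M × ℝ → ℝ} {T : Set (M × ℝ)} (hT : IsCompact T) (hTS : T ⊆ spaceTime M) {C : ℝ}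
    (hFm : AEStronglyMeasurable F ((μₐₜ).restrict (spaceTime M)))
    (hFC : ∀ z, |F z| ≤ C) (hF : ∀ z ∉ T, F z = 0) :
    Integrable (fun z ↦ F z * (‖G z‖ ^ 2 * fluxFactor p m b u G z))
      μₐₜ := by
  have hm1 : AEStronglyMeasurable (fun z ↦ F z * (‖G z‖ ^ 2 * fluxFactor p m b u G z))
      ((μₐₜ).restrict (spaceTime M)) :=
    hFm.mul ((hs.aestronglyMeasurable_norm.pow 2).mul hs.aestronglyMeasurable_fluxFactor)
  have h1 : IntegrableOn (fun z ↦ F z * (‖G z‖ ^ 2 * fluxFactor p m b u G z)) T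
      μₐₜ := by
    refine Integrable.mono' ((hs.energy.integrableOn_compact_subset hTS hT).const_mul (C * K))
      (hm1.mono_measure (Measure.restrict_mono hTS le_rfl)) ?_
    filter_upwards [ae_restrict_mem hT.measurableSet, ae_restrict_of_ae hs.nonneg] with z hz h0
    have h2 := hs.norm_sq_mul_abs_fluxFactor_le (h0 (hTS hz))
    have hC : 0 ≤ C := (abs_nonneg _).trans (hFC z)
    rw [norm_eq_abs, abs_mul, mul_assoc]
    exact mul_le_mul (hFC z) h2 (abs_nonneg _) hC
  refine (integrableOn_iff_integrable_of_support_subset fun z hz ↦ ?_).1 h1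
  by_contra h
  exact hz (by simp only [hF z h, zero_mul])

theorem abs_primitive_le {g : ℝ → ℝ} {B : ℝ} (hg0 : ∀ s, 0 ≤ g s) (hgB : ∀ s, g s ≤ B) (t : ℝ) :
    |∫ s in 0..t, g s| ≤ B * |t| := by
  have := intervalIntegral.norm_integral_le_of_norm_le_const (f := g) (a := 0) (b := t) (C := B)
      fun s _ ↦ by rw [norm_of_nonneg (hg0 s)]; exact hgB s
  simpa using this

theorem integrable_primitive_mul_timeDeriv (hs : IsWeakSolutionWith N p q m K a b V u G D)
    (hχ : IsTestFunction χ) {B : ℝ} (hgc : Continuous g) (hg0 : ∀ s, 0 ≤ g s)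
    (hgB : ∀ s, g s ≤ B) :
    Integrable (fun z ↦ (∫ s in 0..u z, g s) * _root_.timeDeriv χ z)
      μₐₜ := by
  obtain ⟨Λ, hΛ⟩ := hχ.exists_lipschitzWith
  have hPm : AEStronglyMeasurable (fun z ↦ ∫ s in 0..u z, g s)
      ((μₐₜ).restrict (spaceTime M)) :=
    (intervalIntegral.continuous_primitive (fun a b ↦ hgc.intervalIntegrable a b) 0
      ).comp_aestronglyMeasurable hs.aestronglyMeasurable_u
  have h1 : IntegrableOn (fun z ↦ (∫ s in 0..u z, g s) * _root_.timeDeriv χ z)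
      (tsupport χ) μₐₜ := by
    refine Integrable.mul_bdd (c := Λ) ?_ (measurable_timeDeriv hΛ.continuous).aestronglyMeasurable
      (ae_of_all _ fun z ↦ abs_timeDeriv_le hΛ z)
    refine ((hs.timeDeriv.1.integrableOn_compact_subset hχ.2.2 hχ.2.1.isCompact).abs.const_mul
      B).mono' (hPm.mono_measure (Measure.restrict_mono hχ.2.2 le_rfl)) (ae_of_all _ fun z ↦ ?_)
    exact abs_primitive_le hg0 hgB (u z)
  refine (integrableOn_iff_integrable_of_support_subset fun z hz ↦ ?_).1 h1
  by_contra h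
  exact hz (by simp only [timeDeriv_eq_zero h, mul_zero])

end IsWeakSolutionWith
end TestedInequality

section TestedInequality
/-- The integrand of the weak inequality, formally tested with `χ g(u)`. -/
def testedIntegrand (p q m : ℝ) (b : ℝ → ℝ) (V u : M × ℝ → ℝ)
    (G : (z : M × ℝ) → TangentSpace (𝓡 N) z.1) (g : ℝ → ℝ) (χ : M × ℝ → ℝ) (z : M × ℝ) : ℝ :=
  (u z ^ q * V z) * (χ z * g (u z)) -
      (χ z * deriv g (u z)) * (‖G z‖ ^ 2 * fluxFactor p m b u G z) -
    g (u z) * (spaceDeriv N χ z (G z) * fluxFactor p m b u G z) +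
      (∫ s in 0..u z, g s) * timeDeriv χ z

variable {p q m K : ℝ} {b : ℝ → ℝ} {V u : M × ℝ → ℝ} {G : (z : M × ℝ) → TangentSpace (𝓡 N) z.1}
  {D : M × ℝ → ℝ} [ProperSpace M]
  [IsLocallyFiniteMeasure ((weightedMeasure N a).prod (volume : Measure ℝ))] {g : ℝ → ℝ}
  {χ : M × ℝ → ℝ} {ℓ B B' C : ℝ}

namespace IsWeakSolutionWith

theorem _root_.IsTestFunction.exists_bound (hχ : IsTestFunction χ) :
    ∃ L, 0 ≤ L ∧ ∀ z, |χ z| ≤ L := by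
  obtain ⟨L, hL⟩ := hχ.2.1.exists_bound_of_continuous hχ.1.continuous
  exact ⟨max L 0, le_max_right _ _, fun z ↦ (hL z).trans (le_max_left _ _)⟩

theorem integrable_reaction_mul (hs : IsWeakSolutionWith N p q m K a b V u G D)
    (hχ : IsTestFunction χ) {F : M × ℝ → ℝ} {C : ℝ}
    (hFm : AEStronglyMeasurable F ((μₐₜ).restrict (spaceTime M)))
    (hFC : ∀ z, |F z| ≤ C) :
    Integrable (fun z ↦ (u z ^ q * V z) * (χ z * F z)) μₐₜ := by
  obtain ⟨L, hL⟩ := hχ.2.1.exists_bound_of_continuous hχ.1.continuous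
  refine integrable_mul_of_locallyIntegrableOn hs.reaction hχ.2.1.isCompact hχ.2.2 (C := L * C)
    (hχ.1.continuous.measurable.aestronglyMeasurable.mul
      (hFm.mono_measure (Measure.restrict_mono hχ.2.2 le_rfl))) (ae_of_all _ fun z ↦ ?_)
    fun z hz ↦ by rw [image_eq_zero_of_notMem_tsupport hz, zero_mul]
  rw [abs_mul]
  exact mul_le_mul (hL z) (hFC z) (abs_nonneg _) ((norm_nonneg _).trans (hL z))

theorem integrable_timeDeriv_mul (hs : IsWeakSolutionWith N p q m K a b V u G D)
    (hχ : IsTestFunction χ) {F : M × ℝ → ℝ} {C : ℝ}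
    (hFm : AEStronglyMeasurable F ((μₐₜ).restrict (spaceTime M)))
    (hFC : ∀ z, |F z| ≤ C) :
    Integrable (fun z ↦ D z * (χ z * F z)) μₐₜ := by
  obtain ⟨L, hL⟩ := hχ.2.1.exists_bound_of_continuous hχ.1.continuous
  refine integrable_mul_of_locallyIntegrableOn hs.timeDeriv.2.1 hχ.2.1.isCompact hχ.2.2
    (C := L * C) (hχ.1.continuous.measurable.aestronglyMeasurable.mul
      (hFm.mono_measure (Measure.restrict_mono hχ.2.2 le_rfl))) (ae_of_all _ fun z ↦ ?_)
    fun z hz ↦ by rw [image_eq_zero_of_notMem_tsupport hz, zero_mul]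
  rw [abs_mul]
  exact mul_le_mul (hL z) (hFC z) (abs_nonneg _) ((norm_nonneg _).trans (hL z))

theorem integrable_dissipation (hs : IsWeakSolutionWith N p q m K a b V u G D)
    (hχ : IsTestFunction χ) (hg : IsAdmissible ℓ B B' C g) :
    Integrable (fun z ↦ (χ z * deriv g (u z)) * (‖G z‖ ^ 2 * fluxFactor p m b u G z))
      μₐₜ := by
  obtain ⟨L, hL⟩ := hχ.2.1.exists_bound_of_continuous hχ.1.continuous
  refine hs.integrable_norm_sq_mul hχ.2.1.isCompact hχ.2.2 (C := L * B')
    (hχ.1.continuous.measurable.aestronglyMeasurable.mul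
      ((measurable_deriv g).comp_aemeasurable
        hs.aestronglyMeasurable_u.aemeasurable).aestronglyMeasurable) (fun z ↦ ?_)
    fun z hz ↦ by rw [image_eq_zero_of_notMem_tsupport hz, zero_mul]
  rw [abs_mul]
  exact mul_le_mul (hL z) (hg.abs_deriv_le _) (abs_nonneg _) ((norm_nonneg _).trans (hL z))

theorem aestronglyMeasurable_comp (hs : IsWeakSolutionWith N p q m K a b V u G D)
    (hg : Continuous g) : AEStronglyMeasurable (fun z ↦ g (u z))
      ((μₐₜ).restrict (spaceTime M)) :=
  hg.comp_aestronglyMeasurable hs.aestronglyMeasurable_u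

theorem _root_.IsAdmissible.abs_le (hg : IsAdmissible ℓ B B' C g) (s : ℝ) : |g s| ≤ B := by
  rw [abs_of_nonneg (hg.nonneg s)]; exact hg.le s

theorem integrable_testedIntegrand (hs : IsWeakSolutionWith N p q m K a b V u G D)
    (hχ : IsTestFunction χ) (hg : IsAdmissible ℓ B B' C g) :
    Integrable (testedIntegrand p q m b V u G g χ) μₐₜ :=
  (((hs.integrable_reaction_mul hχ (hs.aestronglyMeasurable_comp hg.contDiff.continuous)
    fun z ↦ hg.abs_le (u z)).sub (hs.integrable_dissipation hχ hg)).sub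
    (hs.integrable_spaceDeriv_mul hχ (hs.aestronglyMeasurable_comp hg.contDiff.continuous)
      fun z ↦ hg.abs_le (u z))).add
    (hs.integrable_primitive_mul_timeDeriv hχ hg.contDiff.continuous hg.nonneg hg.le)

section Limit
variable {O : Set (M × ℝ)} {ζ : ℕ → M × ℝ → ℝ}

/-- The time derivative part of the tested inequality. -/
theorem integral_timeDeriv_mul_le (hs : IsWeakSolutionWith N p q m K a b V u G D)
    (hχ : IsTestFunction χ) (hχ0 : ∀ z, 0 ≤ χ z) (hg : IsAdmissible ℓ B B' C g) (hga : Antitone g)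
    (hO : IsOpen O) (hOχ : tsupport χ ⊆ O) (hζ : ∀ k, LocallyLipschitzOn O (ζ k))
    (hζB : ∀ k, ∀ z ∈ O, 0 ≤ ζ k z ∧ ζ k z ≤ B)
    (hζt : ∀ᵐ z ∂μₐₜ, z ∈ O →
      Tendsto (fun k ↦ ζ k z) atTop (𝓝 (g (u z)))) :
    ∫ z, D z * (χ z * g (u z)) ∂μₐₜ ≤
      - ∫ z, (∫ s in 0..u z, g s) * _root_.timeDeriv χ z
        ∂μₐₜ := by
  obtain ⟨δ, hδ, hδS⟩ := hχ.2.1.isCompact.exists_cthickening_subset_open (isOpen_spaceTime M) hχ.2.2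
  set T := cthickening δ (tsupport χ) with hT
  have hTc : IsCompact T := hχ.2.1.isCompact.cthickening
  have hχT : tsupport χ ⊆ T := self_subset_cthickening _
  obtain ⟨L, hLB, hL⟩ := hχ.exists_bound
  have hL' (z : M × ℝ) : χ z ≤ L := (le_abs_self _).trans (hL z)
  obtain ⟨Λ, hΛ⟩ := hχ.exists_lipschitzWith
  have hψ (k : ℕ) : IsTestFunction fun z ↦ χ z * ζ k z := hχ.mul_of_locallyLipschitzOn hO (hζ k) hOχ
  have hψs (k : ℕ) : tsupport (fun z ↦ χ z * ζ k z) ⊆ tsupport χ := tsupport_mul_subset_left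
  choose Λ' hΛ' using fun k ↦ (hψ k).exists_lipschitzWith
  have hsd {φ : M × ℝ → ℝ} (hφ : IsTestFunction φ) :
      ∀ᵐ z ∂μₐₜ,
        DifferentiableAt ℝ (fun r ↦ φ (z.1, r)) z.2 := by
    filter_upwards [(hφ.1.locallyLipschitzOn (s := univ)).ae_sliceDifferentiableAt (N := N)
      hs.continuous_weight isOpen_univ] with z hz using (hz (mem_univ _)).2
  have hB : 0 ≤ B := (hg.nonneg 0).trans (hg.le 0)
  have hUi : Integrable (T.indicator u) μₐₜ :=
    (integrable_indicator_iff hTc.measurableSet).2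
      (hs.timeDeriv.1.integrableOn_compact_subset hδS hTc)
  have hDi : Integrable (T.indicator D) μₐₜ :=
    (integrable_indicator_iff hTc.measurableSet).2
      (hs.timeDeriv.2.1.integrableOn_compact_subset hδS hTc)
  have hmul {F φ : M × ℝ → ℝ} (hφ : ∀ z ∉ T, φ z = 0) (z : M × ℝ) :
      T.indicator F z * φ z = F z * φ z := by
    by_cases hz : z ∈ T
    · rw [indicator_of_mem hz]
    · rw [hφ z hz, mul_zero, mul_zero]
  have key := integral_timeDeriv_primitive_le hUi hDi hg.contDiff.continuous hga hg.nonneg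
    hg.le hΛ hχ0 hL' (hsd hχ) (ψ := fun k z ↦ χ z * ζ k z) (mul_nonneg hLB hB) hΛ' ?_
    (fun k ↦ hsd (hψ k)) hδ ?_ ?_
  · have e1 (z : M × ℝ) : T.indicator D z * (χ z * g (T.indicator u z)) =
        D z * (χ z * g (u z)) := by
      by_cases hz : z ∈ T
      · rw [indicator_of_mem hz, indicator_of_mem hz]
      · rw [image_eq_zero_of_notMem_tsupport fun h ↦ hz (hχT h)]; ring
    have e2 (z : M × ℝ) : (∫ s in 0..T.indicator u z, g s) * _root_.timeDeriv χ z =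
        (∫ s in 0..u z, g s) * _root_.timeDeriv χ z := by
      by_cases hz : z ∈ T
      · rw [indicator_of_mem hz]
      · rw [timeDeriv_eq_zero fun h ↦ hz (hχT h)]; ring
    simpa only [e1, e2] using key
  · intro k z
    by_cases hz : z ∈ O
    · obtain ⟨h1, h2⟩ := hζB k z hz
      rw [abs_mul, abs_of_nonneg h1]
      exact mul_le_mul (hL z) h2 h1 hLB
    · rw [image_eq_zero_of_notMem_tsupport fun h ↦ hz (hOχ h), zero_mul, abs_zero]
      positivity
  · intro k s hsδ
    have hsδ' : |s| ≤ δ := by rw [abs_of_nonneg hsδ.1]; exact hsδ.2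
    have hsub : tsupport ((fun z ↦ χ z * ζ k z) ∘ timeShift s) ⊆ T :=
      (tsupport_comp_timeShift_subset hsδ').trans
        (cthickening_subset_of_subset δ (hψs k))
    have htest := (hψ k).comp_timeShift hsδ'
      ((cthickening_subset_of_subset δ (hψs k)).trans hδS)
    have h1 := hs.timeDeriv.2.2 _ htest
    have e1 := hmul (F := u) (φ := _root_.timeDeriv ((fun z ↦ χ z * ζ k z) ∘ timeShift s))
      fun z hz ↦ timeDeriv_eq_zero fun h ↦ hz (hsub h)
    have e2 := hmul (F := D) (φ := (fun z ↦ χ z * ζ k z) ∘ timeShift s)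
      fun z hz ↦ image_eq_zero_of_notMem_tsupport fun h ↦ hz (hsub h)
    simp only [Function.comp] at e2 h1
    simp only [e1, e2, h1]
  · filter_upwards [hζt] with z h
    by_cases hz : z ∈ O
    · by_cases hzT : z ∈ T
      · rw [indicator_of_mem hzT]
        exact (h hz).const_mul _
      · simp only [image_eq_zero_of_notMem_tsupport fun h ↦ hzT (hχT h), zero_mul]
        exact tendsto_const_nhds
    · simp only [image_eq_zero_of_notMem_tsupport fun h ↦ hz (hOχ h), zero_mul]
      exact tendsto_const_nhds

/-- The tested inequality, near points where `g(u)` can be approximated by Lipschitz functions. -/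
theorem integral_testedIntegrand_nonpos_of_approximation
    (hs : IsWeakSolutionWith N p q m K a b V u G D)
    (hχ : IsTestFunction χ) (hχ0 : ∀ z, 0 ≤ χ z) (hg : IsAdmissible ℓ B B' C g) (hga : Antitone g)
    (hO : IsOpen O) (hOS : O ⊆ spaceTime M) (hOχ : tsupport χ ⊆ O)
    (happ : HasLipschitzApproximation p m a u G g B O) :
    ∫ z, testedIntegrand p q m b V u G g χ z ∂μₐₜ ≤ 0 := by
  obtain ⟨ζ, hζ, hζB, hζt, hζi⟩ := happ
  have htime := hs.integral_timeDeriv_mul_le hχ hχ0 hg hga hO hOχ hζ hζB hζt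
  obtain ⟨L, hL0, hL⟩ := hχ.exists_bound
  have hgm := hs.aestronglyMeasurable_comp hg.contDiff.continuous
  have hB : 0 ≤ B := (hg.nonneg 0).trans (hg.le 0)
  have hψ (k : ℕ) : IsTestFunction fun z ↦ χ z * ζ k z := hχ.mul_of_locallyLipschitzOn hO (hζ k) hOχ
  obtain ⟨ζ', hζ'⟩ : ∃ ζ' : ℕ → M × ℝ → ℝ, ζ' = fun k ↦ O.indicator (ζ k) := ⟨_, rfl⟩
  have hζ'm (k : ℕ) : Measurable (ζ' k) := by
    classical
    have := (hζ k).continuousOn.measurable_piecewise (continuousOn_const (c := (0 : ℝ)))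
      hO.measurableSet
    rw [hζ']
    simp only [← piecewise_eq_indicator]
    exact this
  have hζ'B (k : ℕ) (z : M × ℝ) : |ζ' k z| ≤ B := by
    rw [hζ']
    by_cases hz : z ∈ O
    · simp only [indicator_of_mem hz]
      rw [abs_of_nonneg (hζB k z hz).1]; exact (hζB k z hz).2
    · simp only [indicator_of_notMem hz, abs_zero]; exact hB
  have hζ't : ∀ᵐ z ∂μₐₜ, z ∈ O →
      Tendsto (fun k ↦ ζ' k z) atTop (𝓝 (g (u z))) := by
    filter_upwards [hζt] with z h hz
    rw [hζ']; simpa only [indicator_of_mem hz] using h hz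
  have hχζ (k : ℕ) (z : M × ℝ) : χ z * ζ k z = χ z * ζ' k z := by
    rw [hζ']
    by_cases hz : z ∈ O
    · simp only [indicator_of_mem hz]
    · rw [image_eq_zero_of_notMem_tsupport fun h ↦ hz (hOχ h), zero_mul, zero_mul]
  have hptw (k : ℕ) : ∀ᵐ z ∂μₐₜ,
      spaceDeriv N (fun z ↦ χ z * ζ k z) z (G z) * fluxFactor p m b u G z =
      χ z * (spaceDeriv N (ζ k) z (G z) * fluxFactor p m b u G z) +
        ζ' k z * (spaceDeriv N χ z (G z) * fluxFactor p m b u G z) := by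
    filter_upwards [(hζ k).ae_sliceDifferentiableAt hs.continuous_weight hO,
      (hχ.1.locallyLipschitzOn (s := univ)).ae_sliceDifferentiableAt (N := N)
      hs.continuous_weight isOpen_univ] with z h1 h2
    by_cases hz : z ∈ O
    · rw [spaceDeriv_mul (h2 (mem_univ _)) (h1 hz), hζ']
      simp only [indicator_of_mem hz]
      ring
    · have h3 : z ∉ tsupport χ := fun h ↦ hz (hOχ h)
      have h4 : z ∉ tsupport fun z ↦ χ z * ζ k z := fun h ↦ h3 (tsupport_mul_subset_left h)
      rw [spaceDeriv_eq_zero h4, spaceDeriv_eq_zero h3, image_eq_zero_of_notMem_tsupport h3]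
      simp only [zero_apply]
      ring
  -- the limit of the reaction terms
  have l1 : Tendsto (fun k ↦ ∫ z, (u z ^ q * V z) * (χ z * ζ' k z)
      ∂μₐₜ) atTop
      (𝓝 (∫ z, (u z ^ q * V z) * (χ z * g (u z)) ∂μₐₜ)) := by
    refine tendsto_integral_of_dominated_convergence
      (fun z ↦ |(u z ^ q * V z) * (χ z * (fun _ ↦ B) z)|)
      (fun k ↦ (hs.integrable_reaction_mul hχ (hζ'm k).aestronglyMeasurable (hζ'B k)).1)
      (hs.integrable_reaction_mul hχ aestronglyMeasurable_const fun _ ↦ le_of_eq rfl).abs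
      (fun k ↦ ae_of_all _ fun z ↦ ?_) ?_
    · simp only [norm_eq_abs, abs_mul, abs_of_nonneg hB]
      have := hζ'B k z
      gcongr
    · filter_upwards [hζ't] with z h
      by_cases hz : z ∈ O
      · exact ((h hz).const_mul _).const_mul _
      · simp only [image_eq_zero_of_notMem_tsupport fun h ↦ hz (hOχ h), zero_mul, mul_zero]
        exact tendsto_const_nhds
  have l2 : Tendsto (fun k ↦ ∫ z, D z * (χ z * ζ' k z)
      ∂μₐₜ) atTop
      (𝓝 (∫ z, D z * (χ z * g (u z)) ∂μₐₜ)) := by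
    refine tendsto_integral_of_dominated_convergence
      (fun z ↦ |D z * (χ z * (fun _ ↦ B) z)|)
      (fun k ↦ (hs.integrable_timeDeriv_mul hχ (hζ'm k).aestronglyMeasurable (hζ'B k)).1)
      (hs.integrable_timeDeriv_mul hχ aestronglyMeasurable_const fun _ ↦ le_of_eq rfl).abs
      (fun k ↦ ae_of_all _ fun z ↦ ?_) ?_
    · simp only [norm_eq_abs, abs_mul, abs_of_nonneg hB]
      have := hζ'B k z
      gcongr
    · filter_upwards [hζ't] with z h
      by_cases hz : z ∈ O
      · exact ((h hz).const_mul _).const_mul _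
      · simp only [image_eq_zero_of_notMem_tsupport fun h ↦ hz (hOχ h), zero_mul, mul_zero]
        exact tendsto_const_nhds
  have l3 : Tendsto (fun k ↦ ∫ z, ζ' k z * (spaceDeriv N χ z (G z) * fluxFactor p m b u G z)
      ∂μₐₜ) atTop
      (𝓝 (∫ z, g (u z) * (spaceDeriv N χ z (G z) * fluxFactor p m b u G z)
        ∂μₐₜ)) := by
    refine tendsto_integral_of_dominated_convergence
      (fun z ↦ |(fun _ ↦ B) z * (spaceDeriv N χ z (G z) * fluxFactor p m b u G z)|)
      (fun k ↦ (hs.integrable_spaceDeriv_mul hχ (hζ'm k).aestronglyMeasurable (hζ'B k)).1)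
      (hs.integrable_spaceDeriv_mul hχ aestronglyMeasurable_const fun _ ↦ le_of_eq rfl).abs
      (fun k ↦ ae_of_all _ fun z ↦ ?_) ?_
    · simp only [norm_eq_abs, abs_mul, abs_of_nonneg hB]
      have := hζ'B k z
      gcongr
    · filter_upwards [hζ't] with z h
      by_cases hz : z ∈ O
      · exact (h hz).mul_const _
      · simp only [spaceDeriv_eq_zero fun h ↦ hz (hOχ h), zero_apply, zero_mul, mul_zero]
        exact tendsto_const_nhds
  have hdis := hs.integrable_dissipation hχ hg
  have hGm := hs.aestronglyMeasurable_norm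
  have hfm := hs.aestronglyMeasurable_fluxFactor
  have hdiffm (k : ℕ) : AEStronglyMeasurable (fun z ↦ χ z *
      (spaceDeriv N (ζ k) z (G z) * fluxFactor p m b u G z) -
      (χ z * deriv g (u z)) * (‖G z‖ ^ 2 * fluxFactor p m b u G z))
      ((μₐₜ).restrict O) := by
    refine AEStronglyMeasurable.sub ?_ (hdis.1.mono_measure Measure.restrict_le_self)
    exact hχ.1.continuous.measurable.aestronglyMeasurable.mul
      ((hs.gradient.aestronglyMeasurable_spaceDeriv hs.continuous_weight hO hOS (hζ k)).mul
        (hfm.mono_measure (Measure.restrict_mono hOS le_rfl)))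
  have hbound (k : ℕ) : ∫⁻ z, ‖χ z * (spaceDeriv N (ζ k) z (G z) * fluxFactor p m b u G z) -
      (χ z * deriv g (u z)) * (‖G z‖ ^ 2 * fluxFactor p m b u G z)‖ₑ
        ∂μₐₜ ≤ ofReal (L * K) * ∫⁻ z in O,
        ‖(spaceDeriv N (ζ k) z (G z) - deriv g (u z) * ‖G z‖ ^ 2) *
          (u z ^ (m - 1) * ‖G z‖ ^ (p - 2))‖ₑ ∂μₐₜ := by
    rw [← lintegral_const_mul' _ _ ofReal_ne_top,
      ← lintegral_indicator hO.measurableSet]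
    refine lintegral_mono fun z ↦ ?_
    by_cases hz : z ∈ O
    · rw [indicator_of_mem hz, ← ofReal_norm, ← ofReal_norm,
        ← ofReal_mul (mul_nonneg hL0 hs.bound_nonneg)]
      refine ofReal_le_ofReal ?_
      have e : χ z * (spaceDeriv N (ζ k) z (G z) * fluxFactor p m b u G z) -
          (χ z * deriv g (u z)) * (‖G z‖ ^ 2 * fluxFactor p m b u G z) =
          χ z * b ‖G z‖ * ((spaceDeriv N (ζ k) z (G z) - deriv g (u z) * ‖G z‖ ^ 2) *
          (u z ^ (m - 1) * ‖G z‖ ^ (p - 2))) := by rw [fluxFactor]; ring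
      rw [e, norm_mul, norm_mul]
      have h1 : ‖b ‖G z‖‖ ≤ K := by
        rw [norm_of_nonneg (hs.b_nonneg _ (norm_nonneg _))]
        exact hs.b_le _ (norm_nonneg _)
      have h2 : ‖χ z‖ ≤ L := hL z
      gcongr
    · rw [indicator_of_notMem hz, image_eq_zero_of_notMem_tsupport fun h ↦ hz (hOχ h)]
      simp
  have hlim0 : Tendsto (fun k ↦ ∫⁻ z, ‖χ z * (spaceDeriv N (ζ k) z (G z) *
      fluxFactor p m b u G z) - (χ z * deriv g (u z)) * (‖G z‖ ^ 2 * fluxFactor p m b u G z)‖ₑ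
        ∂μₐₜ) atTop (𝓝 0) := by
    have h1 := ENNReal.Tendsto.const_mul (a := ofReal (L * K)) hζi
      (Or.inr ofReal_ne_top)
    rw [mul_zero] at h1
    exact tendsto_of_tendsto_of_tendsto_of_le_of_le tendsto_const_nhds h1 (fun _ ↦ zero_le) hbound
  have hin : ∀ᶠ k in atTop, Integrable (fun z ↦ χ z * (spaceDeriv N (ζ k) z (G z) *
      fluxFactor p m b u G z)) μₐₜ := by
    filter_upwards [hlim0.eventually_lt_const zero_lt_one] with k hk
    have h1 : IntegrableOn (fun z ↦ χ z *
      (spaceDeriv N (ζ k) z (G z) * fluxFactor p m b u G z) -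
      (χ z * deriv g (u z)) * (‖G z‖ ^ 2 * fluxFactor p m b u G z)) O
        μₐₜ :=
      ⟨hdiffm k, (setLIntegral_le_lintegral _ _).trans_lt (hk.trans ENNReal.one_lt_top)⟩
    have h2 := (integrableOn_iff_integrable_of_support_subset fun z hz ↦ by
      by_contra h
      refine hz ?_
      simp only [image_eq_zero_of_notMem_tsupport fun h' ↦ h (hOχ h'), zero_mul, sub_zero]).1 h1
    refine (h2.add hdis).congr (ae_of_all _ fun z ↦ ?_)
    simp only [Pi.add_apply, sub_add_cancel]
  have l4 := tendsto_integral_of_L1 _ hdis.1 hin hlim0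
  have hle : ∀ᶠ k in atTop, ∫ z, (u z ^ q * V z) * (χ z * ζ' k z)
      ∂μₐₜ ≤
      (∫ z, χ z * (spaceDeriv N (ζ k) z (G z) * fluxFactor p m b u G z)
        ∂μₐₜ) +
      (∫ z, ζ' k z * (spaceDeriv N χ z (G z) * fluxFactor p m b u G z)
        ∂μₐₜ) +
      ∫ z, D z * (χ z * ζ' k z) ∂μₐₜ := by
    filter_upwards [hin] with k hk
    have h1 := hs.le _ (hψ k) fun z ↦ by
      by_cases hz : z ∈ O
      · exact mul_nonneg (hχ0 z) (hζB k z hz).1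
      · rw [image_eq_zero_of_notMem_tsupport fun h ↦ hz (hOχ h), zero_mul]
    rw [integral_congr_ae (hptw k), integral_add hk
      (hs.integrable_spaceDeriv_mul hχ (hζ'm k).aestronglyMeasurable (hζ'B k))] at h1
    simp only [hχζ] at h1
    simpa only [mul_comm] using h1
  have hfinal := le_of_tendsto_of_tendsto l1 ((l4.add l3).add l2) hle
  have i1 := hs.integrable_reaction_mul hχ hgm fun z ↦ hg.abs_le (u z)
  have i3 := hs.integrable_spaceDeriv_mul hχ hgm fun z ↦ hg.abs_le (u z)
  have i4 := hs.integrable_primitive_mul_timeDeriv hχ hg.contDiff.continuous hg.nonneg hg.le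
  have hsplit : ∫ z, testedIntegrand p q m b V u G g χ z ∂μₐₜ =
      (∫ z, (u z ^ q * V z) * (χ z * g (u z)) ∂μₐₜ) -
      (∫ z, (χ z * deriv g (u z)) * (‖G z‖ ^ 2 * fluxFactor p m b u G z)
        ∂μₐₜ) -
      (∫ z, g (u z) * (spaceDeriv N χ z (G z) * fluxFactor p m b u G z)
        ∂μₐₜ) +
      ∫ z, (∫ s in 0..u z, g s) * _root_.timeDeriv χ z
        ∂μₐₜ := by
    have j1 : Integrable (fun z ↦ (u z ^ q * V z) * (χ z * g (u z)) -
        (χ z * deriv g (u z)) * (‖G z‖ ^ 2 * fluxFactor p m b u G z))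
        μₐₜ := i1.sub hdis
    have j2 : Integrable (fun z ↦ (u z ^ q * V z) * (χ z * g (u z)) -
        (χ z * deriv g (u z)) * (‖G z‖ ^ 2 * fluxFactor p m b u G z) -
        g (u z) * (spaceDeriv N χ z (G z) * fluxFactor p m b u G z))
        μₐₜ := j1.sub i3
    simp only [testedIntegrand]
    rw [integral_add j2 i4, integral_sub j1 i3, integral_sub i1 hdis]
  rw [hsplit]
  linarith

end Limit

/-- The weak inequality tested with `χ g(u)`. -/
theorem integral_testedIntegrand_nonpos (hs : IsWeakSolutionWith N p q m K a b V u G D)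
    (hχ : IsTestFunction χ) (hχ0 : ∀ z, 0 ≤ χ z) (hg : IsAdmissible ℓ B B' C g) (hga : Antitone g)
    (happ : ∀ z ∈ spaceTime M, ∃ O, IsOpen O ∧ z ∈ O ∧ O ⊆ spaceTime M ∧
      HasLipschitzApproximation p m a u G g B O) :
    ∫ z, testedIntegrand p q m b V u G g χ z ∂μₐₜ ≤ 0 := by
  have hr (z : M × ℝ) : z ∈ spaceTime M → ∃ r > 0, ∃ O, IsOpen O ∧ O ⊆ spaceTime M ∧
      closedBall z (2 * r) ⊆ O ∧ HasLipschitzApproximation p m a u G g B O := by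
    intro hz
    obtain ⟨O, h1, h2, h3, h4⟩ := happ z hz
    obtain ⟨ρ, hρ, hb⟩ := nhds_basis_closedBall.mem_iff.1 (h1.mem_nhds h2)
    exact ⟨ρ / 2, by positivity, O, h1, h3, by convert hb using 2; ring, h4⟩
  choose! r hr0 O hO hOS hOr hOa using hr
  obtain ⟨t, htS, hcov⟩ := hχ.2.1.isCompact.elim_nhds_subcover
    (fun z ↦ closedBall z (r z)) (fun z hz ↦ closedBall_mem_nhds z (hr0 z (hχ.2.2 hz)))
  have key : ∀ (t : Finset (M × ℝ)), (∀ z ∈ t, z ∈ spaceTime M) → ∀ χ : M × ℝ → ℝ,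
      IsTestFunction χ → (∀ z, 0 ≤ χ z) → tsupport χ ⊆ ⋃ z ∈ t, closedBall z (r z) →
      ∫ z, testedIntegrand p q m b V u G g χ z ∂μₐₜ ≤ 0 := by
    classical
    clear hcov htS t
    intro t
    induction t using Finset.induction_on with
    | empty =>
      clear hχ hχ0
      intro _ χ _ _ hcov
      have h0 : tsupport χ = ∅ := by simpa using hcov
      have h1 (z : M × ℝ) : testedIntegrand p q m b V u G g χ z = 0 := by
        have hz : z ∉ tsupport χ := by rw [h0]; exact notMem_empty z
        simp [testedIntegrand, spaceDeriv_eq_zero hz, timeDeriv_eq_zero hz,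
          image_eq_zero_of_notMem_tsupport hz]
      simp [h1]
    | insert w t hw ih =>
      clear hχ hχ0
      intro htS χ hχ hχ0 hcov
      have hwS := htS w (Finset.mem_insert_self _ _)
      have hrw := hr0 w hwS
      obtain ⟨η, hη⟩ : ∃ η : M × ℝ → ℝ, η = fun z ↦ max 0 (min 1 (2 - dist z w / r w)) := ⟨_, rfl⟩
      have hη0 (z : M × ℝ) : 0 ≤ η z := by rw [hη]; exact le_max_left _ _
      have hη1 (z : M × ℝ) : η z ≤ 1 := by
        rw [hη]; exact max_le zero_le_one (min_le_left _ _)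
      have hηL : LocallyLipschitz η := by
        have h1 : LipschitzWith ((r w)⁻¹.toNNReal * 1) fun z ↦ dist z w / r w := by
          have : LipschitzWith (r w)⁻¹.toNNReal fun s : ℝ ↦ s / r w := by
            refine LipschitzWith.of_dist_le_mul fun s s' ↦ le_of_eq ?_
            rw [dist_eq, dist_eq, ← sub_div, abs_div, abs_of_pos hrw,
              coe_toNNReal _ (by positivity), div_eq_inv_mul]
          exact this.comp (LipschitzWith.dist_left w)
        have h2 := ((LipschitzWith.const (2 : ℝ)).sub h1).const_min 1
        rw [hη]
        exact (h2.const_max 0).locallyLipschitz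
      have hηin : ∀ z ∈ closedBall w (r w), η z = 1 := by
        intro z hz
        have h1 : dist z w / r w ≤ 1 := (div_le_one hrw).2 hz
        rw [hη]
        simp only
        rw [min_eq_left (by linarith), max_eq_right zero_le_one]
      have hηout : ∀ z ∉ closedBall w (2 * r w), η z = 0 := by
        intro z hz
        have h1 : 2 ≤ dist z w / r w := by
          rw [le_div_iff₀ hrw]; exact (not_le.1 hz).le
        rw [hη]
        simp only
        rw [max_eq_left]
        exact (min_le_right _ _).trans (by linarith)
      have t1 := hχ.mul hηL
      have t2 := hχ.mul (ζ := fun z ↦ 1 - η z) (by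
        have : LocallyLipschitz fun z ↦ 1 - η z :=
          (LocallyLipschitz.const (1 : ℝ)).sub hηL
        exact this)
      have s1 : tsupport (fun z ↦ χ z * η z) ⊆ O w := by
        refine (closure_minimal (fun z hz ↦ ?_) isClosed_closedBall).trans (hOr w hwS)
        by_contra h
        exact hz (by simp only [hηout z h, mul_zero])
      have s2 : tsupport (fun z ↦ χ z * (1 - η z)) ⊆ ⋃ z ∈ t, closedBall z (r z) := by
        refine closure_minimal (fun z hz ↦ ?_)
          (t.finite_toSet.isClosed_biUnion fun z _ ↦ isClosed_closedBall)
        have h1 : z ∈ tsupport χ := subset_tsupport χ fun h ↦ hz (by simp only [h, zero_mul])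
        have h2 := hcov h1
        rw [Finset.set_biUnion_insert] at h2
        refine h2.resolve_left fun h3 ↦ hz ?_
        simp only [hηin z h3, sub_self, mul_zero]
      have a1 := hs.integral_testedIntegrand_nonpos_of_approximation t1
        (fun z ↦ mul_nonneg (hχ0 z) (hη0 z)) hg hga (hO w hwS) (hOS w hwS) s1 (hOa w hwS)
      have a2 := ih (fun z hz ↦ htS z (Finset.mem_insert_of_mem hz)) _ t2
        (fun z ↦ mul_nonneg (hχ0 z) (by linarith [hη1 z])) s2
      have hadd : ∀ᵐ z ∂μₐₜ,
          testedIntegrand p q m b V u G g χ z =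
          testedIntegrand p q m b V u G g (fun z ↦ χ z * η z) z +
            testedIntegrand p q m b V u G g (fun z ↦ χ z * (1 - η z)) z := by
        filter_upwards [(t1.1.locallyLipschitzOn (s := univ)).ae_sliceDifferentiableAt (N := N)
          hs.continuous_weight isOpen_univ, (t2.1.locallyLipschitzOn
            (s := univ)).ae_sliceDifferentiableAt (N := N) hs.continuous_weight isOpen_univ]
          with z h1 h2
        have e : χ = fun z ↦ χ z * η z + χ z * (1 - η z) := by ext z; ring
        have d1 := spaceDeriv_add (h1 (mem_univ _)) (h2 (mem_univ _)) (G z)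
        have d2 := timeDeriv_add (h1 (mem_univ _)) (h2 (mem_univ _))
        rw [← e] at d1 d2
        simp only [testedIntegrand, d1, d2]
        ring
      rw [integral_congr_ae hadd, integral_add (hs.integrable_testedIntegrand t1 hg)
        (hs.integrable_testedIntegrand t2 hg)]
      linarith
  exact key t (fun z hz ↦ hχ.2.2 (htS z hz)) χ hχ hχ0 hcov

end IsWeakSolutionWith
end TestedInequality

section PowerProfile

/-- The function `-g'`, where `g` is `powerProfile`. -/
def powerProfileDensity (ℓ α ε s : ℝ) : ℝ := α * ℓ * |s| ^ (ℓ - 1) * (ε + |s| ^ ℓ) ^ (-α - 1)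

/-- A nonincreasing bounded `C¹` function that equals `(ε + w^ℓ)^(-α)` for `w ≥ 0`. -/
def powerProfile (ℓ α ε w : ℝ) : ℝ := ε ^ (-α) - ∫ s in 0..w, powerProfileDensity ℓ α ε s

variable {ℓ α ε : ℝ}

theorem continuous_powerProfileDensity (hℓ : 1 ≤ ℓ) (hε : 0 < ε) :
    Continuous (powerProfileDensity ℓ α ε) := by
  have h1 : Continuous fun s : ℝ ↦ |s| ^ (ℓ - 1) :=
    continuous_abs.rpow_const fun _ ↦ Or.inr (by linarith)
  have h2 : Continuous fun s : ℝ ↦ |s| ^ ℓ := continuous_abs.rpow_const fun _ ↦ Or.inr (by linarith)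
  have h3 : Continuous fun s : ℝ ↦ (ε + |s| ^ ℓ) ^ (-α - 1) :=
    (continuous_const.add h2).rpow_const fun s ↦ Or.inl
      (add_pos_of_pos_of_nonneg hε (rpow_nonneg (abs_nonneg s) ℓ)).ne'
  exact (h1.const_mul (α * ℓ)).mul h3

theorem powerProfileDensity_nonneg (hℓ : 1 ≤ ℓ) (hα : 0 ≤ α) (hε : 0 < ε) (s : ℝ) :
    0 ≤ powerProfileDensity ℓ α ε s := by
  unfold powerProfileDensity; positivity

theorem hasDerivAt_powerProfile (hℓ : 1 ≤ ℓ) (hε : 0 < ε) (w : ℝ) :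
    HasDerivAt (powerProfile ℓ α ε) (-powerProfileDensity ℓ α ε w) w :=
  (intervalIntegral.integral_hasDerivAt_right
    ((continuous_powerProfileDensity hℓ hε).intervalIntegrable _ _)
    (continuous_powerProfileDensity hℓ hε).stronglyMeasurable.stronglyMeasurableAtFilter
    (continuous_powerProfileDensity hℓ hε).continuousAt).const_sub _

theorem powerProfile_of_nonneg (hℓ : 1 ≤ ℓ) (hε : 0 < ε) {w : ℝ} (hw : 0 ≤ w) :
    powerProfile ℓ α ε w = (ε + w ^ ℓ) ^ (-α) := by
  have hpos (s : ℝ) (hs : 0 ≤ s) : 0 < ε + s ^ ℓ :=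
    add_pos_of_pos_of_nonneg hε (rpow_nonneg hs ℓ)
  have h := intervalIntegral.integral_eq_sub_of_hasDerivAt_of_le (f := fun s ↦ -(ε + s ^ ℓ) ^ (-α))
    (f' := powerProfileDensity ℓ α ε) hw ?_ ?_
    ((continuous_powerProfileDensity hℓ hε).intervalIntegrable _ _)
  · rw [powerProfile, h, zero_rpow (by linarith : ℓ ≠ 0)]
    simp
  · refine ContinuousOn.neg (ContinuousOn.rpow_const (continuousOn_const.add
      (continuousOn_id.rpow_const fun _ _ ↦ Or.inr (by linarith))) fun s hs ↦
        Or.inl (hpos s hs.1).ne')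
  · intro s hs
    have h1 := ((hasDerivAt_rpow_const (x := s) (p := ℓ) (Or.inl hs.1.ne')).const_add
      ε).rpow_const (p := -α) (Or.inl (hpos s hs.1.le).ne')
    convert h1.neg using 1
    all_goals first | rfl | (rw [powerProfileDensity, abs_of_pos hs.1]; ring)

theorem powerProfile_neg (ℓ α ε w : ℝ) :
    powerProfile ℓ α ε (-w) = 2 * ε ^ (-α) - powerProfile ℓ α ε w := by
  have h1 : ∫ s in 0..(-w), powerProfileDensity ℓ α ε s =
      -∫ s in 0..w, powerProfileDensity ℓ α ε s := by
    have h2 := intervalIntegral.integral_comp_neg (a := 0) (b := w) (powerProfileDensity ℓ α ε)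
    have h3 (s : ℝ) : powerProfileDensity ℓ α ε (-s) = powerProfileDensity ℓ α ε s := by
      simp only [powerProfileDensity, abs_neg]
    simp only [h3, neg_zero] at h2
    rw [intervalIntegral.integral_symm, ← h2]
  rw [powerProfile, powerProfile, h1]
  ring

theorem antitone_powerProfile (hℓ : 1 ≤ ℓ) (hα : 0 ≤ α) (hε : 0 < ε) :
    Antitone (powerProfile ℓ α ε) :=
  antitone_of_hasDerivAt_nonpos (fun w ↦ hasDerivAt_powerProfile hℓ hε w)
    fun w ↦ neg_nonpos.2 (powerProfileDensity_nonneg hℓ hα hε w)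

theorem powerProfile_mem_of_nonneg (hℓ : 1 ≤ ℓ) (hα : 0 ≤ α) (hε : 0 < ε) {w : ℝ} (hw : 0 ≤ w) :
    0 ≤ powerProfile ℓ α ε w ∧ powerProfile ℓ α ε w ≤ ε ^ (-α) := by
  rw [powerProfile_of_nonneg hℓ hε hw]
  have h1 := rpow_nonneg hw ℓ
  exact ⟨by positivity, rpow_le_rpow_of_nonpos hε (by linarith) (by linarith)⟩

theorem powerProfile_mem (hℓ : 1 ≤ ℓ) (hα : 0 ≤ α) (hε : 0 < ε) (w : ℝ) :
    0 ≤ powerProfile ℓ α ε w ∧ powerProfile ℓ α ε w ≤ 2 * ε ^ (-α) := by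
  have h0 : 0 < ε ^ (-α) := by positivity
  rcases le_total 0 w with h | h
  · obtain ⟨h1, h2⟩ := powerProfile_mem_of_nonneg hℓ hα hε h
    exact ⟨h1, by linarith⟩
  · obtain ⟨h1, h2⟩ := powerProfile_mem_of_nonneg hℓ hα hε (neg_nonneg.2 h)
    have h3 := powerProfile_neg ℓ α ε (-w)
    rw [neg_neg] at h3
    rw [h3]
    exact ⟨by linarith, by linarith⟩

theorem abs_rpow_sub_one_le {t α : ℝ} (ht : 0 < t) (hα : 0 ≤ α) (hα1 : α ≤ 1) :
    |t ^ α - 1| ≤ |t - 1| := by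
  rcases le_total t 1 with h | h
  · have h1 : t ^ α ≤ 1 := rpow_le_one ht.le h hα
    have h2 : t ≤ t ^ α := by
      nth_rewrite 1 [← rpow_one t]
      exact rpow_le_rpow_of_exponent_ge ht h hα1
    rw [abs_of_nonpos (by linarith), abs_of_nonpos (by linarith)]
    linarith
  · have h1 : 1 ≤ t ^ α := one_le_rpow h hα
    have h2 : t ^ α ≤ t := by
      nth_rewrite 2 [← rpow_one t]
      exact rpow_le_rpow_of_exponent_le h hα1
    rw [abs_of_nonneg (by linarith), abs_of_nonneg (by linarith)]
    linarith

theorem isAdmissible_powerProfile (hℓ : 1 ≤ ℓ) (hα : 0 ≤ α) (hα1 : α ≤ 1) (hε : 0 < ε) :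
    ∃ B B' C, IsAdmissible ℓ B B' C (powerProfile ℓ α ε) := by
  have hd (w : ℝ) : deriv (powerProfile ℓ α ε) w = -powerProfileDensity ℓ α ε w :=
    (hasDerivAt_powerProfile hℓ hε w).deriv
  have hx (a : ℝ) (ha : 0 ≤ a) : a ^ (ℓ - 1) ≤ (1 + ε⁻¹) * (ε + a ^ ℓ) := by
    have h0 := rpow_nonneg ha ℓ
    have h1 : (1 + ε⁻¹) * (ε + a ^ ℓ) = ε + a ^ ℓ + 1 + ε⁻¹ * a ^ ℓ := by
      field_simp; ring
    have h2 : 0 ≤ ε⁻¹ * a ^ ℓ := by positivity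
    rw [h1]
    rcases le_total a 1 with h | h
    · have := rpow_le_one ha h (by linarith : 0 ≤ ℓ - 1)
      linarith
    · have := rpow_le_rpow_of_exponent_le h (by linarith : ℓ - 1 ≤ ℓ)
      linarith
  refine ⟨2 * ε ^ (-α), α * ℓ * ((1 + ε⁻¹) * ε ^ (-α)), (1 + ε⁻¹) * ε ^ (-α), ?_,
    fun s ↦ (powerProfile_mem hℓ hα hε s).1, fun s ↦ (powerProfile_mem hℓ hα hε s).2, fun s ↦ ?_,
    by positivity, fun a b ha hb ↦ ?_⟩
  · rw [contDiff_one_iff_deriv]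
    refine ⟨fun w ↦ (hasDerivAt_powerProfile hℓ hε w).differentiableAt, ?_⟩
    rw [show deriv (powerProfile ℓ α ε) = fun w ↦ -powerProfileDensity ℓ α ε w from funext hd]
    exact (continuous_powerProfileDensity hℓ hε).neg
  · rw [hd, abs_neg, abs_of_nonneg (powerProfileDensity_nonneg hℓ hα hε s), powerProfileDensity]
    have h1 := hx |s| (abs_nonneg s)
    have h2 : 0 < ε + |s| ^ ℓ := by positivity
    have h3 : (ε + |s| ^ ℓ) ^ (-α) ≤ ε ^ (-α) := by
      have := rpow_nonneg (abs_nonneg s) ℓ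
      exact rpow_le_rpow_of_nonpos hε (by linarith) (by linarith)
    have h4 : (ε + |s| ^ ℓ) * (ε + |s| ^ ℓ) ^ (-α - 1) = (ε + |s| ^ ℓ) ^ (-α) := by
      rw [rpow_sub_one h2.ne']; field_simp
    calc α * ℓ * |s| ^ (ℓ - 1) * (ε + |s| ^ ℓ) ^ (-α - 1)
        ≤ α * ℓ * ((1 + ε⁻¹) * (ε + |s| ^ ℓ)) * (ε + |s| ^ ℓ) ^ (-α - 1) := by gcongr
      _ = α * ℓ * ((1 + ε⁻¹) * (ε + |s| ^ ℓ) ^ (-α)) := by rw [← h4]; ring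
      _ ≤ _ := by gcongr
  · rw [powerProfile_of_nonneg hℓ hε ha, powerProfile_of_nonneg hℓ hε hb]
    have hX : 0 < ε + a ^ ℓ := by positivity
    have hY : 0 < ε + b ^ ℓ := by positivity
    have h3 : (ε + b ^ ℓ) ^ (-α) ≤ ε ^ (-α) := by
      have := rpow_nonneg hb ℓ
      exact rpow_le_rpow_of_nonpos hε (by linarith) (by linarith)
    have e : (ε + b ^ ℓ) ^ (-α) - (ε + a ^ ℓ) ^ (-α) =
        -((ε + b ^ ℓ) ^ (-α) * (((ε + b ^ ℓ) / (ε + a ^ ℓ)) ^ α - 1)) := by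
      rw [div_rpow hY.le hX.le, rpow_neg hY.le, rpow_neg hX.le]
      have : (ε + b ^ ℓ) ^ α ≠ 0 := (rpow_pos_of_pos hY α).ne'
      have : (ε + a ^ ℓ) ^ α ≠ 0 := (rpow_pos_of_pos hX α).ne'
      field_simp
      ring
    have h4 := abs_rpow_sub_one_le (div_pos hY hX) hα hα1
    have h5 : |(ε + b ^ ℓ) / (ε + a ^ ℓ) - 1| = |b ^ ℓ - a ^ ℓ| / (ε + a ^ ℓ) := by
      rw [div_sub_one hX.ne', abs_div, abs_of_pos hX]
      congr 2; ring
    rw [h5] at h4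
    rw [e, abs_neg, abs_mul, abs_of_pos (rpow_pos_of_pos hY _)]
    calc a ^ (ℓ - 1) * ((ε + b ^ ℓ) ^ (-α) * |((ε + b ^ ℓ) / (ε + a ^ ℓ)) ^ α - 1|)
        ≤ ((1 + ε⁻¹) * (ε + a ^ ℓ)) * (ε ^ (-α) * (|b ^ ℓ - a ^ ℓ| / (ε + a ^ ℓ))) := by
          have := hx a ha
          gcongr
      _ = _ := by field_simp

/-- The primitive of the profile is controlled by `w ^ (1 - α ℓ)`. -/
theorem integral_powerProfile_le (hℓ : 1 ≤ ℓ) (hα : 0 ≤ α) (hαℓ : α * ℓ ≤ 1 / 2) (hε : 0 < ε)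
    {w : ℝ} (hw : 0 ≤ w) :
    ∫ s in 0..w, powerProfile ℓ α ε s ≤ 2 * w ^ (1 - α * ℓ) := by
  have hcont : Continuous (powerProfile ℓ α ε) :=
    continuous_iff_continuousAt.2 fun w ↦ (hasDerivAt_powerProfile hℓ hε w).continuousAt
  have h1 : ∫ s in 0..w, powerProfile ℓ α ε s ≤ ∫ s in 0..w, s ^ (-(α * ℓ)) := by
    refine intervalIntegral.integral_mono_on_of_le_Ioo hw (hcont.intervalIntegrable _ _)
      (intervalIntegral.intervalIntegrable_rpow' (by linarith)) fun s hs ↦ ?_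
    rw [powerProfile_of_nonneg hℓ hε hs.1.le]
    have h2 : 0 < s ^ ℓ := rpow_pos_of_pos hs.1 ℓ
    refine (rpow_le_rpow_of_nonpos h2 (by linarith) (by linarith)).trans (le_of_eq ?_)
    rw [← rpow_mul hs.1.le]
    congr 1; ring
  rw [integral_rpow (Or.inl (by linarith))] at h1
  refine h1.trans ?_
  rw [zero_rpow (by linarith), sub_zero, div_le_iff₀ (by linarith),
    show -(α * ℓ) + 1 = 1 - α * ℓ by ring]
  have h3 := rpow_nonneg hw (1 - α * ℓ)
  nlinarith

end PowerProfile


theorem mul_rpow_le_add_rpow_mul_rpow {P Q w r s : ℝ} (hP : 0 ≤ P) (hQ : 0 < Q) (hw : 0 ≤ w)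
    (hr : 0 ≤ r) (hrs : r < s) :
    P * w ^ r ≤ Q * w ^ s + P ^ (s / (s - r)) * Q ^ (-(r / (s - r))) := by
  have hD : 0 < s - r := by linarith
  have h0 : 0 ≤ P ^ (s / (s - r)) * Q ^ (-(r / (s - r))) := by positivity
  have h0' : 0 ≤ Q * w ^ s := by positivity
  by_cases h : P * w ^ r ≤ Q * w ^ s
  · linarith
  have h1 : w ^ (s - r) ≤ P / Q := by
    rcases hw.eq_or_lt with hw0 | hw0
    · rw [← hw0, zero_rpow hD.ne']; positivity
    · rw [le_div_iff₀ hQ, rpow_sub hw0, div_mul_eq_mul_div,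
        div_le_iff₀ (rpow_pos_of_pos hw0 r)]
      linarith
  have h2 : w ^ r ≤ (P / Q) ^ (r / (s - r)) := by
    calc w ^ r = (w ^ (s - r)) ^ (r / (s - r)) := by
          rw [← rpow_mul hw, mul_div_cancel₀ _ hD.ne']
      _ ≤ _ := rpow_le_rpow (by positivity) h1 (by positivity)
  have h3 : P * (P / Q) ^ (r / (s - r)) = P ^ (s / (s - r)) * Q ^ (-(r / (s - r))) := by
    rcases hP.eq_or_lt with hP0 | hP0
    · rw [← hP0, zero_mul, zero_rpow (div_pos (hr.trans_lt hrs) hD).ne', zero_mul]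
    · rw [div_rpow hP hQ.le, rpow_neg hQ.le, div_eq_mul_inv, ← mul_assoc]
      congr 1
      nth_rewrite 1 [← rpow_one P]
      rw [← rpow_add hP0]
      congr 1
      field_simp
      ring
  calc P * w ^ r ≤ P * (P / Q) ^ (r / (s - r)) := by gcongr
    _ ≤ _ := by rw [h3]; linarith

theorem mul_cutoff_rpow_le {c φ A V w r s q e n : ℝ} (hc : 0 ≤ c) (hφ : 0 < φ) (hφ1 : φ ≤ 1)
    (hA : 0 ≤ A) (hV : 0 < V) (hw : 0 ≤ w) (hr : 0 ≤ r) (hrs : r < s) (hsq : s ≤ q)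
    (hn : e * s / (s - r) ≤ n) :
    c * φ ^ (n - e) * A * w ^ r ≤ 1 / 4 * (φ ^ n * V * w ^ s) +
      (4 * (1 + c)) ^ (2 * (q / (s - r))) * (A ^ (s / (s - r)) * V ^ (-(r / (s - r)))) := by
  have hD : 0 < s - r := by linarith
  have h := mul_rpow_le_add_rpow_mul_rpow (P := c * φ ^ (n - e) * A) (Q := 1 / 4 * (φ ^ n * V))
    (w := w) (by positivity) (by positivity) hw hr hrs
  refine h.trans (le_of_eq_of_le (by ring : _ = 1 / 4 * (φ ^ n * V * w ^ s) +
    (c * φ ^ (n - e) * A) ^ (s / (s - r)) * (1 / 4 * (φ ^ n * V)) ^ (-(r / (s - r)))) ?_)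
  refine add_le_add le_rfl ?_
  have hsD : s / (s - r) ≤ q / (s - r) := by gcongr
  have hrD : r / (s - r) ≤ q / (s - r) := by gcongr; linarith
  have e1 : (c * φ ^ (n - e) * A) ^ (s / (s - r)) * (1 / 4 * (φ ^ n * V)) ^ (-(r / (s - r))) =
      (c ^ (s / (s - r)) * 4 ^ (r / (s - r))) * φ ^ (n - e * s / (s - r)) *
        (A ^ (s / (s - r)) * V ^ (-(r / (s - r)))) := by
    rw [mul_rpow (by positivity) hA, mul_rpow hc (by positivity),
      mul_rpow (by positivity) (by positivity), mul_rpow (by positivity) hV.le,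
      ← rpow_mul hφ.le, ← rpow_mul hφ.le,
      show (1 / 4 : ℝ) ^ (-(r / (s - r))) = 4 ^ (r / (s - r)) by
        rw [one_div, inv_rpow (by norm_num), ← rpow_neg (by norm_num), neg_neg],
      show n - e * s / (s - r) = (n - e) * (s / (s - r)) + n * -(r / (s - r)) by
        field_simp; ring, rpow_add hφ]
    ring
  rw [e1]
  have h1 : φ ^ (n - e * s / (s - r)) ≤ 1 := rpow_le_one hφ.le hφ1 (by linarith)
  have h2 : c ^ (s / (s - r)) ≤ (4 * (1 + c)) ^ (q / (s - r)) :=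
    (rpow_le_rpow hc (show c ≤ 4 * (1 + c) by linarith) (div_nonneg (by linarith)
      hD.le)).trans (rpow_le_rpow_of_exponent_le (by linarith) hsD)
  have h3 : (4 : ℝ) ^ (r / (s - r)) ≤ (4 * (1 + c)) ^ (q / (s - r)) :=
    (rpow_le_rpow_of_exponent_le (by norm_num) hrD).trans (rpow_le_rpow (by norm_num)
      (by linarith) (div_nonneg (by linarith) hD.le))
  have h4 : (4 * (1 + c)) ^ (2 * (q / (s - r))) =
      (4 * (1 + c)) ^ (q / (s - r)) * (4 * (1 + c)) ^ (q / (s - r)) := by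
    rw [← rpow_add (by positivity)]; congr 1; ring
  rw [h4]
  refine mul_le_mul_of_nonneg_right ?_ (by positivity)
  calc _ ≤ c ^ (s / (s - r)) * 4 ^ (r / (s - r)) * 1 := by gcongr
    _ ≤ _ := by rw [mul_one]; gcongr

/-- Absorption of the term with the gradient of the cutoff into the dissipation. -/
theorem flux_mul_le {p m θ ℓ ε K φ U X A b σ : ℝ} {n : ℕ} (hp : 1 < p) (hm : 1 ≤ m)
    (hℓ : ℓ = (p + m - 1) / p) (hθ : 0 < θ) (hε : 0 < ε) (hφ : 0 ≤ φ) (hU : 0 ≤ U) (hX : 0 ≤ X)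
    (hA : 0 ≤ A) (hb : 0 ≤ b) (hbK : b ≤ K) (hn : p < n) (hσ : |σ| ≤ A * X) :
    (ε + U ^ ℓ) ^ (-(θ / ℓ)) * (n * φ ^ (n - 1) * σ * (U ^ (m - 1) * X ^ (p - 2) * b)) ≤
      φ ^ n * powerProfileDensity ℓ (θ / ℓ) ε U * (X ^ 2 * (U ^ (m - 1) * X ^ (p - 2) * b)) +
      K * n ^ p * θ ^ (1 - p) * φ ^ (n - p) * A ^ p *
        (U ^ (ℓ - 1) * (ε + U ^ ℓ) ^ (p - 1 - θ / ℓ)) := by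
  have hℓ1 : ℓ - 1 = (m - 1) / p := by rw [hℓ]; field_simp; ring
  have hℓ0 : 1 ≤ ℓ := by have : 0 ≤ (m - 1) / p := div_nonneg (by linarith) (by linarith)
                         linarith
  have hn1 : 1 < n := by exact_mod_cast hp.trans hn
  have hK : 0 ≤ K := hb.trans hbK
  have hβ : 0 < ε + U ^ ℓ := by positivity
  have hdens := powerProfileDensity_nonneg hℓ0 (div_nonneg hθ.le (by linarith)) hε U (α := θ / ℓ)
  have hR : 0 ≤ φ ^ n * powerProfileDensity ℓ (θ / ℓ) ε U *
      (X ^ 2 * (U ^ (m - 1) * X ^ (p - 2) * b)) + K * n ^ p * θ ^ (1 - p) * φ ^ (n - p) * A ^ p *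
        (U ^ (ℓ - 1) * (ε + U ^ ℓ) ^ (p - 1 - θ / ℓ)) := by positivity
  rcases hφ.eq_or_lt with h0 | hφ'
  · rw [← h0] at hR ⊢
    rw [zero_pow (by omega : n - 1 ≠ 0)]
    simpa using hR
  rcases hX.eq_or_lt with h0 | hX'
  · have : σ = 0 := by rw [← h0, mul_zero] at hσ; exact abs_nonpos_iff.1 hσ
    rw [this, mul_zero, zero_mul, mul_zero]; exact hR
  by_cases hUm : U ^ (m - 1) = 0
  · rw [hUm, zero_mul, zero_mul, mul_zero, mul_zero]; simpa [hUm] using hR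
  have hUe : U ^ (m - 1) * (U ^ (ℓ - 1)) ^ (1 - p) = U ^ (ℓ - 1) ∧ 0 < U ^ (ℓ - 1) := by
    rcases hU.eq_or_lt with h0 | hU'
    · have : m = 1 := by
        by_contra h
        exact hUm (by rw [← h0, zero_rpow (sub_ne_zero.2 h)])
      have : ℓ - 1 = 0 := by rw [hℓ1, this]; simp
      rw [this, ‹m = 1›]; simp
    · refine ⟨?_, rpow_pos_of_pos hU' _⟩
      rw [← rpow_mul hU, ← rpow_add hU', hℓ1]
      congr 1; field_simp; ring
  obtain ⟨c, hc⟩ : ∃ c, c = φ ^ (n - 1) * (ε + U ^ ℓ) ^ (-(θ / ℓ)) * U ^ (m - 1) * b := ⟨_, rfl⟩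
  obtain ⟨s, hs⟩ : ∃ s, s = φ * θ * U ^ (ℓ - 1) / (ε + U ^ ℓ) := ⟨_, rfl⟩
  have hc0 : 0 ≤ c := by rw [hc]; positivity
  have hs0 : 0 < s := by rw [hs]; have := hUe.2; positivity
  have hXp : X * X ^ (p - 2) = X ^ (p - 1) := by
    nth_rewrite 1 [← rpow_one X]; rw [← rpow_add hX']; congr 1; ring
  have hXp2 : X ^ 2 * X ^ (p - 2) = X ^ p := by
    rw [← rpow_natCast, ← rpow_add hX']; congr 1; push_cast; ring
  have hY := mul_rpow_le_add (mul_nonneg (Nat.cast_nonneg (α := ℝ) n) hA) hX hs0 hp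
  have hφn : φ ^ (n - 1) * φ = φ ^ n := pow_sub_one_mul (by omega) φ
  calc (ε + U ^ ℓ) ^ (-(θ / ℓ)) * (n * φ ^ (n - 1) * σ * (U ^ (m - 1) * X ^ (p - 2) * b))
      ≤ (ε + U ^ ℓ) ^ (-(θ / ℓ)) * (n * φ ^ (n - 1) * (A * X) *
          (U ^ (m - 1) * X ^ (p - 2) * b)) := by
        gcongr; exact (le_abs_self σ).trans hσ
    _ = c * (n * A * X ^ (p - 1)) := by rw [hc, ← hXp]; ring
    _ ≤ c * (s ^ (1 - p) * (n * A) ^ p + s * X ^ p) := by gcongr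
    _ = c * s * X ^ p + c * s ^ (1 - p) * (n * A) ^ p := by ring
    _ ≤ _ := ?_
  refine add_le_add (le_of_eq ?_) ?_
  · rw [powerProfileDensity, abs_of_nonneg hU, rpow_sub_one hβ.ne', hc, hs, ← hXp2, ← hφn,
      div_mul_cancel₀ _ (by linarith : ℓ ≠ 0)]
    ring
  · have e1 : c * s ^ (1 - p) * (n * A) ^ p = b * n ^ p * θ ^ (1 - p) * φ ^ (n - p) * A ^ p *
        (U ^ (ℓ - 1) * (ε + U ^ ℓ) ^ (p - 1 - θ / ℓ)) := by
      rw [hc, hs, mul_rpow (Nat.cast_nonneg n) hA, div_rpow (by positivity) hβ.le,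
        mul_rpow (by positivity) hUe.2.le, mul_rpow hφ hθ.le,
        show p - 1 - θ / ℓ = -(θ / ℓ) - (1 - p) by ring,
        rpow_sub hβ (-(θ / ℓ)) (1 - p),
        show (n : ℝ) - p = ((n - 1 : ℕ) : ℝ) + (1 - p) by
          rw [Nat.cast_sub hn1.le]; push_cast; ring, rpow_add hφ', rpow_natCast]
      nth_rewrite 2 [← hUe.1]
      ring
    rw [e1]
    gcongr


section EnergyEstimate
theorem lintegral_le_of_ae_tendsto {X : Type*} [MeasurableSpace X] {ν : Measure X}
    {F : ℕ → X → ℝ≥0∞} {F₀ : X → ℝ≥0∞} {c : ℕ → ℝ≥0∞} {c₀ : ℝ≥0∞}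
    (hF : ∀ j, AEMeasurable (F j) ν) (hlim : ∀ᵐ z ∂ν, Tendsto (fun j ↦ F j z) atTop (𝓝 (F₀ z)))
    (hle : ∀ j, ∫⁻ z, F j z ∂ν ≤ c j) (hc : Tendsto c atTop (𝓝 c₀)) : ∫⁻ z, F₀ z ∂ν ≤ c₀ :=
  calc ∫⁻ z, F₀ z ∂ν = ∫⁻ z, liminf (fun j ↦ F j z) atTop ∂ν :=
        lintegral_congr_ae (hlim.mono fun _ h ↦ h.liminf_eq.symm)
    _ ≤ liminf (fun j ↦ ∫⁻ z, F j z ∂ν) atTop := lintegral_liminf_le' hF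
    _ ≤ liminf c atTop := liminf_le_liminf (Eventually.of_forall hle)
    _ = c₀ := hc.liminf_eq

theorem IsTestFunction.pow {φ : M × ℝ → ℝ} (hφ : IsTestFunction φ) {n : ℕ} (hn : n ≠ 0) :
    IsTestFunction fun z ↦ φ z ^ n :=
  ⟨((contDiff_id (𝕜 := ℝ) (E := ℝ)).pow n).locallyLipschitz.comp hφ.1,
    hφ.2.1.comp_left (g := fun s ↦ s ^ n) (zero_pow hn),
    (tsupport_comp_subset (g := fun s : ℝ ↦ s ^ n) (zero_pow hn) φ).trans hφ.2.2⟩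

variable (N) in
/-- A cutoff function together with bounds of its derivatives. -/
structure IsCutoff (L : ℝ) (φ A B : M × ℝ → ℝ) : Prop where
  isTestFunction : IsTestFunction φ
  nonneg : ∀ z, 0 ≤ φ z
  le_one : ∀ z, φ z ≤ 1
  spaceBound_nonneg : ∀ z, 0 ≤ A z
  spaceBound_le : ∀ z, A z ≤ L
  timeBound_nonneg : ∀ z, 0 ≤ B z
  timeBound_le : ∀ z, B z ≤ L
  abs_spaceDeriv_le : ∀ (z) (X : TangentSpace (𝓡 N) z.1), |spaceDeriv N φ z X| ≤ A z * ‖X‖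
  neg_timeDeriv_le : ∀ z, -timeDeriv φ z ≤ B z

variable {p q m K θ L : ℝ} {b : ℝ → ℝ} {V u φ A B : M × ℝ → ℝ} {n : ℕ}
  {G : (z : M × ℝ) → TangentSpace (𝓡 N) z.1} {D : M × ℝ → ℝ} [ProperSpace M]
  [IsLocallyFiniteMeasure ((weightedMeasure N a).prod (volume : Measure ℝ))]

namespace IsWeakSolutionWith

theorem integrable_of_abs_le (hs : IsWeakSolutionWith N p q m K a b V u G D) {T : Set (M × ℝ)}
    (hT : IsCompact T) (hTS : T ⊆ spaceTime M) {F : M × ℝ → ℝ}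
    (hFm : AEStronglyMeasurable F ((μₐₜ).restrict (spaceTime M)))
    {c : ℝ} (hF : ∀ z ∈ T, 0 ≤ u z → |F z| ≤ c * (1 + u z ^ (p + m - 1)))
    (h0 : ∀ z ∉ T, F z = 0) : Integrable F μₐₜ := by
  have h1 : IntegrableOn F T μₐₜ := by
    have hloc : LocallyIntegrableOn (fun z ↦ 1 + u z ^ (p + m - 1)) (spaceTime M)
        μₐₜ :=
      ((locallyIntegrable_const (1 : ℝ)).locallyIntegrableOn _).add hs.power
    refine ((hloc.integrableOn_compact_subset hTS hT).const_mul c).mono'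
      (hFm.mono_measure (Measure.restrict_mono hTS le_rfl)) ?_
    filter_upwards [ae_restrict_mem hT.measurableSet, ae_restrict_of_ae hs.nonneg] with z hz hu
    exact hF z hz (hu (hTS hz))
  refine (integrableOn_iff_integrable_of_support_subset fun z hz ↦ ?_).1 h1
  by_contra h
  exact hz (h0 z h)

/-- The right-hand side of the energy estimate, where `F` is a function of `u`. -/
def _root_.energyMajorant (p K θ : ℝ) (n : ℕ) (u φ A B : M × ℝ → ℝ) (F : ℝ → ℝ) (z : M × ℝ) : ℝ :=
  K * n ^ p * φ z ^ (n - p) * (θ ^ (1 - p) * A z ^ p) * F (u z) +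
    2 * n * φ z ^ (n - 1 : ℝ) * B z * u z ^ (1 - θ)

theorem _root_.energyMajorant_eq_zero {z : M × ℝ} (hp : 1 < p) (hn : p < n) (hz : φ z = 0)
    (F : ℝ → ℝ) : energyMajorant p K θ n u φ A B F z = 0 := by
  have h1 : (n : ℝ) - p ≠ 0 := by linarith
  have h2 : (n : ℝ) - 1 ≠ 0 := by linarith
  simp [energyMajorant, hz, zero_rpow h1, zero_rpow h2]

theorem energyMajorant_mono (hs : IsWeakSolutionWith N p q m K a b V u G D)
    (hφ : IsCutoff N L φ A B) (hθ : 0 < θ) (hn : p < n) {F F' : ℝ → ℝ}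
    (h : ∀ U, 0 ≤ U → 0 ≤ F U ∧ F U ≤ F' U) {z : M × ℝ} (hz : z ∈ spaceTime M → 0 ≤ u z) :
    0 ≤ energyMajorant p K θ n u φ A B F z ∧
      energyMajorant p K θ n u φ A B F z ≤ energyMajorant p K θ n u φ A B F' z := by
  by_cases h0 : φ z = 0
  · rw [energyMajorant_eq_zero hs.one_lt hn h0, energyMajorant_eq_zero hs.one_lt hn h0]; simp
  · have hzS : z ∈ spaceTime M := hφ.isTestFunction.2.2 (subset_tsupport _ h0)
    have hu := hz hzS
    have := hφ.nonneg z
    have := hφ.spaceBound_nonneg z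
    have := hφ.timeBound_nonneg z
    have := hs.bound_nonneg
    have := (h _ hu).1
    unfold energyMajorant
    refine ⟨by positivity, ?_⟩
    gcongr
    exact (h _ hu).2

theorem integrable_energyMajorant (hs : IsWeakSolutionWith N p q m K a b V u G D)
    (hφ : IsCutoff N L φ A B) (hA : Measurable A) (hB : Measurable B) (hθ : 0 < θ)
    (hθ1 : θ ≤ 1 / 2) (hn : p < n) {F : ℝ → ℝ} (hFm : Measurable F) {c : ℝ}
    (h : ∀ U, 0 ≤ U → 0 ≤ F U ∧ F U ≤ c * (1 + U ^ (p + m - 1))) :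
    Integrable (energyMajorant p K θ n u φ A B F) μₐₜ := by
  have hp := hs.one_lt
  have hm := hs.one_le
  have hK := hs.bound_nonneg
  have hφm : Measurable φ := hφ.isTestFunction.1.continuous.measurable
  have hum := hs.aestronglyMeasurable_u.aemeasurable
  refine hs.integrable_of_abs_le hφ.isTestFunction.2.1.isCompact hφ.isTestFunction.2.2
    (AEMeasurable.aestronglyMeasurable ?_)
    (c := K * n ^ p * 1 * (θ ^ (1 - p) * L ^ p) * c + 2 * n * 1 * L * 1) (fun z hz hu ↦ ?_)
    fun z hz ↦ energyMajorant_eq_zero hp hn (image_eq_zero_of_notMem_tsupport hz) F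
  · exact ((((hφm.pow_const _).const_mul _).mul
      ((hA.pow_const p).const_mul _)).aemeasurable.mul (hFm.comp_aemeasurable hum)).add
      ((((hφm.pow_const _).const_mul _).mul hB).aemeasurable.mul (hum.pow_const _))
  · obtain ⟨h1, h2⟩ := h _ hu
    have i1 := hφ.nonneg z
    have i2 := hφ.spaceBound_nonneg z
    have i3 := hφ.timeBound_nonneg z
    have i4 := hφ.spaceBound_le z
    have i5 := hφ.timeBound_le z
    have i6 : 0 ≤ u z ^ (p + m - 1) := by positivity
    have hn1 : (1 : ℝ) < n := hp.trans hn
    have j1 : φ z ^ (n - p) ≤ 1 := rpow_le_one i1 (hφ.le_one z) (by linarith)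
    have j2 : φ z ^ (n - 1 : ℝ) ≤ 1 := rpow_le_one i1 (hφ.le_one z) (by linarith)
    have j3 : A z ^ p ≤ L ^ p := rpow_le_rpow i2 i4 (by linarith)
    have j4 : u z ^ (1 - θ) ≤ 1 * (1 + u z ^ (p + m - 1)) := by
      rw [one_mul]
      rcases le_total (u z) 1 with h | h
      · exact (rpow_le_one hu h (by linarith)).trans (by linarith)
      · exact (rpow_le_rpow_of_exponent_le h
          (show 1 - θ ≤ p + m - 1 by linarith)).trans (by linarith)
    have hL : 0 ≤ L := i2.trans i4
    have hn0 : (0 : ℝ) ≤ n := by linarith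
    unfold energyMajorant
    rw [abs_of_nonneg (by positivity), add_mul, mul_assoc _ c, mul_assoc _ (1 : ℝ) (1 + _)]
    gcongr

theorem lintegral_reaction_powerProfile_le (hs : IsWeakSolutionWith N p q m K a b V u G D)
    (hV : ∀ᵐ z ∂μₐₜ, z ∈ spaceTime M → 0 < V z)
    (happ : ∀ g B B' C, IsAdmissible ((p + m - 1) / p) B B' C g → ∀ z ∈ spaceTime M,
      ∃ O, IsOpen O ∧ z ∈ O ∧ O ⊆ spaceTime M ∧ HasLipschitzApproximation p m a u G g B O)
    (hφ : IsCutoff N L φ A B) (hθ : 0 < θ) (hθ1 : θ ≤ 1 / 2) (hn : p < n) {ℓ ε : ℝ}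
    (hℓ : ℓ = (p + m - 1) / p) (hε : 0 < ε)
    (hHi : Integrable (energyMajorant p K θ n u φ A B
      fun U ↦ U ^ (ℓ - 1) * (ε + U ^ ℓ) ^ (p - 1 - θ / ℓ)) μₐₜ) :
    AEMeasurable (fun z ↦ ofReal
        ((u z ^ q * V z) * (φ z ^ n * powerProfile ℓ (θ / ℓ) ε (u z))))
        μₐₜ ∧
      ∫⁻ z, ofReal ((u z ^ q * V z) * (φ z ^ n * powerProfile ℓ (θ / ℓ) ε (u z)))
        ∂μₐₜ ≤
      ∫⁻ z, ofReal (energyMajorant p K θ n u φ A B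
        (fun U ↦ U ^ (ℓ - 1) * (ε + U ^ ℓ) ^ (p - 1 - θ / ℓ)) z)
        ∂μₐₜ := by
  have hp := hs.one_lt
  have hm := hs.one_le
  have hK := hs.bound_nonneg
  have hℓ0 : 1 ≤ ℓ := by rw [hℓ, le_div_iff₀ (by linarith)]; linarith
  have hα : 0 ≤ θ / ℓ := div_nonneg hθ.le (by linarith)
  have hαℓ : θ / ℓ * ℓ = θ := div_mul_cancel₀ _ (by linarith)
  have hα1 : θ / ℓ ≤ 1 := by rw [div_le_one (by linarith)]; linarith
  have hn1 : 1 < n := by exact_mod_cast hp.trans hn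
  obtain ⟨C₁, C₂, C₃, hg⟩ := isAdmissible_powerProfile hℓ0 hα hα1 hε
  have hχ := hφ.isTestFunction.pow (n := n) (by omega)
  have hχ0 (z : M × ℝ) : 0 ≤ φ z ^ n := pow_nonneg (hφ.nonneg z) n
  have hT := hs.integral_testedIntegrand_nonpos hχ hχ0 hg (antitone_powerProfile hℓ0 hα hε)
    (happ _ _ C₂ C₃ (by rw [← hℓ]; exact hg))
  have hTi := hs.integrable_testedIntegrand hχ hg
  have hFi := hs.integrable_reaction_mul hχ
    (hg.contDiff.continuous.comp_aestronglyMeasurable hs.aestronglyMeasurable_u)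
    (fun z ↦ hg.abs_le (u z))
  refine ⟨hFi.aemeasurable.ennreal_ofReal, ?_⟩
  have hF0 : ∀ᵐ z ∂μₐₜ,
      0 ≤ (u z ^ q * V z) * (φ z ^ n * powerProfile ℓ (θ / ℓ) ε (u z)) := by
    filter_upwards [hs.nonneg, hV] with z h1 h2
    by_cases hz : φ z = 0
    · rw [hz, zero_pow (by omega)]; simp
    · have hzS : z ∈ spaceTime M := hφ.isTestFunction.2.2 (subset_tsupport _ hz)
      have := h1 hzS
      have := h2 hzS
      exact mul_nonneg (by positivity) (mul_nonneg (hχ0 z) (hg.nonneg _))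
  have hH0 : ∀ᵐ z ∂μₐₜ,
      0 ≤ energyMajorant p K θ n u φ A B
        (fun U ↦ U ^ (ℓ - 1) * (ε + U ^ ℓ) ^ (p - 1 - θ / ℓ)) z := by
    filter_upwards [hs.nonneg] with z h1
    exact (hs.energyMajorant_mono hφ hθ hn
      (fun U hU ↦ ⟨by positivity, le_rfl⟩) h1).1
  rw [← ofReal_integral_eq_lintegral_ofReal hFi hF0, ← ofReal_integral_eq_lintegral_ofReal hHi hH0]
  refine ofReal_le_ofReal ?_
  have hle := integral_mono_ae hFi (hTi.add hHi) (f := fun z ↦ (u z ^ q * V z) *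
    (φ z ^ n * powerProfile ℓ (θ / ℓ) ε (u z))) ?_
  · have h1 := integral_add hTi hHi
    simp only [Pi.add_apply] at hle
    linarith
  filter_upwards [hs.nonneg, (hφ.isTestFunction.1.locallyLipschitzOn
    (s := univ)).ae_sliceDifferentiableAt (N := N) hs.continuous_weight isOpen_univ] with z h1 h2
  by_cases hz : z ∈ tsupport φ
  swap
  · have hz0 := image_eq_zero_of_notMem_tsupport hz
    have hz' : z ∉ tsupport fun z ↦ φ z ^ n := fun h ↦ hz
      (tsupport_comp_subset (g := fun s : ℝ ↦ s ^ n) (zero_pow (by omega)) φ h)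
    simp [testedIntegrand, energyMajorant_eq_zero hp hn hz0, hz0, zero_pow (by omega : n ≠ 0),
      spaceDeriv_eq_zero hz', timeDeriv_eq_zero hz']
  have hU := h1 (hφ.isTestFunction.2.2 hz)
  have hd := h2 (mem_univ z)
  have d1 : spaceDeriv N (fun z ↦ φ z ^ n) z (G z) = n * φ z ^ (n - 1) * spaceDeriv N φ z (G z) := by
    have := spaceDeriv_comp hd (differentiableAt_pow (𝕜 := ℝ) n (x := φ z)) (G z)
    refine this.trans ?_
    simp
  have d2 : _root_.timeDeriv (fun z ↦ φ z ^ n) z = n * φ z ^ (n - 1) * _root_.timeDeriv φ z :=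
    (hd.2.hasDerivAt.pow n).deriv
  have k1 := flux_mul_le (n := n) (b := b ‖G z‖) (σ := spaceDeriv N φ z (G z)) hp hm hℓ hθ hε
    (hφ.nonneg z) hU (norm_nonneg (G z)) (hφ.spaceBound_nonneg z) (hs.b_nonneg _ (norm_nonneg _))
    (hs.b_le _ (norm_nonneg _)) hn (hφ.abs_spaceDeriv_le z (G z))
  have k2 := integral_powerProfile_le hℓ0 hα (by rw [hαℓ]; exact hθ1) hε hU
  have k3 : 0 ≤ ∫ s in 0..u z, powerProfile ℓ (θ / ℓ) ε s :=
    intervalIntegral.integral_nonneg hU fun s _ ↦ hg.nonneg s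
  have k4 : -(2 * n * φ z ^ (n - 1) * B z * u z ^ (1 - θ)) ≤
      (∫ s in 0..u z, powerProfile ℓ (θ / ℓ) ε s) * (n * φ z ^ (n - 1) * _root_.timeDeriv φ z) := by
    have := hφ.nonneg z
    have := hφ.timeBound_nonneg z
    have := hφ.neg_timeDeriv_le z
    rw [hαℓ] at k2
    calc -(2 * n * φ z ^ (n - 1) * B z * u z ^ (1 - θ))
        = -((2 * u z ^ (1 - θ)) * (n * φ z ^ (n - 1) * B z)) := by ring
      _ ≤ -((∫ s in 0..u z, powerProfile ℓ (θ / ℓ) ε s) * (n * φ z ^ (n - 1) * B z)) := by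
        gcongr
      _ = (∫ s in 0..u z, powerProfile ℓ (θ / ℓ) ε s) * (n * φ z ^ (n - 1) * -B z) := by ring
      _ ≤ _ := by gcongr; linarith
  have k5 : φ z ^ (n - 1 : ℝ) = φ z ^ (n - 1) := by
    rw [← rpow_natCast, Nat.cast_sub hn1.le, Nat.cast_one]
  simp only [Pi.add_apply, testedIntegrand, energyMajorant, d1, d2, fluxFactor, k5,
    (hasDerivAt_powerProfile hℓ0 hε (u z)).deriv]
  rw [powerProfile_of_nonneg hℓ0 hε hU]
  nlinarith [k1, k4]

end IsWeakSolutionWith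
end EnergyEstimate

section EnergyEstimate
variable {p q m K θ L : ℝ} {b : ℝ → ℝ} {V u φ A B : M × ℝ → ℝ} {n : ℕ}
  {G : (z : M × ℝ) → TangentSpace (𝓡 N) z.1} {D : M × ℝ → ℝ} [ProperSpace M]
  [IsLocallyFiniteMeasure ((weightedMeasure N a).prod (volume : Measure ℝ))]

namespace IsWeakSolutionWith

/-- The energy estimate. -/
theorem lintegral_reaction_le_energyMajorant (hs : IsWeakSolutionWith N p q m K a b V u G D)
    (hV : ∀ᵐ z ∂μₐₜ, z ∈ spaceTime M → 0 < V z)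
    (happ : ∀ g B B' C, IsAdmissible ((p + m - 1) / p) B B' C g → ∀ z ∈ spaceTime M,
      ∃ O, IsOpen O ∧ z ∈ O ∧ O ⊆ spaceTime M ∧ HasLipschitzApproximation p m a u G g B O)
    (hφ : IsCutoff N L φ A B) (hA : Measurable A) (hB : Measurable B) (hθ : 0 < θ)
    (hθ1 : θ ≤ 1 / 2) (hθp : θ < p - 1) (hq : 1 < q) (hn : p < n) :
    ∫⁻ z, ofReal (φ z ^ (n : ℝ) * V z * u z ^ (q - θ))
        ∂μₐₜ ≤
      ∫⁻ z, ofReal (energyMajorant p K θ n u φ A B (fun U ↦ U ^ (p + m - 2 - θ)) z)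
        ∂μₐₜ ∧
    ∫⁻ z, ofReal (energyMajorant p K θ n u φ A B (fun U ↦ U ^ (p + m - 2 - θ)) z)
        ∂μₐₜ ≠ ⊤ := by
  have hp := hs.one_lt
  have hm := hs.one_le
  obtain ⟨ℓ, hℓ⟩ : ∃ ℓ, ℓ = (p + m - 1) / p := ⟨_, rfl⟩
  have hℓp : ℓ * p = p + m - 1 := by rw [hℓ]; field_simp
  have hℓ0 : 1 ≤ ℓ := by rw [hℓ, le_div_iff₀ (by linarith)]; linarith
  have hα : θ / ℓ ≤ θ := div_le_self hθ.le hℓ0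
  have hα0 : 0 < θ / ℓ := by positivity
  have hαℓ : θ / ℓ * ℓ = θ := div_mul_cancel₀ _ (by linarith)
  obtain ⟨F₁, hF₁⟩ : ∃ F₁ : ℝ → ℝ, F₁ = fun U ↦ 2 ^ p * (1 + U ^ (p + m - 1)) := ⟨_, rfl⟩
  obtain ⟨F, hF⟩ : ∃ F : ℕ → ℝ → ℝ, F = fun (j : ℕ) (U : ℝ) ↦
    U ^ (ℓ - 1) * (1 / ((j : ℝ) + 1) + U ^ ℓ) ^ (p - 1 - θ / ℓ) := ⟨_, rfl⟩
  have hFle (j : ℕ) (U : ℝ) (hU : 0 ≤ U) : 0 ≤ F j U ∧ F j U ≤ F₁ U := by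
    have hj : (1 : ℝ) / (j + 1) ≤ 1 := by
      rw [div_le_one (by positivity)]; linarith [Nat.cast_nonneg (α := ℝ) j]
    have hj0 : (0 : ℝ) < 1 / (j + 1) := by positivity
    have hUℓ : 0 ≤ U ^ ℓ := by positivity
    rw [hF, hF₁]
    refine ⟨by positivity, ?_⟩
    have h1 : U ^ (ℓ - 1) ≤ 1 + U ^ ℓ := by
      rcases le_total U 1 with h | h
      · exact (rpow_le_one hU h (by linarith)).trans (by linarith)
      · exact (rpow_le_rpow_of_exponent_le h (show ℓ - 1 ≤ ℓ by linarith)).trans (by linarith)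
    have h2 : (1 + U ^ ℓ) ^ p ≤ 2 ^ p * (1 + U ^ (p + m - 1)) := by
      have h3 : 1 + U ^ ℓ ≤ 2 * max 1 (U ^ ℓ) := by
        linarith [le_max_left 1 (U ^ ℓ), le_max_right 1 (U ^ ℓ)]
      refine (rpow_le_rpow (by positivity) h3 (by linarith)).trans ?_
      rw [mul_rpow (by norm_num) (by positivity)]
      gcongr
      have h4 : 0 ≤ U ^ (p + m - 1) := by positivity
      rcases max_choice 1 (U ^ ℓ) with h | h <;> rw [h]
      · rw [one_rpow]; linarith
      · rw [← rpow_mul hU, hℓp]; linarith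
    refine le_trans ?_ h2
    calc U ^ (ℓ - 1) * (1 / ((j : ℝ) + 1) + U ^ ℓ) ^ (p - 1 - θ / ℓ)
        ≤ (1 + U ^ ℓ) * (1 + U ^ ℓ) ^ (p - 1 - θ / ℓ) := by
          gcongr; linarith
      _ = (1 + U ^ ℓ) ^ (1 + (p - 1 - θ / ℓ)) := by
          rw [rpow_add (by positivity), rpow_one]
      _ ≤ _ := rpow_le_rpow_of_exponent_le (by linarith) (by linarith)
  have hFm (j : ℕ) : Measurable (F j) := by
    rw [hF]
    exact (measurable_id.pow_const _).mul (((measurable_id.pow_const ℓ).const_add _).pow_const _)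
  have hF₁m : Measurable F₁ := by
    rw [hF₁]
    exact ((measurable_id.pow_const _).const_add 1).const_mul _
  have hcj : Tendsto (fun j : ℕ ↦ (1 : ℝ) / (j + 1)) atTop (𝓝 0) :=
    tendsto_one_div_add_atTop_nhds_zero_nat
  have hFlim (U : ℝ) (hU : 0 ≤ U) : Tendsto (fun j ↦ F j U) atTop (𝓝 (U ^ (p + m - 2 - θ))) := by
    have h1 : Tendsto (fun j : ℕ ↦ U ^ (ℓ - 1) * (1 / ((j : ℝ) + 1) + U ^ ℓ) ^ (p - 1 - θ / ℓ))
        atTop (𝓝 (U ^ (ℓ - 1) * (0 + U ^ ℓ) ^ (p - 1 - θ / ℓ))) :=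
      ((hcj.add_const _).rpow_const (Or.inr (by linarith))).const_mul _
    have h2 : U ^ (ℓ - 1) * (0 + U ^ ℓ) ^ (p - 1 - θ / ℓ) = U ^ (p + m - 2 - θ) := by
      rw [zero_add]
      rcases hU.eq_or_lt with h | h
      · rw [← h, zero_rpow (by linarith : ℓ ≠ 0),
          zero_rpow (by linarith : p - 1 - θ / ℓ ≠ 0), mul_zero,
          zero_rpow (by linarith : p + m - 2 - θ ≠ 0)]
      · rw [← rpow_mul hU, ← rpow_add h]
        congr 1
        linear_combination hℓp - hαℓ
    rw [hF, ← h2]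
    exact h1
  have hHi (j : ℕ) : Integrable (energyMajorant p K θ n u φ A B (F j))
      μₐₜ :=
    hs.integrable_energyMajorant hφ hA hB hθ hθ1 hn (hFm j) (hF₁ ▸ hFle j)
  have hH₁i : Integrable (energyMajorant p K θ n u φ A B F₁)
      μₐₜ :=
    hs.integrable_energyMajorant hφ hA hB hθ hθ1 hn hF₁m (c := 2 ^ p) fun U hU ↦
      ⟨(hFle 0 U hU).1.trans (hFle 0 U hU).2, by rw [hF₁]⟩
  have hHlim : ∀ᵐ z ∂μₐₜ,
      Tendsto (fun j ↦ ofReal (energyMajorant p K θ n u φ A B (F j) z)) atTop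
        (𝓝 (ofReal (energyMajorant p K θ n u φ A B (fun U ↦ U ^ (p + m - 2 - θ)) z))) := by
    filter_upwards [hs.nonneg] with z hz
    refine ENNReal.tendsto_ofReal ?_
    by_cases h0 : φ z = 0
    · simp only [energyMajorant_eq_zero hp hn h0]
      exact tendsto_const_nhds
    · exact ((hFlim _ (hz (hφ.isTestFunction.2.2 (subset_tsupport _ h0)))).const_mul _).add_const _
  have hc := tendsto_lintegral_of_dominated_convergence'
    (fun z ↦ ofReal (energyMajorant p K θ n u φ A B F₁ z))
    (fun j ↦ (hHi j).aemeasurable.ennreal_ofReal) (fun j ↦ ?_) ?_ hHlim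
  · constructor
    · refine lintegral_le_of_ae_tendsto (F := fun j z ↦ ofReal
        ((u z ^ q * V z) * (φ z ^ n * powerProfile ℓ (θ / ℓ) (1 / ((j : ℝ) + 1)) (u z))))
        (fun j ↦ ?_) ?_ (fun j ↦ ?_) hc
      · exact (hs.lintegral_reaction_powerProfile_le hV happ hφ hθ hθ1 hn hℓ
          (by positivity) (by have := hHi j; rw [hF] at this; exact this)).1
      · filter_upwards [hs.nonneg] with z hz
        refine ENNReal.tendsto_ofReal ?_
        by_cases h0 : φ z = 0
        · have : (n : ℝ) ≠ 0 := by linarith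
          rw [h0, zero_pow (by exact_mod_cast this), zero_rpow this]
          simp
        have hU := hz (hφ.isTestFunction.2.2 (subset_tsupport _ h0))
        have e (j : ℕ) := powerProfile_of_nonneg hℓ0 (ε := 1 / ((j : ℝ) + 1)) (α := θ / ℓ)
          (by positivity) hU
        simp only [e, rpow_natCast]
        rcases hU.eq_or_lt with h | h
        · rw [← h, zero_rpow (by linarith : q ≠ 0), zero_rpow (by linarith : q - θ ≠ 0)]
          simp
        have hUℓ : 0 < u z ^ ℓ := by positivity
        have h1 : Tendsto (fun j : ℕ ↦ (u z ^ q * V z) * (φ z ^ n *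
            (1 / ((j : ℝ) + 1) + u z ^ ℓ) ^ (-(θ / ℓ)))) atTop
            (𝓝 ((u z ^ q * V z) * (φ z ^ n * (0 + u z ^ ℓ) ^ (-(θ / ℓ))))) :=
          (((hcj.add_const _).rpow_const (Or.inl (by linarith))).const_mul _).const_mul _
        convert h1 using 2
        rw [zero_add, ← rpow_mul hU, show ℓ * -(θ / ℓ) = -θ by linear_combination -hαℓ,
          sub_eq_add_neg, rpow_add h]
        ring
      · have := (hs.lintegral_reaction_powerProfile_le hV happ hφ hθ hθ1 hn hℓ
          (ε := 1 / ((j : ℝ) + 1)) (by positivity)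
          (by have := hHi j; rw [hF] at this; exact this)).2
        rw [hF]; exact this
    · refine ne_top_of_le_ne_top (hH₁i.lintegral_lt_top).ne (lintegral_mono_ae ?_)
      filter_upwards [hs.nonneg] with z hz
      exact ofReal_le_ofReal (hs.energyMajorant_mono hφ hθ hn
        (fun U hU ↦ ⟨by positivity, le_of_tendsto (hFlim U hU) (Eventually.of_forall
          fun j ↦ (hFle j U hU).2)⟩) hz).2
  · filter_upwards [hs.nonneg] with z hz
    exact ofReal_le_ofReal (hs.energyMajorant_mono hφ hθ hn (hFle j) hz).2
  · exact (hH₁i.lintegral_lt_top).ne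

theorem aemeasurable_reaction (hs : IsWeakSolutionWith N p q m K a b V u G D)
    (hVm : AEMeasurable V ((μₐₜ).restrict (spaceTime M)))
    (hφ : IsTestFunction φ) (hn : 0 < n) (r : ℝ) :
    AEMeasurable (fun z ↦ ofReal (φ z ^ (n : ℝ) * V z * u z ^ r))
      μₐₜ := by
  have e : (fun z ↦ ofReal (φ z ^ (n : ℝ) * V z * u z ^ r)) = (spaceTime M).indicator
      fun z ↦ ofReal (φ z ^ (n : ℝ) * V z * u z ^ r) := by
    refine (indicator_eq_self.2 fun z hz ↦ ?_).symm
    by_contra h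
    refine hz ?_
    simp only [image_eq_zero_of_notMem_tsupport fun h' ↦ h (hφ.2.2 h'),
      zero_rpow (by positivity : (n : ℝ) ≠ 0), zero_mul, ENNReal.ofReal_zero]
  rw [e]
  exact (aemeasurable_indicator_iff (isOpen_spaceTime M).measurableSet).2
    (((hφ.1.continuous.measurable.pow_const _).aemeasurable.mul hVm).mul
      (hs.aestronglyMeasurable_u.aemeasurable.pow_const _)).ennreal_ofReal

/-- The energy estimate after absorption of the powers of `u`. -/
theorem lintegral_reaction_le (hs : IsWeakSolutionWith N p q m K a b V u G D)
    (hV : ∀ᵐ z ∂μₐₜ, z ∈ spaceTime M → 0 < V z)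
    (hVm : AEMeasurable V ((μₐₜ).restrict (spaceTime M)))
    (happ : ∀ g B B' C, IsAdmissible ((p + m - 1) / p) B B' C g → ∀ z ∈ spaceTime M,
      ∃ O, IsOpen O ∧ z ∈ O ∧ O ⊆ spaceTime M ∧ HasLipschitzApproximation p m a u G g B O)
    (hφ : IsCutoff N L φ A B) (hA : Measurable A) (hB : Measurable B) (hθ : 0 < θ)
    (hθ1 : θ ≤ 1 / 2) (hθp : θ < p - 1) (hq : 1 < q) (hD : 0 < q - p - m + 2) (hn : p < n)
    (hn1 : p * q / (q - p - m + 2) ≤ n) (hn2 : q / (q - 1) ≤ n) {c₁ c₂ : ℝ}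
    (hc₁ : c₁ = (4 * (1 + K * n ^ p)) ^ (2 * (q / (q - p - m + 2))))
    (hc₂ : c₂ = (4 * (1 + 2 * n)) ^ (2 * (q / (q - 1)))) :
    ∫⁻ z, ofReal (φ z ^ (n : ℝ) * V z * u z ^ (q - θ))
        ∂μₐₜ ≤
      2 * ∫⁻ z in {z | φ z ≠ 0}, (ofReal (c₁ * ((θ ^ (1 - p) * A z ^ p) ^
          ((q - θ) / (q - p - m + 2)) * V z ^ (-((p + m - 2 - θ) / (q - p - m + 2))))) +
        ofReal (c₂ * (B z ^ ((q - θ) / (q - 1)) * V z ^ (-((1 - θ) / (q - 1))))))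
        ∂μₐₜ := by
  have hp := hs.one_lt
  have hm := hs.one_le
  have hK := hs.bound_nonneg
  obtain ⟨h1, h2⟩ := hs.lintegral_reaction_le_energyMajorant hV happ hφ hA hB hθ hθ1 hθp hq hn
  have hφm : Measurable φ := hφ.isTestFunction.1.continuous.measurable
  have hφs : MeasurableSet {z | φ z ≠ 0} := (measurableSet_eq_fun hφm measurable_const).compl
  obtain ⟨R, hR⟩ : ∃ R : M × ℝ → ℝ≥0∞, R = {z | φ z ≠ 0}.indicator fun z ↦
    (ofReal (c₁ * ((θ ^ (1 - p) * A z ^ p) ^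
          ((q - θ) / (q - p - m + 2)) * V z ^ (-((p + m - 2 - θ) / (q - p - m + 2))))) +
        ofReal (c₂ * (B z ^ ((q - θ) / (q - 1)) * V z ^ (-((1 - θ) / (q - 1)))))) :=
    ⟨_, rfl⟩
  rw [← lintegral_indicator hφs, ← hR]
  have hpt : ∀ᵐ z ∂μₐₜ,
      ofReal (energyMajorant p K θ n u φ A B (fun U ↦ U ^ (p + m - 2 - θ)) z) ≤
        2⁻¹ * ofReal (φ z ^ (n : ℝ) * V z * u z ^ (q - θ)) + R z := by
    filter_upwards [hs.nonneg, hV] with z hz hVz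
    by_cases h0 : φ z = 0
    · rw [energyMajorant_eq_zero hp hn h0]; simp
    have hzS : z ∈ spaceTime M := hφ.isTestFunction.2.2 (subset_tsupport _ h0)
    have hφ0 : 0 < φ z := (hφ.nonneg z).lt_of_ne' h0
    have hU := hz hzS
    have hVp := hVz hzS
    have hn0 : (0 : ℝ) ≤ n := Nat.cast_nonneg n
    have hAz : 0 ≤ θ ^ (1 - p) * A z ^ p :=
      mul_nonneg (by positivity) (rpow_nonneg (hφ.spaceBound_nonneg z) p)
    have hBz := hφ.timeBound_nonneg z
    have e1 : q - θ - (p + m - 2 - θ) = q - p - m + 2 := by ring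
    have e2 : q - θ - (1 - θ) = q - 1 := by ring
    have k1 := mul_cutoff_rpow_le (c := K * n ^ p) (e := p) (n := n) (A := θ ^ (1 - p) * A z ^ p)
      (r := p + m - 2 - θ) (s := q - θ) (q := q) (by positivity)
      hφ0 (hφ.le_one z) hAz hVp hU (by linarith) (by linarith) (by linarith) (by
        rw [e1]; refine le_trans ?_ hn1; gcongr; linarith)
    have k2 := mul_cutoff_rpow_le (c := 2 * n) (e := 1) (n := n) (A := B z)
      (r := 1 - θ) (s := q - θ) (q := q) (by positivity)
      hφ0 (hφ.le_one z) hBz hVp hU (by linarith) (by linarith) (by linarith) (by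
        rw [e2, one_mul]; refine le_trans ?_ hn2; gcongr; linarith)
    rw [e1, ← hc₁] at k1
    rw [e2, ← hc₂] at k2
    rw [hR, indicator_of_mem (show z ∈ {z | φ z ≠ 0} from h0)]
    have hc₁0 : 0 ≤ c₁ := by rw [hc₁]; positivity
    have hc₂0 : 0 ≤ c₂ := by rw [hc₂]; positivity
    rw [← ofReal_add (by positivity) (by positivity),
      show (2 : ℝ≥0∞)⁻¹ = ofReal (1 / 2) by
        rw [one_div, ENNReal.ofReal_inv_of_pos (by norm_num)]; simp,
      ← ofReal_mul (by norm_num), ← ofReal_add (by positivity) (by positivity)]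
    refine ofReal_le_ofReal ?_
    unfold energyMajorant
    linarith
  have hm' := hs.aemeasurable_reaction hVm hφ.isTestFunction (show 0 < n by
    exact_mod_cast (by linarith : (0 : ℝ) < n)) (q - θ)
  have h3 := h1.trans (lintegral_mono_ae hpt)
  rw [lintegral_add_left' (hm'.const_mul _), lintegral_const_mul'' _ hm'] at h3
  have h4 := ne_top_of_le_ne_top h2 h1
  have h5 := mul_le_mul_right h3 2
  rw [mul_add, ← mul_assoc, ENNReal.mul_inv_cancel (by norm_num) (by norm_num), one_mul,
    two_mul (∫⁻ z, ofReal (φ z ^ (n : ℝ) * V z * u z ^ (q - θ))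
        ∂μₐₜ)] at h5
  exact (ENNReal.add_le_add_iff_left h4).1 h5

end IsWeakSolutionWith
end EnergyEstimate

section Clamp

theorem abs_log_max_sub_le {a b c : ℝ} (hc : 0 < c) (ha : c ≤ max 1 a) (hb : c ≤ max 1 b) :
    |log (max 1 a) - log (max 1 b)| ≤ |a - b| / c := by
  have key (x y : ℝ) (hy : c ≤ max 1 y) :
      log (max 1 x) - log (max 1 y) ≤ |x - y| / c := by
    have hx0 : 0 < max 1 x := lt_max_of_lt_left one_pos
    have hy0 : 0 < max 1 y := lt_max_of_lt_left one_pos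
    rw [← log_div hx0.ne' hy0.ne']
    refine (log_le_sub_one_of_pos (by positivity)).trans ?_
    rw [div_sub_one hy0.ne']
    have h1 : max 1 x - max 1 y ≤ |x - y| := by
      have := abs_max_sub_max_le_abs x y 1
      rw [max_comm x, max_comm y] at this
      exact (le_abs_self _).trans this
    exact (div_le_div_of_nonneg_right h1 hy0.le).trans (by gcongr)
  rw [abs_le']
  refine ⟨key a b hb, ?_⟩
  rw [neg_sub, abs_sub_comm]
  exact key b a ha

theorem lipschitzWith_log_max : LipschitzWith 1 fun s : ℝ ↦ log (max 1 s) :=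
  LipschitzWith.of_dist_le_mul fun a b ↦ by
    simpa [dist_eq] using
      abs_log_max_sub_le one_pos (le_max_left 1 a) (le_max_left 1 b)

/-- The projection to the interval `[L, 2 * L]`. -/
def dyadicClamp (L s : ℝ) : ℝ := max L (min s (2 * L))

variable {L α β : ℝ}

theorem lipschitzWith_dyadicClamp (L : ℝ) : LipschitzWith 1 (dyadicClamp L) :=
  (LipschitzWith.id.min_const (2 * L)).const_max L

theorem le_dyadicClamp (L s : ℝ) : L ≤ dyadicClamp L s := le_max_left _ _

theorem dyadicClamp_le (hL : 0 ≤ L) (s : ℝ) : dyadicClamp L s ≤ 2 * L :=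
  max_le (by linarith) (min_le_right _ _)

theorem dyadicClamp_of_le (hα : α ≤ L) : dyadicClamp L α = L :=
  max_eq_left ((min_le_left _ _).trans hα)

theorem dyadicClamp_of_ge (hL : 0 ≤ L) (hα : 2 * L ≤ α) : dyadicClamp L α = 2 * L := by
  rw [dyadicClamp, min_eq_right hα, max_eq_right (by linarith)]

theorem abs_max_dyadicClamp_sub_le (L α α' β : ℝ) :
    |max (dyadicClamp L α') (dyadicClamp L β) - max (dyadicClamp L α) (dyadicClamp L β)| ≤
      |α' - α| := by
  have h := (lipschitzWith_dyadicClamp L).dist_le_mul α' α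
  rw [dist_eq, dist_eq] at h
  exact (abs_max_sub_max_le_abs _ _ _).trans (by simpa using h)

theorem eventually_max_dyadicClamp_eq (hL : 0 ≤ L) (h : α < L ∨ 2 * L < α ∨ α < β) :
    ∀ᶠ α' in 𝓝 α, max (dyadicClamp L α') (dyadicClamp L β) =
      max (dyadicClamp L α) (dyadicClamp L β) := by
  rcases h with h | h | h
  · filter_upwards [eventually_lt_nhds h] with α' h'
    rw [dyadicClamp_of_le h.le, dyadicClamp_of_le h'.le]
  · filter_upwards [eventually_gt_nhds h] with α' h'
    rw [dyadicClamp_of_ge hL h.le, dyadicClamp_of_ge hL (le_of_lt h')]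
  · have key (γ : ℝ) (hγ : γ ≤ β) : max (dyadicClamp L γ) (dyadicClamp L β) = dyadicClamp L β :=
      max_eq_right (max_le_max_left _ (min_le_min_right _ hγ))
    filter_upwards [eventually_lt_nhds h] with α' h'
    rw [key α h.le, key α' h'.le]

theorem neg_deriv_le_of_eventually {f : ℝ → ℝ} {t B : ℝ} (hB : 0 ≤ B)
    (h : ∀ᶠ s in 𝓝[>] t, -(B * (s - t)) ≤ f s - f t) : -deriv f t ≤ B := by
  by_cases hd : DifferentiableAt ℝ f t
  · have h1 := (hasDerivAt_iff_tendsto_slope.1 hd.hasDerivAt).mono_left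
      (nhdsWithin_mono t (s := Ioi t) fun s hs ↦ ne_of_gt hs)
    have h2 : ∀ᶠ s in 𝓝[>] t, -B ≤ slope f t s := by
      filter_upwards [h, self_mem_nhdsWithin] with s hs hst
      have : 0 < s - t := sub_pos.2 hst
      rw [slope_def_field, le_div_iff₀ this]
      linarith
    linarith [ge_of_tendsto h1 h2]
  · rw [deriv_zero_of_not_differentiableAt hd]; linarith

end Clamp

section LogCutoff
/-- The factor of the logarithmic cutoff that vanishes for small times. -/
def initialCutoff (L t : ℝ) : ℝ := max 0 (min 1 (L * t - 1))

/-- The larger one of the clamped logarithms of distance and time. -/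
def logScale (x₀ : M) (κ L : ℝ) (z : M × ℝ) : ℝ :=
  max (dyadicClamp L (log (max 1 (dist z.1 x₀))))
    (dyadicClamp L (log (max 1 z.2) / κ))

/-- The logarithmic cutoff: it decreases from `1` to `0` where the distance grows from `e^L` to
`e^(2 * L)` or the time grows from `e^(κL)` to `e^(2 * κ * L)`. -/
def logCutoff (x₀ : M) (κ L : ℝ) (z : M × ℝ) : ℝ :=
  (2 - logScale x₀ κ L z / L) * initialCutoff L z.2

/-- The region where the logarithmic cutoff depends on the distance. -/
def spaceShell (x₀ : M) (κ L : ℝ) : Set (M × ℝ) :=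
  {z | exp L ≤ dist z.1 x₀ ∧ dist z.1 x₀ ≤ exp (2 * L) ∧ z.2 ≤ dist z.1 x₀ ^ κ}

/-- The region where the logarithmic cutoff decreases in time. -/
def timeShell (x₀ : M) (κ L : ℝ) : Set (M × ℝ) :=
  {z | exp (κ * L) ≤ z.2 ∧ z.2 ≤ exp (κ * (2 * L)) ∧ dist z.1 x₀ ≤ z.2 ^ (1 / κ)}

/-- A bound of the gradient of the logarithmic cutoff. -/
def logCutoffSpaceBound (x₀ : M) (κ L : ℝ) : M × ℝ → ℝ :=
  (spaceShell x₀ κ L).indicator fun z ↦ 2 / (L * dist z.1 x₀)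

/-- A bound of the decay in time of the logarithmic cutoff. -/
def logCutoffTimeBound (x₀ : M) (κ L : ℝ) : M × ℝ → ℝ :=
  (timeShell x₀ κ L).indicator fun z ↦ 2 / (L * (κ * z.2))

variable {x₀ : M} {κ L : ℝ} {z : M × ℝ}

theorem measurableSet_spaceShell :
    MeasurableSet (spaceShell x₀ κ L) := by
  have h1 : Measurable fun z : M × ℝ ↦ dist z.1 x₀ := (continuous_fst.dist continuous_const).measurable
  exact (measurableSet_le measurable_const h1).inter ((measurableSet_le h1 measurable_const).inter
    (measurableSet_le measurable_snd (h1.pow_const κ)))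

theorem measurableSet_timeShell :
    MeasurableSet (timeShell x₀ κ L) := by
  have h1 : Measurable fun z : M × ℝ ↦ dist z.1 x₀ := (continuous_fst.dist continuous_const).measurable
  exact (measurableSet_le measurable_const measurable_snd).inter
    ((measurableSet_le measurable_snd measurable_const).inter
    (measurableSet_le h1 (measurable_snd.pow_const _)))

theorem measurable_logCutoffSpaceBound : Measurable (logCutoffSpaceBound x₀ κ L) :=
  Measurable.indicator (measurable_const.div ((continuous_fst.dist
    continuous_const).measurable.const_mul L)) measurableSet_spaceShell

theorem measurable_logCutoffTimeBound : Measurable (logCutoffTimeBound x₀ κ L) :=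
  Measurable.indicator (measurable_const.div ((measurable_snd.const_mul κ).const_mul L))
    measurableSet_timeShell

theorem logScale_mem (hL : 0 ≤ L) : L ≤ logScale x₀ κ L z ∧ logScale x₀ κ L z ≤ 2 * L :=
  ⟨(le_dyadicClamp _ _).trans (le_max_left _ _),
    max_le (dyadicClamp_le hL _) (dyadicClamp_le hL _)⟩

theorem initialCutoff_mem (L t : ℝ) : 0 ≤ initialCutoff L t ∧ initialCutoff L t ≤ 1 :=
  ⟨le_max_left _ _, max_le zero_le_one (min_le_left _ _)⟩

theorem two_sub_logScale_mem (hL : 0 < L) :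
    0 ≤ 2 - logScale x₀ κ L z / L ∧ 2 - logScale x₀ κ L z / L ≤ 1 := by
  obtain ⟨h1, h2⟩ := logScale_mem (x₀ := x₀) (κ := κ) (z := z) hL.le
  have h3 : 1 ≤ logScale x₀ κ L z / L := by rwa [le_div_iff₀ hL, one_mul]
  have h4 : logScale x₀ κ L z / L ≤ 2 := by rwa [div_le_iff₀ hL]
  exact ⟨by linarith, by linarith⟩

theorem logCutoff_mem (hL : 0 < L) : 0 ≤ logCutoff x₀ κ L z ∧ logCutoff x₀ κ L z ≤ 1 := by
  obtain ⟨h1, h2⟩ := two_sub_logScale_mem (x₀ := x₀) (κ := κ) (z := z) hL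
  obtain ⟨h3, h4⟩ := initialCutoff_mem L z.2
  exact ⟨mul_nonneg h1 h3, mul_le_one₀ h2 h3 h4⟩

theorem mem_of_logCutoff_ne_zero (hL : 0 < L) (hκ : 0 < κ) (h : logCutoff x₀ κ L z ≠ 0) :
    dist z.1 x₀ < exp (2 * L) ∧ 1 / L < z.2 ∧ z.2 < exp (κ * (2 * L)) := by
  have h1 : logScale x₀ κ L z < 2 * L := by
    refine (logScale_mem hL.le).2.lt_of_ne fun h' ↦ h ?_
    rw [logCutoff, h', mul_div_cancel_right₀ _ hL.ne', sub_self, zero_mul]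
  have key (s : ℝ) (hs : dyadicClamp L s < 2 * L) : s < 2 * L := by
    by_contra h'
    rw [dyadicClamp_of_ge hL.le (not_lt.1 h')] at hs
    exact lt_irrefl _ hs
  have key2 (s c : ℝ) (hs : log (max 1 s) < c) : s < exp c := by
    rw [log_lt_iff_lt_exp (lt_max_of_lt_left one_pos)] at hs
    exact (le_max_right _ _).trans_lt hs
  refine ⟨key2 _ _ (key _ ((le_max_left _ _).trans_lt h1)), ?_, key2 _ _ ?_⟩
  · by_contra h'
    refine h ?_
    have : L * z.2 - 1 ≤ 0 := by
      have h2 := mul_le_mul_of_nonneg_left (not_lt.1 h') hL.le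
      rw [mul_one_div_cancel hL.ne'] at h2
      linarith
    rw [logCutoff, initialCutoff, max_eq_left ((min_le_right _ _).trans this), mul_zero]
  · have := key _ ((le_max_right _ _).trans_lt h1)
    rw [div_lt_iff₀ hκ] at this
    linarith

theorem logCutoff_eq_one (hL : 0 < L) (h1 : log (max 1 (dist z.1 x₀)) ≤ L)
    (h2 : log (max 1 z.2) / κ ≤ L) (h3 : 2 ≤ L * z.2) : logCutoff x₀ κ L z = 1 := by
  rw [logCutoff, logScale, dyadicClamp_of_le h1, dyadicClamp_of_le h2, max_self, div_self hL.ne',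
    initialCutoff, min_eq_left (by linarith), max_eq_right zero_le_one]
  norm_num

theorem isTestFunction_logCutoff [ProperSpace M] (hL : 0 < L) (hκ : 0 < κ) :
    IsTestFunction (logCutoff x₀ κ L) := by
  have hsub : tsupport (logCutoff x₀ κ L) ⊆
      closedBall x₀ (exp (2 * L)) ×ˢ Icc (1 / L) (exp (κ * (2 * L))) := by
    refine closure_minimal (fun z hz ↦ ?_) (isClosed_closedBall.prod isClosed_Icc)
    obtain ⟨h1, h2, h3⟩ := mem_of_logCutoff_ne_zero hL hκ hz
    exact ⟨h1.le, h2.le, h3.le⟩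
  refine ⟨?_, ((isCompact_closedBall x₀ _).prod isCompact_Icc).of_isClosed_subset
    (isClosed_tsupport _) hsub, fun z hz ↦ ⟨mem_univ _, ?_⟩⟩
  · have l1 : LocallyLipschitz fun z : M × ℝ ↦
        dyadicClamp L (log (max 1 (dist z.1 x₀))) :=
      ((lipschitzWith_dyadicClamp L).comp (lipschitzWith_log_max.comp
        ((LipschitzWith.dist_left x₀).comp LipschitzWith.prod_fst))).locallyLipschitz
    have l2 : LocallyLipschitz fun z : M × ℝ ↦ dyadicClamp L (log (max 1 z.2) / κ) := by
      have : LipschitzWith (κ⁻¹).toNNReal fun s : ℝ ↦ s / κ :=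
        LipschitzWith.of_dist_le_mul fun s t ↦ by
          rw [dist_eq, dist_eq, ← sub_div, abs_div, abs_of_pos hκ,
            coe_toNNReal _ (by positivity), div_eq_inv_mul]
      exact ((lipschitzWith_dyadicClamp L).comp (this.comp (lipschitzWith_log_max.comp
        LipschitzWith.prod_snd))).locallyLipschitz
    have l3 : LocallyLipschitz fun z : M × ℝ ↦ initialCutoff L z.2 := by
      have : ContDiff ℝ 1 fun t : ℝ ↦ L * t - 1 := by fun_prop
      exact (((this.locallyLipschitz.const_min 1).const_max 0).comp
        LipschitzWith.prod_snd.locallyLipschitz)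
    have l4 : LocallyLipschitz fun z : M × ℝ ↦ 2 - logScale x₀ κ L z / L := by
      have : ContDiff ℝ 1 fun s : ℝ ↦ 2 - s / L := by fun_prop
      exact this.locallyLipschitz.comp (l1.max l2)
    exact l4.mul_real l3
  · exact (show (0 : ℝ) < 1 / L by positivity).trans_le (hsub hz).2.1

theorem abs_spaceDeriv_logCutoff_le (hL : 1 ≤ L) (hκ : 0 < κ) (z : M × ℝ)
    (X : TangentSpace (𝓡 N) z.1) :
    |spaceDeriv N (logCutoff x₀ κ L) z X| ≤ logCutoffSpaceBound x₀ κ L z * ‖X‖ := by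
  have hL0 : 0 < L := by linarith
  have hr : Tendsto (fun y ↦ log (max 1 (dist y x₀))) (𝓝 z.1)
      (𝓝 (log (max 1 (dist z.1 x₀)))) :=
    (lipschitzWith_log_max.continuous.comp (continuous_id.dist continuous_const)).tendsto z.1
  have e (y : M) : |logCutoff x₀ κ L (y, z.2) - logCutoff x₀ κ L (z.1, z.2)| ≤
      |logScale x₀ κ L (y, z.2) - logScale x₀ κ L z| / L := by
    obtain ⟨i1, i2⟩ := initialCutoff_mem L z.2
    have : logCutoff x₀ κ L (y, z.2) - logCutoff x₀ κ L (z.1, z.2) =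
        -((logScale x₀ κ L (y, z.2) - logScale x₀ κ L z) / L * initialCutoff L z.2) := by
      simp only [logCutoff]; ring
    rw [this, abs_neg, abs_mul, abs_div, abs_of_pos hL0, abs_of_nonneg i1]
    exact mul_le_of_le_one_right (by positivity) i2
  by_cases hz : z ∈ spaceShell x₀ κ L
  · obtain ⟨z1, z2, z3⟩ := hz
    have hr0 : 0 < dist z.1 x₀ := (exp_pos L).trans_le z1
    rw [logCutoffSpaceBound, indicator_of_mem (show z ∈ spaceShell x₀ κ L from ⟨z1, z2, z3⟩)]
    refine abs_mfderiv_le_of_eventually_le (by positivity) ?_ X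
    have h1 : ∀ᶠ y in 𝓝 z.1, dist z.1 x₀ / 2 < dist y x₀ :=
      (continuous_id.dist continuous_const).continuousAt.eventually_const_lt (half_lt_self hr0)
    filter_upwards [h1] with y hy
    have h2 := abs_max_dyadicClamp_sub_le L (log (max 1 (dist z.1 x₀)))
      (log (max 1 (dist y x₀))) (log (max 1 z.2) / κ)
    have h3 := abs_log_max_sub_le (a := dist y x₀) (b := dist z.1 x₀)
      (show 0 < dist z.1 x₀ / 2 by positivity)
      (hy.le.trans (le_max_right _ _)) (le_trans (by linarith) (le_max_right 1 _))
    have h4 : |dist y x₀ - dist z.1 x₀| ≤ dist y z.1 := abs_dist_sub_le _ _ _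
    calc _ ≤ |logScale x₀ κ L (y, z.2) - logScale x₀ κ L z| / L := e y
      _ ≤ (dist y z.1 / (dist z.1 x₀ / 2)) / L := by
        gcongr
        exact (h2.trans h3).trans (by gcongr)
      _ = _ := by field_simp
  · rw [logCutoffSpaceBound, indicator_of_notMem hz]
    refine abs_mfderiv_le_of_eventually_le le_rfl ?_ X
    have hcase : log (max 1 (dist z.1 x₀)) < L ∨ 2 * L < log (max 1 (dist z.1 x₀)) ∨
        log (max 1 (dist z.1 x₀)) < log (max 1 z.2) / κ := by
      by_contra! h
      obtain ⟨h1, h2, h3⟩ := h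
      have hm0 : 0 < max 1 (dist z.1 x₀) := lt_max_of_lt_left one_pos
      rw [le_log_iff_exp_le hm0] at h1
      rw [log_le_iff_le_exp hm0] at h2
      have h4 : max 1 (dist z.1 x₀) = dist z.1 x₀ := by
        refine max_eq_right ?_
        by_contra h'
        rw [max_eq_left (not_le.1 h').le] at h1
        linarith [add_one_le_exp L]
      rw [h4] at h1 h2 h3 hm0
      refine hz ⟨h1, h2, ?_⟩
      rw [div_le_iff₀ hκ, mul_comm, ← log_rpow hm0, log_le_log_iff
        (lt_max_of_lt_left one_pos) (by positivity)] at h3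
      exact (le_max_right _ _).trans h3
    filter_upwards [hr.eventually (eventually_max_dyadicClamp_eq hL0.le hcase)] with y hy
    refine (e y).trans ?_
    rw [show logScale x₀ κ L (y, z.2) = logScale x₀ κ L z from hy]
    simp

theorem neg_timeDeriv_logCutoff_le (hL : 1 ≤ L) (hκ : 0 < κ) (z : M × ℝ) :
    -timeDeriv (logCutoff x₀ κ L) z ≤ logCutoffTimeBound x₀ κ L z := by
  have hL0 : 0 < L := by linarith
  have hr : Tendsto (fun s ↦ log (max 1 s) / κ) (𝓝 z.2)
      (𝓝 (log (max 1 z.2) / κ)) :=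
    (lipschitzWith_log_max.continuous.div_const κ).tendsto z.2
  have e (s : ℝ) (hs : z.2 < s) : -(|logScale x₀ κ L (z.1, s) - logScale x₀ κ L z| / L) ≤
      logCutoff x₀ κ L (z.1, s) - logCutoff x₀ κ L (z.1, z.2) := by
    obtain ⟨i1, i2⟩ := initialCutoff_mem L z.2
    have i3 : initialCutoff L z.2 ≤ initialCutoff L s :=
      max_le_max_left _ (min_le_min_left _ (by gcongr))
    have i4 := (two_sub_logScale_mem (x₀ := x₀) (κ := κ) (z := (z.1, s)) hL0).1
    have : logCutoff x₀ κ L (z.1, s) - logCutoff x₀ κ L (z.1, z.2) =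
        (2 - logScale x₀ κ L (z.1, s) / L) * (initialCutoff L s - initialCutoff L z.2) -
        (logScale x₀ κ L (z.1, s) - logScale x₀ κ L z) / L * initialCutoff L z.2 := by
      simp only [logCutoff]; ring
    rw [this]
    have h1 : 0 ≤ (2 - logScale x₀ κ L (z.1, s) / L) * (initialCutoff L s - initialCutoff L z.2) :=
      mul_nonneg i4 (by linarith)
    have h2 : (logScale x₀ κ L (z.1, s) - logScale x₀ κ L z) / L * initialCutoff L z.2 ≤
        |logScale x₀ κ L (z.1, s) - logScale x₀ κ L z| / L := by
      calc _ ≤ |logScale x₀ κ L (z.1, s) - logScale x₀ κ L z| / L * initialCutoff L z.2 := by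
            gcongr; exact le_abs_self _
        _ ≤ _ := mul_le_of_le_one_right (by positivity) i2
    linarith
  have hcomm (s : ℝ) : logScale x₀ κ L (z.1, s) = max (dyadicClamp L (log (max 1 s) / κ))
      (dyadicClamp L (log (max 1 (dist z.1 x₀)))) := max_comm _ _
  by_cases hz : z ∈ timeShell x₀ κ L
  · obtain ⟨z1, z2, z3⟩ := hz
    have ht0 : 0 < z.2 := (exp_pos _).trans_le z1
    rw [logCutoffTimeBound, indicator_of_mem (show z ∈ timeShell x₀ κ L from ⟨z1, z2, z3⟩)]
    refine neg_deriv_le_of_eventually (by positivity) ?_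
    filter_upwards [self_mem_nhdsWithin] with s hs
    have hs' : z.2 < s := hs
    have h2 := abs_max_dyadicClamp_sub_le L (log (max 1 z.2) / κ) (log (max 1 s) / κ)
      (log (max 1 (dist z.1 x₀)))
    have h3 := abs_log_max_sub_le (a := s) (b := z.2) (show 0 < z.2 / 2 by positivity)
      (le_trans (by linarith) (le_max_right 1 _)) (le_trans (by linarith) (le_max_right 1 _))
    rw [abs_of_pos (sub_pos.2 hs')] at h3
    refine le_trans ?_ (e s hs')
    rw [neg_le_neg_iff]
    calc |logScale x₀ κ L (z.1, s) - logScale x₀ κ L z| / L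
        ≤ (((s - z.2) / (z.2 / 2)) / κ) / L := by
          rw [show logScale x₀ κ L z = logScale x₀ κ L (z.1, z.2) from rfl, hcomm, hcomm]
          refine div_le_div_of_nonneg_right (h2.trans ?_) hL0.le
          rw [← sub_div, abs_div, abs_of_pos hκ]
          exact div_le_div_of_nonneg_right h3 hκ.le
      _ = _ := by field_simp
  · rw [logCutoffTimeBound, indicator_of_notMem hz]
    refine neg_deriv_le_of_eventually le_rfl ?_
    have hcase : log (max 1 z.2) / κ < L ∨ 2 * L < log (max 1 z.2) / κ ∨
        log (max 1 z.2) / κ < log (max 1 (dist z.1 x₀)) := by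
      by_contra! h
      obtain ⟨h1, h2, h3⟩ := h
      have hm0 : 0 < max 1 z.2 := lt_max_of_lt_left one_pos
      rw [le_div_iff₀ hκ, le_log_iff_exp_le hm0, mul_comm] at h1
      rw [div_le_iff₀ hκ, log_le_iff_le_exp hm0, mul_comm] at h2
      have h4 : max 1 z.2 = z.2 := by
        refine max_eq_right ?_
        by_contra h'
        rw [max_eq_left (not_le.1 h').le] at h1
        have := add_one_le_exp (κ * L)
        have : 0 < κ * L := by positivity
        linarith
      rw [h4] at h1 h2 h3 hm0
      refine hz ⟨h1, h2, ?_⟩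
      rw [div_eq_inv_mul, ← one_div, ← log_rpow hm0, log_le_log_iff
        (lt_max_of_lt_left one_pos) (by positivity)] at h3
      exact (le_max_right _ _).trans h3
    filter_upwards [nhdsWithin_le_nhds (hr.eventually (eventually_max_dyadicClamp_eq hL0.le hcase)),
      self_mem_nhdsWithin] with s hy hs
    refine le_trans ?_ (e s hs)
    rw [hcomm, show logScale x₀ κ L z = logScale x₀ κ L (z.1, z.2) from rfl, hcomm, hy]
    simp

theorem isCutoff_logCutoff [ProperSpace M] (x₀ : M) (hL : 1 ≤ L) (hκ : 0 < κ) :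
    IsCutoff N (2 + 2 / κ) (logCutoff x₀ κ L) (logCutoffSpaceBound x₀ κ L)
      (logCutoffTimeBound x₀ κ L) := by
  have hL0 : 0 < L := by linarith
  have hexp (s : ℝ) (hs : 0 ≤ s) : 1 ≤ exp s := one_le_exp hs
  have h2κ : 0 < 2 / κ := by positivity
  refine ⟨isTestFunction_logCutoff hL0 hκ, fun z ↦ (logCutoff_mem hL0).1,
    fun z ↦ (logCutoff_mem hL0).2, fun z ↦ indicator_nonneg (fun z hz ↦ ?_) z,
    fun z ↦ indicator_apply_le' (fun hz ↦ ?_) fun _ ↦ by positivity,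
    fun z ↦ indicator_nonneg (fun z hz ↦ ?_) z,
    fun z ↦ indicator_apply_le' (fun hz ↦ ?_) fun _ ↦ by positivity,
    abs_spaceDeriv_logCutoff_le hL hκ, neg_timeDeriv_logCutoff_le hL hκ⟩
  · have := dist_nonneg (x := z.1) (y := x₀)
    positivity
  · have h1 : 1 ≤ dist z.1 x₀ := (hexp L hL0.le).trans hz.1
    have h2 : 1 ≤ L * dist z.1 x₀ := by nlinarith
    have : 2 / (L * dist z.1 x₀) ≤ 2 := div_le_self (by norm_num) h2
    linarith
  · have : 0 < z.2 := (exp_pos _).trans_le hz.1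
    positivity
  · have h1 : 1 ≤ z.2 := (hexp (κ * L) (by positivity)).trans hz.1
    have h2 : κ ≤ L * (κ * z.2) := by
      have : 1 ≤ L * z.2 := by nlinarith
      nlinarith
    have : 2 / (L * (κ * z.2)) ≤ 2 / κ := by gcongr
    linarith

end LogCutoff

section Shells
variable {W : Measure M} [SFinite W] {x₀ : M} {κ : ℝ}

theorem exists_lintegral_shells_le {F : M → ℝ≥0∞} {H : ℝ → ℝ≥0∞} (hF : AEMeasurable F W)
    (hH : AEMeasurable H (volume.restrict (Ioi 0))) {C σ σ' δ δ' P : ℝ} (hC : 0 < C) (hκ : 0 < κ)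
    (hσ : 0 ≤ σ) (hσ' : 0 ≤ σ') (hδ : 0 ≤ δ) (hδ' : 0 ≤ δ') (hP : σ + κ * σ' ≤ P)
    (hFR : ∀ᶠ R : ℝ in atTop, ∫⁻ x in ball x₀ R, F x ∂W ≤
      ofReal (C * R ^ σ * log R ^ δ))
    (hHT : ∀ᶠ T : ℝ in atTop, ∫⁻ t in Ioo 0 T, H t ≤
      ofReal (C * T ^ σ' * log T ^ δ')) :
    ∃ C', 0 ≤ C' ∧ ∀ᶠ L : ℕ in atTop, ∀ (E : Set (M × ℝ)) (ρ : M × ℝ → ℝ), MeasurableSet E →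
      Measurable ρ → (∀ z ∈ E, L ≤ ρ z ∧ ρ z ≤ 2 * L ∧ dist z.1 x₀ ≤ exp (ρ z) ∧ 0 < z.2 ∧
        z.2 ≤ exp (κ * ρ z)) →
      ∫⁻ z in E, ofReal (exp (-(P * ρ z))) * (F z.1 * H z.2) ∂(W.prod volume) ≤
        ofReal (C' * (L : ℝ) ^ (1 + (δ + δ'))) := by
  have hP0 : 0 ≤ P := le_trans (by positivity) hP
  refine ⟨2 * (C * C * κ ^ δ' * exp P * 3 ^ (δ + δ')), by positivity, ?_⟩
  have t1 : Tendsto (fun j : ℕ ↦ exp ((j : ℝ) + 1)) atTop atTop :=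
    tendsto_exp_atTop.comp (tendsto_atTop_add_const_right _ _ tendsto_natCast_atTop_atTop)
  have t2 : Tendsto (fun j : ℕ ↦ exp (κ * ((j : ℝ) + 1))) atTop atTop :=
    tendsto_exp_atTop.comp ((tendsto_atTop_add_const_right _ _
      tendsto_natCast_atTop_atTop).const_mul_atTop hκ)
  obtain ⟨j₀, hj₀⟩ := eventually_atTop.1 ((t1.eventually hFR).and (t2.eventually hHT))
  filter_upwards [eventually_ge_atTop j₀, eventually_ge_atTop 1] with L hL hL1 E ρ hE hρ hEρ
  have hL1' : (1 : ℝ) ≤ L := by exact_mod_cast hL1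
  obtain ⟨S, hS⟩ : ∃ S : ℕ → Set (M × ℝ), S = fun j : ℕ ↦ E ∩ {z | (j : ℝ) ≤ ρ z ∧ ρ z < j + 1} :=
    ⟨_, rfl⟩
  have hSm (j : ℕ) : MeasurableSet (S j) := by
    rw [hS]
    exact hE.inter ((measurableSet_le measurable_const hρ).inter
      (measurableSet_lt hρ measurable_const))
  have hcov : E ⊆ ⋃ j ∈ Finset.Icc L (2 * L), S j := by
    intro z hz
    obtain ⟨h1, h2, -⟩ := hEρ z hz
    have h0 : 0 ≤ ρ z := by linarith
    refine mem_iUnion₂.2 ⟨⌊ρ z⌋₊, Finset.mem_Icc.2 ⟨Nat.le_floor h1, ?_⟩, ?_⟩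
    · have : ((⌊ρ z⌋₊ : ℕ) : ℝ) ≤ ((2 * L : ℕ) : ℝ) := (Nat.floor_le h0).trans (by push_cast; exact h2)
      exact_mod_cast this
    · rw [hS]
      exact ⟨hz, Nat.floor_le h0, Nat.lt_floor_add_one _⟩
  have hj (j : ℕ) (hj1 : L ≤ j) (hj2 : j ≤ 2 * L) :
      ∫⁻ z in S j, ofReal (exp (-(P * ρ z))) * (F z.1 * H z.2) ∂(W.prod volume) ≤
        ofReal (C * C * κ ^ δ' * exp P * (3 * L) ^ (δ + δ')) := by
    obtain ⟨b1, b2⟩ := hj₀ j (hL.trans hj1)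
    have hsub : S j ⊆ ball x₀ (exp ((j : ℝ) + 1)) ×ˢ
        Ioo 0 (exp (κ * ((j : ℝ) + 1))) := by
      rw [hS]
      rintro z ⟨hz, h1, h2⟩
      obtain ⟨-, -, k1, k2, k3⟩ := hEρ z hz
      exact ⟨k1.trans_lt (exp_lt_exp.2 h2), k2, k3.trans_lt (exp_lt_exp.2 (by gcongr))⟩
    have hHm : AEMeasurable H (volume.restrict (Ioo 0 (exp (κ * ((j : ℝ) + 1))))) :=
      hH.mono_measure (Measure.restrict_mono Ioo_subset_Ioi_self le_rfl)
    have hj0 : (0 : ℝ) < j + 1 := by positivity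
    calc ∫⁻ z in S j, ofReal (exp (-(P * ρ z))) * (F z.1 * H z.2) ∂(W.prod volume)
        ≤ ∫⁻ z in S j, ofReal (exp (-(P * j))) * (F z.1 * H z.2) ∂(W.prod volume) := by
          refine setLIntegral_mono' (hSm j) fun z hz ↦ ?_
          rw [hS] at hz
          have := hz.2.1
          gcongr
      _ ≤ ∫⁻ z in ball x₀ (exp ((j : ℝ) + 1)) ×ˢ Ioo 0 (exp (κ * ((j : ℝ) + 1))),
            ofReal (exp (-(P * j))) * (F z.1 * H z.2) ∂(W.prod volume) :=
          lintegral_mono_set hsub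
      _ = ofReal (exp (-(P * j))) *
            ((∫⁻ x in ball x₀ (exp ((j : ℝ) + 1)), F x ∂W) *
              ∫⁻ t in Ioo 0 (exp (κ * ((j : ℝ) + 1))), H t) := by
          rw [lintegral_const_mul' _ _ ofReal_ne_top, ← Measure.prod_restrict,
            lintegral_prod_mul hF.restrict hHm]
      _ ≤ ofReal (exp (-(P * j))) * (ofReal (C * exp ((j : ℝ) + 1) ^ σ *
            log (exp ((j : ℝ) + 1)) ^ δ) *
            ofReal (C * exp (κ * ((j : ℝ) + 1)) ^ σ' *
            log (exp (κ * ((j : ℝ) + 1))) ^ δ')) := by gcongr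
      _ ≤ _ := ?_
    rw [log_exp, log_exp, ← ofReal_mul (by positivity),
      ← ofReal_mul (by positivity)]
    refine ofReal_le_ofReal ?_
    have e1 : exp (-(P * j)) * (C * exp ((j : ℝ) + 1) ^ σ * ((j : ℝ) + 1) ^ δ *
        (C * exp (κ * ((j : ℝ) + 1)) ^ σ' * (κ * ((j : ℝ) + 1)) ^ δ')) =
        C * C * κ ^ δ' * exp ((σ + κ * σ') * (j + 1) - P * j) *
          ((j : ℝ) + 1) ^ (δ + δ') := by
      rw [mul_rpow hκ.le hj0.le, rpow_add hj0, ← exp_mul, ← exp_mul,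
        show (σ + κ * σ') * ((j : ℝ) + 1) - P * j =
          -(P * j) + (((j : ℝ) + 1) * σ + κ * ((j : ℝ) + 1) * σ') by ring, exp_add,
        exp_add]
      ring
    rw [e1]
    have h2L : ((j : ℝ) + 1) ≤ 3 * L := by
      have : (j : ℝ) ≤ 2 * L := by exact_mod_cast hj2
      linarith
    have hexp : (σ + κ * σ') * (j + 1) - P * j ≤ P := by
      have := mul_le_mul_of_nonneg_right hP hj0.le
      linarith
    gcongr
  calc _ ≤ ∫⁻ z in ⋃ j ∈ Finset.Icc L (2 * L), S j,
        ofReal (exp (-(P * ρ z))) * (F z.1 * H z.2) ∂(W.prod volume) :=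
        lintegral_mono_set hcov
    _ ≤ ∑ j ∈ Finset.Icc L (2 * L), ∫⁻ z in S j,
        ofReal (exp (-(P * ρ z))) * (F z.1 * H z.2) ∂(W.prod volume) := by
        have h1 := lintegral_iUnion_le (μ := W.prod 𝓛)
          (fun j : Finset.Icc L (2 * L) ↦ S j)
          fun z ↦ ofReal (exp (-(P * ρ z))) * (F z.1 * H z.2)
        rw [Finset.tsum_subtype (Finset.Icc L (2 * L)) fun j ↦ ∫⁻ z in S j,
          ofReal (exp (-(P * ρ z))) * (F z.1 * H z.2) ∂(W.prod volume)] at h1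
        refine le_trans (le_of_eq ?_) h1
        congr 2
        ext z
        simp
    _ ≤ ∑ j ∈ Finset.Icc L (2 * L),
        ofReal (C * C * κ ^ δ' * exp P * (3 * L) ^ (δ + δ')) :=
        Finset.sum_le_sum fun j hj' ↦ hj j (Finset.mem_Icc.1 hj').1 (Finset.mem_Icc.1 hj').2
    _ ≤ _ := ?_
  rw [Finset.sum_const, Nat.card_Icc, ← ENNReal.ofReal_nsmul]
  refine ofReal_le_ofReal ?_
  have h1 : ((2 * L + 1 - L : ℕ) : ℝ) ≤ 2 * L := by
    rw [show 2 * L + 1 - L = L + 1 by omega]; push_cast; linarith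
  rw [nsmul_eq_mul, rpow_add (by linarith) 1 (δ + δ'), rpow_one,
    mul_rpow (by norm_num) (by linarith)]
  calc _ ≤ (2 * L) * (C * C * κ ^ δ' * exp P * (3 ^ (δ + δ') * (L : ℝ) ^ (δ + δ'))) := by
        gcongr
    _ = _ := by ring

theorem rpow_mul_rpow_neg_le {c L ρ D r₀ q P V h f lam : ℝ} (hc : 0 ≤ c) (hL : 1 ≤ L)
    (hρ : ρ ≤ 2 * L) (hD : 0 < D) (hq : D + r₀ = q) (hr : 1 / L ≤ r₀) (hP : 0 ≤ P)
    (hh : 0 < h) (hf : 0 < f) (hV : h * f ≤ V) (hlam : h * f ≤ exp (lam * L)) :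
    (c / L * exp (-(P * ρ))) ^ ((q - 1 / L) / D) * V ^ (-((r₀ - 1 / L) / D)) ≤
      (1 + c) ^ (q / D) * exp ((1 + 2 * P + lam) / D) * L ^ (-(q / D)) *
        (exp (-(P * (q / D) * ρ)) * (h ^ (-(r₀ / D)) * f ^ (-(r₀ / D)))) := by
  have hL0 : 0 < L := by linarith
  have hθ : 0 < 1 / L := by positivity
  have hs : 0 ≤ (q - 1 / L) / D := div_nonneg (by linarith) hD.le
  have hhf : 0 < h * f := mul_pos hh hf
  have e1 : (c / L * exp (-(P * ρ))) ^ ((q - 1 / L) / D) =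
      c ^ ((q - 1 / L) / D) * (L ^ (-(q / D)) * L ^ (1 / L / D)) *
        (exp (-(P * (q / D) * ρ)) * exp (P * ρ * (1 / L / D))) := by
    rw [mul_rpow (by positivity) (exp_pos _).le, div_rpow hc hL0.le,
      ← rpow_add hL0, ← exp_add, ← exp_mul, div_eq_mul_inv (c ^ _),
      ← rpow_neg hL0.le]
    congr 2
    · congr 1; ring
    · ring_nf
  have k1 : c ^ ((q - 1 / L) / D) ≤ (1 + c) ^ (q / D) :=
    (rpow_le_rpow hc (by linarith) hs).trans (rpow_le_rpow_of_exponent_le (by linarith)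
      (by gcongr; linarith))
  have k2 : L ^ (1 / L / D) ≤ exp (1 / D) := by
    calc L ^ (1 / L / D) ≤ (exp L) ^ (1 / L / D) :=
          rpow_le_rpow hL0.le (by linarith [add_one_le_exp L]) (by positivity)
      _ = _ := by rw [← exp_mul]; congr 1; field_simp
  have k3 : exp (P * ρ * (1 / L / D)) ≤ exp (2 * P / D) := by
    rw [exp_le_exp]
    calc P * ρ * (1 / L / D) ≤ P * (2 * L) * (1 / L / D) := by gcongr
      _ = _ := by field_simp
  have k4 : V ^ (-((r₀ - 1 / L) / D)) ≤
      (h ^ (-(r₀ / D)) * f ^ (-(r₀ / D))) * exp (lam / D) := by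
    calc V ^ (-((r₀ - 1 / L) / D)) ≤ (h * f) ^ (-((r₀ - 1 / L) / D)) :=
          rpow_le_rpow_of_nonpos hhf hV (neg_nonpos.2 (div_nonneg (by linarith) hD.le))
      _ = (h * f) ^ (-(r₀ / D)) * (h * f) ^ (1 / L / D) := by
          rw [← rpow_add hhf]; congr 1; ring
      _ ≤ (h * f) ^ (-(r₀ / D)) * (exp (lam * L)) ^ (1 / L / D) := by gcongr
      _ = _ := by
          rw [mul_rpow hh.le hf.le, ← exp_mul]
          congr 2; field_simp
  rw [e1]
  have hV0 : 0 < V := hhf.trans_le hV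
  calc _ ≤ (1 + c) ^ (q / D) * (L ^ (-(q / D)) * exp (1 / D)) *
        (exp (-(P * (q / D) * ρ)) * exp (2 * P / D)) *
        ((h ^ (-(r₀ / D)) * f ^ (-(r₀ / D))) * exp (lam / D)) := by gcongr
    _ = _ := by
        rw [show (1 + 2 * P + lam) / D = 1 / D + 2 * P / D + lam / D by ring, exp_add,
          exp_add]
        ring

theorem mul_le_exp_of_growth {C α₁ α₂ r t h f L : ℝ} (hC : 0 < C) (hα₁ : 0 ≤ α₁) (hα₂ : 0 ≤ α₂)
    (hκ : 0 < κ) (hL : 1 ≤ L) (hr0 : 0 ≤ r) (ht0 : 0 ≤ t) (hr : r ≤ exp (2 * L))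
    (ht : t ≤ exp (κ * (2 * L))) (hh : h ≤ C * (1 + r) ^ α₁) (hf : f ≤ C * (1 + t) ^ α₂)
    (hf0 : 0 < f) :
    h * f ≤ exp ((2 * C + 3 * α₁ + (1 + 2 * κ) * α₂) * L) := by
  have key (s c : ℝ) (hc : 0 ≤ c) (hs : s ≤ exp (c * L)) : 1 + s ≤ exp ((1 + c) * L) := by
    have h1 : 1 ≤ exp (c * L) := one_le_exp (by positivity)
    have h2 : 2 ≤ exp L := by linarith [add_one_le_exp L]
    rw [add_mul, one_mul, exp_add]
    nlinarith
  have h1 := key r 2 (by norm_num) hr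
  have h2 := key t (2 * κ) (by positivity) (by rw [mul_comm 2 κ, mul_assoc]; exact ht)
  have h3 : C ≤ exp (C * L) := by
    have : C ≤ C * L := le_mul_of_one_le_right hC.le hL
    linarith [add_one_le_exp (C * L)]
  calc h * f ≤ (exp (C * L) * exp ((1 + 2) * L) ^ α₁) *
        (exp (C * L) * exp ((1 + 2 * κ) * L) ^ α₂) := by
        refine mul_le_mul (hh.trans ?_) (hf.trans ?_) hf0.le (by positivity)
        · gcongr
        · gcongr
    _ = _ := by
        rw [← exp_mul, ← exp_mul, ← exp_add, ← exp_add, ← exp_add]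
        congr 1; ring

theorem tendsto_lintegral_shells {h : M → ℝ} {f : ℝ → ℝ} {V : M × ℝ → ℝ} (hh : AEMeasurable h W)
    (hf : AEMeasurable f (volume.restrict (Ioi 0))) {C α₁ α₂ σ σ' δ δ' D r₀ q P c c₁ : ℝ}
    (hC : 0 < C) (hα₁ : 0 ≤ α₁) (hα₂ : 0 ≤ α₂) (hκ : 0 < κ) (hσ : 0 ≤ σ) (hσ' : 0 ≤ σ')
    (hδ : 0 ≤ δ) (hδ' : 0 ≤ δ') (hD : 0 < D) (hr₀ : 0 < r₀) (hq : D + r₀ = q) (hP : 0 ≤ P)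
    (hc : 0 ≤ c) (hc₁ : 0 ≤ c₁) (hσP : σ + κ * σ' ≤ P * (q / D)) (hδD : δ + δ' < r₀ / D)
    (hae : ∀ᵐ z ∂W.prod 𝓛, z ∈ spaceTime M → 0 < h z.1 ∧ 0 < f z.2 ∧
      h z.1 ≤ C * (1 + dist x₀ z.1) ^ α₁ ∧ f z.2 ≤ C * (1 + z.2) ^ α₂ ∧ h z.1 * f z.2 ≤ V z)
    (hFR : ∀ᶠ R : ℝ in atTop, ∫⁻ x in ball x₀ R, ofReal (h x ^ (-(r₀ / D))) ∂W ≤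
      ofReal (C * R ^ σ * log R ^ δ))
    (hHT : ∀ᶠ T : ℝ in atTop, ∫⁻ t in Ioo 0 T, ofReal (f t ^ (-(r₀ / D))) ≤
      ofReal (C * T ^ σ' * log T ^ δ'))
    {E S : ℕ → Set (M × ℝ)} {ρ : M × ℝ → ℝ} {X : ℕ → M × ℝ → ℝ} (hE : ∀ L, MeasurableSet (E L))
    (hS : ∀ L, MeasurableSet (S L)) (hρ : Measurable ρ)
    (hEρ : ∀ L : ℕ, ∀ z ∈ E L, L ≤ ρ z ∧ ρ z ≤ 2 * L ∧ dist z.1 x₀ ≤ exp (ρ z) ∧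
      z.2 ≤ exp (κ * ρ z))
    (hSr : ∀ L : ℕ, 1 ≤ L → ∀ z ∈ S L, dist z.1 x₀ ≤ exp (2 * L) ∧ 0 < z.2 ∧
      z.2 ≤ exp (κ * (2 * L)))
    (hX : ∀ L : ℕ, 1 ≤ L → ∀ z ∈ E L, 0 < z.2 → X L z = c / L * exp (-(P * ρ z)))
    (hX0 : ∀ L : ℕ, ∀ z ∉ E L, X L z = 0) :
    Tendsto (fun L : ℕ ↦ ∫⁻ z in S L, ofReal (c₁ * (X L z ^ ((q - 1 / (L : ℝ)) / D) *
      V z ^ (-((r₀ - 1 / (L : ℝ)) / D)))) ∂(W.prod volume)) atTop (𝓝 0) := by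
  obtain ⟨C', hC', hshell⟩ := exists_lintegral_shells_le (hh.pow_const _).ennreal_ofReal
    (hf.pow_const _).ennreal_ofReal hC hκ hσ hσ' hδ hδ' hσP hFR hHT
  obtain ⟨c₂, hc₂⟩ : ∃ c₂, c₂ = c₁ * ((1 + c) ^ (q / D) *
    exp ((1 + 2 * P + (2 * C + 3 * α₁ + (1 + 2 * κ) * α₂)) / D)) := ⟨_, rfl⟩
  have hc₂0 : 0 ≤ c₂ := by rw [hc₂]; positivity
  have hlim : Tendsto (fun L : ℕ ↦ ofReal (c₂ * C' * (L : ℝ) ^ (-(r₀ / D - (δ + δ')))))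
      atTop (𝓝 0) := by
    have h1 : Tendsto (fun L : ℕ ↦ c₂ * C' * (L : ℝ) ^ (-(r₀ / D - (δ + δ')))) atTop
        (𝓝 (c₂ * C' * 0)) := ((tendsto_rpow_neg_atTop (by linarith)).comp
          tendsto_natCast_atTop_atTop).const_mul _
    rw [mul_zero] at h1
    simpa using ENNReal.tendsto_ofReal h1
  refine tendsto_of_tendsto_of_tendsto_of_le_of_le' tendsto_const_nhds hlim
    (Eventually.of_forall fun _ ↦ zero_le) ?_
  have hinv : ∀ᶠ L : ℕ in atTop, 1 / (L : ℝ) ≤ r₀ :=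
    (tendsto_one_div_atTop_nhds_zero_nat (𝕜 := ℝ)).eventually_le_const hr₀
  filter_upwards [hshell, hinv, eventually_ge_atTop 1] with L hsh hLr hL1
  have hL1' : (1 : ℝ) ≤ L := by exact_mod_cast hL1
  have hL0 : (0 : ℝ) < L := by linarith
  have hsh' := hsh (S L ∩ E L) ρ ((hS L).inter (hE L)) hρ fun z hz ↦ by
    obtain ⟨h1, h2, h3, h4⟩ := hEρ L z hz.2
    exact ⟨h1, h2, h3, (hSr L hL1 z hz.1).2.1, h4⟩
  calc _ ≤ ∫⁻ z in S L, (E L).indicator (fun z ↦ ofReal (c₂ * (L : ℝ) ^ (-(q / D))) *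
        (ofReal (exp (-(P * (q / D) * ρ z))) *
          (ofReal (h z.1 ^ (-(r₀ / D))) * ofReal (f z.2 ^ (-(r₀ / D)))))) z
          ∂(W.prod volume) := by
        refine lintegral_mono_ae ?_
        filter_upwards [ae_restrict_mem (hS L), ae_restrict_of_ae hae] with z hz hzae
        obtain ⟨z1, z2, z3⟩ := hSr L hL1 z hz
        obtain ⟨a1, a2, a3, a4, a5⟩ := hzae ⟨mem_univ _, z2⟩
        by_cases hzE : z ∈ E L
        · rw [indicator_of_mem hzE, hX L hL1 z hzE z2]
          obtain ⟨h1, h2, h3, h4⟩ := hEρ L z hzE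
          have k := rpow_mul_rpow_neg_le hc hL1' h2 hD hq hLr hP a1 a2 a5
            (mul_le_exp_of_growth hC hα₁ hα₂ hκ hL1' dist_nonneg z2.le
              (by rw [dist_comm]; exact z1) z3 a3 a4 a2)
          have i1 : 0 ≤ h z.1 ^ (-(r₀ / D)) := by positivity
          rw [← ofReal_mul i1, ← ofReal_mul (exp_pos _).le,
            ← ofReal_mul (by positivity)]
          refine ofReal_le_ofReal ((mul_le_mul_of_nonneg_left k hc₁).trans (le_of_eq ?_))
          rw [hc₂]; ring
        · rw [indicator_of_notMem hzE, hX0 L z hzE, zero_rpow, zero_mul, mul_zero,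
            ENNReal.ofReal_zero]
          exact (div_pos (by linarith) hD).ne'
    _ = ofReal (c₂ * (L : ℝ) ^ (-(q / D))) * ∫⁻ z in S L ∩ E L,
        ofReal (exp (-(P * (q / D) * ρ z))) *
          (ofReal (h z.1 ^ (-(r₀ / D))) * ofReal (f z.2 ^ (-(r₀ / D))))
          ∂(W.prod volume) := by
        rw [lintegral_indicator (hE L), Measure.restrict_restrict (hE L), inter_comm,
          lintegral_const_mul' _ _ ofReal_ne_top]
    _ ≤ ofReal (c₂ * (L : ℝ) ^ (-(q / D))) *
        ofReal (C' * (L : ℝ) ^ (1 + (δ + δ'))) := by gcongr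
    _ = _ := by
        rw [← ofReal_mul (by positivity), show -(r₀ / D - (δ + δ')) =
          -(q / D) + (1 + (δ + δ')) by rw [← hq]; field_simp; ring,
          rpow_add hL0 (-(q / D))]
        congr 1; ring

end Shells

section Vanishing

theorem exists_pos_scale {σ₁ σ₄ A' B' : ℝ} (hσ₁ : 0 ≤ σ₁) (hσ₄ : 0 ≤ σ₄) (hA' : 0 ≤ A')
    (hB' : 0 ≤ B') (h1 : A' = 0 → σ₁ = 0) (h2 : B' = 0 → σ₄ = 0) (h : σ₁ * σ₄ ≤ A' * B') :
    ∃ κ, 0 < κ ∧ σ₁ ≤ κ * A' ∧ κ * σ₄ ≤ B' := by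
  rcases hσ₄.eq_or_lt with h4 | h4
  · rcases hA'.eq_or_lt with hA | hA
    · exact ⟨1, one_pos, by rw [h1 hA.symm, ← hA, mul_zero], by rw [← h4]; linarith⟩
    · refine ⟨σ₁ / A' + 1, by positivity, ?_, by rw [← h4]; linarith⟩
      rw [add_mul, div_mul_cancel₀ _ hA.ne']; linarith
  · have hB : 0 < B' := hB'.lt_of_ne fun hB ↦ h4.ne' (h2 hB.symm)
    refine ⟨B' / σ₄, by positivity, ?_, by rw [div_mul_cancel₀ _ h4.ne']⟩
    rw [div_mul_eq_mul_div, le_div_iff₀ h4]; linarith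

variable {p q m K θ L : ℝ} {b : ℝ → ℝ} {V u φ A B : M × ℝ → ℝ} {n : ℕ}
  {G : (z : M × ℝ) → TangentSpace (𝓡 N) z.1} {D : M × ℝ → ℝ} [ProperSpace M]
  [IsLocallyFiniteMeasure ((weightedMeasure N a).prod (volume : Measure ℝ))]

theorem mem_spaceShell {x₀ : M} {κ : ℝ} {L : ℕ} {z : M × ℝ}
    (hz : z ∈ spaceShell x₀ κ L) : L ≤ log (dist z.1 x₀) ∧
      log (dist z.1 x₀) ≤ 2 * L ∧ dist z.1 x₀ ≤ exp (log (dist z.1 x₀)) ∧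
      z.2 ≤ exp (κ * log (dist z.1 x₀)) := by
  have h0 : 0 < dist z.1 x₀ := (exp_pos _).trans_le hz.1
  refine ⟨(le_log_iff_exp_le h0).2 hz.1, (log_le_iff_le_exp h0).2 hz.2.1,
    (exp_log h0).ge, ?_⟩
  rw [mul_comm, ← rpow_def_of_pos h0]
  exact hz.2.2

theorem mem_timeShell {x₀ : M} {κ : ℝ} (hκ : 0 < κ) {L : ℕ} {z : M × ℝ}
    (hz : z ∈ timeShell x₀ κ L) : L ≤ log z.2 / κ ∧
      log z.2 / κ ≤ 2 * L ∧ dist z.1 x₀ ≤ exp (log z.2 / κ) ∧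
      z.2 ≤ exp (κ * (log z.2 / κ)) := by
  have h0 : 0 < z.2 := (exp_pos _).trans_le hz.1
  refine ⟨?_, ?_, ?_, ?_⟩
  · rw [le_div_iff₀ hκ, mul_comm, le_log_iff_exp_le h0]; exact hz.1
  · rw [div_le_iff₀ hκ, mul_comm, log_le_iff_le_exp h0]; exact hz.2.1
  · rw [← mul_one_div, ← rpow_def_of_pos h0]; exact hz.2.2
  · rw [mul_div_cancel₀ _ hκ.ne', exp_log h0]

theorem logCutoffSpaceBound_rpow {x₀ : M} {κ L : ℝ} {z : M × ℝ} (hL : 0 < L)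
    (hz : z ∈ spaceShell x₀ κ L) : (1 / L) ^ (1 - p) * logCutoffSpaceBound x₀ κ L z ^ p =
      2 ^ p / L * exp (-(p * log (dist z.1 x₀))) := by
  have h0 : 0 < dist z.1 x₀ := (exp_pos _).trans_le hz.1
  rw [logCutoffSpaceBound, indicator_of_mem hz,
    div_rpow zero_le_two (by positivity : 0 ≤ L * dist z.1 x₀), mul_rpow hL.le h0.le, one_div, inv_rpow hL.le, ← rpow_neg hL.le,
    show -(p * log (dist z.1 x₀)) = log (dist z.1 x₀) * -p by ring,
    ← rpow_def_of_pos h0, rpow_neg h0.le, neg_sub, rpow_sub_one hL.ne']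
  have : L ^ p ≠ 0 := (rpow_pos_of_pos hL p).ne'
  field_simp

theorem logCutoffTimeBound_eq {x₀ : M} {κ L : ℝ} {z : M × ℝ} (hκ : 0 < κ)
    (hz : z ∈ timeShell x₀ κ L) : logCutoffTimeBound x₀ κ L z =
      2 / κ / L * exp (-(κ * (log z.2 / κ))) := by
  have h0 : 0 < z.2 := (exp_pos _).trans_le hz.1
  rw [logCutoffTimeBound, indicator_of_mem hz, mul_div_cancel₀ _ hκ.ne', exp_neg,
    exp_log h0]
  field_simp

theorem eventually_logCutoff_eq_one (x₀ : M) {κ : ℝ} {z : M × ℝ} (hz : 0 < z.2) :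
    ∀ᶠ L : ℕ in atTop, logCutoff x₀ κ L z = 1 := by
  have hN := tendsto_natCast_atTop_atTop (R := ℝ)
  filter_upwards [hN.eventually_ge_atTop (log (max 1 (dist z.1 x₀))),
    hN.eventually_ge_atTop (log (max 1 z.2) / κ), hN.eventually_ge_atTop (2 / z.2),
    hN.eventually_gt_atTop 0] with L h1 h2 h3 h4
  exact logCutoff_eq_one h4 h1 h2 ((div_le_iff₀ hz).1 h3)

theorem IsWeakSolutionWith.ae_eq_zero (hs : IsWeakSolutionWith N p q m K a b V u G D)
    (hq : 1 < q) (hD : 0 < q - p - m + 2)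
    (happ : ∀ g B B' C, IsAdmissible ((p + m - 1) / p) B B' C g → ∀ z ∈ spaceTime M,
      ∃ O, IsOpen O ∧ z ∈ O ∧ O ⊆ spaceTime M ∧ HasLipschitzApproximation p m a u G g B O)
    (hVm : AEMeasurable V ((μₐₜ).restrict (spaceTime M)))
    (x₀ : M) {h : M → ℝ} {f : ℝ → ℝ} (hh : AEMeasurable h (weightedMeasure N a))
    (hf : AEMeasurable f (volume.restrict (Ioi 0)))
    {C α₁ α₂ σ₁ σ₂ σ₃ σ₄ δ₁ δ₂ δ₃ δ₄ : ℝ} (hC : 0 < C) (hα₁ : 0 ≤ α₁) (hα₂ : 0 ≤ α₂)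
    (hσ₁ : 0 ≤ σ₁) (hσ₂ : 0 ≤ σ₂) (hσ₃ : 0 ≤ σ₃) (hσ₄ : 0 ≤ σ₄)
    (hδ₁ : 0 ≤ δ₁) (hδ₂ : 0 ≤ δ₂) (hδ₃ : 0 ≤ δ₃) (hδ₄ : 0 ≤ δ₄)
    (hae : ∀ᵐ z ∂μₐₜ, z ∈ spaceTime M → 0 < h z.1 ∧
      0 < f z.2 ∧ h z.1 ≤ C * (1 + dist x₀ z.1) ^ α₁ ∧ f z.2 ≤ C * (1 + z.2) ^ α₂ ∧
      h z.1 * f z.2 ≤ V z)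
    (hh₁ : ∀ᶠ R : ℝ in atTop,
      ∫⁻ x in ball x₀ R, ofReal (h x ^ (-(1 / (q - 1)))) ∂(weightedMeasure N a)
        ≤ ofReal (C * R ^ σ₁ * log R ^ δ₁))
    (hf₁ : ∀ᶠ T : ℝ in atTop,
      ∫⁻ t in Ioo 0 T, ofReal (f t ^ (-(1 / (q - 1))))
        ≤ ofReal (C * T ^ σ₂ * log T ^ δ₂))
    (hh₂ : ∀ᶠ R : ℝ in atTop,
      ∫⁻ x in ball x₀ R, ofReal (h x ^ (-((p + m - 2) / (q - p - m + 2))))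
          ∂(weightedMeasure N a)
        ≤ ofReal (C * R ^ σ₃ * log R ^ δ₃))
    (hf₂ : ∀ᶠ T : ℝ in atTop,
      ∫⁻ t in Ioo 0 T, ofReal (f t ^ (-((p + m - 2) / (q - p - m + 2))))
        ≤ ofReal (C * T ^ σ₄ * log T ^ δ₄))
    (hi₁ : δ₁ + δ₂ < 1 / (q - 1)) (hi₂ : δ₃ + δ₄ < (p + m - 2) / (q - p - m + 2))
    (hii₁ : σ₂ ≤ q / (q - 1)) (hii₂ : σ₃ ≤ p * q / (q - p - m + 2))
    (hiii₁ : σ₂ = q / (q - 1) → σ₁ = 0) (hiii₂ : σ₃ = p * q / (q - p - m + 2) → σ₄ = 0)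
    (hiv : σ₁ * σ₄ ≤ (q / (q - 1) - σ₂) * (p * q / (q - p - m + 2) - σ₃)) :
    ∀ᵐ z ∂μₐₜ, z ∈ spaceTime M → u z = 0 := by
  have hp := hs.one_lt
  have hm := hs.one_le
  have hK := hs.bound_nonneg
  obtain ⟨κ, hκ, hκ₁, hκ₂⟩ := exists_pos_scale hσ₁ hσ₄ (sub_nonneg.2 hii₁) (sub_nonneg.2 hii₂)
    (fun h ↦ hiii₁ (sub_eq_zero.1 h).symm) (fun h ↦ hiii₂ (sub_eq_zero.1 h).symm) hiv
  obtain ⟨n, hn⟩ := exists_nat_gt (max p (max (p * q / (q - p - m + 2)) (q / (q - 1))))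
  have hn0 : p < n := (le_max_left _ _).trans_lt hn
  have hn1 : p * q / (q - p - m + 2) ≤ n :=
    ((le_max_left _ _).trans (le_max_right _ _)).trans hn.le
  have hn2 : q / (q - 1) ≤ n := ((le_max_right _ _).trans (le_max_right _ _)).trans hn.le
  have hnpos : 0 < n := by exact_mod_cast (by linarith : (0 : ℝ) < n)
  have hV : ∀ᵐ z ∂μₐₜ, z ∈ spaceTime M → 0 < V z := by
    filter_upwards [hae] with z hz hzS
    obtain ⟨h1, h2, -, -, h5⟩ := hz hzS
    exact (mul_pos h1 h2).trans_le h5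
  obtain ⟨c₁, hc₁⟩ : ∃ c₁, c₁ = (4 * (1 + K * n ^ p)) ^ (2 * (q / (q - p - m + 2))) := ⟨_, rfl⟩
  obtain ⟨c₂, hc₂⟩ : ∃ c₂ : ℝ, c₂ = (4 * (1 + 2 * n)) ^ (2 * (q / (q - 1))) := ⟨_, rfl⟩
  have hc₁0 : 0 ≤ c₁ := by rw [hc₁]; positivity
  have hc₂0 : 0 ≤ c₂ := by rw [hc₂]; positivity
  obtain ⟨S, hS⟩ : ∃ S : ℕ → Set (M × ℝ), S = fun L : ℕ ↦ {z | logCutoff x₀ κ L z ≠ 0} := ⟨_, rfl⟩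
  have hcut (L : ℕ) (hL : 1 ≤ L) := isCutoff_logCutoff (N := N) x₀ (κ := κ) (L := L)
    (by exact_mod_cast hL) hκ
  have hcm (L : ℕ) : Measurable (logCutoff x₀ κ L) := by
    have h1 : Measurable fun z : M × ℝ ↦ dist z.1 x₀ :=
      (continuous_fst.dist continuous_const).measurable
    have h2 := (lipschitzWith_dyadicClamp L).continuous.measurable
    have h3 := lipschitzWith_log_max.continuous.measurable
    exact ((((h2.comp (h3.comp h1)).max (h2.comp ((h3.comp measurable_snd).div_const
      κ))).div_const _).const_sub _).mul (measurable_const.max (measurable_const.min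
        ((measurable_snd.const_mul _).sub_const _)))
  have hSm (L : ℕ) : MeasurableSet (S L) := by
    rw [hS]; exact (measurableSet_eq_fun (hcm L) measurable_const).compl
  have hSr (L : ℕ) (hL : 1 ≤ L) (z : M × ℝ) (hz : z ∈ S L) : dist z.1 x₀ ≤ exp (2 * L) ∧
      0 < z.2 ∧ z.2 ≤ exp (κ * (2 * L)) := by
    rw [hS] at hz
    have hL0 : (0 : ℝ) < L := by exact_mod_cast hL
    obtain ⟨h1, h2, h3⟩ := mem_of_logCutoff_ne_zero hL0 hκ hz
    exact ⟨h1.le, (by positivity : (0 : ℝ) < 1 / L).trans h2, h3.le⟩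
  have T1 := tendsto_lintegral_shells (x₀ := x₀) (V := V) hh hf (c := 2 ^ p) (c₁ := c₁) (r₀ := p + m - 2)
    (D := q - p - m + 2) (q := q) (P := p) hC hα₁ hα₂ hκ hσ₃ hσ₄ hδ₃ hδ₄ hD (by linarith) (by ring)
    (by linarith) (by positivity) hc₁0 (by rw [← mul_div_assoc]; linarith) hi₂ hae hh₂ hf₂
    (E := fun L : ℕ ↦ spaceShell x₀ κ L) (ρ := fun z ↦ log (dist z.1 x₀))
    (X := fun (L : ℕ) z ↦ (1 / (L : ℝ)) ^ (1 - p) * logCutoffSpaceBound x₀ κ L z ^ p)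
    (fun L ↦ measurableSet_spaceShell) hSm
    (measurable_log.comp (continuous_fst.dist continuous_const).measurable)
    (fun L z hz ↦ mem_spaceShell hz) hSr
    (fun L hL z hz _ ↦ logCutoffSpaceBound_rpow (by exact_mod_cast hL) hz)
    (fun L z hz ↦ by
      simp only [logCutoffSpaceBound]
      rw [indicator_of_notMem hz, zero_rpow (by linarith), mul_zero])
  have T2 := tendsto_lintegral_shells (x₀ := x₀) (V := V) hh hf (c := 2 / κ) (c₁ := c₂) (r₀ := 1)
    (D := q - 1) (q := q) (P := κ) hC hα₁ hα₂ hκ hσ₁ hσ₂ hδ₁ hδ₂ (by linarith) one_pos (by ring)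
    hκ.le (by positivity) hc₂0 (by linarith) hi₁ hae hh₁ hf₁
    (E := fun L : ℕ ↦ timeShell x₀ κ L) (ρ := fun z ↦ log z.2 / κ)
    (X := fun (L : ℕ) ↦ logCutoffTimeBound x₀ κ L)
    (fun L ↦ measurableSet_timeShell) hSm
    ((measurable_log.comp measurable_snd).div_const κ)
    (fun L z hz ↦ mem_timeShell hκ hz) hSr
    (fun L hL z hz _ ↦ logCutoffTimeBound_eq hκ hz)
    (fun L z hz ↦ indicator_of_notMem hz _)
  have T3 := ENNReal.Tendsto.const_mul (a := 2) (T1.add T2) (Or.inr (by norm_num))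
  rw [add_zero, mul_zero] at T3
  have hθ : Tendsto (fun L : ℕ ↦ 1 / (L : ℝ)) atTop (𝓝 0) := tendsto_one_div_atTop_nhds_zero_nat
  have T4 : Tendsto (fun L : ℕ ↦ ∫⁻ z, ofReal (logCutoff x₀ κ L z ^ (n : ℝ) * V z *
      u z ^ (q - 1 / (L : ℝ))) ∂μₐₜ) atTop (𝓝 0) := by
    refine tendsto_of_tendsto_of_tendsto_of_le_of_le' tendsto_const_nhds T3
      (Eventually.of_forall fun _ ↦ zero_le) ?_
    filter_upwards [eventually_ge_atTop 1, hθ.eventually_le_const (show (0 : ℝ) < 1 / 2 by norm_num),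
      hθ.eventually_lt_const (show 0 < p - 1 by linarith)] with L hL h1 h2
    have hL0 : (0 : ℝ) < L := by exact_mod_cast hL
    have hSS : S L ⊆ spaceTime M := fun z hz ↦ ⟨mem_univ _, (hSr L hL z hz).2.1⟩
    have hmeas : AEMeasurable (fun z ↦ ofReal (c₁ * (((1 / (L : ℝ)) ^ (1 - p) *
        logCutoffSpaceBound x₀ κ L z ^ p) ^ ((q - 1 / (L : ℝ)) / (q - p - m + 2)) *
        V z ^ (-((p + m - 2 - 1 / (L : ℝ)) / (q - p - m + 2))))))
        ((μₐₜ).restrict (S L)) :=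
      ((((measurable_logCutoffSpaceBound.pow_const p).const_mul _).pow_const _).aemeasurable.mul
        ((hVm.mono_measure (Measure.restrict_mono hSS le_rfl)).pow_const _)).const_mul
          c₁ |>.ennreal_ofReal
    have h3 := hs.lintegral_reaction_le hV hVm happ (hcut L hL) measurable_logCutoffSpaceBound
      measurable_logCutoffTimeBound (θ := 1 / (L : ℝ)) (by positivity) h1 h2 hq hD hn0 hn1 hn2
      hc₁ hc₂
    rw [show {z | logCutoff x₀ κ L z ≠ 0} = S L by rw [hS], lintegral_add_left' hmeas] at h3
    exact h3
  have hF0 := lintegral_le_of_ae_tendsto (ν := μₐₜ)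
    (F := fun (j : ℕ) z ↦ ofReal (logCutoff x₀ κ ((j + 1 : ℕ) : ℝ) z ^ (n : ℝ) * V z *
      u z ^ (q - 1 / ((j + 1 : ℕ) : ℝ))))
    (F₀ := fun z ↦ ofReal ((spaceTime M).indicator (fun z ↦ V z * u z ^ q) z))
    (fun j ↦ hs.aemeasurable_reaction hVm (hcut (j + 1) (by omega)).isTestFunction hnpos _)
    ?_ (fun j ↦ le_rfl) ((tendsto_add_atTop_iff_nat 1).2 T4)
  swap
  · filter_upwards [hs.nonneg] with z hz
    refine ENNReal.tendsto_ofReal ((tendsto_add_atTop_iff_nat (f := fun L : ℕ ↦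
      logCutoff x₀ κ L z ^ (n : ℝ) * V z * u z ^ (q - 1 / (L : ℝ))) 1).2 ?_)
    by_cases hzS : z ∈ spaceTime M
    · rw [indicator_of_mem hzS]
      have h1 : Tendsto (fun L : ℕ ↦ V z * u z ^ (q - 1 / (L : ℝ))) atTop
          (𝓝 (V z * u z ^ q)) := by
        refine Tendsto.const_mul _ ?_
        have h2 : Tendsto (fun L : ℕ ↦ q - 1 / (L : ℝ)) atTop (𝓝 (q - 0)) := hθ.const_sub q
        rw [sub_zero] at h2
        exact tendsto_const_nhds.rpow h2 (Or.inr (by linarith))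
      refine h1.congr' ?_
      filter_upwards [eventually_logCutoff_eq_one x₀ (κ := κ) hzS.2] with L hL
      rw [hL, one_rpow, one_mul]
    · rw [indicator_of_notMem hzS]
      refine tendsto_const_nhds.congr' ?_
      filter_upwards [eventually_ge_atTop 1] with L hL
      have : logCutoff x₀ κ L z = 0 := by
        by_contra h
        exact hzS ⟨mem_univ _, (hSr L hL z (by rw [hS]; exact h)).2.1⟩
      rw [this, zero_rpow (by positivity), zero_mul, zero_mul]
  have hFm : AEMeasurable (fun z ↦ ofReal ((spaceTime M).indicator
      (fun z ↦ V z * u z ^ q) z)) μₐₜ :=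
    ((aemeasurable_indicator_iff (isOpen_spaceTime M).measurableSet).2
      (hVm.mul (hs.aestronglyMeasurable_u.aemeasurable.pow_const _))).ennreal_ofReal
  have hzero := (lintegral_eq_zero_iff' hFm).1 (nonpos_iff_eq_zero.1 hF0)
  filter_upwards [hzero, hs.nonneg, hV] with z h1 h2 h3 hzS
  simp only [Pi.zero_apply, indicator_of_mem hzS, ENNReal.ofReal_eq_zero] at h1
  have hu := h2 hzS
  have hVz := h3 hzS
  by_contra h
  have : 0 < u z := hu.lt_of_ne' h
  have : 0 < V z * u z ^ q := by positivity
  linarith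

end Vanishing

section WeakSolutions
theorem isLocallyFiniteMeasure_of_lintegral_ball_le {W : Measure M} {x₀ : M}
    {h : M → ℝ} {C α γ : ℝ} {c : ℝ → ℝ} (hα : 0 ≤ α) (hγ : 0 ≤ γ) (hC : 0 < C)
    (hh : ∀ᵐ x ∂W, 0 < h x ∧ h x ≤ C * (1 + dist x₀ x) ^ α)
    (hR : ∀ᶠ R : ℝ in atTop, ∫⁻ x in ball x₀ R, ofReal (h x ^ (-γ)) ∂W ≤
      ofReal (c R)) : IsLocallyFiniteMeasure W := by
  refine ⟨fun x ↦ ?_⟩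
  obtain ⟨R, hR1, hR2⟩ := (hR.and (eventually_gt_atTop (dist x x₀))).exists
  refine ⟨ball x₀ R, isOpen_ball.mem_nhds hR2, ?_⟩
  have hR0 : 0 < R := dist_nonneg.trans_lt hR2
  have hc : 0 < (C * (1 + R) ^ α) ^ (-γ) := by positivity
  have h1 : ofReal ((C * (1 + R) ^ α) ^ (-γ)) * W (ball x₀ R) ≤
      ofReal (c R) := by
    rw [← setLIntegral_const]
    refine le_trans (lintegral_mono_ae ?_) hR1
    filter_upwards [ae_restrict_of_ae hh, ae_restrict_mem measurableSet_ball] with y hy hyR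
    refine ofReal_le_ofReal (rpow_le_rpow_of_nonpos hy.1 (hy.2.trans ?_) (by linarith))
    have : dist x₀ y ≤ R := by rw [dist_comm]; exact (mem_ball.1 hyR).le
    gcongr
  by_contra h
  rw [not_lt, top_le_iff] at h
  rw [h, ENNReal.mul_top (by simpa using hc)] at h1
  exact absurd h1 (by simp)

theorem weightedMeasure_absolutelyContinuous :
    μₐₜ ≪ (riemannianMeasure N M).prod volume :=
  (withDensity_absolutelyContinuous _ _).prod Measure.AbsolutelyContinuous.rfl

theorem riemannianMeasure_absolutelyContinuous (ha : Continuous a)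
    (hpos : ∀ᵐ x ∂(riemannianMeasure N M), 0 < a x) :
    (riemannianMeasure N M).prod 𝓛 ≪ μₐₜ :=
  (withDensity_absolutelyContinuous' ha.measurable.ennreal_ofReal.aemeasurable
    (hpos.mono fun x hx ↦ by simpa using hx)).prod Measure.AbsolutelyContinuous.rfl

theorem hasLipschitzApproximation_of_null {p m : ℝ} {u : M × ℝ → ℝ}
    {G : (z : M × ℝ) → TangentSpace (𝓡 N) z.1} {g : ℝ → ℝ} {B : ℝ} {O : Set (M × ℝ)} (hB : 0 ≤ B)
    (hO : μₐₜ O = 0) :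
    HasLipschitzApproximation p m a u G g B O := by
  refine ⟨fun _ _ ↦ 0, fun _ ↦ (LocallyLipschitz.const 0).locallyLipschitzOn,
    fun _ _ _ ↦ ⟨le_rfl, hB⟩, ?_, ?_⟩
  · exact (measure_eq_zero_iff_ae_notMem.1 hO).mono fun z h h' ↦ absurd h' h
  · simp [Measure.restrict_eq_zero.2 hO]

variable {p q m K : ℝ} {b : ℝ → ℝ} {V u : M × ℝ → ℝ} {G : (z : M × ℝ) → TangentSpace (𝓡 N) z.1}
  {D : M × ℝ → ℝ}

theorem IsWeakSolution.exists_isWeakSolutionWith (hs : IsWeakSolution N p q m a b V u)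
    (hp : 1 < p) (hm : 1 ≤ m) (ha : Continuous a) (hb : Measurable b) (hK : 0 ≤ K)
    (hbK : ∀ s, 0 ≤ s → 0 ≤ b s ∧ b s ≤ K) :
    ∃ G D, IsWeakSolutionWith N p q m K a b V u G D ∧ ∃ O : Set (M × ℝ), IsOpen O ∧
      O ⊆ spaceTime M ∧ {x | a x = 0} ×ˢ Ioi (0 : ℝ) ⊆ O ∧ IsEnergyGradientOn N p m a O u G := by
  obtain ⟨-, h0, G, D, ⟨hD, hG, hO⟩, h1, h2, h3, -, h4⟩ := hs
  refine ⟨G, D, ⟨hp, hm, hK, hb, fun s h ↦ (hbK s h).1, fun s h ↦ (hbK s h).2, ha, ?_, hD, hG, h1,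
    h2, h3, fun ψ hψ hψ0 ↦ ?_⟩, hO⟩
  · rw [ae_restrict_iff' (isOpen_spaceTime M).measurableSet] at h0
    exact weightedMeasure_absolutelyContinuous h0
  have hz {z : M × ℝ} (hz : z ∉ spaceTime M) : z ∉ tsupport ψ := fun h ↦ hz (hψ.2.2 h)
  have h5 := h4 ψ hψ hψ0
  have h6 := hD.2.2 ψ hψ
  rw [setIntegral_eq_integral_of_forall_compl_eq_zero fun z h ↦ by
      rw [image_eq_zero_of_notMem_tsupport (hz h), zero_mul, zero_mul],
    setIntegral_eq_integral_of_forall_compl_eq_zero fun z h ↦ by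
      rw [spaceDeriv_eq_zero (hz h), zero_apply, zero_mul],
    setIntegral_eq_integral_of_forall_compl_eq_zero fun z h ↦ by
      rw [timeDeriv_eq_zero (hz h), zero_mul]] at h5
  simp only [mul_comm (timeDeriv ψ _), h6, sub_neg_eq_add, mul_assoc] at h5
  simpa only [fluxFactor, mul_assoc] using h5

theorem IsWeakSolutionWith.exists_hasLipschitzApproximation
    [ProperSpace M] (hs : IsWeakSolutionWith N p q m K a b V u G D)
    {O' : Set (M × ℝ)} (hO' : IsOpen O') (hO'S : O' ⊆ spaceTime M)
    (haO' : {x | a x = 0} ×ˢ Ioi (0 : ℝ) ⊆ O') (hE : IsEnergyGradientOn N p m a O' u G)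
    {g : ℝ → ℝ} {B B' C : ℝ} (hg : IsAdmissible ((p + m - 1) / p) B B' C g) {z : M × ℝ}
    (hz : z ∈ spaceTime M) :
    ∃ O, IsOpen O ∧ z ∈ O ∧ O ⊆ spaceTime M ∧ HasLipschitzApproximation p m a u G g B O := by
  rcases lt_trichotomy (a z.1) 0 with h | h | h
  · refine ⟨{x | a x < 0} ×ˢ Ioi (0 : ℝ),
      (isOpen_lt hs.continuous_weight continuous_const).prod isOpen_Ioi, ⟨h, hz.2⟩,
      prod_mono_left (subset_univ _),
      hasLipschitzApproximation_of_null ((hg.nonneg 0).trans (hg.le 0)) ?_⟩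
    rw [Measure.prod_prod, weightedMeasure, withDensity_apply _
      (measurableSet_lt hs.continuous_weight.measurable measurable_const),
      setLIntegral_congr_fun (measurableSet_lt hs.continuous_weight.measurable measurable_const)
        fun x hx ↦ ENNReal.ofReal_of_nonpos (le_of_lt hx)]
    simp
  · exact exists_lipschitzApproximation_of_energyGradient hs.continuous_weight hs.one_lt
      hs.timeDeriv.1 hs.nonneg hs.energy hg hO' hO'S hE (haO' ⟨h, hz.2⟩)
  · exact exists_lipschitzApproximation_of_pos hs.continuous_weight hs.one_lt hs.one_le hs.nonneg
      hs.gradient hs.power hs.energy hg hz.2 h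

end WeakSolutions

end

theorem corollary2 (N : ℕ) {M : Type*} [MetricSpace M] [SecondCountableTopology M]
    [ChartedSpace (EuclideanSpace ℝ (Fin N)) M] [IsManifold (𝓡 N) ∞ M]
    [RiemannianBundle (fun x : M ↦ TangentSpace (𝓡 N) x)]
    [IsContMDiffRiemannianBundle (𝓡 N) ∞ (EuclideanSpace ℝ (Fin N))
      (fun x : M ↦ TangentSpace (𝓡 N) x)]
    [IsRiemannianManifold (𝓡 N) M] [CompleteSpace M] [NoncompactSpace M]
    [MeasurableSpace M] [BorelSpace M]
    (x₀ : M) (p q m : ℝ) (hp : 1 < p) (hm : 1 ≤ m) (hq : max (p + m - 2) 1 < q)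
    (a : M → ℝ) (ha_lip : LocallyLipschitz a)
    (ha_pos : ∀ᵐ x ∂(riemannianMeasure N M), 0 < a x)
    (b : ℝ → ℝ) (hb_meas : Measurable b) (K : ℝ) (hK : 0 < K)
    (hb : ∀ s : ℝ, 0 ≤ s → 0 ≤ b s ∧ b s ≤ K)
    (V : M × ℝ → ℝ)
    (hV : LocallyIntegrableOn V (spaceTime M) ((riemannianMeasure N M).prod volume))
    (h : M → ℝ) (f : ℝ → ℝ)
    (hh_meas : AEMeasurable h (riemannianMeasure N M))
    (hf_meas : AEMeasurable f (volume.restrict (Ioi (0 : ℝ))))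
    (hVhf : ∀ᵐ z ∂((riemannianMeasure N M).prod volume).restrict (spaceTime M),
      h z.1 * f z.2 ≤ V z)
    (C α₁ α₂ σ₁ σ₂ σ₃ σ₄ δ₁ δ₂ δ₃ δ₄ : ℝ) (hC : 0 < C) (hα₁ : 0 ≤ α₁) (hα₂ : 0 ≤ α₂)
    (hσ₁ : 0 ≤ σ₁) (hσ₂ : 0 ≤ σ₂) (hσ₃ : 0 ≤ σ₃) (hσ₄ : 0 ≤ σ₄)
    (hδ₁ : 0 ≤ δ₁) (hδ₂ : 0 ≤ δ₂) (hδ₃ : 0 ≤ δ₃) (hδ₄ : 0 ≤ δ₄)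
    (hh : ∀ᵐ x ∂(riemannianMeasure N M), 0 < h x ∧ h x ≤ C * (1 + dist x₀ x) ^ α₁)
    (hf : ∀ᵐ t ∂(volume.restrict (Ioi (0 : ℝ))), 0 < f t ∧ f t ≤ C * (1 + t) ^ α₂)
    (hh₁ : ∀ᶠ R : ℝ in atTop,
      ∫⁻ x in Metric.ball x₀ R, ENNReal.ofReal (h x ^ (-(1 / (q - 1)))) ∂(weightedMeasure N a)
        ≤ ENNReal.ofReal (C * R ^ σ₁ * Real.log R ^ δ₁))
    (hf₁ : ∀ᶠ T : ℝ in atTop,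
      ∫⁻ t in Ioo 0 T, ENNReal.ofReal (f t ^ (-(1 / (q - 1))))
        ≤ ENNReal.ofReal (C * T ^ σ₂ * Real.log T ^ δ₂))
    (hh₂ : ∀ᶠ R : ℝ in atTop,
      ∫⁻ x in Metric.ball x₀ R, ENNReal.ofReal (h x ^ (-((p + m - 2) / (q - p - m + 2))))
          ∂(weightedMeasure N a)
        ≤ ENNReal.ofReal (C * R ^ σ₃ * Real.log R ^ δ₃))
    (hf₂ : ∀ᶠ T : ℝ in atTop,
      ∫⁻ t in Ioo 0 T, ENNReal.ofReal (f t ^ (-((p + m - 2) / (q - p - m + 2))))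
        ≤ ENNReal.ofReal (C * T ^ σ₄ * Real.log T ^ δ₄))
    (hi₁ : δ₁ + δ₂ < 1 / (q - 1)) (hi₂ : δ₃ + δ₄ < (p + m - 2) / (q - p - m + 2))
    (hii₁ : σ₂ ≤ q / (q - 1)) (hii₂ : σ₃ ≤ p * q / (q - p - m + 2))
    (hiii₁ : σ₂ = q / (q - 1) → σ₁ = 0) (hiii₂ : σ₃ = p * q / (q - p - m + 2) → σ₄ = 0)
    (hiv : σ₁ * σ₄ ≤ (q / (q - 1) - σ₂) * (p * q / (q - p - m + 2) - σ₃)) :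
    ∀ u : M × ℝ → ℝ, IsWeakSolution N p q m a b V u →
      ∀ᵐ z ∂((riemannianMeasure N M).prod volume).restrict (spaceTime M), u z = 0 := by
  intro u hu
  have hq1 : 1 < q := (le_max_right _ _).trans_lt hq
  have hq2 : p + m - 2 < q := (le_max_left _ _).trans_lt hq
  have hac : weightedMeasure N a ≪ riemannianMeasure N M := withDensity_absolutelyContinuous _ _
  have : ProperSpace M := properSpace_of_complete_riemannian N
  have : IsLocallyFiniteMeasure (weightedMeasure N a) :=
    isLocallyFiniteMeasure_of_lintegral_ball_le (c := fun R ↦ C * R ^ σ₁ * Real.log R ^ δ₁) hα₁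
      (one_div_nonneg.2 (by linarith)) hC (hac hh) hh₁
  obtain ⟨G, D, hs, O, hO, hOS, haO, hE⟩ :=
    hu.exists_isWeakSolutionWith hp hm ha_lip.continuous hb_meas hK.le hb
  rw [ae_restrict_iff' (isOpen_spaceTime M).measurableSet] at hVhf
  rw [ae_restrict_iff' measurableSet_Ioi] at hf
  have hac' := weightedMeasure_absolutelyContinuous (N := N) (a := a)
  have hae : ∀ᵐ z ∂(weightedMeasure N a).prod (volume : Measure ℝ), z ∈ spaceTime M →
      0 < h z.1 ∧ 0 < f z.2 ∧ h z.1 ≤ C * (1 + dist x₀ z.1) ^ α₁ ∧ f z.2 ≤ C * (1 + z.2) ^ α₂ ∧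
      h z.1 * f z.2 ≤ V z := by
    filter_upwards [hac' hVhf, Measure.quasiMeasurePreserving_fst.ae (hac hh),
      Measure.quasiMeasurePreserving_snd.ae hf] with z h1 h2 h3 hz
    exact ⟨h2.1, (h3 hz.2).1, h2.2, (h3 hz.2).2, h1 hz⟩
  have hzero := hs.ae_eq_zero hq1 (by linarith) (fun g B B' C hg z hz ↦
    hs.exists_hasLipschitzApproximation hO hOS haO hE hg hz)
    (hV.aestronglyMeasurable.aemeasurable.mono_ac (hac'.restrict _)) x₀ (hh_meas.mono_ac hac)
    hf_meas hC hα₁ hα₂ hσ₁ hσ₂ hσ₃ hσ₄ hδ₁ hδ₂ hδ₃ hδ₄ hae hh₁ hf₁ hh₂ hf₂ hi₁ hi₂ hii₁ hii₂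
    hiii₁ hiii₂ hiv
  rw [ae_restrict_iff' (isOpen_spaceTime M).measurableSet]
  exact riemannianMeasure_absolutelyContinuous ha_lip.continuous ha_pos hzero
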